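/- **Setting.** Let $a=(a_1,\dots,a_d)$ be a basis of $\mathbb R^d$, let $\Gamma=\mathrm{Span}_{\mathbb Z}\{a_1,\dots,a_d\}$, and let $\Gamma^*=\{g\in\mathbb R^d: g\cdot\gamma\in2\pi\mathbb Z\ \forall\gamma\in\Gamma\}$. The configuration space $\mathcal X$ is either $\mathbb R^d$ with Lebesgue measure, or a non-empty locally finite $\Gamma$-invariant subset of $\mathbb R^d$ with counting measure; write $|\cdot|$ for this measure. On $\mathcal H=L^2(\mathcal X,\mathbb C^N)$ let $(T_\gamma\psi)(x)=M(\gamma,x)\psi(x-\gamma)$, $\gamma\in\Gamma$, where the unitary matrices $M(\gamma,x)$ are measurable in $x$ and satisfy $M(\gamma_1+\gamma_2,x)=M(\gamma_2,x)M(\gamma_1,x-\gamma_2)$. An operator on $\mathcal H$ is called periodic if it commutes with all $T_\gamma$. Let $X_j$ be multiplication by $x_j$, and let $\chi_\Omega$ be multiplication by the indicator function of $\Omega$. For $L>0$ let $\mathcal C_L$ be the set of $x=\sum_j\alpha_ja_j\in\mathcal X$ with $|\alpha_j|\le L/2$ for all $j$, and let $\widetilde{\mathcal C}_L$ be defined in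 the same way from a second basis of the lattice $\Gamma$. We assume that $\mathcal C_1$ and $\widetilde{\mathcal C}_1$ are primitive cells: their translates by distinct elements of $\Gamma$ are disjoint up to null sets. Let $P_\gamma=(\mathcal C_1-\gamma)\cap\widetilde{\mathcal C}_1$ for $\gamma\in\Gamma$, let $I\subset\Gamma$ be a finite set with $P_\gamma=\varnothing$ for $\gamma\notin I$, and let $\widehat P_\gamma=\bigcup_{\eta\in\Gamma}(P_\gamma+\eta)$. The trace per unit volume of an operator $A$ that is trace class on compact sets is $\tau(A)=\lim_{L\to\infty,\ L\ \mathrm{odd}}|\mathcal C_L|^{-1}\mathrm{Tr}(\chi_{\mathcal C_L}A\chi_{\mathcal C_L})$. Let $\mathcal H_f$ be the space of locally square-integrable $\varphi:\mathcal X\to\mathbb C^N$ with $T_\gamma\varphi=\varphi$ for all $\gamma\in\Gamma$, with the norm of $L^2(\mathcal C_1,\mathbb C^N)$. The Bloch–Floquet–Zak transform is the continuous extension $\mathcal U$ to $\mathcal H$ of $(\mathcal U\psi)(k,y)=e^{-ik\cdot y}\sum_{\gamma\in\Gamma}e^{ik\cdot\gamma}(T_\gamma\psi)(y)$, $\psi$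 compactly supported; its values are the locally square-integrable functions $\varphi:\mathbb R^d\to\mathcal H_f$ with $\varphi(k+g)=\varrho(g)\varphi(k)$ for $g\in\Gamma^*$, where $(\varrho(g)\varphi)(y)=e^{-ig\cdot y}\varphi(y)$. Let $H_0$ be a periodic self-adjoint operator on $\mathcal H$, bounded from below, with $\mathcal UH_0\mathcal U^{-1}=\int^\oplus H_0(k)\,dk$, where the $H_0(k)$ are self-adjoint on a common dense domain $\mathcal D_f\subset\mathcal H_f$ that is invariant under all $\varrho(g)$, $H_0(k+g)=\varrho(g)H_0(k)\varrho(g)^{-1}$ for $g\in\Gamma^*$, and $k\mapsto H_0(k)$ is a smooth map into the bounded operators from $\mathcal D_f$ (with the graph norm of $H_0(0)$) to $\mathcal H_f$. Let $\mu\in\mathbb R$ lie in the resolvent set of $H_0$, and let $\Pi_0=\chi_{(-\infty,\mu)}(H_0)$, whose fibers $\Pi_0(k)$ are assumed to be projections of finite rank. Let $S=1\otimes s$ be periodic, where $s$ is a self-adjoint $N\times N$ matrix that acts as a bounded operator on $\mathcal D_f$. Denote by $\overline{[X_j,\Pi_0]}$ and $\overline{[H_0,X_i]}$ the closures of the commutators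 restricted to the vectors whose transform is a smooth map $\mathbb R^d\to\mathcal H_f$, respectively $\mathbb R^d\to\mathcal D_f$, and set $$\Pi_1=\frac{i}{2\pi}\oint_C(H_0-z)^{-1}\big[\overline{[X_j,\Pi_0]},\Pi_0\big](H_0-z)^{-1}\,dz,\qquad J_{\mathrm{conv},i}^S=\tfrac12\big(i\,\overline{[H_0,X_i]}\,S+i\,S\,\overline{[H_0,X_i]}\big),$$ where $C$ is a positively oriented circle in the resolvent set of $H_0$ enclosing exactly the part of the spectrum below $\mu$. **Proposition.** Let $i\ne j$, let $n\ge2$, let $\vartheta=2\pi/n$, and let $\mathrm R$ be the counterclockwise rotation by $\vartheta$ in the $(x_i,x_j)$ plane. Let $\rho$ be a unitary $N\times N$ matrix. Suppose that $\mathrm R\Gamma=\Gamma$ and $\mathrm R\mathcal X=\mathcal X$, and let $(R\psi)(x)=\rho\,\psi(\mathrm R^{-1}x)$ on $\mathcal H$. Suppose further that $R^{-1}\chi_{\widehat P_\gamma}R=\chi_{\widehat P_\gamma}$ for all $\gamma\in I$, that $R^{-1}H_0R=H_0$, and that $\rho^{-1}s\rho=s$. Then: (i) $\overline{[X_j,\Pi_0]}$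 is bounded and everywhere defined (so that $\Pi_1$ is defined), and for every $\gamma\in I$ the operator $\chi_{P_\gamma}\,i[H_0,S]\Pi_1\,\chi_{P_\gamma}$ is trace class with $\mathrm{Tr}\big(\chi_{P_\gamma}\,i[H_0,S]\Pi_1\,\chi_{P_\gamma}\big)=0$; (ii) $J_{\mathrm{conv},i}^S\Pi_0$ is trace class on compact sets, its trace per unit volume exists, and $\tau(J_{\mathrm{conv},i}^S\Pi_0)=0$. -/

import Mathlib

open MeasureTheory Filter Topology
open scoped ContDiff InnerProductSpace

noncomputable section

namespace SpinTransport

/-! ## Partially defined operators on a Hilbert space -/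

section Abstract

variable {F : Type} [NormedAddCommGroup F] [InnerProductSpace ℂ F]

/-- A bounded operator, seen as a partially defined operator with full domain. -/
def ofCLM (B : F →L[ℂ] F) : F →ₗ.[ℂ] F := (B : F →ₗ[ℂ] F).toPMap ⊤

/-- The composition `A B` on its natural domain `{ψ ∈ D(B) | B ψ ∈ D(A)}`. -/
def pcomp (A B : F →ₗ.[ℂ] F) : F →ₗ.[ℂ] F :=
  A.comp (B.domRestrict ((A.domain.comap B.toFun).map B.domain.subtype)) (by
    rintro ⟨x, hx⟩
    obtain ⟨hx1, hxB⟩ := hx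
    obtain ⟨y, hy, rfl⟩ := hx1
    exact hy)

/-- The commutator `[A, B] = A B - B A` on its natural domain. -/
def pcomm (A B : F →ₗ.[ℂ] F) : F →ₗ.[ℂ] F := pcomp A B - pcomp B A

/-- The domain of `A`, to be equipped with the graph norm `(‖φ‖² + ‖A φ‖²)^(1/2)`. -/
def GraphDomain (A : F →ₗ.[ℂ] F) : Type := A.domain

instance (A : F →ₗ.[ℂ] F) : AddCommGroup (GraphDomain A) :=
  inferInstanceAs (AddCommGroup A.domain)

instance (A : F →ₗ.[ℂ] F) : Module ℂ (GraphDomain A) :=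
  inferInstanceAs (Module ℂ A.domain)

/-- The embedding of the domain of `A` into the ambient space. -/
def GraphDomain.val (A : F →ₗ.[ℂ] F) : GraphDomain A →ₗ[ℂ] F := A.domain.subtype

/-- The map `φ ↦ (φ, A φ)` into the Hilbert sum, which induces the graph norm. -/
def GraphDomain.toGraph (A : F →ₗ.[ℂ] F) : GraphDomain A →ₗ[ℂ] WithLp 2 (F × F) :=
  ((WithLp.linearEquiv 2 ℂ (F × F)).symm : (F × F) →ₗ[ℂ] WithLp 2 (F × F)) ∘ₗ
    ((GraphDomain.val A).prod A.toFun)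

theorem GraphDomain.toGraph_injective (A : F →ₗ.[ℂ] F) :
    Function.Injective (GraphDomain.toGraph A) := by
  intro x y h
  have h1 : ((GraphDomain.val A).prod A.toFun) x = ((GraphDomain.val A).prod A.toFun) y :=
    (WithLp.linearEquiv 2 ℂ (F × F)).symm.injective h
  have h2 : GraphDomain.val A x = GraphDomain.val A y := congrArg Prod.fst h1
  exact Subtype.ext h2

instance (A : F →ₗ.[ℂ] F) : NormedAddCommGroup (GraphDomain A) :=
  NormedAddCommGroup.induced (GraphDomain A) (WithLp 2 (F × F)) (GraphDomain.toGraph A)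
    (GraphDomain.toGraph_injective A)

instance (A : F →ₗ.[ℂ] F) : NormedSpace ℂ (GraphDomain A) :=
  NormedSpace.induced ℂ (GraphDomain A) (WithLp 2 (F × F)) (GraphDomain.toGraph A)

/-- `R` is the bounded inverse of `A - z`. -/
def IsResolventAt (A : F →ₗ.[ℂ] F) (z : ℂ) (R : F →L[ℂ] F) : Prop :=
  (∀ ψ, ∃ h : R ψ ∈ A.domain, A ⟨R ψ, h⟩ - z • R ψ = ψ) ∧
    ∀ ψ : A.domain, R (A ψ - z • (ψ : F)) = ψ

/-- The resolvent set of `A`; its complement is the spectrum of `A`. -/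
def resolventSetOf (A : F →ₗ.[ℂ] F) : Set ℂ := {z | ∃ R, IsResolventAt A z R}

open Classical in
/-- The resolvent `(A - z)⁻¹` for `z` in the resolvent set (and `0` elsewhere). -/
def resolventOf (A : F →ₗ.[ℂ] F) (z : ℂ) : F →L[ℂ] F :=
  if h : ∃ R, IsResolventAt A z R then h.choose else 0

variable [CompleteSpace F]

/-- The spectral projection `χ_{(-∞, μ)}(A)` of a self-adjoint operator `A` which is bounded from
below, for a real number `μ` in its resolvent set. As `t ↦ 1 / (t - μ)` maps the part of the
spectrum below `μ` to the negative part of the spectrum of the bounded self-adjoint operator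
`(A - μ)⁻¹`, and the part above `μ` to the positive part, it is `χ_{(-∞, 0)}((A - μ)⁻¹)`, where
`χ_{(-∞, 0)}` is continuous on the spectrum of `(A - μ)⁻¹`. -/
def spectralProjectionBelow (A : F →ₗ.[ℂ] F) (μ : ℝ) : F →L[ℂ] F :=
  cfc (fun t : ℝ ↦ if t < 0 then (1 : ℝ) else 0) (resolventOf A (μ : ℂ))

/-- The circle with centre `c` and radius `r` lies in the resolvent set of `A` and encloses exactly
the part of the spectrum of the self-adjoint operator `A` below `μ`. -/
def EnclosesSpectrumBelow (A : F →ₗ.[ℂ] F) (μ : ℝ) (c : ℂ) (r : ℝ) : Prop :=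
  0 < r ∧ ∀ z : ℂ, z ∉ resolventSetOf A →
    (z.re < μ → z ∈ Metric.ball c r) ∧ (μ ≤ z.re → z ∉ Metric.closedBall c r)

/-- `I(B) = (i / 2π) ∮ (A - z)⁻¹ [B, P] (A - z)⁻¹ dz`, the integral being over the positively
oriented circle with centre `c` and radius `r`. -/
def inverseLiouvillian (A : F →ₗ.[ℂ] F) (P : F →L[ℂ] F) (c : ℂ) (r : ℝ) (B : F →L[ℂ] F) :
    F →L[ℂ] F :=
  (Complex.I / (2 * Real.pi)) •
    ∮ z in C(c, r), resolventOf A z ∘L (B ∘L P - P ∘L B) ∘L resolventOf A z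

/-- Trace class operators: `∑ ⟨e, |B| e⟩ < ∞` for orthonormal bases. -/
def IsTraceClass (B : F →L[ℂ] F) : Prop :=
  ∀ (ι : Type) (e : HilbertBasis ι ℂ F), Summable fun n ↦ ⟪e n, CFC.abs B (e n)⟫_ℂ

/-- The partially defined operator `A` is everywhere defined, bounded and trace class, and
`Tr A = t`. -/
def HasTrace (A : F →ₗ.[ℂ] F) (t : ℂ) : Prop :=
  ∃ B : F →L[ℂ] F, A = ofCLM B ∧ IsTraceClass B ∧
    ∀ (ι : Type) (e : HilbertBasis ι ℂ F), HasSum (fun n ↦ ⟪e n, B (e n)⟫_ℂ) t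

end Abstract

/-! ## Operators on `L²(μ; ℂ^N)` -/

/-- Euclidean space `ℝ^d`. -/
abbrev Pos (d : ℕ) := EuclideanSpace ℝ (Fin d)

/-- The internal space `ℂ^N`. -/
abbrev Spin (N : ℕ) := EuclideanSpace ℂ (Fin N)

/-- `L²(μ; ℂ^N)`. -/
abbrev L2 {d : ℕ} (N : ℕ) (μ : Measure (Pos d)) := Lp (Spin N) 2 μ

section L2ops

variable {d N : ℕ} {μ : Measure (Pos d)}

theorem memLp_mul {B : Pos d → Spin N →L[ℂ] Spin N} (hB : StronglyMeasurable B) {C : ℝ}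
    (hC : ∀ x, ‖B x‖ ≤ C) (ψ : L2 N μ) : MemLp (fun x ↦ B x (ψ x)) 2 μ := by
  refine (Lp.memLp ψ).of_le_mul (c := C) ?_ ?_
  · exact isBoundedBilinearMap_apply.continuous.comp_aestronglyMeasurable₂
      hB.aestronglyMeasurable (Lp.aestronglyMeasurable ψ)
  · exact Eventually.of_forall fun x ↦
      ((B x).le_opNorm _).trans (mul_le_mul_of_nonneg_right (hC x) (norm_nonneg _))

/-- Multiplication by a bounded measurable matrix-valued function:
`(mulOp B ψ)(x) = B(x) ψ(x)`. -/
def mulOp (μ : Measure (Pos d)) (B : Pos d → Spin N →L[ℂ] Spin N) (hB : StronglyMeasurable B)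
    (C : ℝ) (hC : ∀ x, ‖B x‖ ≤ C) : L2 N μ →L[ℂ] L2 N μ :=
  LinearMap.mkContinuous
    { toFun := fun ψ ↦ (memLp_mul hB hC ψ).toLp _
      map_add' := by
        intro ψ φ
        apply Lp.ext
        filter_upwards [(memLp_mul hB hC (ψ + φ)).coeFn_toLp, (memLp_mul hB hC ψ).coeFn_toLp,
          (memLp_mul hB hC φ).coeFn_toLp, Lp.coeFn_add ψ φ,
          Lp.coeFn_add ((memLp_mul hB hC ψ).toLp _) ((memLp_mul hB hC φ).toLp _)]
          with x h1 h2 h3 h4 h5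
        rw [h1, h5, Pi.add_apply, h2, h3, h4, Pi.add_apply, map_add]
      map_smul' := by
        intro c ψ
        apply Lp.ext
        filter_upwards [(memLp_mul hB hC (c • ψ)).coeFn_toLp, (memLp_mul hB hC ψ).coeFn_toLp,
          Lp.coeFn_smul c ψ, Lp.coeFn_smul c ((memLp_mul hB hC ψ).toLp _)]
          with x h1 h2 h3 h4
        rw [h1, RingHom.id_apply, h4, Pi.smul_apply, h2, h3, Pi.smul_apply, map_smul] }
    C (by
      intro ψ
      refine Lp.norm_le_mul_norm_of_ae_le_mul ?_
      filter_upwards [(memLp_mul hB hC ψ).coeFn_toLp] with x h1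
      change ‖((memLp_mul hB hC ψ).toLp _ : L2 N μ) x‖ ≤ _
      rw [h1]
      exact ((B x).le_opNorm _).trans (mul_le_mul_of_nonneg_right (hC x) (norm_nonneg _)))

theorem coeFn_mulOp (B : Pos d → Spin N →L[ℂ] Spin N) (hB : StronglyMeasurable B)
    (C : ℝ) (hC : ∀ x, ‖B x‖ ≤ C) (ψ : L2 N μ) :
    mulOp μ B hB C hC ψ =ᵐ[μ] fun x ↦ B x (ψ x) :=
  (memLp_mul hB hC ψ).coeFn_toLp

theorem norm_unitary_le (U : unitary (Spin N →L[ℂ] Spin N)) :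
    ‖(U : Spin N →L[ℂ] Spin N)‖ ≤ 1 := by
  have h := CStarRing.norm_coe_unitary_mul U (1 : Spin N →L[ℂ] Spin N)
  rw [mul_one] at h
  rw [h]
  exact ContinuousLinearMap.norm_id_le

/-- The projection `χ_Ω` which multiplies by the characteristic function of `Ω`. -/
def chi (N : ℕ) (μ : Measure (Pos d)) (Ω : Set (Pos d)) (hΩ : MeasurableSet Ω) :
    L2 N μ →L[ℂ] L2 N μ :=
  mulOp μ (Ω.indicator fun _ ↦ 1) (stronglyMeasurable_const.indicator hΩ) 1
    fun _ ↦ (norm_indicator_le_norm_self _ _).trans ContinuousLinearMap.norm_id_le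

/-- The operator `1 ⊗ s` of pointwise multiplication by the matrix `s`. -/
def spinOp (μ : Measure (Pos d)) (s : Spin N →L[ℂ] Spin N) : L2 N μ →L[ℂ] L2 N μ :=
  mulOp μ (fun _ ↦ s) stronglyMeasurable_const ‖s‖ fun _ ↦ le_rfl

/-- Multiplication by the phase `e^{-i k · x}`. -/
def phaseOp (N : ℕ) (μ : Measure (Pos d)) (k : Pos d) : L2 N μ →L[ℂ] L2 N μ :=
  mulOp μ (fun x ↦ Complex.exp (-(Complex.I * ((⟪k, x⟫_ℝ : ℝ) : ℂ))) • 1)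
    (Continuous.stronglyMeasurable (by fun_prop)) 1 fun x ↦ by
      have h : (-(Complex.I * ((⟪k, x⟫_ℝ : ℝ) : ℂ))).re = 0 := by simp
      rw [norm_smul, Complex.norm_exp, h, Real.exp_zero, one_mul]
      exact ContinuousLinearMap.norm_id_le

theorem coord_smul_zero (j : Fin d) :
    (fun x ↦ ((x j : ℝ) : ℂ) • (0 : L2 N μ) x) =ᵐ[μ] 0 := by
  filter_upwards [Lp.coeFn_zero (Spin N) 2 μ] with x hx
  rw [hx, Pi.zero_apply, smul_zero]

theorem coord_smul_add (j : Fin d) (ψ φ : L2 N μ) :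
    (fun x ↦ ((x j : ℝ) : ℂ) • (ψ + φ : L2 N μ) x) =ᵐ[μ]
      (fun x ↦ ((x j : ℝ) : ℂ) • ψ x) + fun x ↦ ((x j : ℝ) : ℂ) • φ x := by
  filter_upwards [Lp.coeFn_add ψ φ] with x hx
  rw [hx, Pi.add_apply, smul_add, Pi.add_apply]

theorem coord_smul_smul (j : Fin d) (c : ℂ) (ψ : L2 N μ) :
    (fun x ↦ ((x j : ℝ) : ℂ) • (c • ψ : L2 N μ) x) =ᵐ[μ]
      c • fun x ↦ ((x j : ℝ) : ℂ) • ψ x := by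
  filter_upwards [Lp.coeFn_smul c ψ] with x hx
  rw [hx, Pi.smul_apply, smul_comm, Pi.smul_apply]

/-- The domain `{ψ | x_j ψ ∈ L²}` of the position operator `X_j`. -/
def positionDomain (N : ℕ) (μ : Measure (Pos d)) (j : Fin d) : Submodule ℂ (L2 N μ) where
  carrier := {ψ | MemLp (fun x ↦ ((x j : ℝ) : ℂ) • ψ x) 2 μ}
  zero_mem' := (memLp_congr_ae (coord_smul_zero j)).mpr MemLp.zero
  add_mem' := fun {ψ φ} hψ hφ ↦ (memLp_congr_ae (coord_smul_add j ψ φ)).mpr (MemLp.add hψ hφ)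
  smul_mem' := fun c ψ hψ ↦
    (memLp_congr_ae (coord_smul_smul j c ψ)).mpr (MemLp.const_smul hψ c)

theorem memLp_position (N : ℕ) (μ : Measure (Pos d)) (j : Fin d) (ψ : L2 N μ)
    (hψ : ψ ∈ positionDomain N μ j) : MemLp (fun x ↦ ((x j : ℝ) : ℂ) • ψ x) 2 μ := hψ

theorem toLp_position_add (j : Fin d) (ψ φ : L2 N μ) (h1 : ψ ∈ positionDomain N μ j)
    (h2 : φ ∈ positionDomain N μ j) (h3 : ψ + φ ∈ positionDomain N μ j) :
    (memLp_position N μ j (ψ + φ) h3).toLp _ =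
      (memLp_position N μ j ψ h1).toLp _ + (memLp_position N μ j φ h2).toLp _ := by
  rw [← MemLp.toLp_add (memLp_position N μ j ψ h1) (memLp_position N μ j φ h2)]
  exact MemLp.toLp_congr _ _ (coord_smul_add j ψ φ)

theorem toLp_position_smul (j : Fin d) (c : ℂ) (ψ : L2 N μ) (h1 : ψ ∈ positionDomain N μ j)
    (h3 : c • ψ ∈ positionDomain N μ j) :
    (memLp_position N μ j (c • ψ) h3).toLp _ = c • (memLp_position N μ j ψ h1).toLp _ := by
  rw [← MemLp.toLp_const_smul c (memLp_position N μ j ψ h1)]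
  exact MemLp.toLp_congr _ _ (coord_smul_smul j c ψ)

/-- The position operator `(X_j ψ)(x) = x_j ψ(x)`. -/
def positionOp (N : ℕ) (μ : Measure (Pos d)) (j : Fin d) : L2 N μ →ₗ.[ℂ] L2 N μ where
  domain := positionDomain N μ j
  toFun :=
    { toFun := fun ψ ↦ (memLp_position N μ j ψ.1 ψ.2).toLp _
      map_add' := fun ψ φ ↦ toLp_position_add j ψ.1 φ.1 ψ.2 φ.2 (ψ + φ).2
      map_smul' := fun c ψ ↦ toLp_position_smul j c ψ.1 ψ.2 (c • ψ).2 }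

end L2ops

/-! ## Crystals -/

/-- A `d`-dimensional crystal: a configuration space `X ⊆ ℝ^d`, which is either all of `ℝ^d`
(continuum models) or a non-empty locally finite set of points (discrete models), and which is
invariant under the translations by a Bravais lattice with basis `a`. -/
structure Crystal (d : ℕ) where
  X : Set (Pos d)
  a : Module.Basis (Fin d) ℝ (Pos d)
  continuum_or_discrete :
    X = Set.univ ∨ (X.Nonempty ∧ ∀ r : ℝ, (X ∩ Metric.closedBall 0 r).Finite)
  add_mem : ∀ γ ∈ Submodule.span ℤ (Set.range a), ∀ x ∈ X, x + γ ∈ X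

namespace Crystal

variable {d : ℕ} (C : Crystal d)

/-- The Bravais lattice `Γ`. -/
def lattice : Submodule ℤ (Pos d) := Submodule.span ℤ (Set.range C.a)

instance : Countable C.lattice :=
  inferInstanceAs (Countable (Submodule.span ℤ (Set.range C.a)))

/-- The dual lattice `Γ*`. -/
def dualLattice : Set (Pos d) :=
  {g | ∀ γ ∈ C.lattice, ∃ n : ℤ, (⟪g, γ⟫_ℝ : ℝ) = 2 * Real.pi * n}

open Classical in
/-- The measure of the configuration space: Lebesgue measure in the continuum case, the counting
measure of `X` in the discrete case. -/
def measure : Measure (Pos d) := if C.X = Set.univ then volume else Measure.count.restrict C.X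

theorem measurableSet_X : MeasurableSet C.X := by
  rcases C.continuum_or_discrete with h | ⟨-, h⟩
  · rw [h]; exact MeasurableSet.univ
  · have : C.X = ⋃ n : ℕ, C.X ∩ Metric.closedBall 0 (n : ℝ) := by
      ext x
      simp only [Set.mem_iUnion, Set.mem_inter_iff, Metric.mem_closedBall, dist_zero_right]
      exact ⟨fun hx ↦ (exists_nat_ge ‖x‖).imp fun n hn ↦ ⟨hx, hn⟩, fun ⟨n, hx, _⟩ ↦ hx⟩
    rw [this]
    exact MeasurableSet.iUnion fun n ↦ (h n).measurableSet

theorem measurePreserving (e : Pos d ≃ᵐ Pos d) (hvol : MeasurePreserving e volume volume)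
    (hX : ∀ x, e x ∈ C.X ↔ x ∈ C.X) : MeasurePreserving e C.measure C.measure := by
  unfold measure
  split_ifs with h
  · exact hvol
  · have hpre : e ⁻¹' C.X = C.X := Set.ext hX
    refine ⟨e.measurable, Measure.ext fun s hs ↦ ?_⟩
    rw [Measure.map_apply e.measurable hs, Measure.restrict_apply hs,
      Measure.restrict_apply (e.measurable hs)]
    have h1 : e ⁻¹' s ∩ C.X = e ⁻¹' (s ∩ C.X) := by rw [Set.preimage_inter, hpre]
    rw [h1, ← Measure.count_injective_image e.injective,
      Set.image_preimage_eq _ e.surjective]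

theorem sub_mem_iff (γ : C.lattice) (x : Pos d) : x - γ ∈ C.X ↔ x ∈ C.X := by
  constructor
  · intro h
    simpa using C.add_mem γ γ.2 _ h
  · intro h
    simpa [sub_eq_add_neg] using C.add_mem (-γ) (neg_mem γ.2) _ h

theorem measurePreserving_sub (γ : C.lattice) :
    MeasurePreserving (fun x ↦ x - (γ : Pos d)) C.measure C.measure :=
  C.measurePreserving (MeasurableEquiv.subRight (γ : Pos d))
    (measurePreserving_sub_right volume (γ : Pos d)) (C.sub_mem_iff γ)

/-- `b` is another basis of the Bravais lattice. -/
def IsLatticeBasis (b : Module.Basis (Fin d) ℝ (Pos d)) : Prop :=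
  Submodule.span ℤ (Set.range b) = C.lattice

/-- The cell `C_L` of the points of `X` whose coordinates `α_j` with respect to the lattice basis
`b` satisfy `|α_j| ≤ L / 2`. -/
def cell (b : Module.Basis (Fin d) ℝ (Pos d)) (L : ℝ) : Set (Pos d) :=
  {x | x ∈ C.X ∧ ∀ j, |b.repr x j| ≤ L / 2}

theorem measurableSet_cell (b : Module.Basis (Fin d) ℝ (Pos d)) (L : ℝ) :
    MeasurableSet (C.cell b L) := by
  refine C.measurableSet_X.inter ?_
  have : IsClosed {x : Pos d | ∀ j, |b.repr x j| ≤ L / 2} := by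
    simp only [Set.ofPred_forall]
    refine isClosed_iInter fun j ↦ isClosed_le ?_ continuous_const
    exact ((b.coord j).continuous_of_finiteDimensional).abs
  exact this.measurableSet

/-- The cell `C_1` of the lattice basis `b` is a primitive cell: its translates by the lattice (which
always cover `X`) are disjoint up to sets of measure zero. This holds for every lattice basis in the
continuum case; in the discrete case it says that no point of `X` is on the boundary of the cell. -/
def IsPrimitiveCell (b : Module.Basis (Fin d) ℝ (Pos d)) : Prop :=
  ∀ γ : C.lattice, γ ≠ 0 →
    C.measure (C.cell b 1 ∩ (fun x ↦ x - (γ : Pos d)) ⁻¹' C.cell b 1) = 0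

/-- The pieces `P_γ = T_{-γ} C_1 ∩ C̃_1`, where `C_1` is the cell of the basis `a` of the crystal and
`C̃_1` that of the basis `b`. -/
def piece (b : Module.Basis (Fin d) ℝ (Pos d)) (γ : C.lattice) : Set (Pos d) :=
  (fun x ↦ x + (γ : Pos d)) ⁻¹' C.cell C.a 1 ∩ C.cell b 1

theorem measurableSet_piece (b : Module.Basis (Fin d) ℝ (Pos d)) (γ : C.lattice) :
    MeasurableSet (C.piece b γ) :=
  ((measurable_add_const (γ : Pos d)) (C.measurableSet_cell C.a 1)).inter
    (C.measurableSet_cell b 1)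

/-- The union `⋃_η T_η P` of all lattice translates of a set `P`. -/
def saturation (P : Set (Pos d)) : Set (Pos d) :=
  ⋃ η : C.lattice, (fun x ↦ x - (η : Pos d)) ⁻¹' P

theorem measurableSet_saturation {P : Set (Pos d)} (hP : MeasurableSet P) :
    MeasurableSet (C.saturation P) :=
  MeasurableSet.iUnion fun η ↦ (measurable_sub_const (η : Pos d)) hP

end Crystal

/-! ## Magnetic translations and the Bloch–Floquet–Zak transform -/

/-- The unitary matrices `M(γ, x)` which define the magnetic translations, with their cocycle
condition. -/
structure MagneticCocycle {d : ℕ} (C : Crystal d) (N : ℕ) where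
  M : C.lattice → Pos d → unitary (Spin N →L[ℂ] Spin N)
  measurable : ∀ γ, StronglyMeasurable fun x ↦ (M γ x : Spin N →L[ℂ] Spin N)
  cocycle : ∀ γ₁ γ₂ : C.lattice, ∀ x ∈ C.X,
    M (γ₁ + γ₂) x = M γ₂ x * M γ₁ (x - (γ₂ : Pos d))

section Model

variable {d N : ℕ} {C : Crystal d}

/-- The one-particle Hilbert space `L²(X; ℂ^N)`. -/
abbrev Hilb (C : Crystal d) (N : ℕ) := L2 N C.measure

/-- The fiber space: a quasi-periodic function, `T_γ φ = φ` for all `γ ∈ Γ`, is identified with its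
restriction to the cell `C_1`, and its norm is the norm of `L²(C_1; ℂ^N)`. -/
abbrev HilbFiber (C : Crystal d) (N : ℕ) := L2 N (C.measure.restrict (C.cell C.a 1))

/-- The magnetic translation `(T_γ ψ)(x) = M(γ, x) ψ(x - γ)`. -/
def translationOp (T : MagneticCocycle C N) (γ : C.lattice) : Hilb C N →L[ℂ] Hilb C N :=
  mulOp C.measure (fun x ↦ (T.M γ x : Spin N →L[ℂ] Spin N)) (T.measurable γ) 1
      (fun x ↦ norm_unitary_le (T.M γ x)) ∘L
    (Lp.compMeasurePreservingₗᵢ ℂ _ (C.measurePreserving_sub γ)).toContinuousLinearMap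

/-- An operator on `L²(X; ℂ^N)` is periodic if it commutes with the magnetic translations. -/
def IsPeriodic (T : MagneticCocycle C N) (A : Hilb C N →ₗ.[ℂ] Hilb C N) : Prop :=
  ∀ γ, pcomp A (ofCLM (translationOp T γ)) = pcomp (ofCLM (translationOp T γ)) A

/-- `φ` is the Bloch–Floquet–Zak transform of the compactly supported `ψ`:
`φ(k, y) = e^{-i k · y} ∑_γ e^{i k · γ} (T_γ ψ)(y)` for `k ∈ ℝ^d` and `y ∈ C_1`. -/
structure IsCompactBFZ (T : MagneticCocycle C N) (ψ : Hilb C N) (φ : Pos d → HilbFiber C N) :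
    Prop where
  compact_support : ∃ r : ℝ, ∀ᵐ x ∂C.measure, r < ‖x‖ → ψ x = 0
  measurable : AEStronglyMeasurable φ volume
  hasSum : ∀ k : Pos d, ∀ᵐ y ∂(C.measure.restrict (C.cell C.a 1)),
    HasSum (fun γ : C.lattice ↦
      Complex.exp (-(Complex.I * ((⟪k, y⟫_ℝ : ℝ) : ℂ))) •
        Complex.exp (Complex.I * ((⟪k, (γ : Pos d)⟫_ℝ : ℝ) : ℂ)) •
          translationOp T γ ψ y) (φ k y)

/-- `φ` is (a representative of) the Bloch–Floquet–Zak transform of `ψ`, which is the extension by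
continuity of the transform of compactly supported functions; the convergence of the transforms is
in `L²` over all compact sets of `k ∈ ℝ^d`. -/
def IsBFZ (T : MagneticCocycle C N) (ψ : Hilb C N) (φ : Pos d → HilbFiber C N) : Prop :=
  AEStronglyMeasurable φ volume ∧
    ∃ (ψs : ℕ → Hilb C N) (φs : ℕ → Pos d → HilbFiber C N),
      (∀ n, IsCompactBFZ T (ψs n) (φs n)) ∧ Tendsto ψs atTop (𝓝 ψ) ∧
        ∀ K : Set (Pos d), IsCompact K →
          Tendsto (fun n ↦ eLpNorm (φs n - φ) 2 (volume.restrict K)) atTop (𝓝 0)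

theorem IsCompactBFZ.zero (T : MagneticCocycle C N) : IsCompactBFZ T 0 0 where
  compact_support := ⟨0, by
    filter_upwards [Lp.coeFn_zero (Spin N) 2 C.measure] with x hx _
    rw [hx]; rfl⟩
  measurable := aestronglyMeasurable_zero
  hasSum := by
    intro k
    have h1 : ∀ᵐ y ∂(C.measure.restrict (C.cell C.a 1)), ∀ γ : C.lattice,
        translationOp T γ (0 : Hilb C N) y = 0 := by
      refine ae_restrict_of_ae (ae_all_iff.mpr fun γ ↦ ?_)
      rw [map_zero]
      exact Lp.coeFn_zero (Spin N) 2 C.measure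
    filter_upwards [h1, Lp.coeFn_zero (Spin N) 2 (C.measure.restrict (C.cell C.a 1))]
      with y hy h0
    have : ((0 : Pos d → HilbFiber C N) k) y = 0 := h0
    rw [this]
    simp only [hy, smul_zero]
    exact hasSum_zero

theorem IsCompactBFZ.add {T : MagneticCocycle C N} {ψ ψ' : Hilb C N}
    {φ φ' : Pos d → HilbFiber C N} (h : IsCompactBFZ T ψ φ) (h' : IsCompactBFZ T ψ' φ') :
    IsCompactBFZ T (ψ + ψ') (φ + φ') where
  compact_support := by
    obtain ⟨r, hr⟩ := h.compact_support
    obtain ⟨r', hr'⟩ := h'.compact_support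
    refine ⟨max r r', ?_⟩
    filter_upwards [hr, hr', Lp.coeFn_add ψ ψ'] with x h1 h2 h3 hx
    rw [h3, Pi.add_apply, h1 ((le_max_left _ _).trans_lt hx),
      h2 ((le_max_right _ _).trans_lt hx), add_zero]
  measurable := h.measurable.add h'.measurable
  hasSum := by
    intro k
    have h1 : ∀ᵐ y ∂(C.measure.restrict (C.cell C.a 1)), ∀ γ : C.lattice,
        translationOp T γ (ψ + ψ') y = translationOp T γ ψ y + translationOp T γ ψ' y := by
      refine ae_restrict_of_ae (ae_all_iff.mpr fun γ ↦ ?_)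
      rw [map_add]
      exact Lp.coeFn_add _ _
    filter_upwards [h1, h.hasSum k, h'.hasSum k, Lp.coeFn_add (φ k) (φ' k)] with y hy h2 h3 h4
    have : ((φ + φ') k) y = φ k y + φ' k y := h4
    rw [this]
    simp only [hy, smul_add]
    exact h2.add h3

theorem IsCompactBFZ.smul {T : MagneticCocycle C N} {ψ : Hilb C N}
    {φ : Pos d → HilbFiber C N} (c : ℂ) (h : IsCompactBFZ T ψ φ) :
    IsCompactBFZ T (c • ψ) (c • φ) where
  compact_support := by
    obtain ⟨r, hr⟩ := h.compact_support
    refine ⟨r, ?_⟩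
    filter_upwards [hr, Lp.coeFn_smul c ψ] with x h1 h3 hx
    rw [h3, Pi.smul_apply, h1 hx, smul_zero]
  measurable := h.measurable.const_smul c
  hasSum := by
    intro k
    have h1 : ∀ᵐ y ∂(C.measure.restrict (C.cell C.a 1)), ∀ γ : C.lattice,
        translationOp T γ (c • ψ) y = c • translationOp T γ ψ y := by
      refine ae_restrict_of_ae (ae_all_iff.mpr fun γ ↦ ?_)
      rw [map_smul]
      exact Lp.coeFn_smul _ _
    filter_upwards [h1, h.hasSum k, Lp.coeFn_smul c (φ k)] with y hy h2 h4
    have : ((c • φ) k) y = c • φ k y := h4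
    rw [this]
    have h5 := h2.const_smul c
    convert h5 using 2 with γ
    rw [hy, smul_comm c, smul_comm c]

theorem IsBFZ.zero (T : MagneticCocycle C N) : IsBFZ T 0 0 :=
  ⟨aestronglyMeasurable_zero, fun _ ↦ 0, fun _ ↦ 0, fun _ ↦ IsCompactBFZ.zero T,
    tendsto_const_nhds, fun K _ ↦ by simp⟩

theorem IsBFZ.add {T : MagneticCocycle C N} {ψ ψ' : Hilb C N} {φ φ' : Pos d → HilbFiber C N}
    (h : IsBFZ T ψ φ) (h' : IsBFZ T ψ' φ') : IsBFZ T (ψ + ψ') (φ + φ') := by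
  obtain ⟨hm, ψs, φs, h1, h2, h3⟩ := h
  obtain ⟨hm', ψs', φs', h1', h2', h3'⟩ := h'
  refine ⟨hm.add hm', fun n ↦ ψs n + ψs' n, fun n ↦ φs n + φs' n,
    fun n ↦ (h1 n).add (h1' n), h2.add h2', fun K hK ↦ ?_⟩
  have h4 := (h3 K hK).add (h3' K hK)
  rw [add_zero] at h4
  refine tendsto_of_tendsto_of_tendsto_of_le_of_le tendsto_const_nhds h4 (fun n ↦ bot_le) ?_
  intro n
  have : φs n + φs' n - (φ + φ') = (φs n - φ) + (φs' n - φ') := by abel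
  change eLpNorm (φs n + φs' n - (φ + φ')) 2 (volume.restrict K) ≤ _
  rw [this]
  exact eLpNorm_add_le (((h1 n).measurable.sub hm).restrict)
    (((h1' n).measurable.sub hm').restrict) (by norm_num)

theorem IsBFZ.smul {T : MagneticCocycle C N} {ψ : Hilb C N} {φ : Pos d → HilbFiber C N} (c : ℂ)
    (h : IsBFZ T ψ φ) : IsBFZ T (c • ψ) (c • φ) := by
  obtain ⟨hm, ψs, φs, h1, h2, h3⟩ := h
  refine ⟨hm.const_smul c, fun n ↦ c • ψs n, fun n ↦ c • φs n,
    fun n ↦ (h1 n).smul c, h2.const_smul c, fun K hK ↦ ?_⟩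
  have h4 := ENNReal.Tendsto.const_mul (a := ‖c‖ₑ) (h3 K hK) (Or.inr enorm_ne_top)
  rw [mul_zero] at h4
  refine h4.congr fun n ↦ ?_
  rw [← smul_sub, eLpNorm_const_smul]

/-- The space `U⁻¹ C^∞_ϱ(ℝ^d, H_f)` of the `ψ` with smooth Bloch–Floquet–Zak transform. -/
def smoothCore (T : MagneticCocycle C N) : Submodule ℂ (Hilb C N) where
  carrier := {ψ | ∃ φ : Pos d → HilbFiber C N, ContDiff ℝ ∞ φ ∧ IsBFZ T ψ φ}
  zero_mem' := ⟨0, contDiff_const, IsBFZ.zero T⟩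
  add_mem' := by
    rintro ψ ψ' ⟨φ, h1, h2⟩ ⟨φ', h1', h2'⟩
    exact ⟨φ + φ', h1.add h1', h2.add h2'⟩
  smul_mem' := by
    rintro c ψ ⟨φ, h1, h2⟩
    exact ⟨c • φ, h1.const_smul c, h2.smul c⟩

/-- The space `U⁻¹ C^∞_ϱ(ℝ^d, D_f)` of the `ψ` whose Bloch–Floquet–Zak transform is a smooth map into
the domain `D_f` of `h₀`, equipped with its graph norm. -/
def smoothDomainCore (T : MagneticCocycle C N) (h₀ : HilbFiber C N →ₗ.[ℂ] HilbFiber C N) :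
    Submodule ℂ (Hilb C N) where
  carrier := {ψ | ∃ φ : Pos d → GraphDomain h₀, ContDiff ℝ ∞ φ ∧
    IsBFZ T ψ fun k ↦ GraphDomain.val h₀ (φ k)}
  zero_mem' := ⟨0, contDiff_const, by
    have : (fun k : Pos d ↦ GraphDomain.val h₀ ((0 : Pos d → GraphDomain h₀) k)) = 0 := by
      funext k; exact map_zero _
    rw [this]; exact IsBFZ.zero T⟩
  add_mem' := by
    rintro ψ ψ' ⟨φ, h1, h2⟩ ⟨φ', h1', h2'⟩
    refine ⟨φ + φ', h1.add h1', ?_⟩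
    have : (fun k : Pos d ↦ GraphDomain.val h₀ ((φ + φ') k)) =
        (fun k ↦ GraphDomain.val h₀ (φ k)) + fun k ↦ GraphDomain.val h₀ (φ' k) := by
      funext k; exact map_add _ _ _
    rw [this]; exact h2.add h2'
  smul_mem' := by
    rintro c ψ ⟨φ, h1, h2⟩
    refine ⟨c • φ, h1.const_smul c, ?_⟩
    have : (fun k : Pos d ↦ GraphDomain.val h₀ ((c • φ) k)) =
        c • fun k ↦ GraphDomain.val h₀ (φ k) := by
      funext k; exact (GraphDomain.val h₀).map_smul _ _
    rw [this]; exact h2.smul c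

/-- `U A U⁻¹ = ∫^⊕ A(k) dk`: the operator `A` is fibered with fibers `Ak k`. A vector `ψ` is in the
domain of `A` if and only if its transform `φ` has `φ(k)` in the domain of `A(k)` for almost every
`k` and `k ↦ A(k) φ(k)` is the transform of some vector; this vector is then `A ψ`. -/
def IsFibered (T : MagneticCocycle C N) (A : Hilb C N →ₗ.[ℂ] Hilb C N)
    (Ak : Pos d → HilbFiber C N →ₗ.[ℂ] HilbFiber C N) : Prop :=
  ∀ ψ η : Hilb C N, (ψ, η) ∈ A.graph ↔
    ∃ φ χ : Pos d → HilbFiber C N, IsBFZ T ψ φ ∧ IsBFZ T η χ ∧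
      ∀ᵐ k : Pos d, (φ k, χ k) ∈ (Ak k).graph

/-- The assumptions on the unperturbed Hamiltonian `H₀`, on its fibers `Hk k` and on the Fermi
energy `μ`. -/
structure IsGappedPeriodicHamiltonian (T : MagneticCocycle C N)
    (H₀ : Hilb C N →ₗ.[ℂ] Hilb C N) (Hk : Pos d → HilbFiber C N →ₗ.[ℂ] HilbFiber C N)
    (μ : ℝ) : Prop where
  dense_domain : Dense (H₀.domain : Set (Hilb C N))
  selfAdjoint : IsSelfAdjoint H₀
  periodic : IsPeriodic T H₀
  bounded_below : ∃ m : ℝ, ∀ ψ : H₀.domain,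
    m * ‖(ψ : Hilb C N)‖ ^ 2 ≤ (⟪(ψ : Hilb C N), H₀ ψ⟫_ℂ).re
  fibered : IsFibered T H₀ Hk
  domain_eq : ∀ k, (Hk k).domain = (Hk 0).domain
  dense_fiber_domain : Dense ((Hk 0).domain : Set (HilbFiber C N))
  fiber_selfAdjoint : ∀ k, IsSelfAdjoint (Hk k)
  /-- `k ↦ H₀(k)` is a smooth map into the bounded operators from `D_f` to `H_f`. -/
  smooth : ∃ h : Pos d → (GraphDomain (Hk 0) →L[ℂ] HilbFiber C N), ContDiff ℝ ∞ h ∧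
    ∀ k φ, (GraphDomain.val (Hk 0) φ, h k φ) ∈ (Hk k).graph
  /-- `ϱ(γ*)` maps `D_f` to `D_f`. -/
  phase_mem : ∀ g ∈ C.dualLattice, ∀ φ ∈ (Hk 0).domain, phaseOp N _ g φ ∈ (Hk 0).domain
  /-- `H₀(k + γ*) = ϱ(γ*) H₀(k) ϱ(γ*)⁻¹`. -/
  equivariant : ∀ g ∈ C.dualLattice, ∀ k,
    Hk (k + g) = pcomp (ofCLM (phaseOp N _ g)) (pcomp (Hk k) (ofCLM (phaseOp N _ (-g))))
  gap : (μ : ℂ) ∈ resolventSetOf H₀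
  /-- The Fermi projection is fibered by projections of finite rank. -/
  finite_rank : ∃ P : Pos d → HilbFiber C N →L[ℂ] HilbFiber C N,
    IsFibered T (ofCLM (spectralProjectionBelow H₀ μ)) (fun k ↦ ofCLM (P k)) ∧
      ∀ k, IsStarProjection (P k) ∧ FiniteDimensional ℂ (P k).range

/-- The assumptions on the generalized spin operator `S = 1 ⊗ s`. -/
structure IsSpin (T : MagneticCocycle C N) (h₀ : HilbFiber C N →ₗ.[ℂ] HilbFiber C N)
    (s : Spin N →L[ℂ] Spin N) : Prop where
  selfAdjoint : IsSelfAdjoint s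
  periodic : IsPeriodic T (ofCLM (spinOp C.measure s))
  /-- The fiber of `S` is a bounded operator on `D_f`. -/
  bounded_on_domain : ∃ F : GraphDomain h₀ →L[ℂ] GraphDomain h₀,
    ∀ φ, GraphDomain.val h₀ (F φ) = spinOp _ s (GraphDomain.val h₀ φ)

/-- `Π₁ = I(D)` where the bounded operator `D` is the closure of the commutator `[X_j, Π₀]` on
`U⁻¹ C^∞_ϱ(ℝ^d, H_f)`; the integral in `I` is over the circle with centre `c` and radius `r`. -/
def IsFirstOrderNEASS (T : MagneticCocycle C N) (H₀ : Hilb C N →ₗ.[ℂ] Hilb C N) (μ : ℝ)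
    (j : Fin d) (c : ℂ) (r : ℝ) (P₁ : Hilb C N →L[ℂ] Hilb C N) : Prop :=
  ∃ D : Hilb C N →L[ℂ] Hilb C N,
    ((pcomm (positionOp N C.measure j) (ofCLM (spectralProjectionBelow H₀ μ))).domRestrict
      (smoothCore T)).closure = ofCLM D ∧
    P₁ = inverseLiouvillian H₀ (spectralProjectionBelow H₀ μ) c r D

/-- The closure of the commutator `[H₀, X_i]` on `U⁻¹ C^∞_ϱ(ℝ^d, D_f)`. -/
def velocityCommutator (T : MagneticCocycle C N) (H₀ : Hilb C N →ₗ.[ℂ] Hilb C N)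
    (h₀ : HilbFiber C N →ₗ.[ℂ] HilbFiber C N) (i : Fin d) : Hilb C N →ₗ.[ℂ] Hilb C N :=
  ((pcomm H₀ (positionOp N C.measure i)).domRestrict (smoothDomainCore T h₀)).closure

/-- The conventional `S`-current operator `(i [H₀, X_i] S + i S [H₀, X_i]) / 2`. -/
def conventionalCurrent (T : MagneticCocycle C N) (H₀ : Hilb C N →ₗ.[ℂ] Hilb C N)
    (h₀ : HilbFiber C N →ₗ.[ℂ] HilbFiber C N) (s : Spin N →L[ℂ] Spin N) (i : Fin d) :
    Hilb C N →ₗ.[ℂ] Hilb C N :=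
  (1 / 2 : ℂ) • (Complex.I • pcomp (velocityCommutator T H₀ h₀ i) (ofCLM (spinOp C.measure s)) +
    Complex.I • pcomp (ofCLM (spinOp C.measure s)) (velocityCommutator T H₀ h₀ i))

/-- The `S`-rotation operator `R = i [H₀, S] Π₁`. -/
def spinRotation (H₀ : Hilb C N →ₗ.[ℂ] Hilb C N) (s : Spin N →L[ℂ] Spin N)
    (P₁ : Hilb C N →L[ℂ] Hilb C N) : Hilb C N →ₗ.[ℂ] Hilb C N :=
  Complex.I • pcomp (pcomm H₀ (ofCLM (spinOp C.measure s))) (ofCLM P₁)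

/-- The compression `χ_Ω A χ_Ω`. -/
def compress (Ω : Set (Pos d)) (hΩ : MeasurableSet Ω) (A : Hilb C N →ₗ.[ℂ] Hilb C N) :
    Hilb C N →ₗ.[ℂ] Hilb C N :=
  pcomp (ofCLM (chi N C.measure Ω hΩ)) (pcomp A (ofCLM (chi N C.measure Ω hΩ)))

/-- `A` is trace class on compact sets and `τ(A) = t`, where `τ(A)` is the limit of
`Tr(χ_L A χ_L) / |C_L|` as the odd number `L = 2 l + 1` tends to infinity. -/
def HasTracePerUnitVolume (A : Hilb C N →ₗ.[ℂ] Hilb C N) (t : ℂ) : Prop :=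
  (∀ (K : Set (Pos d)) (hK : IsCompact K), ∃ u, HasTrace (compress K hK.measurableSet A) u) ∧
    ∃ u : ℕ → ℂ,
      (∀ l : ℕ, HasTrace (compress (C.cell C.a (2 * l + 1)) (C.measurableSet_cell _ _) A) (u l)) ∧
      Tendsto (fun l : ℕ ↦ u l / (C.measure.real (C.cell C.a (2 * l + 1)) : ℂ)) atTop (𝓝 t)

end Model

/-! ## Rotations -/

section Rotation

variable {d N : ℕ}

/-- The counterclockwise rotation by the angle `θ` in the plane `(x_i, x_j)`, as a linear map. -/
def rotationLinear (θ : ℝ) (i j : Fin d) : Pos d →ₗ[ℝ] Pos d where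
  toFun x := WithLp.toLp 2 fun l ↦
    if l = i then Real.cos θ * x i - Real.sin θ * x j
    else if l = j then Real.sin θ * x i + Real.cos θ * x j
    else x l
  map_add' x y := by
    ext l
    simp only [PiLp.add_apply]
    split_ifs <;> ring
  map_smul' c x := by
    ext l
    simp only [PiLp.smul_apply, smul_eq_mul, RingHom.id_apply]
    split_ifs <;> ring

theorem norm_rotationLinear (θ : ℝ) {i j : Fin d} (hij : i ≠ j) (x : Pos d) :
    ‖rotationLinear θ i j x‖ = ‖x‖ := by
  have h : ∑ l, (rotationLinear θ i j x l ^ 2 - x l ^ 2) = 0 := by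
    rw [Finset.sum_eq_add i j hij]
    · have h1 : rotationLinear θ i j x i = Real.cos θ * x i - Real.sin θ * x j := by
        simp [rotationLinear]
      have h2 : rotationLinear θ i j x j = Real.sin θ * x i + Real.cos θ * x j := by
        simp [rotationLinear, hij.symm]
      rw [h1, h2]
      linear_combination (x i ^ 2 + x j ^ 2) * Real.sin_sq_add_cos_sq θ
    · rintro l - ⟨h1, h2⟩
      simp [rotationLinear, h1, h2]
    · simp
    · simp
  rw [Finset.sum_sub_distrib, sub_eq_zero] at h
  rw [EuclideanSpace.norm_eq, EuclideanSpace.norm_eq]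
  simp only [Real.norm_eq_abs, sq_abs]
  rw [h]

/-- The counterclockwise rotation by the angle `θ` in the plane `(x_i, x_j)`. -/
def planeRotation (θ : ℝ) {i j : Fin d} (hij : i ≠ j) : Pos d ≃ₗᵢ[ℝ] Pos d :=
  LinearIsometry.toLinearIsometryEquiv
    { rotationLinear θ i j with norm_map' := norm_rotationLinear θ hij } rfl

theorem measurePreserving_isometry (C : Crystal d) (e : Pos d ≃ₗᵢ[ℝ] Pos d)
    (he : ∀ x, x ∈ C.X ↔ e x ∈ C.X) : MeasurePreserving e C.measure C.measure :=
  C.measurePreserving e.toMeasurableEquiv e.measurePreserving fun x ↦ (he x).symm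

theorem mem_symm_iff {C : Crystal d} {e : Pos d ≃ₗᵢ[ℝ] Pos d}
    (he : ∀ x, x ∈ C.X ↔ e x ∈ C.X) (x : Pos d) : x ∈ C.X ↔ e.symm x ∈ C.X := by
  rw [he (e.symm x), e.apply_symm_apply]

/-- The operator `ψ ↦ ρ ψ(e⁻¹ ·)` for an isometry `e` of the crystal. -/
def rotationAux (C : Crystal d) (ρ : unitary (Spin N →L[ℂ] Spin N)) (e : Pos d ≃ₗᵢ[ℝ] Pos d)
    (he : ∀ x, x ∈ C.X ↔ e x ∈ C.X) : Hilb C N →L[ℂ] Hilb C N :=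
  spinOp C.measure (ρ : Spin N →L[ℂ] Spin N) ∘L
    (Lp.compMeasurePreservingₗᵢ ℂ _
      (measurePreserving_isometry C e.symm (mem_symm_iff he))).toContinuousLinearMap

theorem coeFn_rotationAux (C : Crystal d) (ρ : unitary (Spin N →L[ℂ] Spin N))
    (e : Pos d ≃ₗᵢ[ℝ] Pos d) (he : ∀ x, x ∈ C.X ↔ e x ∈ C.X) (ψ : Hilb C N) :
    rotationAux C ρ e he ψ =ᵐ[C.measure]
      fun x ↦ (ρ : Spin N →L[ℂ] Spin N) (ψ (e.symm x)) := by
  have hm := measurePreserving_isometry C e.symm (mem_symm_iff he)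
  filter_upwards [coeFn_mulOp (fun _ ↦ (ρ : Spin N →L[ℂ] Spin N)) stronglyMeasurable_const
    ‖(ρ : Spin N →L[ℂ] Spin N)‖ (fun _ ↦ le_rfl) (Lp.compMeasurePreserving e.symm hm ψ),
    Lp.coeFn_compMeasurePreserving ψ hm] with x h1 h2
  exact h1.trans (congrArg _ h2)

theorem rotationAux_inverse (C : Crystal d) (ρ ρ' : unitary (Spin N →L[ℂ] Spin N))
    (e e' : Pos d ≃ₗᵢ[ℝ] Pos d) (he : ∀ x, x ∈ C.X ↔ e x ∈ C.X)
    (he' : ∀ x, x ∈ C.X ↔ e' x ∈ C.X) (hρ : ρ' * ρ = 1) (hee : ∀ x, e.symm (e'.symm x) = x)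
    (ψ : Hilb C N) : rotationAux C ρ' e' he' (rotationAux C ρ e he ψ) = ψ := by
  have hm := measurePreserving_isometry C e'.symm (mem_symm_iff he')
  apply Lp.ext
  filter_upwards [coeFn_rotationAux C ρ' e' he' (rotationAux C ρ e he ψ),
    hm.quasiMeasurePreserving.ae (coeFn_rotationAux C ρ e he ψ)] with x h1 h2
  rw [h1, h2, hee]
  have h3 : (ρ' : Spin N →L[ℂ] Spin N) * (ρ : Spin N →L[ℂ] Spin N) = 1 :=
    congrArg Subtype.val hρ
  exact congrArg (fun f : Spin N →L[ℂ] Spin N ↦ f (ψ x)) h3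

/-- The invertible operator `(R ψ)(x) = ρ ψ(e⁻¹ x)` for an isometry `e` of the crystal. -/
def rotationOp (C : Crystal d) (ρ : unitary (Spin N →L[ℂ] Spin N)) (e : Pos d ≃ₗᵢ[ℝ] Pos d)
    (he : ∀ x, x ∈ C.X ↔ e x ∈ C.X) : Hilb C N ≃L[ℂ] Hilb C N :=
  ContinuousLinearEquiv.equivOfInverse (rotationAux C ρ e he)
    (rotationAux C ρ⁻¹ e.symm (mem_symm_iff he))
    (rotationAux_inverse C ρ ρ⁻¹ e e.symm he (mem_symm_iff he) (inv_mul_cancel ρ) (by simp))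
    (rotationAux_inverse C ρ⁻¹ ρ e.symm e (mem_symm_iff he) he (mul_inv_cancel ρ) (by simp))

/-- `R⁻¹ A R = A`. -/
def IsRotationInvariant {C : Crystal d} (R : Hilb C N ≃L[ℂ] Hilb C N)
    (A : Hilb C N →ₗ.[ℂ] Hilb C N) : Prop :=
  pcomp (ofCLM (R.symm : Hilb C N →L[ℂ] Hilb C N))
    (pcomp A (ofCLM (R : Hilb C N →L[ℂ] Hilb C N))) = A

end Rotation

end SpinTransport

end

open SpinTransport

noncomputable section

namespace SpinTransport

/-! ## Graphs of partially defined operators -/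

section Graphs

variable {F : Type} [NormedAddCommGroup F] [InnerProductSpace ℂ F]

/-! The proof splits a resolvent off every unbounded operator. Let R = (H₀ - i)⁻¹, let D_l be the
closure of [X_l, Π₀], and write Π₀ = R K and S R = R Q. The inverse Liouvillian gives Π₁ = R 𝓛(D_j)
with 𝓛(D_j) bounded, and the closure of [H₀, X_l] composed with R is a bounded W_l with R W_l =
[X_l, R]. Hence i[H₀, S]Π₁ = i(Q - S)𝓛(D_j) and J_i Π₀ = (i/2)(W_i Q + S W_i)K are bounded and
periodic, and each is one component of a pair, with indices i and j, which depends linearly on the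
commutators with X_i and X_j.

Symmetry. The rotation operator U commutes with H₀ and S, hence with R, Π₀, Q and K, while X_i and
X_j are mixed by the rotation matrix. So such a pair (A, B) satisfies A U = U(cos ϑ A - sin ϑ B) and
B U = U(sin ϑ A + cos ϑ B). For a periodic operator the trace over P, a set whose translates are
disjoint up to null sets, depends only on the union of these translates
(`localTrace_eq_of_saturation`). The rotated P_γ has the same union, because χ of that union
commutes with U. Therefore the two traces over P_γ form a vector fixed by a rotation with cos ϑ ≠ 1,
and they vanish (`localTrace_eq_zero_of_rotation`). This is (i). For (ii), every cell of odd side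
length is cut, up to null sets, into translates of the pieces, so all traces in the limit defining τ
are already zero (`localTrace_cell_eq_zero`).

Bounded commutators. The phases E_κ = e^{-iκ·x} shift the momentum by κ. Smoothness and equivariance
of H₀(k) therefore bound H₀E_κ - E_κH₀ by a multiple of |κ|, relative to H₀, uniformly in k. Thus
[E_κ, (H₀ - z)⁻¹] = O(|κ|). The projection below a gap is a Lipschitz function of the resolvent
(`HasGap.norm_cfc_sub_le`), so [E_κ, Π₀] = O(|κ|) as well. A bounded operator with such commutators
preserves the domain of X_l and has a bounded commutator with it (`exists_position_of_commutator`).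

Trace class. The operator E_κΠ₀E_{-κ} - Π₀ has fibers Π₀(k + κ) - Π₀(k), which are therefore O(|κ|)
for almost every k. So the rank of Π₀(k) is essentially bounded on the compact zone, and Plancherel
makes Π₀χ Hilbert–Schmidt for the unit cell (`isHS_projection_cellExtend`). For periodic operators
the cell may be put on either side, so compressions of G Π₀ G' to bounded sets are products of two
Hilbert–Schmidt operators (`isLocallyNuclear_mul_mul`). The factor Π₀ is present in both operators:
K = K Π₀, and 𝓛(D) = Π₀𝓛(D) + 𝓛(D)Π₀ because 𝓛(D) is off-diagonal. -/

theorem mem_graph_ofCLM {B : F →L[ℂ] F} {x y : F} : (x, y) ∈ (ofCLM B).graph ↔ y = B x := by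
  rw [LinearPMap.mem_graph_iff]
  constructor
  · rintro ⟨u, rfl, h⟩
    exact h.symm
  · rintro rfl
    exact ⟨⟨x, trivial⟩, rfl, rfl⟩

/-- Arithmetic of domains is replaced by graphs: identities between partially defined operators are
proved below by chasing pairs through these characterisations. -/
theorem mem_graph_pcomp {A B : F →ₗ.[ℂ] F} {x z : F} :
    (x, z) ∈ (pcomp A B).graph ↔ ∃ y, (x, y) ∈ B.graph ∧ (y, z) ∈ A.graph := by
  constructor
  · intro h
    rw [LinearPMap.mem_graph_iff] at h
    obtain ⟨⟨u, hu⟩, rfl, h⟩ := h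
    obtain ⟨⟨v, hv, rfl⟩, huB⟩ := hu
    refine ⟨B v, B.mem_graph v, ?_⟩
    rw [LinearPMap.mem_graph_iff]
    exact ⟨⟨B v, hv⟩, rfl, h⟩
  · rintro ⟨y, hB, hA⟩
    rw [LinearPMap.mem_graph_iff] at hB hA
    obtain ⟨v, rfl, rfl⟩ := hB
    obtain ⟨w, hw, rfl⟩ := hA
    have hv : B v ∈ A.domain := by
      have h2 := w.2
      rwa [show (w : F) = B v from hw] at h2
    have hw' : w = ⟨B v, hv⟩ := Subtype.ext hw
    subst hw'
    rw [LinearPMap.mem_graph_iff]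
    exact ⟨⟨v, ⟨⟨v, hv, rfl⟩, v.2⟩⟩, rfl, rfl⟩

theorem mem_graph_sub {A B : F →ₗ.[ℂ] F} {x z : F} :
    (x, z) ∈ (A - B).graph ↔ ∃ u v, (x, u) ∈ A.graph ∧ (x, v) ∈ B.graph ∧ z = u - v := by
  constructor
  · intro h
    rw [LinearPMap.mem_graph_iff] at h
    obtain ⟨⟨u, hu⟩, rfl, h⟩ := h
    exact ⟨A ⟨u, hu.1⟩, B ⟨u, hu.2⟩, A.mem_graph ⟨u, hu.1⟩, B.mem_graph ⟨u, hu.2⟩, h.symm⟩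
  · rintro ⟨u, v, hA, hB, rfl⟩
    rw [LinearPMap.mem_graph_iff] at hB hA
    obtain ⟨a, rfl, rfl⟩ := hA
    obtain ⟨b, hb, rfl⟩ := hB
    have hb' : (a : F) ∈ B.domain := by
      have h2 := b.2
      rwa [show (b : F) = a from hb] at h2
    have : b = ⟨a, hb'⟩ := Subtype.ext hb
    subst this
    rw [LinearPMap.mem_graph_iff]
    exact ⟨⟨a, a.2, hb'⟩, rfl, rfl⟩

theorem mem_graph_add {A B : F →ₗ.[ℂ] F} {x z : F} :
    (x, z) ∈ (A + B).graph ↔ ∃ u v, (x, u) ∈ A.graph ∧ (x, v) ∈ B.graph ∧ z = u + v := by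
  constructor
  · intro h
    rw [LinearPMap.mem_graph_iff] at h
    obtain ⟨⟨u, hu⟩, rfl, h⟩ := h
    exact ⟨A ⟨u, hu.1⟩, B ⟨u, hu.2⟩, A.mem_graph ⟨u, hu.1⟩, B.mem_graph ⟨u, hu.2⟩, h.symm⟩
  · rintro ⟨u, v, hA, hB, rfl⟩
    rw [LinearPMap.mem_graph_iff] at hB hA
    obtain ⟨a, rfl, rfl⟩ := hA
    obtain ⟨b, hb, rfl⟩ := hB
    have hb' : (a : F) ∈ B.domain := by
      have h2 := b.2
      rwa [show (b : F) = a from hb] at h2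
    have : b = ⟨a, hb'⟩ := Subtype.ext hb
    subst this
    rw [LinearPMap.mem_graph_iff]
    exact ⟨⟨a, a.2, hb'⟩, rfl, rfl⟩

theorem mem_graph_smul {A : F →ₗ.[ℂ] F} {c : ℂ} {x z : F} (h : (x, z) ∈ A.graph) :
    (x, c • z) ∈ (c • A).graph := by
  rw [LinearPMap.mem_graph_iff] at h ⊢
  obtain ⟨a, rfl, rfl⟩ := h
  exact ⟨a, rfl, rfl⟩

theorem mem_graph_domRestrict {A : F →ₗ.[ℂ] F} {S : Submodule ℂ F} {x z : F} :
    (x, z) ∈ (A.domRestrict S).graph ↔ x ∈ S ∧ (x, z) ∈ A.graph := by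
  constructor
  · intro h
    refine ⟨?_, LinearPMap.le_graph_of_le LinearPMap.domRestrict_le h⟩
    rw [LinearPMap.mem_graph_iff] at h
    obtain ⟨u, rfl, h⟩ := h
    exact u.2.1
  · rintro ⟨hS, hA⟩
    rw [LinearPMap.mem_graph_iff] at hA ⊢
    obtain ⟨a, rfl, rfl⟩ := hA
    exact ⟨⟨a, hS, a.2⟩, rfl, LinearPMap.domRestrict_apply rfl⟩

theorem mem_graph_pcomm {A B : F →ₗ.[ℂ] F} {x z : F} :
    (x, z) ∈ (pcomm A B).graph ↔ ∃ a b u v, (x, b) ∈ B.graph ∧ (b, u) ∈ A.graph ∧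
      (x, a) ∈ A.graph ∧ (a, v) ∈ B.graph ∧ z = u - v := by
  unfold pcomm
  rw [mem_graph_sub]
  simp only [mem_graph_pcomp]
  constructor
  · rintro ⟨u, v, ⟨b, h1, h2⟩, ⟨a, h3, h4⟩, rfl⟩
    exact ⟨a, b, u, v, h1, h2, h3, h4, rfl⟩
  · rintro ⟨a, b, u, v, h1, h2, h3, h4, rfl⟩
    exact ⟨u, v, ⟨b, h1, h2⟩, ⟨a, h3, h4⟩, rfl⟩

/-- An everywhere defined operator has no proper extension, so one inclusion of graphs suffices. -/
theorem eq_ofCLM {A : F →ₗ.[ℂ] F} {B : F →L[ℂ] F} (h : ∀ x, (x, B x) ∈ A.graph) :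
    A = ofCLM B := by
  refine LinearPMap.eq_of_eq_graph (Submodule.ext fun ⟨x, y⟩ ↦ ?_)
  rw [mem_graph_ofCLM]
  exact ⟨fun hy ↦ A.mem_graph_snd_inj hy (h x) rfl, fun hy ↦ hy ▸ h x⟩

theorem exists_mem_graph {A : F →ₗ.[ℂ] F} {x : F} (h : x ∈ A.domain) : ∃ y, (x, y) ∈ A.graph :=
  ⟨A ⟨x, h⟩, A.mem_graph ⟨x, h⟩⟩

theorem mem_domain_of_graph {A : F →ₗ.[ℂ] F} {x y : F} (h : (x, y) ∈ A.graph) : x ∈ A.domain :=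
  A.mem_domain_of_mem_graph h

theorem eq_of_mem_graph {A : F →ₗ.[ℂ] F} {x y z : F} (h : (x, y) ∈ A.graph)
    (h' : (x, z) ∈ A.graph) : y = z :=
  A.mem_graph_snd_inj h h' rfl

theorem graph_add {A : F →ₗ.[ℂ] F} {x y u v : F} (h : (x, y) ∈ A.graph) (h' : (u, v) ∈ A.graph) :
    (x + u, y + v) ∈ A.graph := A.graph.add_mem h h'

theorem graph_smul {A : F →ₗ.[ℂ] F} {x y : F} (c : ℂ) (h : (x, y) ∈ A.graph) :
    (c • x, c • y) ∈ A.graph := A.graph.smul_mem c h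

/-- A densely defined bounded operator extends to a bounded operator. -/
theorem exists_clm_extension [CompleteSpace F] {A : F →ₗ.[ℂ] F} (hd : Dense (A.domain : Set F))
    {C : ℝ} (hC : ∀ x y, (x, y) ∈ A.graph → ‖y‖ ≤ C * ‖x‖) :
    ∃ D : F →L[ℂ] F, ∀ x y, (x, y) ∈ A.graph → y = D x := by
  let f : A.domain →L[ℂ] F := A.toFun.mkContinuous C fun x ↦ hC _ _ (A.mem_graph x)
  have hdr : DenseRange A.domain.subtypeL := by
    rw [DenseRange]
    convert hd
    simp
  have hui : IsUniformInducing A.domain.subtypeL := isUniformEmbedding_subtype_val.isUniformInducing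
  refine ⟨f.extend A.domain.subtypeL, fun x y h ↦ ?_⟩
  rw [LinearPMap.mem_graph_iff] at h
  obtain ⟨a, rfl, rfl⟩ := h
  exact (ContinuousLinearMap.extend_eq f hdr hui a).symm

/-- The closed extension `D` makes `A` closable, and density together with continuity of `D`
approximates each point of the graph of `D` by points of the graph of `A`. -/
theorem closure_eq_ofCLM {A : F →ₗ.[ℂ] F} (hd : Dense (A.domain : Set F)) {D : F →L[ℂ] F}
    (hD : ∀ x y, (x, y) ∈ A.graph → y = D x) : A.closure = ofCLM D := by
  have hcl : (ofCLM D).IsClosed := by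
    have : ((ofCLM D).graph : Set (F × F)) = {p | p.2 = D p.1} := by
      ext ⟨x, y⟩
      exact mem_graph_ofCLM
    change _root_.IsClosed ((ofCLM D).graph : Set (F × F))
    rw [this]
    exact isClosed_eq continuous_snd (D.continuous.comp continuous_fst)
  have hle : A ≤ ofCLM D :=
    LinearPMap.le_of_le_graph fun ⟨x, y⟩ h ↦ mem_graph_ofCLM.mpr (hD x y h)
  have hA : A.IsClosable := hcl.isClosable.leIsClosable hle
  refine eq_ofCLM fun x ↦ ?_
  rw [← hA.graph_closure_eq_closure_graph]
  have hx : x ∈ _root_.closure (A.domain : Set F) := hd x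
  rw [← SetLike.mem_coe, Submodule.topologicalClosure_coe]
  rw [mem_closure_iff_seq_limit] at hx ⊢
  obtain ⟨u, hu, hux⟩ := hx
  refine ⟨fun n ↦ (u n, D (u n)), fun n ↦ ?_,
    hux.prodMk_nhds ((D.continuous.tendsto x).comp hux)⟩
  obtain ⟨y, hy⟩ := exists_mem_graph (hu n)
  change (u n, D (u n)) ∈ A.graph
  rw [← hD _ _ hy]
  exact hy

/-- By density the bound extends to `x = w`, where it reads ‖w‖² ≤ C‖w‖. -/
theorem norm_le_of_forall_inner {S : Set F} (hS : Dense S) {w : F} {C : ℝ} (hC : 0 ≤ C)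
    (h : ∀ x ∈ S, ‖⟪x, w⟫_ℂ‖ ≤ C * ‖x‖) : ‖w‖ ≤ C := by
  have h1 : ∀ x : F, ‖⟪x, w⟫_ℂ‖ ≤ C * ‖x‖ := by
    intro x
    refine hS.induction (P := fun x ↦ ‖⟪x, w⟫_ℂ‖ ≤ C * ‖x‖) h ?_ x
    exact isClosed_le (by fun_prop) (by fun_prop)
  by_cases hw : w = 0
  · rwa [hw, norm_zero]
  · have h2 := h1 w
    rw [inner_self_eq_norm_sq_to_K, norm_pow] at h2
    simp only [Complex.coe_algebraMap, Complex.norm_real, norm_norm] at h2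
    have := norm_pos_iff.mpr hw
    nlinarith

end Graphs

/-! ## Self-adjoint operators and resolvents -/

section SelfAdjoint

variable {F : Type} [NormedAddCommGroup F] [InnerProductSpace ℂ F]

theorem IsResolventAt.mem_graph {A : F →ₗ.[ℂ] F} {z : ℂ} {R : F →L[ℂ] F} (h : IsResolventAt A z R)
    (ψ : F) : (R ψ, ψ + z • R ψ) ∈ A.graph := by
  obtain ⟨hd, he⟩ := h.1 ψ
  rw [LinearPMap.mem_graph_iff]
  exact ⟨⟨R ψ, hd⟩, rfl, sub_eq_iff_eq_add.mp he⟩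

theorem IsResolventAt.apply_sub {A : F →ₗ.[ℂ] F} {z : ℂ} {R : F →L[ℂ] F} (h : IsResolventAt A z R)
    {x y : F} (hxy : (x, y) ∈ A.graph) : R (y - z • x) = x := by
  rw [LinearPMap.mem_graph_iff] at hxy
  obtain ⟨a, rfl, rfl⟩ := hxy
  exact h.2 a

theorem isResolventAt_of_graph {A : F →ₗ.[ℂ] F} {z : ℂ} {R : F →L[ℂ] F}
    (h1 : ∀ ψ, (R ψ, ψ + z • R ψ) ∈ A.graph)
    (h2 : ∀ x y, (x, y) ∈ A.graph → R (y - z • x) = x) : IsResolventAt A z R := by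
  refine ⟨fun ψ ↦ ⟨mem_domain_of_graph (h1 ψ), ?_⟩, fun ψ ↦ h2 _ _ (A.mem_graph ψ)⟩
  rw [sub_eq_iff_eq_add]
  exact eq_of_mem_graph (A.mem_graph _) (h1 ψ)

theorem isResolventAt_resolventOf {A : F →ₗ.[ℂ] F} {z : ℂ} (hz : z ∈ resolventSetOf A) :
    IsResolventAt A z (resolventOf A z) := by
  have h : ∃ R, IsResolventAt A z R := hz
  unfold resolventOf
  rw [dif_pos h]
  exact h.choose_spec

/-- The resolvent identity, for two resolvents of the same operator. -/
theorem IsResolventAt.identity {A : F →ₗ.[ℂ] F} {z w : ℂ} {R Q : F →L[ℂ] F}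
    (hR : IsResolventAt A z R) (hQ : IsResolventAt A w Q) (ψ : F) :
    R ψ = Q ψ + (z - w) • Q (R ψ) := by
  have h := hQ.apply_sub (hR.mem_graph ψ)
  rw [add_sub_assoc, ← sub_smul, map_add, map_smul] at h
  exact h.symm

/-- The bounded operator `V` commutes with `A`. -/
def CommutesWith (A : F →ₗ.[ℂ] F) (V : F →L[ℂ] F) : Prop :=
  ∀ x y, (x, y) ∈ A.graph → (V x, V y) ∈ A.graph

theorem IsResolventAt.commute {A : F →ₗ.[ℂ] F} {z : ℂ} {R V : F →L[ℂ] F}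
    (hR : IsResolventAt A z R) (hV : CommutesWith A V) (ψ : F) : R (V ψ) = V (R ψ) := by
  have h := hR.apply_sub (hV _ _ (hR.mem_graph ψ))
  rw [← h]
  simp

/-- A resolvent commutes with its own operator, so `IsResolventAt.commute` applies with `V = Q`. -/
theorem IsResolventAt.commutesWith {A : F →ₗ.[ℂ] F} {z w : ℂ} {R Q : F →L[ℂ] F}
    (hR : IsResolventAt A z R) (hQ : IsResolventAt A w Q) (ψ : F) : R (Q ψ) = Q (R ψ) := by
  refine hR.commute (fun x y h ↦ ?_) ψ
  have h1 := hQ.mem_graph (y - w • x)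
  have h2 := hQ.apply_sub h
  rw [h2] at h1
  have h3 := hQ.mem_graph x
  have h4 : Q y = x + w • Q x := by
    rw [map_sub, map_smul, sub_eq_iff_eq_add] at h2
    exact h2
  rw [h4]
  exact h3

/-- Units are open, so 1 - (z - w)R(w) is invertible near `w` and the resolvent identity can be
solved for R(z). This is the source of continuity of the resolvent along the contour. -/
theorem eventually_resolvent_eq [CompleteSpace F] {A : F →ₗ.[ℂ] F} {w : ℂ} (hw : w ∈ resolventSetOf A)
    {s : Set ℂ} (hs : s ⊆ resolventSetOf A) :
    ∀ᶠ z in 𝓝[s] w, resolventOf A z =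
      Ring.inverse (1 - (z - w) • resolventOf A w) * resolventOf A w := by
  have hu : IsUnit (1 - (w - w) • resolventOf A w) := by simp
  have hc : ContinuousAt (fun z : ℂ ↦ 1 - (z - w) • resolventOf A w) w := by fun_prop
  have hop : ∀ᶠ z in 𝓝 w, IsUnit (1 - (z - w) • resolventOf A w) :=
    hc.eventually (Units.isOpen.mem_nhds hu)
  filter_upwards [hop.filter_mono nhdsWithin_le_nhds, self_mem_nhdsWithin] with z hz hzs
  have h1 : (1 - (z - w) • resolventOf A w) * resolventOf A z = resolventOf A w := by
    ext ψ
    have := (isResolventAt_resolventOf (hs hzs)).identity (isResolventAt_resolventOf hw) ψ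
    simp only [sub_mul, one_mul, smul_mul_assoc, _root_.sub_apply,
      _root_.smul_apply, mul_apply_eq_comp]
    rw [sub_eq_iff_eq_add]
    exact this
  have h2 := Ring.inverse_mul_cancel_left (1 - (z - w) • resolventOf A w) (resolventOf A z) hz
  rw [h1] at h2
  exact h2.symm

theorem continuousOn_resolventOf [CompleteSpace F] {A : F →ₗ.[ℂ] F} {s : Set ℂ}
    (hs : s ⊆ resolventSetOf A) : ContinuousOn (resolventOf A) s := by
  intro w hw
  have h := eventually_resolvent_eq (hs hw) hs
  refine ContinuousWithinAt.congr_of_eventuallyEq ?_ h (h.self_of_nhdsWithin hw)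
  refine ContinuousAt.continuousWithinAt ?_
  refine ContinuousAt.mul ?_ continuousAt_const
  refine ContinuousAt.comp (g := Ring.inverse) ?_ (by fun_prop)
  have hu : IsUnit (1 - (w - w) • resolventOf A w) := by simp
  obtain ⟨u, hu⟩ := hu
  rw [← hu]
  exact NormedRing.inverse_continuousAt u

variable [CompleteSpace F]

theorem inner_graph_symm {A : F →ₗ.[ℂ] F} (hA : IsSelfAdjoint A) {x y u v : F} (h : (x, y) ∈ A.graph)
    (h' : (u, v) ∈ A.graph) : ⟪y, u⟫_ℂ = ⟪x, v⟫_ℂ := by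
  have hf := LinearPMap.adjoint_isFormalAdjoint hA.dense_domain
  rw [LinearPMap.isSelfAdjoint_def.mp hA] at hf
  rw [LinearPMap.mem_graph_iff] at h h'
  obtain ⟨a, rfl, rfl⟩ := h
  obtain ⟨b, rfl, rfl⟩ := h'
  exact hf a b

theorem mem_graph_of_inner {A : F →ₗ.[ℂ] F} (hA : IsSelfAdjoint A) {v w : F}
    (h : ∀ x y, (x, y) ∈ A.graph → ⟪w, x⟫_ℂ = ⟪v, y⟫_ℂ) : (v, w) ∈ A.graph := by
  have hd := hA.dense_domain
  have h1 : v ∈ A.adjoint.domain :=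
    LinearPMap.mem_adjoint_domain_of_exists v ⟨w, fun x ↦ h _ _ (A.mem_graph x)⟩
  have h2 : A.adjoint ⟨v, h1⟩ = w :=
    LinearPMap.adjoint_apply_eq hd _ fun x ↦ h _ _ (A.mem_graph x)
  have h3 : (v, A.adjoint ⟨v, h1⟩) ∈ A.adjoint.graph := A.adjoint.mem_graph ⟨v, h1⟩
  rw [h2, LinearPMap.isSelfAdjoint_def.mp hA] at h3
  exact h3

/-- A vector which is weakly in the domain of a self-adjoint operator is in its domain. -/
theorem exists_mem_graph_of_bound {A : F →ₗ.[ℂ] F} (hA : IsSelfAdjoint A) {v z : F} {C : ℝ}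
    (hC : 0 ≤ C) (h : ∀ x y, (x, y) ∈ A.graph → ‖⟪v, y⟫_ℂ - ⟪z, x⟫_ℂ‖ ≤ C * ‖x‖) :
    ∃ w, (v, w) ∈ A.graph ∧ ‖w - z‖ ≤ C := by
  have hd := hA.dense_domain
  -- The functional x ↦ ⟪v, A x⟫ is bounded because it differs from ⟪z, x⟫ by at most C‖x‖; so v
  -- lies in the domain of the adjoint, which is that of A.
  have h1 : v ∈ A.adjoint.domain := by
    rw [LinearPMap.mem_adjoint_domain_iff]
    have h3 : ∀ x : A.domain, ‖((innerₛₗ ℂ v).comp A.toFun) x‖ ≤ (C + ‖z‖) * ‖x‖ := by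
      intro x
      have h4 := h _ _ (A.mem_graph x)
      have h5 : ‖⟪z, (x : F)⟫_ℂ‖ ≤ ‖z‖ * ‖(x : F)‖ := norm_inner_le_norm _ _
      have h6 := norm_le_norm_sub_add (⟪v, A x⟫_ℂ) (⟪z, (x : F)⟫_ℂ)
      change ‖⟪v, A x⟫_ℂ‖ ≤ (C + ‖z‖) * ‖(x : F)‖
      linarith
    exact (LinearMap.mkContinuous _ _ h3).continuous
  rw [LinearPMap.isSelfAdjoint_def.mp hA] at h1
  obtain ⟨w, hw⟩ := exists_mem_graph h1
  refine ⟨w, hw, norm_le_of_forall_inner hd hC fun x hx ↦ ?_⟩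
  obtain ⟨y, hy⟩ := exists_mem_graph hx
  rw [← inner_conj_symm, RCLike.norm_conj, inner_sub_left, inner_graph_symm hA hw hy]
  exact h x y hy

/-- The cross term vanishes because ⟪x, A x⟫ is real. Hence A - i is bounded below in the graph
norm. -/
theorem norm_sub_I_sq {A : F →ₗ.[ℂ] F} (hA : IsSelfAdjoint A) {x y : F} (h : (x, y) ∈ A.graph) :
    ‖y - Complex.I • x‖ ^ 2 = ‖y‖ ^ 2 + ‖x‖ ^ 2 := by
  have h1 := inner_graph_symm hA h h
  rw [@norm_sub_sq ℂ, inner_smul_right, h1, norm_smul, Complex.norm_I, one_mul]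
  have h2 : (⟪x, y⟫_ℂ).im = 0 := by
    rw [← Complex.conj_eq_iff_im, inner_conj_symm, h1]
  simp [h2]

/-- On the closed graph, A - i is antilipschitz and so has closed range. A vector orthogonal to the
range is an eigenvector of A for -i, and symmetry forces it to be zero. The point i thus serves as a
reference resolvent for H₀ and for all fibers at once. -/
theorem exists_isResolventAt_I {A : F →ₗ.[ℂ] F} (hA : IsSelfAdjoint A) :
    ∃ R, IsResolventAt A Complex.I R := by
  have hc : IsClosed (A.graph : Set (F × F)) := hA.isClosed
  have : CompleteSpace A.graph := hc.completeSpace_coe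
  let t : A.graph →L[ℂ] F :=
    (ContinuousLinearMap.snd ℂ F F - Complex.I • ContinuousLinearMap.fst ℂ F F) ∘L A.graph.subtypeL
  have ht : ∀ p : A.graph, t p = (p : F × F).2 - Complex.I • (p : F × F).1 := fun p ↦ rfl
  have hsq : ∀ p : A.graph, ‖t p‖ ^ 2 = ‖(p : F × F).2‖ ^ 2 + ‖(p : F × F).1‖ ^ 2 :=
    fun p ↦ norm_sub_I_sq hA p.2
  have hanti : AntilipschitzWith 1 t := by
    refine ContinuousLinearMap.antilipschitz_of_bound _ fun p ↦ ?_
    have := hsq p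
    rw [NNReal.coe_one, one_mul]
    change ‖(p : F × F)‖ ≤ _
    rw [Prod.norm_def]
    refine max_le ?_ ?_
    · exact abs_le_of_sq_le_sq' (by nlinarith [sq_nonneg ‖(p : F × F).2‖]) (norm_nonneg _) |>.2
    · exact abs_le_of_sq_le_sq' (by nlinarith [sq_nonneg ‖(p : F × F).1‖]) (norm_nonneg _) |>.2
  have hcl : IsClosed (Set.range t) := hanti.isClosed_range t.uniformContinuous
  have hsurj : LinearMap.range (t : A.graph →ₗ[ℂ] F) = ⊤ := by
    have : CompleteSpace (LinearMap.range (t : A.graph →ₗ[ℂ] F)) := hcl.completeSpace_coe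
    rw [← Submodule.orthogonal_eq_bot_iff, Submodule.eq_bot_iff]
    intro v hv
    rw [Submodule.mem_orthogonal'] at hv
    have h1 : (v, -Complex.I • v) ∈ A.graph := by
      refine mem_graph_of_inner hA fun x y h ↦ ?_
      have h2 := hv (t ⟨(x, y), h⟩) ⟨_, rfl⟩
      rw [ht, inner_sub_right, inner_smul_right, sub_eq_zero] at h2
      rw [h2, inner_smul_left]
      simp
    have h3 := inner_graph_symm hA h1 h1
    rw [inner_smul_left, inner_smul_right] at h3
    simp only [map_neg, Complex.conj_I, neg_neg] at h3
    have h4 : (2 * Complex.I) * ⟪v, v⟫_ℂ = 0 := by linear_combination h3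
    simpa using h4
  let e := ContinuousLinearEquiv.ofBijective t
    (LinearMap.ker_eq_bot.mpr hanti.injective) hsurj
  have he : ∀ p : A.graph, e p = t p := fun p ↦ rfl
  refine ⟨ContinuousLinearMap.fst ℂ F F ∘L A.graph.subtypeL ∘L (e.symm : F →L[ℂ] A.graph),
    isResolventAt_of_graph (fun ψ ↦ ?_) fun x y h ↦ ?_⟩
  · have h1 : t (e.symm ψ) = ψ := by rw [← he, e.apply_symm_apply]
    rw [ht, sub_eq_iff_eq_add] at h1
    have h2 := (e.symm ψ).2
    change (((e.symm ψ : A.graph) : F × F).1, ψ + Complex.I • ((e.symm ψ : A.graph) : F × F).1)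
      ∈ A.graph
    rw [← h1]
    exact h2
  · have h1 : e.symm (y - Complex.I • x) = ⟨(x, y), h⟩ := by
      rw [ContinuousLinearEquiv.symm_apply_eq]
      rfl
    change ((e.symm (y - Complex.I • x) : A.graph) : F × F).1 = x
    rw [h1]

theorem IsResolventAt.isSelfAdjoint {A : F →ₗ.[ℂ] F} (hA : IsSelfAdjoint A) {m : ℝ} {R : F →L[ℂ] F}
    (hR : IsResolventAt A m R) : IsSelfAdjoint R := by
  rw [ContinuousLinearMap.isSelfAdjoint_iff_isSymmetric]
  intro u v
  have h := inner_graph_symm hA (hR.mem_graph u) (hR.mem_graph v)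
  simp only [inner_add_left, inner_add_right, inner_smul_left, inner_smul_right,
    Complex.conj_ofReal] at h
  simpa using h.symm

end SelfAdjoint

/-! ## Spectral projections of bounded self-adjoint operators with a gap -/

section GapProjection

variable {F : Type} [NormedAddCommGroup F] [InnerProductSpace ℂ F] [CompleteSpace F]

/-- The indicator function of the negative half line. -/
def negStep (t : ℝ) : ℝ := if t < 0 then 1 else 0

/-- A continuous function which agrees with `negStep` off the gap `(-c, 0)`. -/
def negRamp (c t : ℝ) : ℝ := max 0 (min 1 (-t / c))

theorem continuous_negRamp (c : ℝ) : Continuous (negRamp c) := by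
  unfold negRamp
  fun_prop

/-- The spectrum of the self-adjoint operator `a` does not meet the gap `(-c, 0)`. -/
structure HasGap (a : F →L[ℂ] F) (c : ℝ) : Prop where
  selfAdjoint : IsSelfAdjoint a
  pos : 0 < c
  spec : ∀ t ∈ spectrum ℝ a, t ≤ -c ∨ 0 ≤ t

theorem negRamp_eq {c t : ℝ} (hc : 0 < c) (ht : t ≤ -c ∨ 0 ≤ t) : negStep t = negRamp c t := by
  unfold negStep negRamp
  rcases ht with h | h
  · have h1 : 1 ≤ -t / c := by rw [le_div_iff₀ hc]; linarith
    rw [if_pos (by linarith), min_eq_left h1, max_eq_right zero_le_one]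
  · have h1 : -t / c ≤ 0 := div_nonpos_of_nonpos_of_nonneg (by linarith) hc.le
    rw [if_neg (by linarith), min_eq_right (by linarith), max_eq_left h1]

theorem negStep_mul_self (t : ℝ) : negStep t * negStep t = negStep t := by
  unfold negStep; split_ifs <;> simp

theorem negStep_nonneg (t : ℝ) : 0 ≤ negStep t := by unfold negStep; split_ifs <;> simp

theorem negStep_le_one (t : ℝ) : negStep t ≤ 1 := by unfold negStep; split_ifs <;> simp

/-- The assumption is a + K a² ≥ 0, so t + K t² ≥ 0 on the spectrum, which excludes -1/K < t < 0. It
will hold for the resolvent at μ of an operator bounded from below. The gap is only on the negative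
side, since 0 is in the spectrum of the resolvent of an unbounded operator. -/
theorem hasGap_of_nonneg {a : F →L[ℂ] F} (ha : IsSelfAdjoint a) {K : ℝ} (hK : 0 < K)
    (h : ∀ x, 0 ≤ (⟪x, a x⟫_ℂ).re + K * ‖a x‖ ^ 2) : HasGap a K⁻¹ := by
  refine ⟨ha, inv_pos.mpr hK, ?_⟩
  have h0 : cfc (fun t : ℝ ↦ t + K * t ^ 2) a = a + K • a ^ 2 := by
    rw [cfc_add a (fun t : ℝ ↦ t) (fun t : ℝ ↦ K * t ^ 2), cfc_id' ℝ a,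
      cfc_const_mul K (fun t : ℝ ↦ t ^ 2) a, cfc_pow_id (R := ℝ) a 2]
  have h1 : (0 : F →L[ℂ] F) ≤ cfc (fun t : ℝ ↦ t + K * t ^ 2) a := by
    rw [ContinuousLinearMap.nonneg_iff_isPositive, ContinuousLinearMap.isPositive_def]
    refine ⟨ContinuousLinearMap.isSelfAdjoint_iff_isSymmetric.mp (cfc_predicate _ _), fun x ↦ ?_⟩
    have h3 : ⟪a (a x), x⟫_ℂ = (‖a x‖ : ℂ) ^ 2 := by
      have h4 : ⟪a (a x), x⟫_ℂ = ⟪a x, a x⟫_ℂ :=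
        (ContinuousLinearMap.isSelfAdjoint_iff_isSymmetric).mp ha (a x) x
      rw [h4, inner_self_eq_norm_sq_to_K]
      rfl
    have h7 : (⟪a x, x⟫_ℂ).re = (⟪x, a x⟫_ℂ).re := by
      rw [← inner_conj_symm, Complex.conj_re]
    rw [ContinuousLinearMap.reApplyInnerSelf_apply, h0]
    have h6 : (a + K • a ^ 2) x = a x + (K : ℂ) • a (a x) := by
      rw [pow_two]
      rfl
    rw [h6, inner_add_left, inner_smul_left, h3, Complex.conj_ofReal, ← Complex.ofReal_pow,
      ← Complex.ofReal_mul]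
    change 0 ≤ (⟪a x, x⟫_ℂ + ((K * ‖a x‖ ^ 2 : ℝ) : ℂ)).re
    rw [Complex.add_re, h7, Complex.ofReal_re]
    exact h x
  rw [cfc_nonneg_iff (fun t : ℝ ↦ t + K * t ^ 2) a] at h1
  intro t ht
  have h2 := h1 t ht
  by_contra! hcon
  obtain ⟨h3, h4⟩ := hcon
  have h5 : -1 < t * K := by
    have := mul_lt_mul_of_pos_right h3 hK
    rwa [neg_mul, inv_mul_cancel₀ hK.ne'] at this
  nlinarith

/-! ### Factorisation and Lipschitz dependence of gap projections -/

namespace HasGap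

variable {a b : F →L[ℂ] F} {c : ℝ}

theorem continuousOn_negStep (ha : HasGap a c) : ContinuousOn negStep (spectrum ℝ a) :=
  (continuous_negRamp c).continuousOn.congr fun t ht ↦ negRamp_eq ha.pos (ha.spec t ht)

theorem cfc_mul_self (ha : HasGap a c) : cfc negStep a * cfc negStep a = cfc negStep a := by
  have h := ha.continuousOn_negStep
  rw [← cfc_mul negStep negStep a]
  exact cfc_congr fun t _ ↦ negStep_mul_self t

theorem isSelfAdjoint_cfc : IsSelfAdjoint (cfc negStep a) := cfc_predicate _ _

theorem norm_cfc_le_one : ‖cfc negStep a‖ ≤ 1 :=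
  norm_cfc_le zero_le_one fun t _ ↦ by
    rw [Real.norm_of_nonneg (negStep_nonneg t)]; exact negStep_le_one t

/-- On the spectrum, negStep t / t agrees with a continuous function, because the denominator min t
(-c) stays away from zero. For a resolvent `a` this places the range of the projection inside the
domain of the operator. -/
theorem exists_factor (ha : HasGap a c) : ∃ g : F →L[ℂ] F, cfc negStep a = a * g := by
  have hc := ha.pos
  have hs := ha.selfAdjoint
  have hg : Continuous fun t : ℝ ↦ negRamp c t / min t (-c) := by
    refine (continuous_negRamp c).div₀ (by fun_prop) fun t ↦ ?_
    exact (lt_of_le_of_lt (min_le_right _ _) (by linarith)).ne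
  refine ⟨cfc (fun t : ℝ ↦ negRamp c t / min t (-c)) a, ?_⟩
  have h1 := cfc_mul (fun t : ℝ ↦ t) (fun t : ℝ ↦ negRamp c t / min t (-c)) a (by fun_prop)
    hg.continuousOn
  rw [cfc_id' ℝ a] at h1
  rw [← h1]
  refine cfc_congr fun t ht ↦ ?_
  have h := ha.spec t ht
  rcases h with h | h
  · rw [negRamp_eq hc (Or.inl h), min_eq_left h, mul_div_cancel₀]
    linarith
  · have : negRamp c t = 0 := by
      rw [← negRamp_eq hc (Or.inr h)]; unfold negStep; rw [if_neg (by linarith)]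
    simp [negRamp_eq hc (Or.inr h), this]

/-- The off-diagonal block X = Q(1 - P) solves the Sylvester equation (s - b)X = X(s - a)(1 - P) +
Q(a - b)(1 - P). The spectrum of a on the range of 1 - P lies in [0, s], so s - a has norm at most s
there. On the range of Q the spectrum of b is below -c, so s - b has an inverse of norm at most 1/(s
+ c). Hence (s + c)‖X‖ ≤ s‖X‖ + ‖a - b‖, and s cancels. -/
theorem norm_mul_one_sub_le (ha : HasGap a c) (hb : HasGap b c) :
    ‖cfc negStep b * (1 - cfc negStep a)‖ ≤ c⁻¹ * ‖a - b‖ := by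
  have hc := ha.pos
  have hsa := ha.selfAdjoint
  have hsb := hb.selfAdjoint
  -- The factor ‖1‖ equals 1 unless the space is trivial; keeping it avoids a case distinction.
  set s := ‖a‖ * ‖(1 : F →L[ℂ] F)‖ with hs
  set P := cfc negStep a
  set Q := cfc negStep b
  have hs0 : 0 ≤ s := by positivity
  have h1 : ‖(algebraMap ℝ _ s - a) * (1 - P)‖ ≤ s := by
    have e1 : (algebraMap ℝ _ s - a) = cfc (fun t : ℝ ↦ s - t) a := by
      rw [cfc_sub (fun _ : ℝ ↦ s) (fun t : ℝ ↦ t) a, cfc_const s a, cfc_id' ℝ a]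
    have e2 : 1 - P = cfc (fun t : ℝ ↦ 1 - negStep t) a := by
      rw [cfc_sub (fun _ : ℝ ↦ (1 : ℝ)) negStep a (by fun_prop) ha.continuousOn_negStep,
        cfc_const_one ℝ a]
    rw [e1, e2, ← cfc_mul (fun t : ℝ ↦ s - t) (fun t : ℝ ↦ 1 - negStep t) a (by fun_prop)
      (continuousOn_const.sub ha.continuousOn_negStep)]
    refine norm_cfc_le hs0 fun t ht ↦ ?_
    have hts : |t| ≤ s := by
      exact spectrum.norm_le_norm_mul_of_mem ht
    rcases ha.spec t ht with h | h
    · have : negStep t = 1 := if_pos (by linarith)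
      rw [this]; simpa using hs0
    · have : negStep t = 0 := if_neg (by linarith)
      rw [this, sub_zero, mul_one, Real.norm_eq_abs, abs_le]
      have := (abs_le.mp hts).2
      constructor <;> linarith
  obtain ⟨g, hg, hgn⟩ : ∃ g : F →L[ℂ] F, Q = g * (algebraMap ℝ _ s - b) ∧ ‖g‖ ≤ (s + c)⁻¹ := by
    have hcont : Continuous fun t : ℝ ↦ negRamp c t / (s - min t (-c)) := by
      refine (continuous_negRamp c).div₀ (by fun_prop) fun t ↦ ?_
      have := min_le_right t (-c)
      exact (by linarith : 0 < s - min t (-c)).ne'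
    refine ⟨cfc (fun t : ℝ ↦ negRamp c t / (s - min t (-c))) b, ?_, ?_⟩
    · have e1 : (algebraMap ℝ _ s - b) = cfc (fun t : ℝ ↦ s - t) b := by
        rw [cfc_sub (fun _ : ℝ ↦ s) (fun t : ℝ ↦ t) b, cfc_const s b, cfc_id' ℝ b]
      rw [e1, ← cfc_mul _ (fun t : ℝ ↦ s - t) b hcont.continuousOn]
      refine cfc_congr fun t ht ↦ ?_
      rcases hb.spec t ht with h | h
      · rw [negRamp_eq hc (Or.inl h), min_eq_left h, div_mul_cancel₀]
        linarith
      · have : negRamp c t = 0 := by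
          rw [← negRamp_eq hc (Or.inr h)]; exact if_neg (by linarith)
        simp [negRamp_eq hc (Or.inr h), this]
    · refine norm_cfc_le (by positivity) fun t ht ↦ ?_
      have h2 := min_le_right t (-c)
      have h3 : 0 ≤ negRamp c t := le_max_left _ _
      have h4 : negRamp c t ≤ 1 := max_le zero_le_one (min_le_left _ _)
      rw [Real.norm_of_nonneg (div_nonneg h3 (by linarith)), inv_eq_one_div]
      exact div_le_div₀ zero_le_one h4 (by linarith) (by linarith)
  have hPP : P * P = P := ha.cfc_mul_self
  have hQQ : Q * Q = Q := hb.cfc_mul_self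
  have hPa : P * a = a * P := (Commute.refl a).cfc_real negStep
  have hQb : Q * b = b * Q := (Commute.refl b).cfc_real negStep
  set X := Q * (1 - P)
  set σ : F →L[ℂ] F := algebraMap ℝ _ s
  have hσ : ∀ y, σ * y = y * σ := fun y ↦ Algebra.commutes s y
  have e1 : X = g * (X * ((σ - a) * (1 - P)) + Q * (a - b) * (1 - P)) := by
    have e2 : X * ((σ - a) * (1 - P)) + Q * (a - b) * (1 - P) = (σ - b) * X := by
      have e3 : X * ((σ - a) * (1 - P)) = Q * (σ - a) * (1 - P) := by
        have e4 : (1 - P) * ((σ - a) * (1 - P)) = (σ - a) * (1 - P) := by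
          have : (1 - P) * (σ - a) = (σ - a) * (1 - P) := by
            simp only [sub_mul, mul_sub, one_mul, mul_one, hPa, hσ P]
            abel
          rw [← mul_assoc, this, mul_assoc]
          congr 1
          rw [mul_sub, mul_one, sub_mul, one_mul, hPP, sub_self, sub_zero]
        change Q * (1 - P) * _ = _
        rw [mul_assoc, e4, mul_assoc]
      rw [e3, ← add_mul, ← mul_add, sub_add_sub_cancel]
      have : Q * (σ - b) = (σ - b) * Q := by rw [mul_sub, sub_mul, hQb, hσ]
      rw [this, mul_assoc]
    rw [e2, ← mul_assoc, ← hg, ← mul_assoc, hQQ]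
  have hQ1 : ‖Q‖ ≤ 1 := norm_cfc_le_one
  have hP1 : ‖1 - P‖ ≤ 1 := by
    have e2 : 1 - P = cfc (fun t : ℝ ↦ 1 - negStep t) a := by
      rw [cfc_sub (fun _ : ℝ ↦ (1 : ℝ)) negStep a (by fun_prop) ha.continuousOn_negStep,
        cfc_const_one ℝ a]
    rw [e2]
    refine norm_cfc_le zero_le_one fun t _ ↦ ?_
    rw [Real.norm_of_nonneg (by linarith [negStep_le_one t])]
    linarith [negStep_nonneg t]
  have h2 : ‖X‖ ≤ (s + c)⁻¹ * (‖X‖ * s + ‖a - b‖) := by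
    calc ‖X‖ = _ := congrArg _ e1
      _ ≤ ‖g‖ * (‖X‖ * ‖(σ - a) * (1 - P)‖ + ‖Q‖ * ‖a - b‖ * ‖1 - P‖) := by
          refine (norm_mul_le _ _).trans (mul_le_mul_of_nonneg_left ((norm_add_le _ _).trans
            (add_le_add (norm_mul_le _ _) ((norm_mul_le _ _).trans
              (mul_le_mul_of_nonneg_right (norm_mul_le _ _) (norm_nonneg _))))) (norm_nonneg _))
      _ ≤ (s + c)⁻¹ * (‖X‖ * s + 1 * ‖a - b‖ * 1) := by gcongr
      _ = _ := by ring
  rw [inv_mul_eq_div, le_div_iff₀ (by linarith)] at h2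
  rw [inv_mul_eq_div, le_div_iff₀ hc]
  linarith

/-- The projection onto the negative spectral subspace depends Lipschitz continuously on operators
with a common gap. -/
theorem norm_cfc_sub_le (ha : HasGap a c) (hb : HasGap b c) :
    ‖cfc negStep a - cfc negStep b‖ ≤ 2 * c⁻¹ * ‖a - b‖ := by
  have h1 := ha.norm_mul_one_sub_le hb
  have h2 := hb.norm_mul_one_sub_le ha
  set P := cfc negStep a
  set Q := cfc negStep b
  -- The halves of P - Q = (1 - Q)P - Q(1 - P) are estimated separately; the first is the adjoint of
  -- P(1 - Q), so the same lemma covers it with a and b exchanged.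
  have h3 : star (P * (1 - Q)) = (1 - Q) * P := by
    have hP : star P = P := isSelfAdjoint_cfc
    have hQ : star Q = Q := isSelfAdjoint_cfc
    rw [star_mul, star_sub, star_one, hP, hQ]
  rw [← norm_star, h3, norm_sub_rev b a] at h2
  have h4 : P - Q = (1 - Q) * P - Q * (1 - P) := by
    rw [sub_mul, mul_sub, one_mul, mul_one]; abel
  rw [h4]
  refine (norm_sub_le _ _).trans ?_
  linarith

end HasGap

end GapProjection

/-! ## Hilbert–Schmidt and nuclear operators -/

section HilbertSchmidt

open ContinuousLinearMap

variable {E G : Type} [NormedAddCommGroup E] [InnerProductSpace ℂ E] [CompleteSpace E]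
  [NormedAddCommGroup G] [InnerProductSpace ℂ G] [CompleteSpace G]

theorem hasSum_norm_inner_sq {ι : Type} (e : HilbertBasis ι ℂ E) (x : E) :
    HasSum (fun n ↦ ‖⟪e n, x⟫_ℂ‖ ^ 2) (‖x‖ ^ 2) := by
  have h := e.hasSum_inner_mul_inner x x
  have h1 : ∀ n, ⟪x, e n⟫_ℂ * ⟪e n, x⟫_ℂ = ((‖⟪e n, x⟫_ℂ‖ ^ 2 : ℝ) : ℂ) := by
    intro n
    rw [← inner_conj_symm x (e n), ← Complex.normSq_eq_conj_mul_self, Complex.normSq_eq_norm_sq]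
  have h2 : ⟪x, x⟫_ℂ = ((‖x‖ ^ 2 : ℝ) : ℂ) := by
    rw [inner_self_eq_norm_sq_to_K, Complex.ofReal_pow]
    rfl
  simp only [h1, h2] at h
  exact Complex.hasSum_ofReal.mp h

theorem tsum_ofReal_norm_inner_sq {ι : Type} (e : HilbertBasis ι ℂ E) (x : E) :
    ∑' n, ENNReal.ofReal (‖⟪e n, x⟫_ℂ‖ ^ 2) = ENNReal.ofReal (‖x‖ ^ 2) := by
  have h := hasSum_norm_inner_sq e x
  rw [← h.tsum_eq, ENNReal.ofReal_tsum_of_nonneg (fun n ↦ by positivity) h.summable]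

/-- Both sides are the double sum of |⟪f m, Z e n⟫|², which may be exchanged in [0, ∞] without any
summability. As `e` and `f` are independent, this also shows that the Hilbert–Schmidt norm does not
depend on the basis. -/
theorem tsum_norm_sq_adjoint {ι κ : Type} (e : HilbertBasis ι ℂ E) (f : HilbertBasis κ ℂ G)
    (Z : E →L[ℂ] G) : ∑' n, ENNReal.ofReal (‖Z (e n)‖ ^ 2) =
      ∑' m, ENNReal.ofReal (‖adjoint Z (f m)‖ ^ 2) := by
  simp only [← tsum_ofReal_norm_inner_sq f (Z _), ← tsum_ofReal_norm_inner_sq e (adjoint Z _)]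
  rw [ENNReal.tsum_comm]
  refine tsum_congr fun m ↦ tsum_congr fun n ↦ ?_
  rw [adjoint_inner_right, ← inner_conj_symm, RCLike.norm_conj]

/-- Hilbert–Schmidt operators. -/
def IsHS (Z : E →L[ℂ] G) : Prop :=
  ∀ (ι : Type) (e : HilbertBasis ι ℂ E), Summable fun n ↦ ‖Z (e n)‖ ^ 2

theorem exists_hilbertBasis_type (E : Type) [NormedAddCommGroup E] [InnerProductSpace ℂ E]
    [CompleteSpace E] : ∃ (ι : Type), Nonempty (HilbertBasis ι ℂ E) := by
  obtain ⟨w, b, -⟩ := exists_hilbertBasis ℂ E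
  exact ⟨w, ⟨b⟩⟩

theorem summable_iff_tsum_ofReal_ne_top {ι : Type} {f : ι → ℝ} (hf : ∀ n, 0 ≤ f n) :
    Summable f ↔ ∑' n, ENNReal.ofReal (f n) ≠ ⊤ := by
  constructor
  · intro h
    rw [← ENNReal.ofReal_tsum_of_nonneg hf h]
    exact ENNReal.ofReal_ne_top
  · intro h
    have := ENNReal.summable_toReal h
    simpa only [ENNReal.toReal_ofReal (hf _)] using this

theorem isHS_of_basis {Z : E →L[ℂ] G} {ι : Type} (e : HilbertBasis ι ℂ E)
    (h : Summable fun n ↦ ‖Z (e n)‖ ^ 2) : IsHS Z := by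
  intro κ f
  obtain ⟨τ, ⟨g⟩⟩ := exists_hilbertBasis_type G
  rw [summable_iff_tsum_ofReal_ne_top (fun _ ↦ by positivity)] at h ⊢
  rwa [tsum_norm_sq_adjoint f g, ← tsum_norm_sq_adjoint e g]

theorem IsHS.adjoint {Z : E →L[ℂ] G} (h : IsHS Z) : IsHS (adjoint Z) := by
  intro κ f
  obtain ⟨τ, ⟨g⟩⟩ := exists_hilbertBasis_type E
  have h1 := h τ g
  rw [summable_iff_tsum_ofReal_ne_top (fun _ ↦ by positivity)] at h1 ⊢
  rwa [← tsum_norm_sq_adjoint g f]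

theorem IsHS.comp_left {E' : Type} [NormedAddCommGroup E'] [InnerProductSpace ℂ E']
    {Z : E →L[ℂ] G} (h : IsHS Z) (V : G →L[ℂ] E') : IsHS (V ∘L Z) := by
  intro κ f
  refine Summable.of_nonneg_of_le (fun _ ↦ by positivity) (fun n ↦ ?_)
    ((h κ f).mul_left (‖V‖ ^ 2))
  rw [← mul_pow]
  exact pow_le_pow_left₀ (norm_nonneg _) (V.le_opNorm _) 2

theorem IsHS.comp_right {E' : Type} [NormedAddCommGroup E'] [InnerProductSpace ℂ E']
    [CompleteSpace E'] {Z : E →L[ℂ] G} (h : IsHS Z) (V : E' →L[ℂ] E) : IsHS (Z ∘L V) := by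
  have h1 := (h.adjoint.comp_left (ContinuousLinearMap.adjoint V)).adjoint
  rwa [adjoint_comp, adjoint_adjoint, adjoint_adjoint] at h1

theorem IsHS.add {Z W : E →L[ℂ] G} (h : IsHS Z) (h' : IsHS W) : IsHS (Z + W) := by
  intro κ f
  refine Summable.of_nonneg_of_le (fun _ ↦ by positivity) (fun n ↦ ?_)
    (((h κ f).add (h' κ f)).mul_left 2)
  have h1 : ‖(Z + W) (f n)‖ ≤ ‖Z (f n)‖ + ‖W (f n)‖ := norm_add_le _ _
  nlinarith [sq_nonneg (‖Z (f n)‖ - ‖W (f n)‖), norm_nonneg ((Z + W) (f n)),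
    norm_nonneg (Z (f n)), norm_nonneg (W (f n))]

theorem IsHS.zero : IsHS (0 : E →L[ℂ] G) := fun _ _ ↦ by simp

theorem IsHS.sum {ι : Type} {s : Finset ι} {Z : ι → E →L[ℂ] G} (h : ∀ n ∈ s, IsHS (Z n)) :
    IsHS (∑ n ∈ s, Z n) := by
  classical
  induction s using Finset.induction_on with
  | empty => simpa using IsHS.zero
  | insert a s ha ih =>
    rw [Finset.sum_insert ha]
    exact (h a (Finset.mem_insert_self _ _)).add
      (ih fun n hn ↦ h n (Finset.mem_insert_of_mem hn))

/-- The trace of a product of two Hilbert–Schmidt operators is cyclic. -/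
theorem exists_hasSum_swap {X Y : E →L[ℂ] E} (hX : IsHS X) (hY : IsHS Y) {ι κ : Type}
    (e : HilbertBasis ι ℂ E) (f : HilbertBasis κ ℂ E) :
    ∃ t : ℂ, HasSum (fun n ↦ ⟪e n, (X * Y) (e n)⟫_ℂ) t ∧
      HasSum (fun m ↦ ⟪f m, (Y * X) (f m)⟫_ℂ) t := by
  -- Both traces are iterated sums of this family. It is absolutely summable by |ab| ≤ |a|² + |b|²,
  -- so the order of summation is irrelevant.
  let F : ι × κ → ℂ := fun p ↦ ⟪e p.1, X (f p.2)⟫_ℂ * ⟪f p.2, Y (e p.1)⟫_ℂ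
  have hs1 : Summable fun p : ι × κ ↦ ‖⟪e p.1, X (f p.2)⟫_ℂ‖ ^ 2 := by
    rw [summable_prod_of_nonneg (fun _ ↦ by positivity)]
    have h0 : ∀ n m, ‖⟪e n, X (f m)⟫_ℂ‖ ^ 2 = ‖⟪f m, ContinuousLinearMap.adjoint X (e n)⟫_ℂ‖ ^ 2 := by
      intro n m
      rw [adjoint_inner_right, ← inner_conj_symm, RCLike.norm_conj]
    simp only [h0]
    refine ⟨fun n ↦ (hasSum_norm_inner_sq f (ContinuousLinearMap.adjoint X (e n))).summable, ?_⟩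
    have h1 : (fun n ↦ ∑' m, ‖⟪f m, ContinuousLinearMap.adjoint X (e n)⟫_ℂ‖ ^ 2) =
        fun n ↦ ‖ContinuousLinearMap.adjoint X (e n)‖ ^ 2 :=
      funext fun n ↦ (hasSum_norm_inner_sq f (ContinuousLinearMap.adjoint X (e n))).tsum_eq
    exact h1 ▸ hX.adjoint ι e
  have hs2 : Summable fun p : ι × κ ↦ ‖⟪f p.2, Y (e p.1)⟫_ℂ‖ ^ 2 := by
    rw [summable_prod_of_nonneg (fun _ ↦ by positivity)]
    refine ⟨fun n ↦ (hasSum_norm_inner_sq f (Y (e n))).summable, ?_⟩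
    have h1 : (fun n ↦ ∑' m, ‖⟪f m, Y (e n)⟫_ℂ‖ ^ 2) = fun n ↦ ‖Y (e n)‖ ^ 2 :=
      funext fun n ↦ (hasSum_norm_inner_sq f (Y (e n))).tsum_eq
    exact h1 ▸ hY ι e
  have hF : Summable F := by
    refine Summable.of_norm_bounded (hs1.add hs2) fun p ↦ ?_
    rw [norm_mul]
    nlinarith [sq_nonneg (‖⟪e p.1, X (f p.2)⟫_ℂ‖ - ‖⟪f p.2, Y (e p.1)⟫_ℂ‖),
      sq_nonneg ‖⟪e p.1, X (f p.2)⟫_ℂ‖, sq_nonneg ‖⟪f p.2, Y (e p.1)⟫_ℂ‖]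
  refine ⟨∑' p, F p, hF.hasSum.prod_fiberwise fun n ↦ ?_, ?_⟩
  · have h := f.hasSum_inner_mul_inner (ContinuousLinearMap.adjoint X (e n)) (Y (e n))
    simp only [adjoint_inner_left] at h
    exact h
  · have h1 : HasSum (F ∘ (Equiv.prodComm κ ι)) (∑' p, F p) :=
      (Equiv.hasSum_iff (Equiv.prodComm κ ι)).mpr hF.hasSum
    refine h1.prod_fiberwise fun m ↦ ?_
    have h := e.hasSum_inner_mul_inner (ContinuousLinearMap.adjoint Y (f m)) (X (f m))
    simp only [adjoint_inner_left] at h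
    have h2 : (fun n ↦ F (n, m)) = fun n ↦ ⟪f m, Y (e n)⟫_ℂ * ⟪e n, X (f m)⟫_ℂ :=
      funext fun n ↦ mul_comm _ _
    change HasSum (fun n ↦ F (n, m)) _
    rw [h2]
    exact h

/-- The span of the products of two Hilbert–Schmidt operators. -/
def nuclear (E : Type) [NormedAddCommGroup E] [InnerProductSpace ℂ E] [CompleteSpace E] :
    Submodule ℂ (E →L[ℂ] E) :=
  Submodule.span ℂ {B | ∃ X Y : E →L[ℂ] E, IsHS X ∧ IsHS Y ∧ B = X * Y}

theorem mul_mem_nuclear {X Y : E →L[ℂ] E} (hX : IsHS X) (hY : IsHS Y) : X * Y ∈ nuclear E :=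
  Submodule.subset_span ⟨X, Y, hX, hY, rfl⟩

theorem nuclear_mul_left (V : E →L[ℂ] E) {B : E →L[ℂ] E} (hB : B ∈ nuclear E) :
    V * B ∈ nuclear E := by
  induction hB using Submodule.span_induction with
  | mem B h =>
    obtain ⟨X, Y, hX, hY, rfl⟩ := h
    rw [← mul_assoc]
    exact mul_mem_nuclear (hX.comp_left V) hY
  | zero => rw [mul_zero]; exact zero_mem _
  | add x y _ _ hx hy => rw [mul_add]; exact add_mem hx hy
  | smul c x _ hx => rw [mul_smul_comm]; exact Submodule.smul_mem _ c hx

theorem nuclear_mul_right (V : E →L[ℂ] E) {B : E →L[ℂ] E} (hB : B ∈ nuclear E) :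
    B * V ∈ nuclear E := by
  induction hB using Submodule.span_induction with
  | mem B h =>
    obtain ⟨X, Y, hX, hY, rfl⟩ := h
    rw [mul_assoc]
    exact mul_mem_nuclear hX (hY.comp_right V)
  | zero => rw [zero_mul]; exact zero_mem _
  | add x y _ _ hx hy => rw [add_mul]; exact add_mem hx hy
  | smul c x _ hx => rw [smul_mul_assoc]; exact Submodule.smul_mem _ c hx

/-- `t` is the trace of `B`, computed in any orthonormal basis. -/
def IsTraceOf (B : E →L[ℂ] E) (t : ℂ) : Prop :=
  ∀ (ι : Type) (e : HilbertBasis ι ℂ E), HasSum (fun n ↦ ⟪e n, B (e n)⟫_ℂ) t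

theorem IsTraceOf.unique {B : E →L[ℂ] E} {t u : ℂ} (h : IsTraceOf B t) (h' : IsTraceOf B u) :
    t = u := by
  obtain ⟨τ, ⟨g⟩⟩ := exists_hilbertBasis_type E
  exact (h τ g).unique (h' τ g)

theorem IsTraceOf.add {B D : E →L[ℂ] E} {t u : ℂ} (h : IsTraceOf B t) (h' : IsTraceOf D u) :
    IsTraceOf (B + D) (t + u) := fun ι e ↦ by
  simpa only [_root_.add_apply, inner_add_right] using (h ι e).add (h' ι e)

theorem IsTraceOf.smul {B : E →L[ℂ] E} {t : ℂ} (c : ℂ) (h : IsTraceOf B t) :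
    IsTraceOf (c • B) (c * t) := fun ι e ↦ by
  simpa only [_root_.smul_apply, inner_smul_right] using (h ι e).mul_left c

theorem IsTraceOf.zero : IsTraceOf (0 : E →L[ℂ] E) 0 := fun ι e ↦ by simp

/-- Comparing an arbitrary basis with one fixed basis `g` through `exists_hasSum_swap` shows that
the value is the same for all bases. -/
theorem exists_isTraceOf_mul {X Y : E →L[ℂ] E} (hX : IsHS X) (hY : IsHS Y) :
    ∃ t, IsTraceOf (X * Y) t ∧ IsTraceOf (Y * X) t := by
  obtain ⟨τ, ⟨g⟩⟩ := exists_hilbertBasis_type E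
  obtain ⟨t, h1, h2⟩ := exists_hasSum_swap hX hY g g
  refine ⟨t, fun ι e ↦ ?_, fun ι e ↦ ?_⟩
  · obtain ⟨u, h3, h4⟩ := exists_hasSum_swap hX hY e g
    rwa [h4.unique h2] at h3
  · obtain ⟨u, h3, h4⟩ := exists_hasSum_swap hX hY g e
    rwa [h3.unique h1] at h4

/-- For B = X Y, the chain Tr(V X Y) = Tr(Y V X) = Tr(X Y V) consists of two swaps of
Hilbert–Schmidt factors. -/
theorem exists_isTraceOf_comm {B : E →L[ℂ] E} (hB : B ∈ nuclear E) (V : E →L[ℂ] E) :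
    ∃ t, IsTraceOf (V * B) t ∧ IsTraceOf (B * V) t := by
  induction hB using Submodule.span_induction with
  | mem B h =>
    obtain ⟨X, Y, hX, hY, rfl⟩ := h
    obtain ⟨t, h1, h2⟩ := exists_isTraceOf_mul (hX.comp_left V) hY
    obtain ⟨u, h3, h4⟩ := exists_isTraceOf_mul hX (hY.comp_right V)
    change IsTraceOf (V * X * Y) t at h1
    change IsTraceOf (Y * (V * X)) t at h2
    change IsTraceOf (X * (Y * V)) u at h3
    change IsTraceOf (Y * V * X) u at h4
    rw [mul_assoc] at h1 h4
    rw [← mul_assoc] at h3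
    rw [h4.unique h2] at h3
    exact ⟨t, h1, h3⟩
  | zero => exact ⟨0, by rw [mul_zero]; exact IsTraceOf.zero, by rw [zero_mul]; exact IsTraceOf.zero⟩
  | add x y _ _ hx hy =>
    obtain ⟨t, h1, h2⟩ := hx
    obtain ⟨u, h3, h4⟩ := hy
    exact ⟨t + u, by rw [mul_add]; exact h1.add h3, by rw [add_mul]; exact h2.add h4⟩
  | smul c x _ hx =>
    obtain ⟨t, h1, h2⟩ := hx
    exact ⟨c * t, by rw [mul_smul_comm]; exact h1.smul c, by rw [smul_mul_assoc]; exact h2.smul c⟩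

open Classical in
/-- The trace of a nuclear operator. -/
def tr (B : E →L[ℂ] E) : ℂ := if h : ∃ t, IsTraceOf B t then h.choose else 0

theorem isTraceOf_tr {B : E →L[ℂ] E} (hB : B ∈ nuclear E) : IsTraceOf B (tr B) := by
  obtain ⟨t, h, -⟩ := exists_isTraceOf_comm hB 1
  rw [one_mul] at h
  have h' : ∃ t, IsTraceOf B t := ⟨t, h⟩
  unfold tr
  rw [dif_pos h']
  exact h'.choose_spec

theorem tr_add {B D : E →L[ℂ] E} (hB : B ∈ nuclear E) (hD : D ∈ nuclear E) :
    tr (B + D) = tr B + tr D :=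
  (isTraceOf_tr (add_mem hB hD)).unique ((isTraceOf_tr hB).add (isTraceOf_tr hD))

theorem tr_smul {B : E →L[ℂ] E} (c : ℂ) (hB : B ∈ nuclear E) : tr (c • B) = c * tr B :=
  (isTraceOf_tr (Submodule.smul_mem _ c hB)).unique ((isTraceOf_tr hB).smul c)

theorem tr_zero : tr (0 : E →L[ℂ] E) = 0 := (isTraceOf_tr (zero_mem _)).unique IsTraceOf.zero

theorem tr_comm {B : E →L[ℂ] E} (hB : B ∈ nuclear E) (V : E →L[ℂ] E) :
    tr (V * B) = tr (B * V) := by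
  obtain ⟨t, h1, h2⟩ := exists_isTraceOf_comm hB V
  rw [(isTraceOf_tr (nuclear_mul_left V hB)).unique h1,
    (isTraceOf_tr (nuclear_mul_right V hB)).unique h2]

theorem tr_sum {ι : Type} {s : Finset ι} {B : ι → E →L[ℂ] E} (h : ∀ n ∈ s, B n ∈ nuclear E) :
    tr (∑ n ∈ s, B n) = ∑ n ∈ s, tr (B n) := by
  classical
  induction s using Finset.induction_on with
  | empty => simpa using tr_zero
  | insert a s ha ih =>
    have h1 : ∀ n ∈ s, B n ∈ nuclear E := fun n hn ↦ h n (Finset.mem_insert_of_mem hn)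
    rw [Finset.sum_insert ha, Finset.sum_insert ha,
      tr_add (h a (Finset.mem_insert_self _ _)) (sum_mem h1), ih h1]

/-- The trace of a compression to an orthogonal sum of subspaces. -/
theorem tr_compress_sum {ι : Type} {s : Finset ι} {p : ι → E →L[ℂ] E} {q B : E →L[ℂ] E}
    (hp : ∀ n ∈ s, p n * p n = p n) (hq : q * q = q) (hsum : q = ∑ n ∈ s, p n)
    (hB : B ∈ nuclear E) : tr (q * B * q) = ∑ n ∈ s, tr (p n * B * p n) := by
  -- Cyclicity turns Tr(r B r) into Tr(r B), which is additive in r.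
  have h1 : ∀ r : E →L[ℂ] E, r * r = r → tr (r * B * r) = tr (r * B) := by
    intro r hr
    rw [← tr_comm (nuclear_mul_left r hB) r, ← mul_assoc, hr]
  rw [h1 q hq, Finset.sum_congr rfl fun n hn ↦ h1 (p n) (hp n hn), hsum, Finset.sum_mul,
    tr_sum fun n _ ↦ nuclear_mul_left _ hB]

/-- For a product, ⟪V e, X Y e⟫ = ⟪X*V e, Y e⟫ is at most ‖X*V e‖² + ‖Y e‖² in modulus, and a
contraction V does not increase the Hilbert–Schmidt norm of X*. The bound is uniform in V, so that V
may be an approximate polar part of B. -/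
theorem exists_bound_of_nuclear {B : E →L[ℂ] E} (hB : B ∈ nuclear E) {ι : Type}
    (e : HilbertBasis ι ℂ E) : ∃ M : ℝ, ∀ V : E →L[ℂ] E, ‖V‖ ≤ 1 → ∀ s : Finset ι,
      ‖∑ n ∈ s, ⟪V (e n), B (e n)⟫_ℂ‖ ≤ M := by
  induction hB using Submodule.span_induction with
  | mem B h =>
    obtain ⟨X, Y, hX, hY, rfl⟩ := h
    refine ⟨∑' n, ‖ContinuousLinearMap.adjoint X (e n)‖ ^ 2 + ∑' n, ‖Y (e n)‖ ^ 2,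
      fun V hV s ↦ ?_⟩
    have hZ := hX.adjoint.comp_right V ι e
    have hZle : ∑' n, ‖(ContinuousLinearMap.adjoint X ∘L V) (e n)‖ ^ 2 ≤
        ∑' n, ‖ContinuousLinearMap.adjoint X (e n)‖ ^ 2 := by
      have h1 := tsum_norm_sq_adjoint e e (ContinuousLinearMap.adjoint X ∘L V)
      have h2 := tsum_norm_sq_adjoint e e X
      rw [adjoint_comp, adjoint_adjoint] at h1
      rw [← ENNReal.ofReal_le_ofReal_iff (tsum_nonneg fun _ ↦ by positivity),
        ENNReal.ofReal_tsum_of_nonneg (fun _ ↦ by positivity) hZ,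
        ENNReal.ofReal_tsum_of_nonneg (fun _ ↦ by positivity) (hX.adjoint ι e), h1, ← h2]
      refine ENNReal.tsum_le_tsum fun n ↦ ENNReal.ofReal_le_ofReal ?_
      refine pow_le_pow_left₀ (norm_nonneg _) ?_ 2
      refine ((ContinuousLinearMap.adjoint V).le_opNorm _).trans ?_
      rw [LinearIsometryEquiv.norm_map]
      exact mul_le_of_le_one_left (norm_nonneg _) hV
    calc ‖∑ n ∈ s, ⟪V (e n), (X * Y) (e n)⟫_ℂ‖
        ≤ ∑ n ∈ s, (‖(ContinuousLinearMap.adjoint X ∘L V) (e n)‖ ^ 2 + ‖Y (e n)‖ ^ 2) := by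
          refine (norm_sum_le _ _).trans (Finset.sum_le_sum fun n _ ↦ ?_)
          have h1 : ⟪V (e n), (X * Y) (e n)⟫_ℂ =
              ⟪(ContinuousLinearMap.adjoint X ∘L V) (e n), Y (e n)⟫_ℂ :=
            (adjoint_inner_left X (Y (e n)) (V (e n))).symm
          rw [h1]
          have h2 := norm_inner_le_norm (𝕜 := ℂ)
            ((ContinuousLinearMap.adjoint X ∘L V) (e n)) (Y (e n))
          nlinarith [sq_nonneg (‖(ContinuousLinearMap.adjoint X ∘L V) (e n)‖ - ‖Y (e n)‖),
            sq_nonneg ‖(ContinuousLinearMap.adjoint X ∘L V) (e n)‖, sq_nonneg ‖Y (e n)‖]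
      _ ≤ _ := by
          rw [Finset.sum_add_distrib]
          exact add_le_add ((hZ.sum_le_tsum s fun _ _ ↦ by positivity).trans hZle)
            ((hY ι e).sum_le_tsum s fun _ _ ↦ by positivity)
  | zero => exact ⟨0, fun V _ s ↦ by simp⟩
  | add x y _ _ hx hy =>
    obtain ⟨M, hM⟩ := hx
    obtain ⟨M', hM'⟩ := hy
    refine ⟨M + M', fun V hV s ↦ ?_⟩
    simp only [_root_.add_apply, inner_add_right, Finset.sum_add_distrib]
    exact (norm_add_le _ _).trans (add_le_add (hM V hV s) (hM' V hV s))
  | smul c x _ hx =>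
    obtain ⟨M, hM⟩ := hx
    refine ⟨‖c‖ * M, fun V hV s ↦ ?_⟩
    simp only [_root_.smul_apply, inner_smul_right, ← Finset.mul_sum, norm_mul]
    exact mul_le_mul_of_nonneg_left (hM V hV s) (norm_nonneg _)

/-- An approximate polar decomposition. -/
theorem exists_approx_polar (B : E →L[ℂ] E) {ε : ℝ} (hε : 0 < ε) :
    ∃ V : E →L[ℂ] E, ‖V‖ ≤ 1 ∧ ‖star V * B - CFC.abs B‖ ≤ ε := by
  set a := CFC.abs B with ha
  have ha0 : 0 ≤ a := CFC.abs_nonneg B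
  have hsa : IsSelfAdjoint a := IsSelfAdjoint.of_nonneg ha0
  have haa : a * a = star B * B := CFC.abs_mul_abs B
  have hspec : ∀ t ∈ spectrum ℝ a, 0 ≤ t := fun t ht ↦ spectrum_nonneg_of_nonneg ha0 ht
  have hmax : ∀ t : ℝ, 0 < max t ε := fun t ↦ lt_max_of_lt_right hε
  have hg : Continuous fun t : ℝ ↦ (max t ε)⁻¹ :=
    Continuous.inv₀ (by fun_prop) fun t ↦ (hmax t).ne'
  set g := cfc (fun t : ℝ ↦ (max t ε)⁻¹) a with hgdef
  have hgs : star g = g := IsSelfAdjoint.cfc (f := fun t : ℝ ↦ (max t ε)⁻¹) (a := a)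
  have e1 : g * (a * a) = cfc (fun t : ℝ ↦ (max t ε)⁻¹ * (t * t)) a := by
    rw [cfc_mul (fun t : ℝ ↦ (max t ε)⁻¹) (fun t : ℝ ↦ t * t) a hg.continuousOn (by fun_prop),
      cfc_mul (fun t : ℝ ↦ t) (fun t : ℝ ↦ t) a, cfc_id' ℝ a]
  -- V = B max(|B|, ε)⁻¹ is a regularised phase of B: V*V = |B|² max(|B|, ε)⁻² ≤ 1, and V*B = |B|²
  -- max(|B|, ε)⁻¹ differs from |B| by at most ε.
  refine ⟨B * g, ?_, ?_⟩
  · have h1 : star (B * g) * (B * g) = cfc (fun t : ℝ ↦ (max t ε)⁻¹ * (t * t) * (max t ε)⁻¹) a := by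
      rw [cfc_mul (fun t : ℝ ↦ (max t ε)⁻¹ * (t * t)) (fun t : ℝ ↦ (max t ε)⁻¹) a
        (hg.continuousOn.mul (by fun_prop)) hg.continuousOn, ← e1, star_mul, hgs, haa, ← hgdef]
      simp only [mul_assoc]
    have h2 : ‖B * g‖ * ‖B * g‖ ≤ 1 := by
      rw [← CStarRing.norm_star_mul_self, h1]
      refine norm_cfc_le zero_le_one fun t ht ↦ ?_
      have ht0 := hspec t ht
      rw [Real.norm_of_nonneg (by have := hmax t; positivity)]
      have h3 : t * (max t ε)⁻¹ ≤ 1 := by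
        rw [mul_inv_le_iff₀ (hmax t), one_mul]
        exact le_max_left _ _
      have h4 : 0 ≤ t * (max t ε)⁻¹ := mul_nonneg ht0 (inv_nonneg.mpr (hmax t).le)
      calc _ = (t * (max t ε)⁻¹) * (t * (max t ε)⁻¹) := by ring
        _ ≤ 1 := mul_le_one₀ h3 h4 h3
    nlinarith [norm_nonneg (B * g)]
  · have h1 : star (B * g) * B - a = cfc (fun t : ℝ ↦ (max t ε)⁻¹ * (t * t) - t) a := by
      rw [cfc_sub (fun t : ℝ ↦ (max t ε)⁻¹ * (t * t)) (fun t : ℝ ↦ t) a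
        (hg.continuousOn.mul (by fun_prop)) (by fun_prop), ← e1, star_mul, hgs, haa, cfc_id' ℝ a,
        mul_assoc]
    rw [h1]
    refine norm_cfc_le hε.le fun t ht ↦ ?_
    have ht0 := hspec t ht
    rcases le_or_gt ε t with h | h
    · rw [max_eq_left h, ← mul_assoc, inv_mul_cancel₀ (by linarith), one_mul, sub_self, norm_zero]
      exact hε.le
    · rw [max_eq_right h.le, Real.norm_eq_abs, abs_le]
      have h3 : ε⁻¹ * (t * t) ≤ t := by
        rw [inv_mul_le_iff₀ hε]
        nlinarith
      have h4 : 0 ≤ ε⁻¹ * (t * t) := by positivity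
      constructor <;> linarith

/-- A partial sum of ⟪e, |B| e⟫ differs by arbitrarily little from a partial sum of ⟪V e, B e⟫ with
a contraction V, and the latter are uniformly bounded. -/
theorem isTraceClass_of_nuclear {B : E →L[ℂ] E} (hB : B ∈ nuclear E) : IsTraceClass B := by
  intro ι e
  obtain ⟨M, hM⟩ := exists_bound_of_nuclear hB e
  have ha0 : 0 ≤ CFC.abs B := CFC.abs_nonneg B
  rw [nonneg_iff_isPositive] at ha0
  have hre : ∀ n, ⟪e n, CFC.abs B (e n)⟫_ℂ = ((RCLike.re ⟪e n, CFC.abs B (e n)⟫_ℂ : ℝ) : ℂ) := by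
    intro n
    exact (RCLike.conj_eq_iff_re.mp (by
      rw [inner_conj_symm]
      exact isSelfAdjoint_iff_isSymmetric.mp ha0.isSelfAdjoint _ _)).symm
  have hnn : ∀ n, 0 ≤ RCLike.re ⟪e n, CFC.abs B (e n)⟫_ℂ := fun n ↦
    ha0.re_inner_nonneg_right (e n)
  have hsum : Summable fun n ↦ RCLike.re ⟪e n, CFC.abs B (e n)⟫_ℂ := by
    refine summable_of_sum_le hnn (c := M) fun s ↦ ?_
    refine le_of_forall_pos_le_add fun δ hδ ↦ ?_
    -- With this ε the card s errors add up to at most δ; the added 1 covers the empty sum.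
    obtain ⟨V, hV, hVB⟩ := exists_approx_polar B (ε := δ / (s.card + 1)) 
      (div_pos hδ (Nat.cast_add_one_pos _))
    have h1 : ‖∑ n ∈ s, ⟪e n, CFC.abs B (e n)⟫_ℂ - ∑ n ∈ s, ⟪V (e n), B (e n)⟫_ℂ‖ ≤ δ := by
      rw [← Finset.sum_sub_distrib]
      refine (norm_sum_le _ _).trans ?_
      have h2 : ∀ n ∈ s, ‖⟪e n, CFC.abs B (e n)⟫_ℂ - ⟪V (e n), B (e n)⟫_ℂ‖ ≤ δ / (s.card + 1) := by
        intro n _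
        have h3 : ⟪V (e n), B (e n)⟫_ℂ = ⟪e n, (star V * B) (e n)⟫_ℂ :=
          (adjoint_inner_right V _ _).symm
        rw [h3, ← inner_sub_right, ← _root_.sub_apply]
        refine (norm_inner_le_norm _ _).trans ?_
        rw [e.orthonormal.1 n, one_mul]
        refine (le_opNorm _ _).trans ?_
        rw [e.orthonormal.1 n, mul_one, norm_sub_rev]
        exact hVB
      refine (Finset.sum_le_card_nsmul s _ _ h2).trans ?_
      rw [nsmul_eq_mul, mul_div_assoc', div_le_iff₀ (Nat.cast_add_one_pos _)]
      nlinarith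
    have h2 : ∑ n ∈ s, RCLike.re ⟪e n, CFC.abs B (e n)⟫_ℂ ≤
        ‖∑ n ∈ s, ⟪e n, CFC.abs B (e n)⟫_ℂ‖ := by
      rw [← map_sum]
      exact RCLike.re_le_norm _
    have h3 := norm_le_norm_sub_add (∑ n ∈ s, ⟪e n, CFC.abs B (e n)⟫_ℂ)
      (∑ n ∈ s, ⟪V (e n), B (e n)⟫_ℂ)
    linarith [hM V hV s]
  rw [summable_congr hre]
  exact Complex.hasSum_ofReal.mpr hsum.hasSum |>.summable

theorem hasTrace_of_nuclear {A : E →ₗ.[ℂ] E} {B : E →L[ℂ] E} (hA : A = ofCLM B)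
    (hB : B ∈ nuclear E) : HasTrace A (tr B) :=
  ⟨B, hA, isTraceClass_of_nuclear hB, isTraceOf_tr hB⟩

end HilbertSchmidt

/-! ## Multiplication operators -/

section Multiplication

variable {d N : ℕ} {μ : Measure (Pos d)}

theorem norm_sq_eq_integral (ψ : L2 N μ) : ‖ψ‖ ^ 2 = ∫ x, ‖ψ x‖ ^ 2 ∂μ := by
  have h := L2.inner_def (𝕜 := ℂ) ψ ψ
  have h1 : ∀ x, ⟪ψ x, ψ x⟫_ℂ = ((‖ψ x‖ ^ 2 : ℝ) : ℂ) := fun x ↦ by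
    rw [inner_self_eq_norm_sq_to_K, Complex.ofReal_pow]; rfl
  simp only [h1] at h
  rw [integral_complex_ofReal, inner_self_eq_norm_sq_to_K] at h
  have h2 : ((‖ψ‖ ^ 2 : ℝ) : ℂ) = ((∫ x, ‖ψ x‖ ^ 2 ∂μ : ℝ) : ℂ) := by
    rw [Complex.ofReal_pow]
    exact h
  exact Complex.ofReal_injective h2

theorem coeFn_chi (Ω : Set (Pos d)) (hΩ : MeasurableSet Ω) (ψ : L2 N μ) :
    chi N μ Ω hΩ ψ =ᵐ[μ] Ω.indicator ψ := by
  filter_upwards [coeFn_mulOp (μ := μ) (Ω.indicator fun _ ↦ (1 : Spin N →L[ℂ] Spin N))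
    (stronglyMeasurable_const.indicator hΩ) 1 (fun _ ↦ (norm_indicator_le_norm_self _ _).trans
      ContinuousLinearMap.norm_id_le) ψ] with x hx
  refine hx.trans ?_
  by_cases h : x ∈ Ω
  · rw [Set.indicator_of_mem h, Set.indicator_of_mem h]; rfl
  · rw [Set.indicator_of_notMem h, Set.indicator_of_notMem h]; rfl

theorem coeFn_spinOp (s : Spin N →L[ℂ] Spin N) (ψ : L2 N μ) :
    spinOp μ s ψ =ᵐ[μ] fun x ↦ s (ψ x) := coeFn_mulOp _ _ _ _ ψ

theorem coeFn_phaseOp (k : Pos d) (ψ : L2 N μ) :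
    phaseOp N μ k ψ =ᵐ[μ] fun x ↦ Complex.exp (-(Complex.I * ((⟪k, x⟫_ℝ : ℝ) : ℂ))) • ψ x := by
  filter_upwards [coeFn_mulOp (μ := μ)
    (fun x ↦ Complex.exp (-(Complex.I * ((⟪k, x⟫_ℝ : ℝ) : ℂ))) • (1 : Spin N →L[ℂ] Spin N)) _ _ _ ψ]
    with x hx
  exact hx

theorem norm_phase (r : ℝ) : ‖Complex.exp (-(Complex.I * (r : ℂ)))‖ = 1 := by
  rw [Complex.norm_exp]
  simp

theorem phaseOp_add (k l : Pos d) (ψ : L2 N μ) :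
    phaseOp N μ k (phaseOp N μ l ψ) = phaseOp N μ (k + l) ψ := by
  apply Lp.ext
  filter_upwards [coeFn_phaseOp k (phaseOp N μ l ψ), coeFn_phaseOp l ψ, coeFn_phaseOp (k + l) ψ]
    with x h1 h2 h3
  rw [h1, h2, h3, smul_smul, ← Complex.exp_add, inner_add_left]
  congr 2
  push_cast
  ring

theorem phaseOp_zero (ψ : L2 N μ) : phaseOp N μ 0 ψ = ψ := by
  apply Lp.ext
  filter_upwards [coeFn_phaseOp (0 : Pos d) ψ] with x h1
  rw [h1]
  simp

theorem norm_phaseOp (k : Pos d) (ψ : L2 N μ) : ‖phaseOp N μ k ψ‖ = ‖ψ‖ := by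
  rw [Lp.norm_def, Lp.norm_def]
  refine congrArg _ (eLpNorm_congr_norm_ae ?_)
  filter_upwards [coeFn_phaseOp k ψ] with x h1
  rw [h1, norm_smul, norm_phase, one_mul]

theorem phaseOp_neg_phaseOp (k : Pos d) (ψ : L2 N μ) :
    phaseOp N μ (-k) (phaseOp N μ k ψ) = ψ := by
  rw [phaseOp_add, neg_add_cancel, phaseOp_zero]

theorem phaseOp_phaseOp_neg (k : Pos d) (ψ : L2 N μ) :
    phaseOp N μ k (phaseOp N μ (-k) ψ) = ψ := by
  rw [phaseOp_add, add_neg_cancel, phaseOp_zero]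

theorem inner_phaseOp_left (k : Pos d) (ψ φ : L2 N μ) :
    ⟪phaseOp N μ k ψ, φ⟫_ℂ = ⟪ψ, phaseOp N μ (-k) φ⟫_ℂ := by
  rw [L2.inner_def, L2.inner_def]
  refine integral_congr_ae ?_
  filter_upwards [coeFn_phaseOp k ψ, coeFn_phaseOp (-k) φ] with x h1 h2
  rw [h1, h2, inner_smul_left, inner_smul_right, ← Complex.exp_conj]
  congr 2
  simp

theorem spinOp_phaseOp (s : Spin N →L[ℂ] Spin N) (k : Pos d) (ψ : L2 N μ) :
    spinOp μ s (phaseOp N μ k ψ) = phaseOp N μ k (spinOp μ s ψ) := by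
  apply Lp.ext
  filter_upwards [coeFn_phaseOp k ψ, coeFn_phaseOp k (spinOp μ s ψ), coeFn_spinOp s ψ,
    coeFn_spinOp s (phaseOp N μ k ψ)] with x h1 h2 h3 h4
  rw [h4, h1, h2, h3, map_smul]

theorem chi_mul_chi (A B : Set (Pos d)) (hA : MeasurableSet A) (hB : MeasurableSet B) :
    chi N μ A hA * chi N μ B hB = chi N μ (A ∩ B) (hA.inter hB) := by
  ext1 ψ
  apply Lp.ext
  change chi N μ A hA (chi N μ B hB ψ) =ᵐ[μ] _
  filter_upwards [coeFn_chi A hA (chi N μ B hB ψ), coeFn_chi B hB ψ,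
    coeFn_chi (A ∩ B) (hA.inter hB) ψ] with x h1 h2 h3
  rw [h1, h3]
  by_cases ha : x ∈ A <;> by_cases hb : x ∈ B <;> simp [Set.indicator, ha, hb, h2]

theorem chi_congr {A B : Set (Pos d)} (hA : MeasurableSet A) (hB : MeasurableSet B)
    (h : ∀ᵐ x ∂μ, x ∈ A ↔ x ∈ B) : chi N μ A hA = chi N μ B hB := by
  ext1 ψ
  apply Lp.ext
  filter_upwards [coeFn_chi A hA ψ, coeFn_chi B hB ψ, h] with x h1 h2 h3
  rw [h1, h2]
  by_cases ha : x ∈ A <;> simp [Set.indicator, ha, ← h3]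

theorem chi_mul_self (A : Set (Pos d)) (hA : MeasurableSet A) :
    chi N μ A hA * chi N μ A hA = chi N μ A hA := by
  rw [chi_mul_chi]
  exact chi_congr _ _ (by simp)

theorem chi_adjoint (A : Set (Pos d)) (hA : MeasurableSet A) :
    ContinuousLinearMap.adjoint (chi N μ A hA) = chi N μ A hA := by
  symm
  rw [ContinuousLinearMap.eq_adjoint_iff]
  intro ψ φ
  rw [L2.inner_def, L2.inner_def]
  refine integral_congr_ae ?_
  filter_upwards [coeFn_chi A hA ψ, coeFn_chi A hA φ] with x h1 h2
  rw [h1, h2]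
  by_cases ha : x ∈ A <;> simp [Set.indicator, ha]

/-- A finite union of sets which are disjoint up to null sets. -/
theorem chi_eq_sum {ι : Type} {s : Finset ι} {A : Set (Pos d)} {B : ι → Set (Pos d)}
    (hA : MeasurableSet A) (hB : ∀ n, MeasurableSet (B n))
    (h : ∀ᵐ x ∂μ, (x ∈ A → ∃ n ∈ s, x ∈ B n ∧ ∀ m ∈ s, x ∈ B m → m = n) ∧
      (x ∉ A → ∀ n ∈ s, x ∉ B n)) :
    chi N μ A hA = ∑ n ∈ s, chi N μ (B n) (hB n) := by
  ext1 ψ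
  apply Lp.ext
  have h0 : (∑ n ∈ s, chi N μ (B n) (hB n)) ψ = ∑ n ∈ s, chi N μ (B n) (hB n) ψ := by
    rw [_root_.sum_apply]
  rw [h0]
  have h1 : ∀ᵐ x ∂μ, ∀ n ∈ s, (chi N μ (B n) (hB n) ψ : L2 N μ) x = (B n).indicator ψ x := by
    rw [eventually_all_finset]
    exact fun n _ ↦ coeFn_chi (B n) (hB n) ψ
  filter_upwards [coeFn_chi A hA ψ, h, h1, Lp.coeFn_finsetSum s fun n ↦ chi N μ (B n) (hB n) ψ]
    with x h2 h3 h4 h5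
  rw [h2, h5, Finset.sum_apply, Finset.sum_congr rfl h4]
  by_cases ha : x ∈ A
  · obtain ⟨n, hn, hxn, hu⟩ := h3.1 ha
    rw [Finset.sum_eq_single_of_mem n hn fun m hm hmn ↦
      Set.indicator_of_notMem (fun hxm ↦ hmn (hu m hm hxm)) _,
      Set.indicator_of_mem ha, Set.indicator_of_mem hxn]
  · rw [Set.indicator_of_notMem ha, Finset.sum_eq_zero fun n hn ↦
      Set.indicator_of_notMem (h3.2 ha n hn) _]

/-! ### Position operators -/

theorem mem_graph_position {l : Fin d} {ψ η : L2 N μ} :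
    (ψ, η) ∈ (positionOp N μ l).graph ↔ η =ᵐ[μ] fun x ↦ ((x l : ℝ) : ℂ) • ψ x := by
  rw [LinearPMap.mem_graph_iff]
  constructor
  · rintro ⟨y, rfl, rfl⟩
    exact (memLp_position N μ l y.1 y.2).coeFn_toLp
  · intro h
    have h1 : ψ ∈ positionDomain N μ l := (memLp_congr_ae h).mp (Lp.memLp η)
    refine ⟨⟨ψ, h1⟩, rfl, ?_⟩
    apply Lp.ext
    exact (memLp_position N μ l ψ h1).coeFn_toLp.trans h.symm

theorem inner_position_symm {l : Fin d} {ψ η φ ξ : L2 N μ}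
    (h : (ψ, η) ∈ (positionOp N μ l).graph) (h' : (φ, ξ) ∈ (positionOp N μ l).graph) :
    ⟪η, φ⟫_ℂ = ⟪ψ, ξ⟫_ℂ := by
  rw [mem_graph_position] at h h'
  rw [L2.inner_def, L2.inner_def]
  refine integral_congr_ae ?_
  filter_upwards [h, h'] with x h1 h2
  rw [h1, h2, inner_smul_left, inner_smul_right, Complex.conj_ofReal]

/-- The phase operators in a coordinate direction. -/
abbrev coordPhase (N : ℕ) (μ : Measure (Pos d)) (l : Fin d) (t : ℝ) : L2 N μ →L[ℂ] L2 N μ :=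
  phaseOp N μ (EuclideanSpace.single l t)

theorem inner_single_real (l : Fin d) (t : ℝ) (x : Pos d) :
    ⟪EuclideanSpace.single l t, x⟫_ℝ = t * x l := by
  rw [EuclideanSpace.inner_single_left]
  simp

theorem coeFn_coordPhase (l : Fin d) (t : ℝ) (ψ : L2 N μ) :
    coordPhase N μ l t ψ =ᵐ[μ] fun x ↦ Complex.exp (-(Complex.I * ((t * x l : ℝ) : ℂ))) • ψ x := by
  filter_upwards [coeFn_phaseOp (EuclideanSpace.single l t) ψ] with x h
  rw [h, inner_single_real]

theorem norm_phase_sub_one_le (r : ℝ) : ‖Complex.exp (-(Complex.I * (r : ℂ))) - 1‖ ≤ |r| := by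
  have h := Real.norm_exp_I_mul_ofReal_sub_one_le (x := -r)
  rw [norm_neg, Real.norm_eq_abs] at h
  convert h using 3
  push_cast
  ring_nf

theorem coeFn_coordPhase_sub (l : Fin d) (t : ℝ) (ψ : L2 N μ) :
    (coordPhase N μ l t ψ - ψ : L2 N μ) =ᵐ[μ]
      fun x ↦ (Complex.exp (-(Complex.I * ((t * x l : ℝ) : ℂ))) - 1) • ψ x := by
  filter_upwards [coeFn_coordPhase l t ψ, Lp.coeFn_sub (coordPhase N μ l t ψ) ψ] with x h1 h2
  rw [h2, Pi.sub_apply, h1, sub_smul, one_smul]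

theorem norm_coordPhase_sub_le {l : Fin d} {ψ η : L2 N μ} (h : (ψ, η) ∈ (positionOp N μ l).graph)
    (t : ℝ) : ‖coordPhase N μ l t ψ - ψ‖ ≤ |t| * ‖η‖ := by
  refine Lp.norm_le_mul_norm_of_ae_le_mul ?_
  filter_upwards [coeFn_coordPhase_sub l t ψ, mem_graph_position.mp h] with x h1 h2
  rw [h1, h2, norm_smul, norm_smul, Complex.norm_real, Real.norm_eq_abs, ← mul_assoc, ← abs_mul]
  exact mul_le_mul_of_nonneg_right (norm_phase_sub_one_le _) (norm_nonneg _)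

theorem tendsto_phase_div (r : ℝ) :
    Tendsto (fun t : ℝ ↦ (t : ℂ)⁻¹ * (Complex.exp (-(Complex.I * ((t * r : ℝ) : ℂ))) - 1))
      (𝓝[≠] 0) (𝓝 (-Complex.I * r)) := by
  have h : HasDerivAt (fun t : ℝ ↦ Complex.exp (-(Complex.I * ((t * r : ℝ) : ℂ))))
      (-Complex.I * r) 0 := by
    have h1 : HasDerivAt (fun t : ℝ ↦ -(Complex.I * ((t * r : ℝ) : ℂ))) (-Complex.I * r) 0 := by
      have h2 : HasDerivAt (fun t : ℝ ↦ ((t * r : ℝ) : ℂ)) ((1 * r : ℝ) : ℂ) 0 :=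
        ((hasDerivAt_id (0 : ℝ)).mul_const r).ofReal_comp
      have h3 := (h2.const_mul Complex.I).neg
      rwa [one_mul, ← neg_mul] at h3
    have h2 := h1.cexp
    simpa using h2
  have h2 := hasDerivAt_iff_tendsto_slope.mp h
  refine h2.congr fun t ↦ ?_
  simp only [slope, sub_zero, vsub_eq_sub, zero_mul, Complex.ofReal_zero, mul_zero, neg_zero,
    Complex.exp_zero]
  rw [Complex.real_smul, Complex.ofReal_inv]

/-- The position operator is the weak derivative of the phase operators. -/
theorem tendsto_inner_coordPhase {l : Fin d} {ψ η : L2 N μ}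
    (h : (ψ, η) ∈ (positionOp N μ l).graph) (χ : L2 N μ) :
    Tendsto (fun t : ℝ ↦ (t : ℂ)⁻¹ * ⟪χ, coordPhase N μ l t ψ - ψ⟫_ℂ) (𝓝[≠] 0)
      (𝓝 (-Complex.I * ⟪χ, η⟫_ℂ)) := by
  rw [mem_graph_position] at h
  have h1 : ∀ t : ℝ, (t : ℂ)⁻¹ * ⟪χ, coordPhase N μ l t ψ - ψ⟫_ℂ =
      ∫ x, ((t : ℂ)⁻¹ * (Complex.exp (-(Complex.I * ((t * x l : ℝ) : ℂ))) - 1)) * ⟪χ x, ψ x⟫_ℂ ∂μ := by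
    intro t
    rw [L2.inner_def, ← integral_const_mul]
    refine integral_congr_ae ?_
    filter_upwards [coeFn_coordPhase_sub l t ψ] with x h1
    rw [h1, inner_smul_right, mul_assoc]
  have h2 : -Complex.I * ⟪χ, η⟫_ℂ = ∫ x, (-Complex.I * (x l : ℂ)) * ⟪χ x, ψ x⟫_ℂ ∂μ := by
    rw [L2.inner_def, ← integral_const_mul]
    refine integral_congr_ae ?_
    filter_upwards [h] with x h1
    rw [h1, inner_smul_right, mul_assoc]
  rw [h2, funext h1]
  have hmeas : AEStronglyMeasurable (fun x ↦ ⟪χ x, ψ x⟫_ℂ) μ :=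
    (Lp.aestronglyMeasurable χ).inner (Lp.aestronglyMeasurable ψ)
  -- Since |e^{-iθ} - 1| ≤ |θ|, the difference quotients are dominated by the integrable function
  -- |⟪χ, x_l ψ⟫|.
  refine tendsto_integral_filter_of_dominated_convergence (fun x ↦ ‖⟪χ x, η x⟫_ℂ‖) ?_ ?_ ?_ ?_
  · refine Eventually.of_forall fun t ↦ AEStronglyMeasurable.mul ?_ hmeas
    refine Continuous.aestronglyMeasurable ?_
    fun_prop
  · filter_upwards [self_mem_nhdsWithin] with t ht
    filter_upwards [h] with x hx
    rw [hx, inner_smul_right, norm_mul, norm_mul, norm_mul]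
    refine mul_le_mul_of_nonneg_right ?_ (norm_nonneg _)
    rw [norm_inv, Complex.norm_real, Complex.norm_real, inv_mul_le_iff₀ (norm_pos_iff.mpr ht),
      Real.norm_eq_abs, Real.norm_eq_abs, ← abs_mul]
    exact norm_phase_sub_one_le _
  · exact (L2.integrable_inner (𝕜 := ℂ) χ η).norm
  · exact Eventually.of_forall fun x ↦ (tendsto_phase_div (x l)).mul_const _

/-- A vector on which the phase operators are Lipschitz is in the domain of the position
operator. -/
theorem exists_position_of_lipschitz {l : Fin d} {ψ : L2 N μ} {K : ℝ}
    (h : ∀ t : ℝ, 0 < t → t ≤ 1 → ‖coordPhase N μ l t ψ - ψ‖ ≤ K * t) :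
    ∃ η, (ψ, η) ∈ (positionOp N μ l).graph := by
  -- Fatou along this sequence: the difference quotients have norm at most K and converge pointwise
  -- to -i x_l ψ, which is therefore square integrable.
  let t : ℕ → ℝ := fun n ↦ 1 / ((n : ℝ) + 1)
  have ht0 : ∀ n, 0 < t n := fun n ↦ by positivity
  have ht1 : ∀ n, t n ≤ 1 := fun n ↦ by
    rw [div_le_one (by positivity)]; linarith [n.cast_nonneg (α := ℝ)]
  have htt : Tendsto t atTop (𝓝[≠] 0) := by
    refine tendsto_nhdsWithin_iff.mpr ⟨tendsto_one_div_add_atTop_nhds_zero_nat, ?_⟩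
    exact Eventually.of_forall fun n ↦ (ht0 n).ne'
  let f : ℕ → Pos d → Spin N := fun n x ↦
    (((t n : ℂ))⁻¹ * (Complex.exp (-(Complex.I * ((t n * x l : ℝ) : ℂ))) - 1)) • ψ x
  have hf : ∀ n, f n =ᵐ[μ] ((((t n : ℝ) : ℂ))⁻¹ • (coordPhase N μ l (t n) ψ - ψ) : L2 N μ) := by
    intro n
    filter_upwards [coeFn_coordPhase_sub l (t n) ψ, Lp.coeFn_smul (((t n : ℝ) : ℂ))⁻¹
      (coordPhase N μ l (t n) ψ - ψ)] with x h1 h2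
    rw [h2, Pi.smul_apply, h1, smul_smul]
  have hfm : ∀ n, AEStronglyMeasurable (f n) μ := fun n ↦
    (Lp.aestronglyMeasurable _).congr (hf n).symm
  have hfn : ∀ n, eLpNorm (f n) 2 μ ≤ ENNReal.ofReal K := by
    intro n
    rw [eLpNorm_congr_ae (hf n), ← ENNReal.ofReal_toReal (Lp.eLpNorm_ne_top _), ← Lp.norm_def]
    refine ENNReal.ofReal_le_ofReal ?_
    rw [norm_smul, norm_inv, Complex.norm_real, Real.norm_of_nonneg (ht0 n).le,
      inv_mul_le_iff₀ (ht0 n), mul_comm]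
    exact h _ (ht0 n) (ht1 n)
  have hlim : ∀ᵐ x ∂μ, Tendsto (fun n ↦ f n x) atTop (𝓝 ((-Complex.I * (x l : ℂ)) • ψ x)) :=
    Eventually.of_forall fun x ↦ ((tendsto_phase_div (x l)).comp htt).smul_const _
  have hle := Lp.eLpNorm_lim_le_liminf_eLpNorm (p := 2) hfm _ hlim
  have hmem : MemLp (fun x ↦ (-Complex.I * (x l : ℂ)) • ψ x) 2 μ := by
    refine ⟨aestronglyMeasurable_of_tendsto_ae atTop hfm hlim, hle.trans_lt ?_⟩
    refine lt_of_le_of_lt (b := ENNReal.ofReal K) ?_ ENNReal.ofReal_lt_top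
    exact (liminf_le_liminf (Eventually.of_forall hfn)).trans (by simp)
  have hmem2 := hmem.const_smul Complex.I
  have h3 : (Complex.I • fun x ↦ (-Complex.I * (x l : ℂ)) • ψ x) =
      fun x ↦ ((x l : ℝ) : ℂ) • ψ x := by
    funext x
    rw [Pi.smul_apply, smul_smul]
    congr 1
    rw [← mul_assoc, mul_neg, Complex.I_mul_I, neg_neg, one_mul]
  rw [h3] at hmem2
  exact ⟨hmem2.toLp _, mem_graph_position.mpr hmem2.coeFn_toLp⟩

/-! ### Vectors with bounded support -/

/-- The vectors with bounded support. -/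
def HasBoundedSupport (ψ : L2 N μ) : Prop := ∃ r : ℝ, ∀ᵐ x ∂μ, r < ‖x‖ → ψ x = 0

theorem HasBoundedSupport.exists_position {ψ : L2 N μ} (h : HasBoundedSupport ψ) (l : Fin d) :
    ∃ η, (ψ, η) ∈ (positionOp N μ l).graph := by
  obtain ⟨r, hr⟩ := h
  have h1 : MemLp (fun x ↦ ((x l : ℝ) : ℂ) • ψ x) 2 μ := by
    refine (Lp.memLp ψ).of_le_mul (c := r) ?_ ?_
    · have h2 : Continuous fun x : Pos d ↦ ((x l : ℝ) : ℂ) := by fun_prop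
      exact h2.aestronglyMeasurable.smul (Lp.aestronglyMeasurable ψ)
    · filter_upwards [hr] with x hx
      rw [norm_smul, Complex.norm_real]
      by_cases h2 : r < ‖x‖
      · simp [hx h2]
      · exact mul_le_mul_of_nonneg_right ((PiLp.norm_apply_le x l).trans (not_lt.mp h2))
          (norm_nonneg _)
  exact ⟨h1.toLp _, mem_graph_position.mpr h1.coeFn_toLp⟩

theorem hasBoundedSupport_chi {r : ℝ} {Ω : Set (Pos d)} {hΩ : MeasurableSet Ω}
    (h : Ω ⊆ Metric.closedBall 0 r) (ψ : L2 N μ) : HasBoundedSupport (chi N μ Ω hΩ ψ) := by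
  refine ⟨r, ?_⟩
  filter_upwards [coeFn_chi Ω hΩ ψ] with x hx hr
  rw [hx, Set.indicator_of_notMem]
  intro hx
  have := h hx
  rw [mem_closedBall_zero_iff] at this
  linarith

/-- Cutoffs to growing balls converge by dominated convergence. These vectors are the common core of
everything below: they lie in the domain of each position operator and have smooth transforms. -/
theorem dense_hasBoundedSupport : Dense {ψ : L2 N μ | HasBoundedSupport ψ} := by
  intro ψ
  have hm : ∀ n : ℕ, MeasurableSet (Metric.closedBall (0 : Pos d) n) := fun n ↦
    Metric.isClosed_closedBall.measurableSet
  refine mem_closure_of_tendsto (f := fun n : ℕ ↦ chi N μ (Metric.closedBall 0 n) (hm n) ψ)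
    (b := atTop) ?_ (Eventually.of_forall fun n ↦ hasBoundedSupport_chi (r := n) subset_rfl ψ)
  rw [tendsto_iff_norm_sub_tendsto_zero]
  have h1 : Tendsto (fun n : ℕ ↦ ‖chi N μ (Metric.closedBall 0 n) (hm n) ψ - ψ‖ ^ 2) atTop (𝓝 0) := by
    simp only [norm_sq_eq_integral]
    have h2 : (0 : ℝ) = ∫ _ : Pos d, (0 : ℝ) ∂μ := by simp
    rw [h2]
    have hae : ∀ n : ℕ, (fun x ↦ ‖(chi N μ (Metric.closedBall 0 n) (hm n) ψ - ψ : L2 N μ) x‖ ^ 2)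
        =ᵐ[μ] fun x ↦ ‖(Metric.closedBall (0 : Pos d) n).indicator ψ x - ψ x‖ ^ 2 := by
      intro n
      filter_upwards [coeFn_chi _ (hm n) ψ,
        Lp.coeFn_sub (chi N μ (Metric.closedBall 0 n) (hm n) ψ) ψ] with x h3 h4
      rw [h4, Pi.sub_apply, h3]
    refine tendsto_integral_of_dominated_convergence (fun x ↦ ‖ψ x‖ ^ 2) ?_ ?_ ?_ ?_
    · exact fun n ↦ ((Lp.aestronglyMeasurable _).norm.pow 2)
    · exact (memLp_two_iff_integrable_sq_norm (Lp.aestronglyMeasurable ψ)).mp (Lp.memLp ψ)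
    · intro n
      filter_upwards [hae n] with x hx
      rw [hx, Real.norm_of_nonneg (sq_nonneg _)]
      by_cases hb : x ∈ Metric.closedBall (0 : Pos d) n
      · rw [Set.indicator_of_mem hb, sub_self, norm_zero, zero_pow two_ne_zero]
        exact sq_nonneg _
      · rw [Set.indicator_of_notMem hb, zero_sub, norm_neg]
    · filter_upwards [ae_all_iff.mpr hae] with x hx
      obtain ⟨m, hm⟩ := exists_nat_ge ‖x‖
      refine tendsto_const_nhds.congr' ?_
      filter_upwards [eventually_ge_atTop m] with n hn
      have hb : x ∈ Metric.closedBall (0 : Pos d) n := by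
        rw [mem_closedBall_zero_iff]
        exact hm.trans (by exact_mod_cast hn)
      rw [hx n, Set.indicator_of_mem hb, sub_self, norm_zero]
      simp
  have h2 := h1.sqrt
  simpa [Real.sqrt_sq (norm_nonneg _)] using h2

end Multiplication

/-! ## Geometry of the crystal and magnetic translations -/

namespace Crystal

variable {d : ℕ} (C : Crystal d)

theorem ae_mem_X : ∀ᵐ x ∂C.measure, x ∈ C.X := by
  unfold measure
  split_ifs with h
  · rw [h]; exact Eventually.of_forall fun x ↦ Set.mem_univ x
  · exact ae_restrict_mem C.measurableSet_X

instance : SigmaFinite C.measure := by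
  unfold measure
  split_ifs with h
  · infer_instance
  · have hX : ∀ r : ℝ, (C.X ∩ Metric.closedBall 0 r).Finite :=
      (C.continuum_or_discrete.resolve_left h).2
    refine ⟨⟨⟨fun n ↦ Metric.closedBall 0 n, fun _ ↦ trivial, fun n ↦ ?_, ?_⟩⟩⟩
    · rw [Measure.restrict_apply Metric.isClosed_closedBall.measurableSet, Set.inter_comm]
      exact Measure.count_apply_lt_top.mpr (hX n)
    · exact Metric.iUnion_closedBall_nat 0

instance discreteTopology_lattice : DiscreteTopology C.lattice :=
  inferInstanceAs (DiscreteTopology (Submodule.span ℤ (Set.range C.a)))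

theorem finite_lattice_norm_le (r : ℝ) : {γ : C.lattice | ‖(γ : Pos d)‖ ≤ r}.Finite := by
  have hd : DiscreteTopology (C.lattice : Set (Pos d)) := C.discreteTopology_lattice
  have hd' : DiscreteTopology C.lattice.toAddSubgroup := C.discreteTopology_lattice
  have h := Metric.finite_isBounded_inter_isClosed (K := Metric.closedBall (0 : Pos d) r)
    (s := (C.lattice : Set (Pos d))) ⟨hd⟩ Metric.isBounded_closedBall ?_
  · refine Set.Finite.of_finite_image (f := fun γ : C.lattice ↦ (γ : Pos d)) (h.subset ?_)
      Subtype.val_injective.injOn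
    rintro _ ⟨γ, hγ, rfl⟩
    exact ⟨mem_closedBall_zero_iff.mpr hγ, γ.2⟩
  · exact AddSubgroup.isClosed_of_discrete (H := C.lattice.toAddSubgroup)

theorem exists_cell_subset (b : Module.Basis (Fin d) ℝ (Pos d)) (L : ℝ) :
    ∃ r : ℝ, C.cell b L ⊆ Metric.closedBall 0 r := by
  refine ⟨∑ j, |L / 2| * ‖b j‖, fun x hx ↦ ?_⟩
  rw [mem_closedBall_zero_iff, ← b.sum_repr x]
  refine (norm_sum_le _ _).trans (Finset.sum_le_sum fun j _ ↦ ?_)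
  rw [norm_smul]
  exact mul_le_mul_of_nonneg_right ((hx.2 j).trans (le_abs_self _)) (norm_nonneg _)

theorem exists_int_repr {b : Module.Basis (Fin d) ℝ (Pos d)} (hb : C.IsLatticeBasis b)
    (γ : C.lattice) : ∃ n : Fin d → ℤ, ∀ j, b.repr (γ : Pos d) j = n j := by
  have h : (γ : Pos d) ∈ Submodule.span ℤ (Set.range b) := by
    rw [show Submodule.span ℤ (Set.range b) = C.lattice from hb]
    exact γ.2
  rw [Module.Basis.mem_span_iff_repr_mem] at h
  choose n hn using h
  exact ⟨n, fun j ↦ (hn j).symm⟩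

theorem exists_lattice_repr {b : Module.Basis (Fin d) ℝ (Pos d)} (hb : C.IsLatticeBasis b)
    (n : Fin d → ℤ) : ∃ γ : C.lattice, ∀ j, b.repr (γ : Pos d) j = n j := by
  have h : ∑ j, (n j : ℝ) • b j ∈ C.lattice := by
    rw [← hb]
    refine Submodule.sum_mem _ fun j _ ↦ ?_
    rw [Int.cast_smul_eq_zsmul]
    exact Submodule.smul_mem _ _ (Submodule.subset_span ⟨j, rfl⟩)
  refine ⟨⟨_, h⟩, fun j ↦ ?_⟩
  simp [Finsupp.single_apply]

theorem isLatticeBasis_self : C.IsLatticeBasis C.a := rfl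

/-- The cell of odd side length is covered by the translates of the unit cell by the lattice points
in it. -/
theorem exists_sub_mem_cell {b : Module.Basis (Fin d) ℝ (Pos d)} (hb : C.IsLatticeBasis b) (l : ℕ)
    {x : Pos d} (hx : x ∈ C.cell b (2 * l + 1)) :
    ∃ γ : C.lattice, (∀ j, |b.repr (γ : Pos d) j| ≤ l) ∧ x - γ ∈ C.cell b 1 := by
  -- ⌈x_j - 1/2⌉ is an integer within 1/2 of x_j. It leaves [-l, l] only for x_j = -(l + 1/2), where
  -- it is -l - 1; the maximum corrects this boundary case.
  obtain ⟨γ, hγ⟩ := C.exists_lattice_repr hb fun j ↦ max (-(l : ℤ)) ⌈b.repr x j - 1 / 2⌉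
  have key : ∀ j, |b.repr (γ : Pos d) j| ≤ l ∧ |b.repr x j - b.repr (γ : Pos d) j| ≤ 1 / 2 := by
    intro j
    have h := abs_le.mp (hx.2 j)
    rw [hγ]
    have h1 := Int.le_ceil (b.repr x j - 1 / 2)
    have h2 := Int.ceil_lt_add_one (b.repr x j - 1 / 2)
    have h3 : ⌈b.repr x j - 1 / 2⌉ ≤ (l : ℤ) := by
      rw [Int.ceil_le]; push_cast; linarith [h.2]
    have h3' : (⌈b.repr x j - 1 / 2⌉ : ℝ) ≤ l := by exact_mod_cast h3
    rcases le_total (-(l : ℤ)) ⌈b.repr x j - 1 / 2⌉ with h4 | h4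
    · rw [max_eq_right h4]
      have h4' : (-(l : ℝ)) ≤ ⌈b.repr x j - 1 / 2⌉ := by exact_mod_cast h4
      exact ⟨abs_le.mpr ⟨h4', h3'⟩, abs_le.mpr ⟨by linarith, by linarith⟩⟩
    · rw [max_eq_left h4]
      have h4' : (⌈b.repr x j - 1 / 2⌉ : ℝ) ≤ -(l : ℝ) := by exact_mod_cast h4
      have h5 : (0 : ℝ) ≤ l := l.cast_nonneg
      push_cast
      exact ⟨abs_le.mpr ⟨by linarith, by linarith⟩, abs_le.mpr ⟨by linarith [h.1], by linarith⟩⟩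
  refine ⟨γ, fun j ↦ (key j).1, (C.sub_mem_iff γ x).mpr hx.1, fun j ↦ ?_⟩
  rw [map_sub, Finsupp.sub_apply]
  exact (key j).2

theorem exists_translate_mem_cell {b : Module.Basis (Fin d) ℝ (Pos d)} (hb : C.IsLatticeBasis b)
    {x : Pos d} (hx : x ∈ C.X) : ∃ γ : C.lattice, x - γ ∈ C.cell b 1 := by
  obtain ⟨l, hl⟩ := exists_nat_ge (∑ j, |b.repr x j|)
  have h : x ∈ C.cell b (2 * l + 1) := by
    refine ⟨hx, fun j ↦ ?_⟩
    have := Finset.single_le_sum (f := fun j ↦ |b.repr x j|) (fun _ _ ↦ abs_nonneg _)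
      (Finset.mem_univ j)
    linarith
  obtain ⟨γ, -, hγ⟩ := C.exists_sub_mem_cell hb l h
  exact ⟨γ, hγ⟩

/-- The translate `A + γ`. -/
def translate (γ : C.lattice) (A : Set (Pos d)) : Set (Pos d) := (fun x ↦ x - (γ : Pos d)) ⁻¹' A

theorem mem_translate {γ : C.lattice} {A : Set (Pos d)} {x : Pos d} :
    x ∈ C.translate γ A ↔ x - γ ∈ A := Iff.rfl

theorem measurableSet_translate (γ : C.lattice) {A : Set (Pos d)} (hA : MeasurableSet A) :
    MeasurableSet (C.translate γ A) := measurable_sub_const (γ : Pos d) hA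

/-- The translates of `A` are disjoint up to null sets. -/
def IsPacking (A : Set (Pos d)) : Prop :=
  ∀ γ : C.lattice, γ ≠ 0 → C.measure (A ∩ C.translate γ A) = 0

theorem measure_translate_inter {A B : Set (Pos d)} (hA : MeasurableSet A) (hB : MeasurableSet B)
    (γ η : C.lattice) : C.measure (C.translate γ A ∩ C.translate η B) =
      C.measure (A ∩ C.translate (η - γ) B) := by
  have h := (C.measurePreserving_sub γ).measure_preimage
    (hA.inter (C.measurableSet_translate (η - γ) hB)).nullMeasurableSet
  rw [← h]
  congr 1
  ext x
  simp [translate]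

theorem IsPacking.ae_unique {A : Set (Pos d)} (hA : C.IsPacking A) (hm : MeasurableSet A) :
    ∀ᵐ x ∂C.measure, ∀ γ η : C.lattice, x - (γ : Pos d) ∈ A →
      x - (η : Pos d) ∈ A → γ = η := by
  rw [ae_all_iff]
  intro γ
  rw [ae_all_iff]
  intro η
  by_cases h : γ = η
  · exact Eventually.of_forall fun x _ _ ↦ h
  · have h1 : C.measure (C.translate γ A ∩ C.translate η A) = 0 := by
      rw [C.measure_translate_inter hm hm]
      exact hA _ (sub_ne_zero.mpr (Ne.symm h))
    filter_upwards [measure_eq_zero_iff_ae_notMem.mp h1] with x hx h2 h3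
    exact absurd ⟨h2, h3⟩ hx

/-- Unfolding of an integral over the unit cell. -/
theorem lintegral_eq_tsum_cell (hC : C.IsPrimitiveCell C.a) (f : Pos d → ENNReal) :
    ∫⁻ x, f x ∂C.measure = ∑' γ : C.lattice, ∫⁻ x in C.translate γ (C.cell C.a 1), f x ∂C.measure := by
  have hm := C.measurableSet_cell C.a 1
  rw [← lintegral_iUnion₀ (fun γ ↦ (C.measurableSet_translate γ hm).nullMeasurableSet)]
  · rw [← setLIntegral_univ]
    refine setLIntegral_congr ?_
    refine (eventuallyEq_univ.mpr ?_).symm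
    filter_upwards [C.ae_mem_X] with x hx
    obtain ⟨γ, hγ⟩ := C.exists_translate_mem_cell C.isLatticeBasis_self hx
    exact Set.mem_iUnion.mpr ⟨γ, hγ⟩
  · intro γ η h
    change C.measure (C.translate γ _ ∩ C.translate η _) = 0
    rw [C.measure_translate_inter hm hm]
    exact hC _ (sub_ne_zero.mpr (Ne.symm h))

end Crystal

/-! ### Magnetic translations as unitary operators -/

section Translations

variable {d N : ℕ} {C : Crystal d} (T : MagneticCocycle C N)

theorem coeFn_translationOp (γ : C.lattice) (ψ : Hilb C N) :
    translationOp T γ ψ =ᵐ[C.measure]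
      fun x ↦ (T.M γ x : Spin N →L[ℂ] Spin N) (ψ (x - γ)) := by
  filter_upwards [coeFn_mulOp (fun x ↦ (T.M γ x : Spin N →L[ℂ] Spin N)) (T.measurable γ) 1
    (fun x ↦ norm_unitary_le (T.M γ x))
    (Lp.compMeasurePreserving (fun x ↦ x - (γ : Pos d)) (C.measurePreserving_sub γ) ψ),
    Lp.coeFn_compMeasurePreserving ψ (C.measurePreserving_sub γ)] with x h1 h2
  exact h1.trans (congrArg _ h2)

theorem norm_unitary_apply (U : unitary (Spin N →L[ℂ] Spin N)) (v : Spin N) :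
    ‖(U : Spin N →L[ℂ] Spin N) v‖ = ‖v‖ := by
  have h := Unitary.norm_map U v
  exact h

theorem translationOp_translationOp (γ η : C.lattice) (ψ : Hilb C N) :
    translationOp T η (translationOp T γ ψ) = translationOp T (γ + η) ψ := by
  apply Lp.ext
  filter_upwards [coeFn_translationOp T η (translationOp T γ ψ),
    (C.measurePreserving_sub η).quasiMeasurePreserving.ae (coeFn_translationOp T γ ψ),
    coeFn_translationOp T (γ + η) ψ, C.ae_mem_X] with x h1 h2 h3 hx
  rw [h1, h2, h3, T.cocycle γ η x hx]
  have : x - ((γ + η : C.lattice) : Pos d) = x - η - γ := by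
    rw [Submodule.coe_add]; abel
  rw [this]
  rfl

/-- The cocycle condition at γ₁ = γ₂ = 0 says that M(0, x) is idempotent, and an invertible
idempotent is the identity. -/
theorem translationOp_zero (ψ : Hilb C N) : translationOp T 0 ψ = ψ := by
  apply Lp.ext
  filter_upwards [coeFn_translationOp T 0 ψ, C.ae_mem_X] with x h1 hx
  have h2 := T.cocycle 0 0 x hx
  simp only [add_zero, ZeroMemClass.coe_zero, sub_zero] at h2
  have h3 : T.M 0 x = 1 := by
    have h4 := congrArg (fun u ↦ (T.M 0 x)⁻¹ * u) h2
    simpa using h4.symm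
  rw [h1, h3]
  simp

theorem norm_translationOp (γ : C.lattice) (ψ : Hilb C N) : ‖translationOp T γ ψ‖ = ‖ψ‖ := by
  have h : ∀ (γ : C.lattice) (ψ : Hilb C N), ‖translationOp T γ ψ‖ ≤ ‖ψ‖ := by
    intro γ ψ
    rw [← Lp.norm_compMeasurePreserving ψ (C.measurePreserving_sub γ)]
    refine Lp.norm_le_norm_of_ae_le ?_
    filter_upwards [coeFn_translationOp T γ ψ,
      Lp.coeFn_compMeasurePreserving ψ (C.measurePreserving_sub γ)] with x h1 h2
    rw [h1, h2, norm_unitary_apply]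
    rfl
  refine le_antisymm (h γ ψ) ?_
  have h1 := h (-γ) (translationOp T γ ψ)
  rwa [translationOp_translationOp, add_neg_cancel, translationOp_zero] at h1

/-- The magnetic translations as unitary operators. -/
def translationIso (γ : C.lattice) : Hilb C N ≃ₗᵢ[ℂ] Hilb C N where
  toLinearEquiv := LinearEquiv.ofLinearMap (translationOp T γ : Hilb C N →ₗ[ℂ] Hilb C N)
    (translationOp T (-γ) : Hilb C N →ₗ[ℂ] Hilb C N)
    (by ext1 ψ; change translationOp T γ (translationOp T (-γ) ψ) = ψ
        rw [translationOp_translationOp, neg_add_cancel, translationOp_zero])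
    (by ext1 ψ; change translationOp T (-γ) (translationOp T γ ψ) = ψ
        rw [translationOp_translationOp, add_neg_cancel, translationOp_zero])
  norm_map' := norm_translationOp T γ

theorem translationIso_apply (γ : C.lattice) (ψ : Hilb C N) :
    translationIso T γ ψ = translationOp T γ ψ := rfl

theorem translationOp_chi (γ : C.lattice) (A : Set (Pos d)) (hA : MeasurableSet A) (ψ : Hilb C N) :
    translationOp T γ (chi N C.measure A hA ψ) =
      chi N C.measure (C.translate γ A) (C.measurableSet_translate γ hA) (translationOp T γ ψ) := by
  apply Lp.ext
  filter_upwards [coeFn_translationOp T γ (chi N C.measure A hA ψ),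
    coeFn_chi _ (C.measurableSet_translate γ hA) (translationOp T γ ψ),
    (C.measurePreserving_sub γ).quasiMeasurePreserving.ae (coeFn_chi A hA ψ),
    coeFn_translationOp T γ ψ] with x h1 h2 h3 h4
  rw [h1, h2, h3]
  by_cases h : x - (γ : Pos d) ∈ A
  · rw [Set.indicator_of_mem h, Set.indicator_of_mem (show x ∈ C.translate γ A from h), h4]
  · rw [Set.indicator_of_notMem h, Set.indicator_of_notMem (show x ∉ C.translate γ A from h),
      map_zero]

theorem translationOp_position (γ : C.lattice) {l : Fin d} {ψ η : Hilb C N}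
    (h : (ψ, η) ∈ (positionOp N C.measure l).graph) :
    (translationOp T γ ψ, translationOp T γ η + (((γ : Pos d) l : ℝ) : ℂ) • translationOp T γ ψ) ∈
      (positionOp N C.measure l).graph := by
  rw [mem_graph_position] at h ⊢
  filter_upwards [coeFn_translationOp T γ ψ, coeFn_translationOp T γ η,
    (C.measurePreserving_sub γ).quasiMeasurePreserving.ae h,
    Lp.coeFn_add (translationOp T γ η) ((((γ : Pos d) l : ℝ) : ℂ) • translationOp T γ ψ),
    Lp.coeFn_smul (((γ : Pos d) l : ℝ) : ℂ) (translationOp T γ ψ)] with x h1 h2 h3 h4 h5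
  rw [h4, Pi.add_apply, h5, Pi.smul_apply, h1, h2, h3, map_smul, ← add_smul]
  congr 1
  rw [PiLp.sub_apply]
  push_cast
  ring

theorem tsum_norm_chi_translate (hC : C.IsPrimitiveCell C.a) (ψ : Hilb C N) :
    ∑' γ : C.lattice, ENNReal.ofReal (‖chi N C.measure (C.translate γ (C.cell C.a 1))
      (C.measurableSet_translate γ (C.measurableSet_cell C.a 1)) ψ‖ ^ 2) =
      ENNReal.ofReal (‖ψ‖ ^ 2) := by
  have h : ∀ φ : Hilb C N, ENNReal.ofReal (‖φ‖ ^ 2) = ∫⁻ x, ‖φ x‖ₑ ^ 2 ∂C.measure := by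
    intro φ
    rw [norm_sq_eq_integral, ofReal_integral_eq_lintegral_ofReal
      ((memLp_two_iff_integrable_sq_norm (Lp.aestronglyMeasurable φ)).mp (Lp.memLp φ))
      (Eventually.of_forall fun _ ↦ sq_nonneg _)]
    refine lintegral_congr fun x ↦ ?_
    rw [ENNReal.ofReal_pow (norm_nonneg _), ofReal_norm]
  rw [h, C.lintegral_eq_tsum_cell hC]
  refine tsum_congr fun γ ↦ ?_
  have hm := C.measurableSet_translate γ (C.measurableSet_cell C.a 1)
  rw [h, ← lintegral_indicator hm]
  refine lintegral_congr_ae ?_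
  filter_upwards [coeFn_chi _ hm ψ] with x hx
  rw [hx]
  by_cases hx : x ∈ C.translate γ (C.cell C.a 1) <;> simp [Set.indicator, hx]

end Translations

/-! ## Momentum space -/

section Torus

/-- The normalised Haar measure of the circle. -/
local instance unitCircleMeasureSpace : MeasureSpace UnitAddCircle := ⟨AddCircle.haarAddCircle⟩

local instance : Measure.IsAddHaarMeasure (volume : Measure UnitAddCircle) :=
  inferInstanceAs (Measure.IsAddHaarMeasure AddCircle.haarAddCircle)

local instance : IsProbabilityMeasure (volume : Measure UnitAddCircle) :=
  inferInstanceAs (IsProbabilityMeasure AddCircle.haarAddCircle)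

theorem eLpNorm_two_sq {α E : Type*} [MeasurableSpace α] [NormedAddCommGroup E] (f : α → E)
    (μ : Measure α) : eLpNorm f 2 μ ^ 2 = ∫⁻ x, ‖f x‖ₑ ^ 2 ∂μ := by
  rw [eLpNorm_eq_lintegral_rpow_enorm_toReal (by norm_num) (by norm_num), ← ENNReal.rpow_natCast,
    ← ENNReal.rpow_mul]
  simp

namespace Crystal

variable {d : ℕ} (C : Crystal d)

/-- The coordinates `k · a_j / 2π` of a momentum. -/
def momentumCoordLinear : Pos d →ₗ[ℝ] (Fin d → ℝ) :=
  LinearMap.pi fun j ↦ (2 * Real.pi)⁻¹ • (innerSL ℝ (C.a j)).toLinearMap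

theorem momentumCoordLinear_apply (k : Pos d) (j : Fin d) :
    C.momentumCoordLinear k j = (2 * Real.pi)⁻¹ * ⟪C.a j, k⟫_ℝ := rfl

theorem momentumCoordLinear_injective : Function.Injective C.momentumCoordLinear := by
  rw [injective_iff_map_eq_zero]
  intro k hk
  have h1 : ∀ j, ⟪C.a j, k⟫_ℝ = 0 := by
    intro j
    have h := congrFun hk j
    rw [momentumCoordLinear_apply] at h
    have hpi := Real.pi_pos
    simpa [hpi.ne'] using h
  have h2 : ∀ x : Pos d, ⟪x, k⟫_ℝ = 0 := by
    intro x
    rw [← C.a.sum_repr x, sum_inner]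
    refine Finset.sum_eq_zero fun j _ ↦ ?_
    rw [inner_smul_left, h1 j, mul_zero]
  exact inner_self_eq_zero.mp (h2 k)

/-- The coordinates `k · a_j / 2π` of a momentum, as a linear equivalence. -/
def momentumCoord : Pos d ≃L[ℝ] (Fin d → ℝ) :=
  (LinearMap.linearEquivOfInjective C.momentumCoordLinear C.momentumCoordLinear_injective
    (by simp)).toContinuousLinearEquiv

theorem momentumCoord_apply (k : Pos d) (j : Fin d) :
    C.momentumCoord k j = (2 * Real.pi)⁻¹ * ⟪C.a j, k⟫_ℝ := rfl

/-- The integer coordinates of a lattice vector. -/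
def latticeCoord (γ : C.lattice) : Fin d → ℤ := (C.exists_int_repr C.isLatticeBasis_self γ).choose

theorem repr_lattice (γ : C.lattice) (j : Fin d) : C.a.repr (γ : Pos d) j = C.latticeCoord γ j :=
  (C.exists_int_repr C.isLatticeBasis_self γ).choose_spec j

theorem latticeCoord_injective : Function.Injective C.latticeCoord := by
  intro γ η h
  refine Subtype.ext (C.a.repr.injective (Finsupp.ext fun j ↦ ?_))
  rw [C.repr_lattice, C.repr_lattice, h]

theorem latticeCoord_surjective : Function.Surjective C.latticeCoord := by
  intro n
  obtain ⟨γ, hγ⟩ := C.exists_lattice_repr C.isLatticeBasis_self n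
  refine ⟨γ, funext fun j ↦ ?_⟩
  have := C.repr_lattice γ j
  rw [hγ] at this
  exact_mod_cast this.symm

theorem inner_lattice (k : Pos d) (γ : C.lattice) :
    ⟪k, (γ : Pos d)⟫_ℝ = 2 * Real.pi * ∑ j, C.latticeCoord γ j * C.momentumCoord k j := by
  conv_lhs => rw [← C.a.sum_repr (γ : Pos d)]
  rw [inner_sum, Finset.mul_sum]
  refine Finset.sum_congr rfl fun j _ ↦ ?_
  rw [inner_smul_right, C.repr_lattice, momentumCoord_apply, real_inner_comm]
  have := Real.pi_pos
  field_simp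

theorem mem_dualLattice_of_coord {g : Pos d} {n : Fin d → ℤ} (h : ∀ j, C.momentumCoord g j = n j) :
    g ∈ C.dualLattice := by
  intro γ hγ
  refine ⟨∑ j, C.latticeCoord ⟨γ, hγ⟩ j * n j, ?_⟩
  have h1 := C.inner_lattice g ⟨γ, hγ⟩
  simp only [h] at h1
  rw [h1]
  push_cast
  ring

/-- The character `e^{i k · γ}`. -/
def character (γ : C.lattice) (k : Pos d) : ℂ :=
  Complex.exp (Complex.I * ((⟪k, (γ : Pos d)⟫_ℝ : ℝ) : ℂ))

theorem norm_character (γ : C.lattice) (k : Pos d) : ‖C.character γ k‖ = 1 := by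
  unfold character
  rw [Complex.norm_exp]
  simp

theorem continuous_character (γ : C.lattice) : Continuous (C.character γ) := by
  unfold character
  fun_prop

/-- The parametrisation of the Brillouin zone with corner `q` by the torus. -/
def zoneMap (q : Fin d → ℝ) (x : UnitAddTorus (Fin d)) : Pos d :=
  C.momentumCoord.symm (UnitAddTorus.measurableEquivPiIoc q x : Fin d → ℝ)

theorem measurable_zoneMap (q : Fin d → ℝ) : Measurable (C.zoneMap q) :=
  C.momentumCoord.symm.continuous.measurable.comp
    (measurable_subtype_coe.comp (UnitAddTorus.measurableEquivPiIoc q).measurable)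

/-- The normalised measure of the Brillouin zone with corner `q`. -/
def zoneMeasure (q : Fin d → ℝ) : Measure (Pos d) :=
  (volume : Measure (UnitAddTorus (Fin d))).map (C.zoneMap q)

theorem measurePreserving_zoneMap (q : Fin d → ℝ) :
    MeasurePreserving (C.zoneMap q) (volume : Measure (UnitAddTorus (Fin d))) (C.zoneMeasure q) :=
  ⟨C.measurable_zoneMap q, rfl⟩

instance (q : Fin d → ℝ) : IsProbabilityMeasure (C.zoneMeasure q) :=
  Measure.isProbabilityMeasure_map (C.measurable_zoneMap q).aemeasurable

/-- In the coordinates k · a_j / 2π the character of γ is the Fourier monomial whose exponents are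
the integer coordinates of γ. -/
theorem character_zoneMap (q : Fin d → ℝ) (γ : C.lattice) (x : UnitAddTorus (Fin d)) :
    C.character γ (C.zoneMap q x) = UnitAddTorus.mFourier (C.latticeCoord γ) x := by
  set y := UnitAddTorus.measurableEquivPiIoc q x with hy
  have hx : x = fun i ↦ ((y : Fin d → ℝ) i : UnitAddCircle) := by
    rw [← UnitAddTorus.coe_symm_measurableEquivPiIoc_apply, hy, MeasurableEquiv.symm_apply_apply]
  have h1 : C.momentumCoord (C.zoneMap q x) = (y : Fin d → ℝ) :=
    C.momentumCoord.apply_symm_apply _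
  unfold character
  rw [C.inner_lattice, h1]
  conv_rhs => rw [hx]
  change _ = ∏ i, fourier (C.latticeCoord γ i) (((y : Fin d → ℝ) i : UnitAddCircle))
  simp only [fourier_coe_apply]
  rw [← Complex.exp_sum]
  congr 1
  push_cast
  rw [Finset.mul_sum, Finset.mul_sum]
  refine Finset.sum_congr rfl fun i _ ↦ ?_
  ring

/-- The cube of momentum coordinates. -/
def cube (q : Fin d → ℝ) : Set (Fin d → ℝ) := {x | ∀ i, x i ∈ Set.Ioc (q i) (q i + 1)}

theorem measurableSet_cube (q : Fin d → ℝ) : MeasurableSet (cube q) :=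
  MeasurableSet.univ_pi' fun _ ↦ measurableSet_Ioc

theorem zoneMeasure_eq (q : Fin d → ℝ) :
    C.zoneMeasure q = ((volume : Measure (Fin d → ℝ)).restrict (cube q)).map C.momentumCoord.symm := by
  have h := (UnitAddTorus.measurePreserving_equivPiIoc q).map_eq
  have h2 : (Measure.comap Subtype.val volume : Measure (cube q)).map Subtype.val =
      (volume : Measure (Fin d → ℝ)).restrict (cube q) :=
    map_comap_subtype_coe (measurableSet_cube q) volume
  rw [← h2]
  unfold zoneMeasure
  change Measure.map (C.momentumCoord.symm ∘ (Subtype.val ∘ UnitAddTorus.measurableEquivPiIoc q)) _ = _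
  rw [← Measure.map_map C.momentumCoord.symm.continuous.measurable
    (measurable_subtype_coe.comp (UnitAddTorus.measurableEquivPiIoc q).measurable),
    ← Measure.map_map measurable_subtype_coe (UnitAddTorus.measurableEquivPiIoc q).measurable]
  congr 2

theorem exists_map_volume : ∃ c : ENNReal, c ≠ 0 ∧ c ≠ ⊤ ∧
    (volume : Measure (Fin d → ℝ)).map C.momentumCoord.symm = c • (volume : Measure (Pos d)) := by
  have h : ((volume : Measure (Fin d → ℝ)).map C.momentumCoord.symm).IsAddHaarMeasure :=
    C.momentumCoord.symm.isAddHaarMeasure_map _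
  refine ⟨Measure.addHaarScalarFactor ((volume : Measure (Fin d → ℝ)).map C.momentumCoord.symm)
    volume, ?_, ENNReal.coe_ne_top, Measure.isAddLeftInvariant_eq_smul _ _⟩
  exact ENNReal.coe_ne_zero.mpr (Measure.addHaarScalarFactor_pos_of_isAddHaarMeasure _ _).ne'

/-- The half-open cube lies in the compact closed one. This transfers the L² convergence on compact
sets, which defines the transform, to each Brillouin zone. -/
theorem exists_zoneMeasure_le (q : Fin d → ℝ) : ∃ (K : Set (Pos d)) (c : ENNReal), IsCompact K ∧
    c ≠ ⊤ ∧ C.zoneMeasure q ≤ c • (volume : Measure (Pos d)).restrict K := by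
  obtain ⟨c, -, hc, h⟩ := C.exists_map_volume
  have hcomp : IsCompact (Set.univ.pi fun i ↦ Set.Icc (q i) (q i + 1)) :=
    isCompact_univ_pi fun i ↦ isCompact_Icc
  refine ⟨C.momentumCoord.symm '' (Set.univ.pi fun i ↦ Set.Icc (q i) (q i + 1)), c,
    hcomp.image C.momentumCoord.symm.continuous, hc, ?_⟩
  have hm := C.momentumCoord.symm.continuous.measurable
  have hcm : MeasurableSet (C.momentumCoord.symm '' (Set.univ.pi fun i ↦ Set.Icc (q i) (q i + 1))) :=
    (hcomp.image C.momentumCoord.symm.continuous).isClosed.measurableSet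
  rw [zoneMeasure_eq, ← Measure.restrict_smul, ← h, Measure.restrict_map hm hcm]
  refine Measure.map_mono (Measure.restrict_mono ?_ le_rfl) hm
  intro x hx
  exact ⟨x, fun i _ ↦ ⟨(hx i).1.le, (hx i).2⟩, rfl⟩

theorem zoneMeasure_absolutelyContinuous (q : Fin d → ℝ) :
    C.zoneMeasure q ≪ (volume : Measure (Pos d)) := by
  obtain ⟨K, c, -, -, h⟩ := C.exists_zoneMeasure_le q
  exact (Measure.absolutelyContinuous_of_le h).trans
    ((Measure.smul_absolutelyContinuous).trans Measure.restrict_le_self.absolutelyContinuous)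

/-- A property which holds almost everywhere in each Brillouin zone holds almost everywhere. -/
theorem ae_of_forall_zoneMeasure {p : Pos d → Prop}
    (h : ∀ q : Fin d → ℝ, ∀ᵐ k ∂C.zoneMeasure q, p k) : ∀ᵐ k : Pos d, p k := by
  obtain ⟨c, hc0, -, hmap⟩ := C.exists_map_volume
  have hemb : MeasurableEmbedding C.momentumCoord.symm :=
    C.momentumCoord.symm.toHomeomorph.measurableEmbedding
  have h1 : ∀ᵐ k ∂(volume : Measure (Fin d → ℝ)).map C.momentumCoord.symm, p k := by
    rw [hemb.ae_map_iff]
    have h2 : ∀ q : Fin d → ℤ, ∀ᵐ x ∂(volume : Measure (Fin d → ℝ)).restrict (cube fun i ↦ q i),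
        p (C.momentumCoord.symm x) := by
      intro q
      have := h fun i ↦ q i
      rwa [zoneMeasure_eq, hemb.ae_map_iff] at this
    have h3 : ∀ᵐ x ∂(volume : Measure (Fin d → ℝ)), ∀ q : Fin d → ℤ,
        x ∈ cube (fun i ↦ (q i : ℝ)) → p (C.momentumCoord.symm x) := by
      rw [ae_all_iff]
      exact fun q ↦ (ae_restrict_iff' (measurableSet_cube _)).mp (h2 q)
    filter_upwards [h3] with x hx
    -- The half-open cubes with integer corners cover space, as ⌈x⌉ - 1 < x ≤ ⌈x⌉.
    refine hx (fun i ↦ ⌈x i⌉ - 1) fun i ↦ ⟨?_, ?_⟩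
    · push_cast; linarith [Int.ceil_lt_add_one (x i)]
    · push_cast; linarith [Int.le_ceil (x i)]
  rw [hmap] at h1
  rwa [ae_iff, Measure.smul_apply, smul_eq_mul, mul_eq_zero, or_iff_right hc0] at h1

/-- A weight on the torus is determined by its integrals against squares of trigonometric
polynomials. -/
theorem ae_le_of_mFourier {G : UnitAddTorus (Fin d) → ENNReal} {B M : ENNReal}
    (hG : AEMeasurable G volume) (hB : B ≠ ⊤) (hGB : ∀ k, G k ≤ B) (hM : M ≠ ⊤)
    (h : ∀ p ∈ Submodule.span ℂ (Set.range (UnitAddTorus.mFourierLp (d := Fin d) 2)),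
      ∫⁻ k, ‖p k‖ₑ ^ 2 * G k ≤ M * ∫⁻ k, ‖p k‖ₑ ^ 2) :
    ∀ᵐ k : UnitAddTorus (Fin d), G k ≤ M := by
  set ν : Measure (UnitAddTorus (Fin d)) := volume.withDensity G with hν
  have hac : ν ≪ volume := withDensity_absolutelyContinuous _ _
  have hint : ∀ p : Lp ℂ 2 (volume : Measure (UnitAddTorus (Fin d))),
      eLpNorm p 2 ν ^ 2 = ∫⁻ k, ‖p k‖ₑ ^ 2 * G k := by
    intro p
    rw [eLpNorm_two_sq, hν, lintegral_withDensity_eq_lintegral_mul₀ hG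
      ((Lp.aestronglyMeasurable p).enorm.pow_const 2)]
    refine lintegral_congr fun k ↦ ?_
    rw [Pi.mul_apply, mul_comm]
  have hle : ∀ p : Lp ℂ 2 (volume : Measure (UnitAddTorus (Fin d))),
      eLpNorm p 2 ν ^ 2 ≤ B * eLpNorm p 2 volume ^ 2 := by
    intro p
    rw [hint, eLpNorm_two_sq, ← lintegral_const_mul' _ _ hB]
    refine lintegral_mono fun k ↦ ?_
    rw [mul_comm]
    exact mul_le_mul_left (hGB k) _
  have hroot : ∀ x y c : ENNReal, x ^ 2 ≤ c * y ^ 2 → x ≤ c ^ (1 / 2 : ℝ) * y := by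
    intro x y c hxy
    have h1 := ENNReal.rpow_le_rpow hxy (by norm_num : (0:ℝ) ≤ 1 / 2)
    rw [ENNReal.mul_rpow_of_nonneg _ _ (by norm_num), ← ENNReal.rpow_natCast, ← ENNReal.rpow_mul,
      ← ENNReal.rpow_natCast, ← ENNReal.rpow_mul] at h1
    simpa using h1
  -- Trigonometric polynomials are dense in L² of the Haar measure; the a priori bound B makes the
  -- weighted norm continuous there, so the inequality passes to the limit.
  have hall : ∀ f : Lp ℂ 2 (volume : Measure (UnitAddTorus (Fin d))),
      eLpNorm f 2 ν ≤ M ^ (1 / 2 : ℝ) * eLpNorm f 2 volume := by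
    intro f
    have hf : f ∈ closure (Submodule.span ℂ
        (Set.range (UnitAddTorus.mFourierLp (d := Fin d) 2)) : Set (Lp ℂ 2 _)) := by
      have h1 := UnitAddTorus.span_mFourierLp_closure_eq_top (d := Fin d) (p := 2) (by norm_num)
      rw [← Submodule.topologicalClosure_coe, h1]
      trivial
    obtain ⟨p, hp, hlim⟩ := mem_closure_iff_seq_limit.mp hf
    have hlim0 : Tendsto (fun n ↦ eLpNorm (f - p n : Lp ℂ 2 _) 2 volume) atTop (𝓝 0) := by
      have h1 : Tendsto (fun n ↦ ‖f - p n‖ₑ) atTop (𝓝 ‖f - f‖ₑ) :=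
        (continuous_enorm.tendsto _).comp (hlim.const_sub f)
      simpa [Lp.enorm_def] using h1
    have hlim1 : Tendsto (fun n ↦ eLpNorm (p n) 2 volume) atTop (𝓝 (eLpNorm f 2 volume)) := by
      have h1 : Tendsto (fun n ↦ ‖p n‖ₑ) atTop (𝓝 ‖f‖ₑ) := (continuous_enorm.tendsto _).comp hlim
      simpa [Lp.enorm_def] using h1
    have hbound : ∀ n, eLpNorm f 2 ν ≤ B ^ (1 / 2 : ℝ) * eLpNorm (f - p n : Lp ℂ 2 _) 2 volume +
        M ^ (1 / 2 : ℝ) * eLpNorm (p n) 2 volume := by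
      intro n
      have h1 : f =ᵐ[ν] ⇑(f - p n) + ⇑(p n) := by
        refine hac ?_
        filter_upwards [Lp.coeFn_sub f (p n)] with k hk
        rw [Pi.add_apply, hk, Pi.sub_apply, sub_add_cancel]
      rw [eLpNorm_congr_ae h1]
      refine (eLpNorm_add_le ((Lp.aestronglyMeasurable _).mono_ac hac)
        ((Lp.aestronglyMeasurable _).mono_ac hac) (by norm_num)).trans ?_
      refine add_le_add (hroot _ _ _ (hle _)) (hroot _ _ _ ?_)
      rw [hint, eLpNorm_two_sq]
      exact h _ (hp n)
    have hlim2 := (ENNReal.Tendsto.const_mul (a := B ^ (1 / 2 : ℝ)) hlim0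
      (Or.inr (ENNReal.rpow_ne_top_of_nonneg (by norm_num) hB))).add
      (ENNReal.Tendsto.const_mul (a := M ^ (1 / 2 : ℝ)) hlim1
      (Or.inr (ENNReal.rpow_ne_top_of_nonneg (by norm_num) hM)))
    rw [mul_zero, zero_add] at hlim2
    exact ge_of_tendsto' hlim2 hbound
  -- Indicator functions as test functions give ∫_s G ≤ M vol(s) for every measurable s.
  refine ae_le_of_forall_setLIntegral_le_of_sigmaFinite₀ hG fun s hs _ ↦ ?_
  have h1 := hall (indicatorConstLp 2 hs (measure_ne_top _ _) (1 : ℂ))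
  have h2 : ∀ ρ : Measure (UnitAddTorus (Fin d)), ρ ≪ volume →
      eLpNorm (indicatorConstLp 2 hs (measure_ne_top _ _) (1 : ℂ) :
        Lp ℂ 2 (volume : Measure (UnitAddTorus (Fin d)))) 2 ρ = ρ s ^ (1 / 2 : ℝ) := by
    intro ρ hρ
    rw [eLpNorm_congr_ae (hρ indicatorConstLp_coeFn), eLpNorm_indicator_const hs (by norm_num)
      (by norm_num)]
    simp
  rw [h2 ν hac, h2 volume Measure.AbsolutelyContinuous.rfl,
    ← ENNReal.mul_rpow_of_nonneg _ _ (by norm_num),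
    ENNReal.rpow_le_rpow_iff (by norm_num), hν, withDensity_apply _ hs] at h1
  simpa using h1

/-- A weight on the Brillouin zone is determined by its integrals against squares of
trigonometric polynomials. -/
theorem ae_le_of_trigonometric (q : Fin d → ℝ) {G : Pos d → ENNReal} {B M : ENNReal}
    (hG : AEMeasurable G (C.zoneMeasure q)) (hB : B ≠ ⊤) (hGB : ∀ k, G k ≤ B) (hM : M ≠ ⊤)
    (h : ∀ c : C.lattice →₀ ℂ,
      ∫⁻ k, ‖c.sum fun γ z ↦ z * C.character γ k‖ₑ ^ 2 * G k ∂C.zoneMeasure q ≤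
        M * ∫⁻ k, ‖c.sum fun γ z ↦ z * C.character γ k‖ₑ ^ 2 ∂C.zoneMeasure q) :
    ∀ᵐ k ∂C.zoneMeasure q, G k ≤ M := by
  have hmp := C.measurePreserving_zoneMap q
  have hchar : ∀ c : C.lattice →₀ ℂ, Measurable fun k ↦ c.sum fun γ z ↦ z * C.character γ k := by
    intro c
    exact Finset.measurable_sum _ fun γ _ ↦ (C.continuous_character γ).measurable.const_mul _
  have hmain : ∀ᵐ x : UnitAddTorus (Fin d), G (C.zoneMap q x) ≤ M := by
    refine ae_le_of_mFourier (hG.comp_quasiMeasurePreserving hmp.quasiMeasurePreserving) hB (fun k ↦ hGB _) hM fun p hp ↦ ?_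
    rw [← C.latticeCoord_surjective.range_comp, Finsupp.mem_span_range_iff_exists_finsupp] at hp
    obtain ⟨c, rfl⟩ := hp
    have hae : ∀ᵐ x : UnitAddTorus (Fin d),
        (c.sum fun γ z ↦ z • (UnitAddTorus.mFourierLp 2 ∘ C.latticeCoord) γ :
          Lp ℂ 2 (volume : Measure (UnitAddTorus (Fin d)))) x =
        c.sum fun γ z ↦ z * C.character γ (C.zoneMap q x) := by
      have h1 : ∀ᵐ x : UnitAddTorus (Fin d), ∀ γ : C.lattice,
          (c γ • UnitAddTorus.mFourierLp 2 (C.latticeCoord γ) :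
            Lp ℂ 2 (volume : Measure (UnitAddTorus (Fin d)))) x =
          c γ * C.character γ (C.zoneMap q x) := by
        rw [ae_all_iff]
        intro γ
        filter_upwards [Lp.coeFn_smul (c γ) (UnitAddTorus.mFourierLp 2 (C.latticeCoord γ)),
          UnitAddTorus.coeFn_mFourierLp 2 (C.latticeCoord γ)] with x h1 h2
        rw [h1, Pi.smul_apply, h2, character_zoneMap, smul_eq_mul]
      filter_upwards [h1, Lp.coeFn_finsetSum c.support fun γ ↦
        (c γ • UnitAddTorus.mFourierLp 2 (C.latticeCoord γ) :
            Lp ℂ 2 (volume : Measure (UnitAddTorus (Fin d))))] with x hx h2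
      simp only [Finsupp.sum, Function.comp_apply]
      rw [h2, Finset.sum_apply]
      exact Finset.sum_congr rfl fun γ _ ↦ hx γ
    have h3 := h c
    rw [← hmp.map_eq, lintegral_map' _ hmp.aemeasurable, lintegral_map' _ hmp.aemeasurable] at h3
    · refine (lintegral_congr_ae ?_).trans_le
        (h3.trans_eq (congrArg (M * ·) (lintegral_congr_ae ?_)))
      · filter_upwards [hae] with x hx
        rw [hx]
      · filter_upwards [hae] with x hx
        rw [hx]
    · exact ((hchar c).enorm.pow_const 2).aemeasurable
    · exact ((hchar c).enorm.pow_const 2).aemeasurable.mul (hmp.map_eq ▸ hG)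
  have hmeas : NullMeasurableSet {k | ¬ G k ≤ M} (C.zoneMeasure q) :=
    (nullMeasurableSet_le hG aemeasurable_const).compl
  rw [ae_iff, ← hmp.measure_preimage hmeas]
  exact hmain

end Crystal

end Torus

/-! ## The Bloch–Floquet–Zak transform -/

section Restrict

variable {d N : ℕ} {C : Crystal d}

/-- Restriction to the unit cell. -/
def cellRestrict (C : Crystal d) (N : ℕ) : Hilb C N →L[ℂ] HilbFiber C N :=
  LpToLpRestrictCLM (Pos d) (Spin N) ℂ C.measure 2 (C.cell C.a 1)

theorem coeFn_cellRestrict (ψ : Hilb C N) :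
    cellRestrict C N ψ =ᵐ[C.measure.restrict (C.cell C.a 1)] ψ :=
  LpToLpRestrictCLM_coeFn ℂ _ ψ

theorem inner_cellRestrict (ψ φ : Hilb C N) : ⟪cellRestrict C N ψ, cellRestrict C N φ⟫_ℂ =
    ⟪chi N C.measure (C.cell C.a 1) (C.measurableSet_cell C.a 1) ψ, φ⟫_ℂ := by
  rw [L2.inner_def, L2.inner_def, ← integral_indicator (C.measurableSet_cell C.a 1)]
  have h1 : ∫ x in C.cell C.a 1, ⟪cellRestrict C N ψ x, cellRestrict C N φ x⟫_ℂ ∂C.measure =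
      ∫ x in C.cell C.a 1, ⟪ψ x, φ x⟫_ℂ ∂C.measure := by
    refine integral_congr_ae ?_
    filter_upwards [coeFn_cellRestrict ψ, coeFn_cellRestrict φ] with x h1 h2
    rw [h1, h2]
  rw [integral_indicator (C.measurableSet_cell C.a 1), h1,
    ← integral_indicator (C.measurableSet_cell C.a 1)]
  refine integral_congr_ae ?_
  filter_upwards [coeFn_chi (C.cell C.a 1) (C.measurableSet_cell C.a 1) ψ] with x h1
  rw [h1]
  by_cases h : x ∈ C.cell C.a 1 <;> simp [h]

theorem cellRestrict_chi (ψ : Hilb C N) : cellRestrict C N (chi N C.measure (C.cell C.a 1)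
    (C.measurableSet_cell C.a 1) ψ) = cellRestrict C N ψ := by
  apply Lp.ext
  filter_upwards [coeFn_cellRestrict ψ, coeFn_cellRestrict (chi N C.measure (C.cell C.a 1)
    (C.measurableSet_cell C.a 1) ψ), ae_restrict_mem (C.measurableSet_cell C.a 1),
    ae_restrict_of_ae (coeFn_chi (C.cell C.a 1) (C.measurableSet_cell C.a 1) ψ)] with x h1 h2 h3 h4
  rw [h1, h2, h4, Set.indicator_of_mem h3]

theorem cellRestrict_eq_zero {A : Set (Pos d)} (hA : MeasurableSet A)
    (h : C.measure (C.cell C.a 1 ∩ A) = 0) (ψ : Hilb C N) :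
    cellRestrict C N (chi N C.measure A hA ψ) = 0 := by
  apply Lp.ext
  have h0 : ∀ᵐ x ∂C.measure, ¬ (x ∈ C.cell C.a 1 ∩ A) := measure_eq_zero_iff_ae_notMem.mp h
  filter_upwards [coeFn_cellRestrict (chi N C.measure A hA ψ),
    ae_restrict_mem (C.measurableSet_cell C.a 1), ae_restrict_of_ae (coeFn_chi A hA ψ),
    ae_restrict_of_ae h0, Lp.coeFn_zero (Spin N) 2 (C.measure.restrict (C.cell C.a 1))]
    with x h1 h2 h3 h4 h5
  rw [h1, h3, h5, Set.indicator_of_notMem (fun hx ↦ h4 ⟨h2, hx⟩)]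
  rfl

theorem cellRestrict_surjective : Function.Surjective (cellRestrict C N) := by
  intro u
  have hm : MemLp ((C.cell C.a 1).indicator u) 2 C.measure :=
    (memLp_indicator_iff_restrict (C.measurableSet_cell C.a 1)).mpr (Lp.memLp u)
  refine ⟨hm.toLp _, ?_⟩
  apply Lp.ext
  filter_upwards [coeFn_cellRestrict (hm.toLp _), ae_restrict_of_ae hm.coeFn_toLp,
    ae_restrict_mem (C.measurableSet_cell C.a 1)] with x h1 h2 h3
  rw [h1, h2, Set.indicator_of_mem h3]

/-- Extension by zero from the unit cell. -/
def cellExtend (C : Crystal d) (N : ℕ) : HilbFiber C N →L[ℂ] Hilb C N :=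
  ContinuousLinearMap.adjoint (cellRestrict C N)

theorem cellExtend_cellRestrict (ψ : Hilb C N) : cellExtend C N (cellRestrict C N ψ) =
    chi N C.measure (C.cell C.a 1) (C.measurableSet_cell C.a 1) ψ := by
  refine ext_inner_right ℂ fun φ ↦ ?_
  rw [cellExtend, ContinuousLinearMap.adjoint_inner_left, inner_cellRestrict]

theorem cellRestrict_cellExtend (u : HilbFiber C N) : cellRestrict C N (cellExtend C N u) = u := by
  obtain ⟨w, rfl⟩ := cellRestrict_surjective u
  rw [cellExtend_cellRestrict, cellRestrict_chi]

theorem hasBoundedSupport_cellExtend (u : HilbFiber C N) : HasBoundedSupport (cellExtend C N u) := by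
  obtain ⟨w, rfl⟩ := cellRestrict_surjective u
  obtain ⟨r, hr⟩ := C.exists_cell_subset C.a 1
  rw [cellExtend_cellRestrict]
  exact hasBoundedSupport_chi hr w

/-- The unitary T_{-γ} carries the cell, and the part of T_γ ψ in it, to the cell moved by -γ. -/
theorem norm_sq_cellRestrict_translationOp (T : MagneticCocycle C N) (γ : C.lattice)
    (ψ : Hilb C N) : ‖cellRestrict C N (translationOp T γ ψ)‖ =
      ‖chi N C.measure (C.translate (-γ) (C.cell C.a 1))
        (C.measurableSet_translate (-γ) (C.measurableSet_cell C.a 1)) ψ‖ := by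
  have h1 : ‖cellRestrict C N (translationOp T γ ψ)‖ ^ 2 =
      ‖chi N C.measure (C.cell C.a 1) (C.measurableSet_cell C.a 1) (translationOp T γ ψ)‖ ^ 2 := by
    have h2 : ∀ χ : Hilb C N, ‖cellRestrict C N χ‖ ^ 2 =
        ‖chi N C.measure (C.cell C.a 1) (C.measurableSet_cell C.a 1) χ‖ ^ 2 := by
      intro χ
      have h3 := inner_cellRestrict χ χ
      rw [← chi_mul_self] at h3
      rw [mul_apply_eq_comp] at h3
      nth_rewrite 1 [← chi_adjoint] at h3
      rw [ContinuousLinearMap.adjoint_inner_left, inner_self_eq_norm_sq_to_K,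
        inner_self_eq_norm_sq_to_K] at h3
      exact_mod_cast h3
    exact h2 _
  have h2 := (sq_eq_sq₀ (norm_nonneg _) (norm_nonneg _)).mp h1
  rw [h2, ← norm_translationOp T (-γ), translationOp_chi, translationOp_translationOp,
    add_neg_cancel, translationOp_zero]

theorem HasBoundedSupport.exists_finset {ψ : Hilb C N} (h : HasBoundedSupport ψ) :
    ∃ F : Finset C.lattice, ∀ T : MagneticCocycle C N, ∀ γ ∉ F,
      cellRestrict C N (translationOp T γ ψ) = 0 := by
  obtain ⟨r, hr⟩ := h
  obtain ⟨r', hr'⟩ := C.exists_cell_subset C.a 1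
  refine ⟨(C.finite_lattice_norm_le (r + r')).toFinset, fun T γ hγ ↦ ?_⟩
  have hγ' : r + r' < ‖(γ : Pos d)‖ := by
    simpa using hγ
  apply Lp.ext
  filter_upwards [coeFn_cellRestrict (translationOp T γ ψ),
    ae_restrict_mem (C.measurableSet_cell C.a 1),
    ae_restrict_of_ae (coeFn_translationOp T γ ψ),
    ae_restrict_of_ae ((C.measurePreserving_sub γ).quasiMeasurePreserving.ae hr),
    Lp.coeFn_zero (Spin N) 2 (C.measure.restrict (C.cell C.a 1))] with x h1 h2 h3 h4 h5
  have h6 : ‖x‖ ≤ r' := by simpa using hr' h2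
  have h7 : r < ‖x - (γ : Pos d)‖ := by
    have := norm_sub_norm_le (γ : Pos d) x
    rw [norm_sub_rev] at this
    linarith
  rw [h1, h3, h4 h7, map_zero, h5]
  rfl

end Restrict

/-! ### Smoothness of the phases on a bounded set -/

section PhaseSmooth

variable {d N : ℕ} {μ : Measure (Pos d)}

/-- The generator of the phases on a bounded set. -/
def phaseGenerator (N : ℕ) (μ : Measure (Pos d)) (r : ℝ) (l : Fin d) : L2 N μ →L[ℂ] L2 N μ :=
  mulOp μ ((Metric.closedBall (0 : Pos d) r).indicator fun x ↦
      (-(Complex.I * ((x l : ℝ) : ℂ))) • (1 : Spin N →L[ℂ] Spin N))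
    ((Continuous.stronglyMeasurable (by fun_prop)).indicator Metric.isClosed_closedBall.measurableSet)
    |r| fun x ↦ by
      by_cases h : x ∈ Metric.closedBall (0 : Pos d) r
      · rw [Set.indicator_of_mem h, norm_smul, norm_neg, norm_mul, Complex.norm_I, one_mul,
          Complex.norm_real]
        have h1 : ‖x l‖ ≤ ‖x‖ := PiLp.norm_apply_le x l
        have h2 : ‖x‖ ≤ r := by simpa using h
        have h3 : ‖(1 : Spin N →L[ℂ] Spin N)‖ ≤ 1 := ContinuousLinearMap.norm_id_le
        calc ‖x l‖ * ‖(1 : Spin N →L[ℂ] Spin N)‖ ≤ ‖x l‖ * 1 := by gcongr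
          _ ≤ |r| := by rw [mul_one]; exact (h1.trans h2).trans (le_abs_self r)
      · rw [Set.indicator_of_notMem h, norm_zero]
        exact abs_nonneg r

/-- The derivative of the phases at zero, as a linear map. -/
def phaseDeriv (N : ℕ) (μ : Measure (Pos d)) (r : ℝ) : Pos d →L[ℝ] (L2 N μ →L[ℂ] L2 N μ) :=
  ∑ l, (EuclideanSpace.proj l : Pos d →L[ℝ] ℝ).smulRight (phaseGenerator N μ r l)

theorem coeFn_phaseDeriv {r : ℝ} (hr : ∀ᵐ x ∂μ, ‖x‖ ≤ r) (k : Pos d) (ψ : L2 N μ) :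
    phaseDeriv N μ r k ψ =ᵐ[μ] fun x ↦ (-(Complex.I * ((⟪k, x⟫_ℝ : ℝ) : ℂ))) • ψ x := by
  have h1 : phaseDeriv N μ r k ψ = ∑ l, ((k l : ℝ) : ℂ) • phaseGenerator N μ r l ψ := by
    unfold phaseDeriv
    rw [_root_.sum_apply, _root_.sum_apply]
    refine Finset.sum_congr rfl fun l _ ↦ ?_
    rfl
  have h2 : ∀ᵐ x ∂μ, ∀ l, (((k l : ℝ) : ℂ) • phaseGenerator N μ r l ψ : L2 N μ) x =
      ((k l : ℝ) : ℂ) • (-(Complex.I * ((x l : ℝ) : ℂ))) • ψ x := by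
    rw [ae_all_iff]
    intro l
    filter_upwards [hr, Lp.coeFn_smul ((k l : ℝ) : ℂ) (phaseGenerator N μ r l ψ),
      coeFn_mulOp (μ := μ) ((Metric.closedBall (0 : Pos d) r).indicator fun x ↦
      (-(Complex.I * ((x l : ℝ) : ℂ))) • (1 : Spin N →L[ℂ] Spin N)) _ _ _ ψ] with x h1 h2 h3
    rw [h2, Pi.smul_apply]
    congr 1
    refine h3.trans ?_
    rw [Set.indicator_of_mem (by simpa using h1)]
    rfl
  filter_upwards [h2, Lp.coeFn_finsetSum Finset.univ fun l ↦
    (((k l : ℝ) : ℂ) • phaseGenerator N μ r l ψ : L2 N μ)] with x h3 h4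
  rw [h1, h4, Finset.sum_apply, Finset.sum_congr rfl fun l _ ↦ h3 l]
  simp only [smul_smul]
  rw [← Finset.sum_smul]
  congr 1
  rw [PiLp.inner_apply]
  push_cast
  rw [Finset.mul_sum, ← Finset.sum_neg_distrib]
  refine Finset.sum_congr rfl fun l _ ↦ ?_
  simp
  ring

/-- The derivative of the phases. -/
def phaseDerivAt (N : ℕ) (μ : Measure (Pos d)) (r : ℝ) (k : Pos d) :
    Pos d →L[ℝ] (L2 N μ →L[ℂ] L2 N μ) :=
  ∑ l, (EuclideanSpace.proj l : Pos d →L[ℝ] ℝ).smulRight (phaseOp N μ k ∘L phaseGenerator N μ r l)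

theorem phaseDerivAt_apply (r : ℝ) (k h : Pos d) (ψ : L2 N μ) :
    phaseDerivAt N μ r k h ψ = phaseOp N μ k (phaseDeriv N μ r h ψ) := by
  unfold phaseDerivAt phaseDeriv
  rw [_root_.sum_apply, _root_.sum_apply, _root_.sum_apply, _root_.sum_apply, map_sum]
  refine Finset.sum_congr rfl fun l _ ↦ ?_
  have h1 : (h l • phaseGenerator N μ r l : L2 N μ →L[ℂ] L2 N μ) ψ =
      ((h l : ℝ) : ℂ) • phaseGenerator N μ r l ψ := rfl
  have h2 : (h l • (phaseOp N μ k ∘L phaseGenerator N μ r l) : L2 N μ →L[ℂ] L2 N μ) ψ =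
      ((h l : ℝ) : ℂ) • phaseOp N μ k (phaseGenerator N μ r l ψ) := rfl
  change (h l • (phaseOp N μ k ∘L phaseGenerator N μ r l) : L2 N μ →L[ℂ] L2 N μ) ψ =
    phaseOp N μ k ((h l • phaseGenerator N μ r l : L2 N μ →L[ℂ] L2 N μ) ψ)
  rw [h1, h2, map_smul]

/-- After the unitary phase at k is factored out, the remainder is multiplication by e^z - 1 - z
with |z| ≤ |r| |h|, hence O(|h|²). Differentiability in operator norm needs |x| ≤ r. -/
theorem hasFDerivAt_phaseOp {r : ℝ} (hr : ∀ᵐ x ∂μ, ‖x‖ ≤ r) (k : Pos d) :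
    HasFDerivAt (𝕜 := ℝ) (fun k ↦ phaseOp N μ k) (phaseDerivAt N μ r k) k := by
  have hr0 : ∀ᵐ x ∂μ, ‖x‖ ≤ |r| := hr.mono fun x hx ↦ hx.trans (le_abs_self r)
  rw [hasFDerivAt_iff_isLittleO_nhds_zero]
  refine Asymptotics.IsBigO.trans_isLittleO (g := fun h : Pos d ↦ ‖h‖ ^ 2) ?_
    (Asymptotics.isLittleO_norm_pow_id one_lt_two)
  refine Asymptotics.IsBigO.of_bound (|r| ^ 2) ?_
  have hsmall : ∀ᶠ h : Pos d in 𝓝 0, ‖h‖ * |r| < 1 := by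
    have : Tendsto (fun h : Pos d ↦ ‖h‖ * |r|) (𝓝 0) (𝓝 (‖(0 : Pos d)‖ * |r|)) :=
      (continuous_norm.mul continuous_const).tendsto _
    rw [norm_zero, zero_mul] at this
    exact this.eventually_lt_const one_pos
  filter_upwards [hsmall] with h hh
  refine ContinuousLinearMap.opNorm_le_bound _ (by positivity) fun ψ ↦ ?_
  rw [_root_.sub_apply, _root_.sub_apply, phaseDerivAt_apply, ← phaseOp_add, ← map_sub, ← map_sub,
    norm_phaseOp]
  refine Lp.norm_le_mul_norm_of_ae_le_mul ?_
  filter_upwards [hr0, coeFn_phaseOp h ψ, coeFn_phaseDeriv hr h ψ, Lp.coeFn_sub (phaseOp N μ h ψ) ψ,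
    Lp.coeFn_sub (phaseOp N μ h ψ - ψ) (phaseDeriv N μ r h ψ)] with x h0 h1 h2 h3 h4
  rw [h4, Pi.sub_apply, h3, Pi.sub_apply, h1, h2]
  set z : ℂ := -(Complex.I * ((⟪h, x⟫_ℝ : ℝ) : ℂ)) with hz
  have h5 : ‖z‖ ≤ ‖h‖ * |r| := by
    rw [hz, norm_neg, norm_mul, Complex.norm_I, one_mul, Complex.norm_real]
    exact (norm_inner_le_norm h x).trans (by gcongr)
  have h6 := Complex.norm_exp_sub_one_sub_id_le (h5.trans hh.le)
  have h7 : Complex.exp z • ψ x - ψ x - z • ψ x = (Complex.exp z - 1 - z) • ψ x := by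
    rw [sub_smul, sub_smul, one_smul]
  rw [h7, norm_smul, norm_pow, norm_norm]
  refine mul_le_mul_of_nonneg_right (h6.trans ?_) (norm_nonneg _)
  rw [← mul_pow, mul_comm]
  gcongr

/-- The derivative consists again of phases, composed with operators independent of k, so smoothness
follows by induction on the order. -/
theorem contDiff_phaseOp {r : ℝ} (hr : ∀ᵐ x ∂μ, ‖x‖ ≤ r) :
    ContDiff ℝ ∞ fun k ↦ phaseOp N μ k := by
  rw [contDiff_infty]
  intro n
  induction n with
  | zero =>
    rw [Nat.cast_zero, contDiff_zero]
    exact continuous_iff_continuousAt.mpr fun k ↦ (hasFDerivAt_phaseOp hr k).continuousAt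
  | succ n ih =>
    rw [Nat.cast_succ, contDiff_succ_iff_hasFDerivAt]
    refine ⟨_, ?_, fun k ↦ hasFDerivAt_phaseOp hr k⟩
    refine ContDiff.sum fun l _ ↦ ?_
    exact contDiff_const.smulRight ((((ContinuousLinearMap.compL ℂ (L2 N μ) (L2 N μ) (L2 N μ)).flip
        (phaseGenerator N μ r l)).restrictScalars ℝ).contDiff.comp ih)

end PhaseSmooth

theorem contDiff_clm_apply {E F G : Type*} [NormedAddCommGroup E] [NormedSpace ℝ E]
    [NormedAddCommGroup F] [NormedSpace ℂ F] [NormedAddCommGroup G] [NormedSpace ℂ G]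
    {n : WithTop ℕ∞} {f : E → F →L[ℂ] G} {g : E → F} (hf : ContDiff ℝ n f) (hg : ContDiff ℝ n g) :
    ContDiff ℝ n fun x ↦ f x (g x) :=
  ((ContinuousLinearMap.restrictScalarsL ℂ F G ℝ ℝ).contDiff.comp hf).clm_apply hg

/-! ### Orthogonality of the lattice characters on the Brillouin zone -/

section CharacterIntegral

variable {d : ℕ} (C : Crystal d)

attribute [local instance] unitCircleMeasureSpace

theorem Crystal.integral_character (q : Fin d → ℝ) (γ η : C.lattice) :
    ∫ k, starRingEnd ℂ (C.character γ k) * C.character η k ∂C.zoneMeasure q =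
      if γ = η then 1 else 0 := by
  have hmp := C.measurePreserving_zoneMap q
  have hc : Continuous fun k ↦ starRingEnd ℂ (C.character γ k) * C.character η k :=
    (Complex.continuous_conj.comp (C.continuous_character γ)).mul (C.continuous_character η)
  rw [← hmp.map_eq, integral_map hmp.aemeasurable hc.aestronglyMeasurable]
  simp only [C.character_zoneMap]
  have h1 := orthonormal_iff_ite.mp (UnitAddTorus.orthonormal_mFourier (d := Fin d))
    (C.latticeCoord γ) (C.latticeCoord η)
  rw [ContinuousMap.inner_toLp] at h1
  rw [if_congr C.latticeCoord_injective.eq_iff rfl rfl] at h1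
  rw [← h1]
  refine integral_congr_ae (Eventually.of_forall fun x ↦ ?_)
  exact mul_comm _ _

theorem Crystal.integral_norm_sq_character_sum {E : Type*} [NormedAddCommGroup E]
    [InnerProductSpace ℂ E] (q : Fin d → ℝ) (F : Finset C.lattice) (v : C.lattice → E) :
    ∫ k, ‖∑ γ ∈ F, C.character γ k • v γ‖ ^ 2 ∂C.zoneMeasure q = ∑ γ ∈ F, ‖v γ‖ ^ 2 := by
  have h1 : ∀ k, ((‖∑ γ ∈ F, C.character γ k • v γ‖ ^ 2 : ℝ) : ℂ) =
      ∑ γ ∈ F, ∑ η ∈ F, starRingEnd ℂ (C.character γ k) * C.character η k * ⟪v γ, v η⟫_ℂ := by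
    intro k
    have h2 := inner_self_eq_norm_sq_to_K (𝕜 := ℂ) (∑ γ ∈ F, C.character γ k • v γ)
    rw [Complex.ofReal_pow]
    refine h2.symm.trans ?_
    rw [sum_inner]
    refine Finset.sum_congr rfl fun γ _ ↦ ?_
    rw [inner_sum]
    refine Finset.sum_congr rfl fun η _ ↦ ?_
    rw [inner_smul_left, inner_smul_right, mul_assoc]
  have hint : ∀ γ η : C.lattice, Integrable
      (fun k ↦ starRingEnd ℂ (C.character γ k) * C.character η k * ⟪v γ, v η⟫_ℂ)
      (C.zoneMeasure q) := by
    intro γ η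
    refine Integrable.of_bound (C := ‖⟪v γ, v η⟫_ℂ‖) ?_ (Eventually.of_forall fun k ↦ ?_)
    · exact (((Complex.continuous_conj.comp (C.continuous_character γ)).mul
        (C.continuous_character η)).mul continuous_const).aestronglyMeasurable
    · rw [norm_mul, norm_mul, RCLike.norm_conj, C.norm_character, C.norm_character, one_mul, one_mul]
  apply Complex.ofReal_injective
  rw [← integral_complex_ofReal]
  simp only [h1]
  rw [integral_finsetSum _ fun γ _ ↦ integrable_finsetSum _ fun η _ ↦ hint γ η]
  push_cast
  refine Finset.sum_congr rfl fun γ hγ ↦ ?_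
  rw [integral_finsetSum _ fun η _ ↦ hint γ η, Finset.sum_eq_single γ]
  · rw [integral_mul_const, C.integral_character, if_pos rfl, one_mul, inner_self_eq_norm_sq_to_K]
    rfl
  · intro η _ hη
    rw [integral_mul_const, C.integral_character, if_neg hη.symm, zero_mul]
  · exact fun h ↦ absurd hγ h

end CharacterIntegral

/-! ### Plancherel identity and uniqueness of the transform -/

section BFZ

variable {d N : ℕ} {C : Crystal d} {T : MagneticCocycle C N}

theorem exists_cell_norm_le (C : Crystal d) :
    ∃ r : ℝ, ∀ᵐ x ∂(C.measure.restrict (C.cell C.a 1)), ‖x‖ ≤ r := by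
  obtain ⟨r, hr⟩ := C.exists_cell_subset C.a 1
  refine ⟨r, ?_⟩
  filter_upwards [ae_restrict_mem (C.measurableSet_cell C.a 1)] with x hx
  simpa using hr hx

variable (T) in
/-- The Bloch–Floquet–Zak transform as a finite sum. -/
def bfzSum (F : Finset C.lattice) (ψ : Hilb C N) (k : Pos d) : HilbFiber C N :=
  phaseOp N _ k (∑ γ ∈ F, C.character γ k • cellRestrict C N (translationOp T γ ψ))

theorem contDiff_bfzSum (F : Finset C.lattice) (ψ : Hilb C N) :
    ContDiff ℝ ∞ (bfzSum T F ψ) := by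
  obtain ⟨r, hr⟩ := exists_cell_norm_le C
  have h1 : ContDiff ℝ ∞ fun k ↦ ∑ γ ∈ F, C.character γ k • cellRestrict C N (translationOp T γ ψ) := ?_
  · exact contDiff_clm_apply (contDiff_phaseOp hr) h1
  refine ContDiff.sum fun γ _ ↦ ?_
  have h2 : ContDiff ℝ ∞ fun k : Pos d ↦ ⟪k, (γ : Pos d)⟫_ℝ :=
    (contDiff_id (E := Pos d)).inner ℝ contDiff_const
  have h3 : ContDiff ℝ ∞ fun k : Pos d ↦ C.character γ k :=
    ContDiff.cexp (contDiff_const.mul (Complex.ofRealCLM.contDiff.comp h2))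
  exact h3.smul contDiff_const

theorem coeFn_bfzSum (F : Finset C.lattice) (ψ : Hilb C N) (k : Pos d) :
    ∀ᵐ y ∂(C.measure.restrict (C.cell C.a 1)), bfzSum T F ψ k y = ∑ γ ∈ F,
      Complex.exp (-(Complex.I * ((⟪k, y⟫_ℝ : ℝ) : ℂ))) •
        Complex.exp (Complex.I * ((⟪k, (γ : Pos d)⟫_ℝ : ℝ) : ℂ)) • translationOp T γ ψ y := by
  have h1 : ∀ᵐ y ∂(C.measure.restrict (C.cell C.a 1)), ∀ γ : C.lattice,
      (C.character γ k • cellRestrict C N (translationOp T γ ψ) : HilbFiber C N) y =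
      C.character γ k • translationOp T γ ψ y := by
    rw [ae_all_iff]
    intro γ
    filter_upwards [Lp.coeFn_smul (C.character γ k) (cellRestrict C N (translationOp T γ ψ)),
      coeFn_cellRestrict (translationOp T γ ψ)] with y h2 h3
    rw [h2, Pi.smul_apply, h3]
  filter_upwards [h1, coeFn_phaseOp k
    (∑ γ ∈ F, C.character γ k • cellRestrict C N (translationOp T γ ψ)),
    Lp.coeFn_finsetSum F fun γ ↦
      (C.character γ k • cellRestrict C N (translationOp T γ ψ) : HilbFiber C N)] with y h2 h3 h4
  rw [bfzSum, h3, h4, Finset.sum_apply, Finset.smul_sum]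
  exact Finset.sum_congr rfl fun γ _ ↦ congrArg _ (h2 γ)

theorem hasSum_bfzSum {F : Finset C.lattice} {ψ : Hilb C N}
    (hF : ∀ γ ∉ F, cellRestrict C N (translationOp T γ ψ) = 0) (k : Pos d) :
    ∀ᵐ y ∂(C.measure.restrict (C.cell C.a 1)), HasSum (fun γ : C.lattice ↦
      Complex.exp (-(Complex.I * ((⟪k, y⟫_ℝ : ℝ) : ℂ))) •
        Complex.exp (Complex.I * ((⟪k, (γ : Pos d)⟫_ℝ : ℝ) : ℂ)) •
          translationOp T γ ψ y) (bfzSum T F ψ k y) := by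
  have h1 : ∀ᵐ y ∂(C.measure.restrict (C.cell C.a 1)), ∀ γ : C.lattice, γ ∉ F →
      translationOp T γ ψ y = 0 := by
    rw [ae_all_iff]
    intro γ
    by_cases h : γ ∈ F
    · exact Eventually.of_forall fun y h' ↦ absurd h h'
    · filter_upwards [coeFn_cellRestrict (translationOp T γ ψ),
        Lp.coeFn_zero (Spin N) 2 (C.measure.restrict (C.cell C.a 1))] with y h2 h3 _
      rw [← h2, hF γ h, h3]
      rfl
  filter_upwards [h1, coeFn_bfzSum (T := T) F ψ k] with y h2 h3
  rw [h3]
  refine hasSum_sum_of_ne_finset_zero fun γ hγ ↦ ?_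
  rw [h2 γ hγ, smul_zero, smul_zero]

theorem isCompactBFZ_bfzSum {F : Finset C.lattice} {ψ : Hilb C N} (hψ : HasBoundedSupport ψ)
    (hF : ∀ γ ∉ F, cellRestrict C N (translationOp T γ ψ) = 0) :
    IsCompactBFZ T ψ (bfzSum T F ψ) where
  compact_support := hψ
  measurable := (contDiff_bfzSum F ψ).continuous.aestronglyMeasurable
  hasSum := hasSum_bfzSum hF

theorem IsCompactBFZ.eq_bfzSum {F : Finset C.lattice} {ψ : Hilb C N} {φ : Pos d → HilbFiber C N}
    (h : IsCompactBFZ T ψ φ) (hF : ∀ γ ∉ F, cellRestrict C N (translationOp T γ ψ) = 0) :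
    φ = bfzSum T F ψ := by
  funext k
  apply Lp.ext
  filter_upwards [h.hasSum k, hasSum_bfzSum hF k] with y h1 h2
  exact h1.unique h2

theorem IsCompactBFZ.exists_eq_bfzSum {ψ : Hilb C N} {φ : Pos d → HilbFiber C N}
    (h : IsCompactBFZ T ψ φ) : ∃ F : Finset C.lattice,
      (∀ γ ∉ F, cellRestrict C N (translationOp T γ ψ) = 0) ∧ φ = bfzSum T F ψ := by
  obtain ⟨F, hF⟩ := HasBoundedSupport.exists_finset h.compact_support
  exact ⟨F, hF T, h.eq_bfzSum (hF T)⟩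

theorem HasBoundedSupport.exists_isCompactBFZ (T : MagneticCocycle C N) {ψ : Hilb C N}
    (h : HasBoundedSupport ψ) : ∃ φ, ContDiff ℝ ∞ φ ∧ IsCompactBFZ T ψ φ := by
  obtain ⟨F, hF⟩ := h.exists_finset
  exact ⟨_, contDiff_bfzSum F ψ, isCompactBFZ_bfzSum h (hF T)⟩

theorem IsCompactBFZ.isBFZ {ψ : Hilb C N} {φ : Pos d → HilbFiber C N} (h : IsCompactBFZ T ψ φ) :
    IsBFZ T ψ φ :=
  ⟨h.measurable, fun _ ↦ ψ, fun _ ↦ φ, fun _ ↦ h, tendsto_const_nhds, fun K _ ↦ by simp⟩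

/-- Orthogonality of the characters leaves the sum of ‖T_γ ψ‖² over the unit cell; its terms are the
squared norms of ψ on the translates of the cell by -γ, which tile the crystal. -/
theorem eLpNorm_bfzSum (hC : C.IsPrimitiveCell C.a) {F : Finset C.lattice} {ψ : Hilb C N}
    (hF : ∀ γ ∉ F, cellRestrict C N (translationOp T γ ψ) = 0) (q : Fin d → ℝ) :
    eLpNorm (bfzSum T F ψ) 2 (C.zoneMeasure q) = ‖ψ‖ₑ := by
  have hcont : Continuous fun k ↦ ‖bfzSum T F ψ k‖ ^ 2 :=
    (contDiff_bfzSum F ψ).continuous.norm.pow 2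
  have h1 : ∫ k, ‖bfzSum T F ψ k‖ ^ 2 ∂C.zoneMeasure q =
      ∑ γ ∈ F, ‖cellRestrict C N (translationOp T γ ψ)‖ ^ 2 := by
    rw [← C.integral_norm_sq_character_sum q]
    simp only [bfzSum, norm_phaseOp]
  have h2 : ENNReal.ofReal (∑ γ ∈ F, ‖cellRestrict C N (translationOp T γ ψ)‖ ^ 2) =
      ENNReal.ofReal (‖ψ‖ ^ 2) := by
    rw [← tsum_norm_chi_translate hC ψ, ← (Equiv.neg C.lattice).tsum_eq,
      ENNReal.ofReal_sum_of_nonneg (fun _ _ ↦ by positivity)]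
    simp only [Equiv.neg_apply, ← norm_sq_cellRestrict_translationOp T]
    rw [tsum_eq_sum]
    intro γ hγ
    rw [hF γ hγ]
    simp
  have hint : Integrable (fun k ↦ ‖bfzSum T F ψ k‖ ^ 2) (C.zoneMeasure q) := by
    refine Integrable.of_bound (C := (∑ γ ∈ F, ‖cellRestrict C N (translationOp T γ ψ)‖) ^ 2)
      hcont.aestronglyMeasurable (Eventually.of_forall fun k ↦ ?_)
    rw [norm_pow, norm_norm, bfzSum, norm_phaseOp]
    gcongr
    refine (norm_sum_le _ _).trans (Finset.sum_le_sum fun γ _ ↦ ?_)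
    rw [norm_smul, C.norm_character, one_mul]
  have h3 : ∀ {G : Type _} [NormedAddCommGroup G] (x : G), ENNReal.ofReal (‖x‖ ^ 2) = ‖x‖ₑ ^ 2 := by
    intro G _ x
    rw [ENNReal.ofReal_pow (norm_nonneg _), ofReal_norm]
  have h4 : eLpNorm (bfzSum T F ψ) 2 (C.zoneMeasure q) ^ 2 = ‖ψ‖ₑ ^ 2 := by
    rw [eLpNorm_two_sq, ← h3 ψ, ← h2, ← h1, ofReal_integral_eq_lintegral_ofReal hint
      (Eventually.of_forall fun _ ↦ by positivity)]
    exact lintegral_congr fun k ↦ (h3 _).symm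
  exact (ENNReal.pow_right_strictMono two_ne_zero).injective h4

theorem IsBFZ.aestronglyMeasurable_zone {ψ : Hilb C N} {φ : Pos d → HilbFiber C N}
    (h : IsBFZ T ψ φ) (q : Fin d → ℝ) : AEStronglyMeasurable φ (C.zoneMeasure q) :=
  h.1.mono_ac (C.zoneMeasure_absolutelyContinuous q)

/-- The identity for compact supports passes to the limit, since convergence on compact sets of
momenta includes convergence on the zone. -/
theorem IsBFZ.eLpNorm_eq (hC : C.IsPrimitiveCell C.a) {ψ : Hilb C N} {φ : Pos d → HilbFiber C N}
    (h : IsBFZ T ψ φ) (q : Fin d → ℝ) : eLpNorm φ 2 (C.zoneMeasure q) = ‖ψ‖ₑ := by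
  have hm := h.aestronglyMeasurable_zone q
  obtain ⟨-, ψs, φs, h1, h2, h3⟩ := h
  obtain ⟨K, c, hK, hc, hle⟩ := C.exists_zoneMeasure_le q
  have hs : ∀ n, eLpNorm (φs n) 2 (C.zoneMeasure q) = ‖ψs n‖ₑ := by
    intro n
    obtain ⟨F, hF, he⟩ := (h1 n).exists_eq_bfzSum
    rw [he, eLpNorm_bfzSum hC hF]
  have hms : ∀ n, AEStronglyMeasurable (φs n) (C.zoneMeasure q) := fun n ↦
    (h1 n).isBFZ.aestronglyMeasurable_zone q
  have hd : Tendsto (fun n ↦ eLpNorm (φs n - φ) 2 (C.zoneMeasure q)) atTop (𝓝 0) := by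
    have h4 := ENNReal.Tendsto.const_mul (a := c ^ (1 / (2 : ENNReal)).toReal) (h3 K hK)
      (Or.inr (ENNReal.rpow_ne_top_of_nonneg (by positivity) hc))
    rw [mul_zero] at h4
    refine tendsto_of_tendsto_of_tendsto_of_le_of_le tendsto_const_nhds h4 (fun n ↦ bot_le) ?_
    intro n
    exact (eLpNorm_mono_measure _ hle).trans (eLpNorm_smul_measure_le _ _ _ _)
  have hn : Tendsto (fun n ↦ ‖ψs n‖ₑ) atTop (𝓝 ‖ψ‖ₑ) := (continuous_enorm.tendsto _).comp h2
  refine le_antisymm ?_ ?_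
  · have h5 := hn.add hd
    rw [add_zero] at h5
    refine ge_of_tendsto' h5 fun n ↦ ?_
    have h6 : φ = φs n - (φs n - φ) := by abel
    conv_lhs => rw [h6]
    rw [← hs n]
    exact eLpNorm_sub_le (hms n) ((hms n).sub hm) (by norm_num)
  · have h5 := (tendsto_const_nhds (x := eLpNorm φ 2 (C.zoneMeasure q))).add hd
    rw [add_zero] at h5
    refine le_of_tendsto_of_tendsto' hn h5 fun n ↦ ?_
    have h6 : φs n = φ + (φs n - φ) := by abel
    rw [← hs n]
    conv_lhs => rw [h6]
    exact eLpNorm_add_le hm ((hms n).sub hm) (by norm_num)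

theorem IsBFZ.congr {ψ : Hilb C N} {φ φ' : Pos d → HilbFiber C N} (h : IsBFZ T ψ φ)
    (he : φ =ᵐ[volume] φ') : IsBFZ T ψ φ' := by
  obtain ⟨hm, ψs, φs, h1, h2, h3⟩ := h
  refine ⟨hm.congr he, ψs, φs, h1, h2, fun K hK ↦ (h3 K hK).congr fun n ↦ ?_⟩
  refine eLpNorm_congr_ae (ae_restrict_of_ae ?_)
  filter_upwards [he] with k hk
  rw [Pi.sub_apply, Pi.sub_apply, hk]

theorem IsBFZ.sub {ψ ψ' : Hilb C N} {φ φ' : Pos d → HilbFiber C N} (h : IsBFZ T ψ φ)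
    (h' : IsBFZ T ψ' φ') : IsBFZ T (ψ - ψ') (φ - φ') := by
  have h1 := h.add (h'.smul (-1))
  rwa [neg_one_smul, neg_one_smul, ← sub_eq_add_neg, ← sub_eq_add_neg] at h1

/-- The difference is a transform of 0, so its norm vanishes in each zone, and the zones cover
momentum space. Thus the relation `IsBFZ` may be used as if it were a function. -/
theorem IsBFZ.ae_eq (hC : C.IsPrimitiveCell C.a) {ψ : Hilb C N} {φ φ' : Pos d → HilbFiber C N}
    (h : IsBFZ T ψ φ) (h' : IsBFZ T ψ φ') : φ =ᵐ[volume] φ' := by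
  have h1 := h.sub h'
  rw [sub_self] at h1
  refine C.ae_of_forall_zoneMeasure fun q ↦ ?_
  have h2 := h1.eLpNorm_eq hC q
  rw [enorm_zero, eLpNorm_eq_zero_iff (h1.aestronglyMeasurable_zone q) (by norm_num)] at h2
  filter_upwards [h2] with k hk
  exact sub_eq_zero.mp hk

theorem IsBFZ.memLp (hC : C.IsPrimitiveCell C.a) {ψ : Hilb C N} {φ : Pos d → HilbFiber C N}
    (h : IsBFZ T ψ φ) (q : Fin d → ℝ) : MemLp φ 2 (C.zoneMeasure q) :=
  ⟨h.aestronglyMeasurable_zone q, by rw [h.eLpNorm_eq hC q]; exact enorm_lt_top⟩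

theorem IsBFZ.integral_norm_sq (hC : C.IsPrimitiveCell C.a) {ψ : Hilb C N}
    {φ : Pos d → HilbFiber C N} (h : IsBFZ T ψ φ) (q : Fin d → ℝ) :
    ∫ k, ‖φ k‖ ^ 2 ∂C.zoneMeasure q = ‖ψ‖ ^ 2 := by
  have hi : Integrable (fun k ↦ ‖φ k‖ ^ 2) (C.zoneMeasure q) := (h.memLp hC q).integrable_norm_pow two_ne_zero
  have h1 := eLpNorm_two_sq φ (C.zoneMeasure q)
  rw [h.eLpNorm_eq hC q] at h1
  have h2 : ENNReal.ofReal (∫ k, ‖φ k‖ ^ 2 ∂C.zoneMeasure q) = ENNReal.ofReal (‖ψ‖ ^ 2) := by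
    rw [ofReal_integral_eq_lintegral_ofReal hi (Eventually.of_forall fun _ ↦ by positivity),
      ENNReal.ofReal_pow (norm_nonneg _), ofReal_norm, h1]
    refine lintegral_congr fun k ↦ ?_
    rw [ENNReal.ofReal_pow (norm_nonneg _), ofReal_norm]
  rwa [ENNReal.ofReal_eq_ofReal_iff (integral_nonneg fun _ ↦ by positivity) (by positivity)] at h2

/-- Polarisation of `IsBFZ.integral_norm_sq`. -/
theorem IsBFZ.integral_inner (hC : C.IsPrimitiveCell C.a) {ψ ψ' : Hilb C N}
    {φ φ' : Pos d → HilbFiber C N} (h : IsBFZ T ψ φ) (h' : IsBFZ T ψ' φ') (q : Fin d → ℝ) :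
    ∫ k, ⟪φ k, φ' k⟫_ℂ ∂C.zoneMeasure q = ⟪ψ, ψ'⟫_ℂ := by
  have key : ∀ z : ℂ, ∫ k, ((‖φ k + z • φ' k‖ ^ 2 : ℝ) : ℂ) ∂C.zoneMeasure q =
      ((‖ψ + z • ψ'‖ ^ 2 : ℝ) : ℂ) := by
    intro z
    rw [integral_complex_ofReal]
    exact congrArg _ ((h.add (h'.smul z)).integral_norm_sq hC q)
  have hi : ∀ z : ℂ, Integrable (fun k ↦ ((‖φ k + z • φ' k‖ ^ 2 : ℝ) : ℂ)) (C.zoneMeasure q) := by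
    intro z
    exact (((h.add (h'.smul z)).memLp hC q).integrable_norm_pow two_ne_zero).ofReal
  have polar : ∀ {G : Type} [NormedAddCommGroup G] [InnerProductSpace ℂ G] (x y : G),
      ⟪x, y⟫_ℂ = (((‖x + (1 : ℂ) • y‖ ^ 2 : ℝ) : ℂ) - ((‖x + (-1 : ℂ) • y‖ ^ 2 : ℝ) : ℂ) +
        (((‖x + (-Complex.I) • y‖ ^ 2 : ℝ) : ℂ) -
          ((‖x + Complex.I • y‖ ^ 2 : ℝ) : ℂ)) * Complex.I) / 4 := by
    intro G _ _ x y
    rw [inner_eq_sum_norm_sq_div_four (𝕜 := ℂ) x y]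
    simp only [one_smul, neg_smul, ← sub_eq_add_neg, Complex.ofReal_pow]
    rfl
  have h1 : ∀ k, ⟪φ k, φ' k⟫_ℂ = _ := fun k ↦ polar (φ k) (φ' k)
  rw [integral_congr_ae (Eventually.of_forall h1), integral_div, integral_add, integral_sub,
    integral_mul_const, integral_sub, key, key, key, key, ← polar]
  · exact hi _
  · exact hi _
  · exact hi _
  · exact hi _
  · exact (hi _).sub (hi _)
  · exact ((hi _).sub (hi _)).mul_const _

end BFZ

/-! ### Operators acting fiberwise -/

section BFZRules

variable {d N : ℕ} {C : Crystal d} {T : MagneticCocycle C N}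

/-- A shift maps compact sets of momenta to compact sets, and M is uniformly bounded, so the
approximating sequences remain approximating. A rule for the transform has to be checked only on
compact supports. -/
theorem IsBFZ.lift {A : Hilb C N →L[ℂ] Hilb C N}
    {M : Pos d → HilbFiber C N →L[ℂ] HilbFiber C N} {κ : Pos d} {c : ℝ} (hM : Continuous M)
    (hc : ∀ k, ‖M k‖ ≤ c)
    (hA : ∀ ψ φ, IsCompactBFZ T ψ φ → IsCompactBFZ T (A ψ) fun k ↦ M k (φ (k + κ)))
    {ψ : Hilb C N} {φ : Pos d → HilbFiber C N} (h : IsBFZ T ψ φ) :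
    IsBFZ T (A ψ) fun k ↦ M k (φ (k + κ)) := by
  obtain ⟨hm, ψs, φs, h1, h2, h3⟩ := h
  have hmp : MeasurePreserving (fun k : Pos d ↦ k + κ) volume volume :=
    measurePreserving_add_right volume κ
  refine ⟨?_, fun n ↦ A (ψs n), fun n k ↦ M k (φs n (k + κ)), fun n ↦ hA _ _ (h1 n),
    (A.continuous.tendsto _).comp h2, fun K hK ↦ ?_⟩
  · exact isBoundedBilinearMap_apply.continuous.comp_aestronglyMeasurable₂ hM.aestronglyMeasurable
      (hm.comp_measurePreserving hmp)
  · set K' : Set (Pos d) := (fun k ↦ k + κ) '' K with hK'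
    have hKc : IsCompact K' := hK.image (continuous_add_const κ)
    have hmp' : MeasurePreserving (fun k : Pos d ↦ k + κ) (volume.restrict K) (volume.restrict K') := by
      have h4 := hmp.restrict_preimage hKc.isClosed.measurableSet
      rwa [hK', Set.preimage_image_eq _ (add_left_injective κ)] at h4
    have h4 := ENNReal.Tendsto.const_mul (a := ENNReal.ofReal c) (h3 K' hKc)
      (Or.inr ENNReal.ofReal_ne_top)
    rw [mul_zero] at h4
    refine tendsto_of_tendsto_of_tendsto_of_le_of_le tendsto_const_nhds h4 (fun n ↦ bot_le) ?_
    intro n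
    change _ ≤ ENNReal.ofReal c * eLpNorm (φs n - φ) 2 (volume.restrict K')
    rw [← eLpNorm_comp_measurePreserving ((h1 n).measurable.sub hm).restrict hmp']
    refine eLpNorm_le_mul_eLpNorm_of_ae_le_mul (Eventually.of_forall fun k ↦ ?_) 2
    rw [Pi.sub_apply, ← map_sub]
    exact ((M k).le_opNorm _).trans (mul_le_mul_of_nonneg_right (hc k) (norm_nonneg _))

theorem norm_id_le_one : ‖(1 : HilbFiber C N →L[ℂ] HilbFiber C N)‖ ≤ 1 :=
  ContinuousLinearMap.norm_id_le

/-- The phase of T_γ(E_κ ψ) at y is e^{-iκ·(y-γ)}, and it combines with e^{-ik·y}e^{ik·γ} to the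
same expression at momentum k + κ. This shift replaces differentiation in k throughout. -/
theorem IsCompactBFZ.phaseOp {ψ : Hilb C N} {φ : Pos d → HilbFiber C N} (h : IsCompactBFZ T ψ φ)
    (κ : Pos d) : IsCompactBFZ T (phaseOp N C.measure κ ψ) fun k ↦ φ (k + κ) where
  compact_support := by
    obtain ⟨r, hr⟩ := h.compact_support
    refine ⟨r, ?_⟩
    filter_upwards [hr, coeFn_phaseOp κ ψ] with x h1 h2 h3
    rw [h2, h1 h3, smul_zero]
  measurable := h.measurable.comp_measurePreserving (measurePreserving_add_right volume κ)
  hasSum := by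
    intro k
    have h1 : ∀ᵐ y ∂(C.measure.restrict (C.cell C.a 1)), ∀ γ : C.lattice,
        translationOp T γ (SpinTransport.phaseOp N C.measure κ ψ) y =
        Complex.exp (-(Complex.I * ((⟪κ, y - (γ : Pos d)⟫_ℝ : ℝ) : ℂ))) • translationOp T γ ψ y := by
      rw [ae_all_iff]
      intro γ
      refine ae_restrict_of_ae ?_
      filter_upwards [coeFn_translationOp T γ (SpinTransport.phaseOp N C.measure κ ψ),
        coeFn_translationOp T γ ψ,
        (C.measurePreserving_sub γ).quasiMeasurePreserving.ae (coeFn_phaseOp κ ψ)] with y h1 h2 h3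
      rw [h1, h2, h3, map_smul]
    filter_upwards [h1, h.hasSum (k + κ)] with y h2 h3
    refine h3.congr_fun fun γ ↦ ?_
    rw [h2 γ, smul_smul, smul_smul, smul_smul, ← Complex.exp_add, ← Complex.exp_add,
      ← Complex.exp_add]
    congr 2
    rw [inner_sub_right, inner_add_left, inner_add_left]
    push_cast
    ring

theorem IsBFZ.phaseOp {ψ : Hilb C N} {φ : Pos d → HilbFiber C N} (h : IsBFZ T ψ φ) (κ : Pos d) :
    IsBFZ T (phaseOp N C.measure κ ψ) fun k ↦ φ (k + κ) :=
  IsBFZ.lift (M := fun _ ↦ 1) continuous_const (fun _ ↦ norm_id_le_one)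
    (fun _ _ h ↦ h.phaseOp κ) h

theorem IsCompactBFZ.spinOp {ψ : Hilb C N} {φ : Pos d → HilbFiber C N} (h : IsCompactBFZ T ψ φ)
    {s : Spin N →L[ℂ] Spin N} (hs : ∀ γ (ψ : Hilb C N), translationOp T γ (spinOp C.measure s ψ) =
      spinOp C.measure s (translationOp T γ ψ)) :
    IsCompactBFZ T (spinOp C.measure s ψ) fun k ↦ spinOp _ s (φ k) where
  compact_support := by
    obtain ⟨r, hr⟩ := h.compact_support
    refine ⟨r, ?_⟩
    filter_upwards [hr, coeFn_spinOp s ψ] with x h1 h2 h3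
    rw [h2, h1 h3, map_zero]
  measurable := (ContinuousLinearMap.continuous _).comp_aestronglyMeasurable h.measurable
  hasSum := by
    intro k
    have h1 : ∀ᵐ y ∂(C.measure.restrict (C.cell C.a 1)), ∀ γ : C.lattice,
        translationOp T γ (SpinTransport.spinOp C.measure s ψ) y = s (translationOp T γ ψ y) := by
      rw [ae_all_iff]
      intro γ
      refine ae_restrict_of_ae ?_
      rw [hs]
      exact coeFn_spinOp s (translationOp T γ ψ)
    filter_upwards [h1, h.hasSum k, coeFn_spinOp s (φ k)] with y h2 h3 h4
    rw [h4]
    refine (s.hasSum h3).congr_fun fun γ ↦ ?_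
    rw [h2 γ, map_smul, map_smul]

theorem IsBFZ.spinOp {ψ : Hilb C N} {φ : Pos d → HilbFiber C N} (h : IsBFZ T ψ φ)
    {s : Spin N →L[ℂ] Spin N} (hs : ∀ γ (ψ : Hilb C N), translationOp T γ (spinOp C.measure s ψ) =
      spinOp C.measure s (translationOp T γ ψ)) :
    IsBFZ T (spinOp C.measure s ψ) fun k ↦ spinOp _ s (φ k) := by
  have h1 := IsBFZ.lift (T := T) (A := SpinTransport.spinOp C.measure s)
    (M := fun _ ↦ SpinTransport.spinOp _ s) (κ := 0) continuous_const (fun _ ↦ le_rfl)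
    (fun ψ φ h ↦ by simpa using h.spinOp hs) h
  simpa using h1

/-- Substituting γ + η for γ in the sum pulls out the character of -η. -/
theorem IsCompactBFZ.translationOp {ψ : Hilb C N} {φ : Pos d → HilbFiber C N}
    (h : IsCompactBFZ T ψ φ) (η : C.lattice) :
    IsCompactBFZ T (translationOp T η ψ) fun k ↦ C.character (-η) k • φ k where
  compact_support := by
    obtain ⟨r, hr⟩ := h.compact_support
    refine ⟨r + ‖(η : Pos d)‖, ?_⟩
    filter_upwards [coeFn_translationOp T η ψ,
      (C.measurePreserving_sub η).quasiMeasurePreserving.ae hr] with x h1 h2 h3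
    have := norm_sub_norm_le x (η : Pos d)
    rw [h1, h2 (by linarith), map_zero]
  measurable := (C.continuous_character (-η)).aestronglyMeasurable.smul h.measurable
  hasSum := by
    intro k
    filter_upwards [h.hasSum k, Lp.coeFn_smul (C.character (-η) k) (φ k)] with y h3 h4
    rw [h4, Pi.smul_apply]
    have h5 := ((Equiv.addLeft η).hasSum_iff.mpr h3).const_smul (C.character (-η) k)
    refine h5.congr_fun fun γ ↦ ?_
    rw [Function.comp_apply, Equiv.coe_addLeft, translationOp_translationOp,
      smul_comm (C.character (-η) k), smul_smul (C.character (-η) k)]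
    congr 2
    rw [Crystal.character, ← Complex.exp_add]
    congr 1
    rw [← mul_add, ← Complex.ofReal_add, ← inner_add_right]
    simp

theorem IsBFZ.translationOp {ψ : Hilb C N} {φ : Pos d → HilbFiber C N} (h : IsBFZ T ψ φ)
    (η : C.lattice) : IsBFZ T (translationOp T η ψ) fun k ↦ C.character (-η) k • φ k := by
  have h1 := IsBFZ.lift (T := T) (A := SpinTransport.translationOp T η)
    (M := fun k ↦ C.character (-η) k • 1) (κ := 0) (c := 1)
    ((C.continuous_character (-η)).smul continuous_const)
    (fun k ↦ by
      rw [norm_smul, C.norm_character, one_mul]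
      exact norm_id_le_one)
    (fun ψ φ h ↦ by
      have := h.translationOp η
      convert this using 2 with k
      simp) h
  convert h1 using 2 with k
  simp

theorem IsBFZ.sum {ι : Type*} {F : Finset ι} {ψ : ι → Hilb C N} {φ : ι → Pos d → HilbFiber C N}
    (h : ∀ n ∈ F, IsBFZ T (ψ n) (φ n)) :
    IsBFZ T (∑ n ∈ F, ψ n) (∑ n ∈ F, φ n) := by
  classical
  induction F using Finset.induction_on with
  | empty => exact IsBFZ.zero T
  | insert a F ha ih =>
    rw [Finset.sum_insert ha, Finset.sum_insert ha]
    exact (h a (Finset.mem_insert_self a F)).add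
      (ih fun n hn ↦ h n (Finset.mem_insert_of_mem hn))

theorem cellRestrict_translationOp_cellExtend (hC : C.IsPrimitiveCell C.a) {γ : C.lattice}
    (hγ : γ ≠ 0) (u : HilbFiber C N) :
    cellRestrict C N (translationOp T γ (cellExtend C N u)) = 0 := by
  obtain ⟨w, rfl⟩ := cellRestrict_surjective u
  rw [cellExtend_cellRestrict, translationOp_chi]
  exact cellRestrict_eq_zero _ (hC γ hγ) _

/-- The other translates of the cell meet it in null sets, so only γ = 0 contributes. Up to the
phase, every fiber vector is realised simultaneously at all momenta. -/
theorem isCompactBFZ_cellExtend (hC : C.IsPrimitiveCell C.a) (u : HilbFiber C N) :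
    IsCompactBFZ T (cellExtend C N u) fun k ↦ phaseOp N _ k u := by
  have h := isCompactBFZ_bfzSum (T := T) (F := {0}) (hasBoundedSupport_cellExtend u)
    fun γ hγ ↦ cellRestrict_translationOp_cellExtend hC (by simpa using hγ) u
  convert h using 2 with k
  rw [bfzSum, Finset.sum_singleton, translationOp_zero, cellRestrict_cellExtend]
  simp [Crystal.character]

/-- Fiberedness provides only some transforms of ψ and B ψ; uniqueness almost everywhere exchanges
the first for the given one. -/
theorem IsFibered.isBFZ_apply (hC : C.IsPrimitiveCell C.a) {B : Hilb C N →L[ℂ] Hilb C N}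
    {Bk : Pos d → HilbFiber C N →L[ℂ] HilbFiber C N}
    (hA : IsFibered T (ofCLM B) fun k ↦ ofCLM (Bk k)) {ψ : Hilb C N} {φ : Pos d → HilbFiber C N}
    (hφ : IsBFZ T ψ φ) : IsBFZ T (B ψ) fun k ↦ Bk k (φ k) := by
  obtain ⟨φ', χ, h1, h2, h3⟩ := (hA ψ (B ψ)).mp (mem_graph_ofCLM.mpr rfl)
  refine h2.congr ?_
  filter_upwards [h3, h1.ae_eq hC hφ] with k h4 h5
  rw [mem_graph_ofCLM] at h4
  rw [h4, h5]

end BFZRules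

/-! ## The fibers of the Hamiltonian -/

section GraphDomain

variable {F : Type} [NormedAddCommGroup F] [InnerProductSpace ℂ F]

theorem GraphDomain.norm_sq (A : F →ₗ.[ℂ] F) (x : GraphDomain A) :
    ‖x‖ ^ 2 = ‖GraphDomain.val A x‖ ^ 2 + ‖A.toFun x‖ ^ 2 := by
  have h : ‖x‖ = ‖GraphDomain.toGraph A x‖ := rfl
  rw [h, WithLp.prod_norm_sq_eq_of_L2]
  rfl

theorem GraphDomain.norm_val_le (A : F →ₗ.[ℂ] F) (x : GraphDomain A) :
    ‖GraphDomain.val A x‖ ≤ ‖x‖ := by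
  have h := GraphDomain.norm_sq A x
  exact (sq_le_sq₀ (norm_nonneg _) (norm_nonneg _)).mp (by nlinarith [sq_nonneg ‖A.toFun x‖])

/-- The embedding of the domain with the graph norm. -/
def GraphDomain.valL (A : F →ₗ.[ℂ] F) : GraphDomain A →L[ℂ] F :=
  (GraphDomain.val A).mkContinuous 1 fun x ↦ by
    rw [one_mul]
    exact GraphDomain.norm_val_le A x

theorem GraphDomain.val_injective (A : F →ₗ.[ℂ] F) : Function.Injective (GraphDomain.val A) :=
  Subtype.val_injective

theorem GraphDomain.exists_val_eq {A : F →ₗ.[ℂ] F} {x : F} (h : x ∈ A.domain) :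
    ∃ φ : GraphDomain A, GraphDomain.val A φ = x := ⟨⟨x, h⟩, rfl⟩

theorem GraphDomain.completeSpace [CompleteSpace F] {A : F →ₗ.[ℂ] F} (hA : A.IsClosed) :
    CompleteSpace (GraphDomain A) := by
  have hi : Isometry (GraphDomain.toGraph A) := by
    refine Isometry.of_dist_eq fun x y ↦ ?_
    rw [dist_eq_norm, dist_eq_norm, ← map_sub]
    rfl
  rw [completeSpace_iff_isComplete_range hi.isUniformInducing]
  refine IsClosed.isComplete ?_
  have : Set.range (GraphDomain.toGraph A) =
      (WithLp.prodContinuousLinearEquiv 2 ℂ F F) ⁻¹' (A.graph : Set (F × F)) := by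
    ext p
    constructor
    · rintro ⟨x, rfl⟩
      exact A.mem_graph x
    · intro hp
      obtain ⟨x, hx, hx'⟩ := (LinearPMap.mem_graph_iff A).mp hp
      exact ⟨x, (WithLp.prodContinuousLinearEquiv 2 ℂ F F).injective (Prod.ext hx hx')⟩
  rw [this]
  exact IsClosed.preimage (WithLp.prodContinuousLinearEquiv 2 ℂ F F).continuous hA

end GraphDomain

/-! ### Uniform relative bounds on the fibers and their transfer to the Hamiltonian -/

section Fibers

variable {d N : ℕ} {C : Crystal d} {T : MagneticCocycle C N}
  {H₀ : Hilb C N →ₗ.[ℂ] Hilb C N} {Hk : Pos d → HilbFiber C N →ₗ.[ℂ] HilbFiber C N} {μ : ℝ}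

/-- Self-adjointness makes H₀(k) - i a bijection from D_f onto H_f. As D_f is complete in its graph
norm, this is an isomorphism of Banach spaces, and inversion of isomorphisms is smooth. The inverse
controls the graph norm of H₀(0) by the graph norm of H₀(k), uniformly for k in a compact set. -/
theorem IsGappedPeriodicHamiltonian.exists_inverse (hH : IsGappedPeriodicHamiltonian T H₀ Hk μ)
    {h : Pos d → (GraphDomain (Hk 0) →L[ℂ] HilbFiber C N)} (hh : ContDiff ℝ ∞ h)
    (hg : ∀ k φ, (GraphDomain.val (Hk 0) φ, h k φ) ∈ (Hk k).graph) :
    ∃ G : Pos d → (HilbFiber C N →L[ℂ] GraphDomain (Hk 0)), ContDiff ℝ ∞ G ∧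
      (∀ k u, h k (G k u) - Complex.I • GraphDomain.val (Hk 0) (G k u) = u) ∧
      ∀ k φ, G k (h k φ - Complex.I • GraphDomain.val (Hk 0) φ) = φ := by
  have hc : CompleteSpace (GraphDomain (Hk 0)) :=
    GraphDomain.completeSpace (hH.fiber_selfAdjoint 0).isClosed
  let g : Pos d → (GraphDomain (Hk 0) →L[ℂ] HilbFiber C N) := fun k ↦
    h k - Complex.I • GraphDomain.valL (Hk 0)
  have hgs : ContDiff ℝ ∞ g := hh.sub contDiff_const
  have hga : ∀ k φ, g k φ = h k φ - Complex.I • GraphDomain.val (Hk 0) φ := fun k φ ↦ rfl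
  have hbij : ∀ k, ∃ e : GraphDomain (Hk 0) ≃L[ℂ] HilbFiber C N,
      (e : GraphDomain (Hk 0) →L[ℂ] HilbFiber C N) = g k := by
    intro k
    obtain ⟨R, hR⟩ := exists_isResolventAt_I (hH.fiber_selfAdjoint k)
    refine ⟨ContinuousLinearEquiv.ofBijective (g k) ?_ ?_, by ext; rfl⟩
    · rw [LinearMap.ker_eq_bot']
      intro φ hφ
      have h1 := hR.apply_sub (hg k φ)
      have h2 : h k φ - Complex.I • GraphDomain.val (Hk 0) φ = 0 := hφ
      rw [h2, map_zero] at h1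
      exact GraphDomain.val_injective _ (by rw [← h1, map_zero])
    · rw [LinearMap.range_eq_top]
      intro u
      have h1 := hR.mem_graph u
      have h2 := mem_domain_of_graph h1
      rw [hH.domain_eq k] at h2
      obtain ⟨φ, hφ⟩ := GraphDomain.exists_val_eq h2
      refine ⟨φ, ?_⟩
      have h3 := hg k φ
      rw [hφ] at h3
      change h k φ - Complex.I • GraphDomain.val (Hk 0) φ = u
      rw [hφ, eq_of_mem_graph h3 h1, add_sub_cancel_right]
  choose e he using hbij
  have hinv : ∀ k, (fun k ↦ ContinuousLinearMap.inverse (g k)) k =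
      ((e k).symm : HilbFiber C N →L[ℂ] GraphDomain (Hk 0)) := by
    intro k
    change ContinuousLinearMap.inverse (g k) = _
    rw [← he k, ContinuousLinearMap.inverse_equiv]
  refine ⟨fun k ↦ ContinuousLinearMap.inverse (g k), ?_, ?_, ?_⟩
  · rw [contDiff_iff_contDiffAt]
    intro k
    have h1 : ContDiffAt ℂ ∞ ContinuousLinearMap.inverse (g k) := by
      rw [← he k]
      exact contDiffAt_map_inverse (e k)
    exact (h1.restrict_scalars ℝ).comp k hgs.contDiffAt
  · intro k u
    rw [← hga, hinv, ← he k]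
    exact (e k).apply_symm_apply u
  · intro k φ
    rw [← hga, hinv, ← he k]
    exact (e k).symm_apply_apply φ

/-- A compact set of momenta which contains a representative of every momentum. -/
theorem Crystal.exists_representatives (C : Crystal d) : ∃ r : ℝ, 0 ≤ r ∧ ∀ k : Pos d,
    ∃ k₀ g : Pos d, ‖k₀‖ ≤ r ∧ g ∈ C.dualLattice ∧ k = k₀ + g := by
  have hcomp : IsCompact (C.momentumCoord.symm '' (Set.univ.pi fun _ ↦ Set.Icc (0 : ℝ) 1)) :=
    (isCompact_univ_pi fun _ ↦ isCompact_Icc).image C.momentumCoord.symm.continuous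
  obtain ⟨r, hr⟩ := hcomp.isBounded.exists_norm_le
  refine ⟨|r|, abs_nonneg r, fun k ↦ ?_⟩
  refine ⟨C.momentumCoord.symm fun i ↦ Int.fract (C.momentumCoord k i),
    C.momentumCoord.symm fun i ↦ ⌊C.momentumCoord k i⌋, ?_, ?_, ?_⟩
  · refine (hr _ ⟨_, fun i _ ↦ ?_, rfl⟩).trans (le_abs_self r)
    exact ⟨Int.fract_nonneg _, (Int.fract_lt_one _).le⟩
  · refine C.mem_dualLattice_of_coord (n := fun i ↦ ⌊C.momentumCoord k i⌋) fun j ↦ ?_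
    rw [ContinuousLinearEquiv.apply_symm_apply]
  · apply C.momentumCoord.injective
    rw [map_add, ContinuousLinearEquiv.apply_symm_apply, ContinuousLinearEquiv.apply_symm_apply]
    funext i
    exact (Int.fract_add_floor _).symm

theorem IsGappedPeriodicHamiltonian.mem_graph_add_iff (hH : IsGappedPeriodicHamiltonian T H₀ Hk μ)
    {g : Pos d} (hg : g ∈ C.dualLattice) (k : Pos d) {x y : HilbFiber C N} :
    (x, y) ∈ (Hk (k + g)).graph ↔ (phaseOp N _ (-g) x, phaseOp N _ (-g) y) ∈ (Hk k).graph := by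
  rw [hH.equivariant g hg k, mem_graph_pcomp]
  constructor
  · rintro ⟨z, h1, h2⟩
    obtain ⟨w, h3, h4⟩ := mem_graph_pcomp.mp h1
    rw [mem_graph_ofCLM] at h2 h3
    rwa [h2, phaseOp_neg_phaseOp, ← h3]
  · intro h1
    refine ⟨phaseOp N _ (-g) y, mem_graph_pcomp.mpr ⟨_, mem_graph_ofCLM.mpr rfl, h1⟩, ?_⟩
    rw [mem_graph_ofCLM, phaseOp_phaseOp_neg]

/-- The fibers are Lipschitz continuous relative to themselves. -/
theorem IsGappedPeriodicHamiltonian.exists_fiber_shift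
    (hH : IsGappedPeriodicHamiltonian T H₀ Hk μ) : ∃ K : ℝ, 0 ≤ K ∧ ∀ k κ : Pos d, ‖κ‖ ≤ 1 →
      ∀ x y, (x, y) ∈ (Hk k).graph → ∃ y', (x, y') ∈ (Hk (k + κ)).graph ∧
        ‖y' - y‖ ≤ K * ‖κ‖ * (‖y‖ + ‖x‖) := by
  obtain ⟨h, hh, hg⟩ := hH.smooth
  obtain ⟨G, hG, hG1, hG2⟩ := hH.exists_inverse hh hg
  obtain ⟨r, hr0, hr⟩ := C.exists_representatives
  obtain ⟨M, hM⟩ := (isCompact_closedBall (0 : Pos d) r).exists_bound_of_continuousOn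
    hG.continuous.continuousOn
  have hfd : Continuous (fderiv ℝ h) := hh.continuous_fderiv (by simp)
  obtain ⟨L, hL⟩ := (isCompact_closedBall (0 : Pos d) (r + 1)).exists_bound_of_continuousOn
    (E := Pos d →L[ℝ] (GraphDomain (Hk 0) →L[ℂ] HilbFiber C N)) hfd.continuousOn
  have hM0 : 0 ≤ M := (norm_nonneg _).trans (hM 0 (by simpa using hr0))
  have hL0 : 0 ≤ L := (norm_nonneg _).trans (hL 0 (by simp; linarith))
  -- On the compact set of representatives the mean value inequality bounds h(k + κ) - h(k) by L‖κ‖;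
  -- the radius r + 1 leaves room for ‖κ‖ ≤ 1. Equivariance, with isometric phases, then extends the
  -- bound to all k with the same constant.
  have key : ∀ k κ : Pos d, ‖k‖ ≤ r → ‖κ‖ ≤ 1 → ∀ x y, (x, y) ∈ (Hk k).graph →
      ∃ y', (x, y') ∈ (Hk (k + κ)).graph ∧ ‖y' - y‖ ≤ L * M * ‖κ‖ * (‖y‖ + ‖x‖) := by
    intro k κ hk hκ x y hxy
    have hx := mem_domain_of_graph hxy
    rw [hH.domain_eq k] at hx
    obtain ⟨φ, hφ⟩ := GraphDomain.exists_val_eq hx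
    have hgk := hg k φ
    rw [hφ] at hgk
    have hy : y = h k φ := eq_of_mem_graph hxy hgk
    have hgk' := hg (k + κ) φ
    rw [hφ] at hgk'
    refine ⟨h (k + κ) φ, hgk', ?_⟩
    have h1 : ‖h (k + κ) - h k‖ ≤ L * ‖κ‖ := by
      have h2 := (convex_closedBall (0 : Pos d) (r + 1)).norm_image_sub_le_of_norm_fderiv_le
        (𝕜 := ℝ) (f := h) (C := L) (x := k) (y := k + κ)
        (fun x _ ↦ (hh.differentiable (by simp)).differentiableAt) hL
        (by simp; linarith) (by simpa using (norm_add_le k κ).trans (by linarith))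
      simpa using h2
    have h3 : ‖φ‖ ≤ M * (‖y‖ + ‖x‖) := by
      conv_lhs => rw [← hG2 k φ]
      refine ((G k).le_opNorm _).trans ?_
      gcongr
      · exact hM k (by simpa using hk)
      · rw [hφ, ← hy]
        refine (norm_sub_le _ _).trans ?_
        rw [norm_smul, Complex.norm_I, one_mul]
    rw [hy, ← _root_.sub_apply]
    calc ‖(h (k + κ) - h k) φ‖ ≤ ‖h (k + κ) - h k‖ * ‖φ‖ := ContinuousLinearMap.le_opNorm _ _
      _ ≤ (L * ‖κ‖) * (M * (‖y‖ + ‖x‖)) := by gcongr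
      _ = _ := by rw [hy]; ring
  refine ⟨L * M, by positivity, fun k κ hκ x y hxy ↦ ?_⟩
  obtain ⟨k₀, g, hk₀, hgd, rfl⟩ := hr k
  have h1 := (hH.mem_graph_add_iff hgd k₀).mp hxy
  obtain ⟨y', hy', hn⟩ := key k₀ κ hk₀ hκ _ _ h1
  refine ⟨phaseOp N _ g y', ?_, ?_⟩
  · rw [add_right_comm, hH.mem_graph_add_iff hgd, phaseOp_neg_phaseOp]
    exact hy'
  · rw [norm_phaseOp, norm_phaseOp] at hn
    rw [← norm_phaseOp (-g), map_sub, phaseOp_neg_phaseOp]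
    exact hn

/-- The spin operator is bounded relative to the fibers. -/
theorem IsGappedPeriodicHamiltonian.exists_fiber_spin
    (hH : IsGappedPeriodicHamiltonian T H₀ Hk μ) {s : Spin N →L[ℂ] Spin N}
    (hs : IsSpin T (Hk 0) s) : ∃ K : ℝ, 0 ≤ K ∧ ∀ k : Pos d,
      ∀ x y, (x, y) ∈ (Hk k).graph → ∃ y', (spinOp _ s x, y') ∈ (Hk k).graph ∧
        ‖y'‖ ≤ K * (‖y‖ + ‖x‖) := by
  obtain ⟨h, hh, hg⟩ := hH.smooth
  obtain ⟨S, hS⟩ := hs.bounded_on_domain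
  obtain ⟨G, hG, hG1, hG2⟩ := hH.exists_inverse hh hg
  obtain ⟨r, hr0, hr⟩ := C.exists_representatives
  obtain ⟨M, hM⟩ := (isCompact_closedBall (0 : Pos d) r).exists_bound_of_continuousOn
    hG.continuous.continuousOn
  obtain ⟨L, hL⟩ := (isCompact_closedBall (0 : Pos d) r).exists_bound_of_continuousOn
    hh.continuous.continuousOn
  have hM0 : 0 ≤ M := (norm_nonneg _).trans (hM 0 (by simpa using hr0))
  have hL0 : 0 ≤ L := (norm_nonneg _).trans (hL 0 (by simpa using hr0))
  have key : ∀ k : Pos d, ‖k‖ ≤ r → ∀ x y, (x, y) ∈ (Hk k).graph →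
      ∃ y', (spinOp _ s x, y') ∈ (Hk k).graph ∧ ‖y'‖ ≤ L * ‖S‖ * M * (‖y‖ + ‖x‖) := by
    intro k hk x y hxy
    have hx := mem_domain_of_graph hxy
    rw [hH.domain_eq k] at hx
    obtain ⟨φ, hφ⟩ := GraphDomain.exists_val_eq hx
    have hgk := hg k φ
    rw [hφ] at hgk
    have hy : y = h k φ := eq_of_mem_graph hxy hgk
    have hgk' := hg k (S φ)
    rw [hS, hφ] at hgk'
    refine ⟨h k (S φ), hgk', ?_⟩
    have h3 : ‖φ‖ ≤ M * (‖y‖ + ‖x‖) := by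
      conv_lhs => rw [← hG2 k φ]
      refine ((G k).le_opNorm _).trans ?_
      gcongr
      · exact hM k (by simpa using hk)
      · rw [hφ, ← hy]
        refine (norm_sub_le _ _).trans ?_
        rw [norm_smul, Complex.norm_I, one_mul]
    calc ‖h k (S φ)‖ ≤ ‖h k‖ * ‖S φ‖ := ContinuousLinearMap.le_opNorm _ _
      _ ≤ ‖h k‖ * (‖S‖ * ‖φ‖) := by gcongr; exact ContinuousLinearMap.le_opNorm _ _
      _ ≤ L * (‖S‖ * (M * (‖y‖ + ‖x‖))) := by gcongr; exact hL k (by simpa using hk)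
      _ = _ := by ring
  refine ⟨L * ‖S‖ * M, by positivity, fun k x y hxy ↦ ?_⟩
  obtain ⟨k₀, g, hk₀, hgd, rfl⟩ := hr k
  have h1 := (hH.mem_graph_add_iff hgd k₀).mp hxy
  obtain ⟨y', hy', hn⟩ := key k₀ hk₀ _ _ h1
  refine ⟨phaseOp N _ g y', ?_, ?_⟩
  · rw [hH.mem_graph_add_iff hgd, phaseOp_neg_phaseOp, ← spinOp_phaseOp]
    exact hy'
  · rw [norm_phaseOp, norm_phaseOp] at hn
    rwa [norm_phaseOp]

theorem integral_norm_mul_norm_le {α E F : Type*} [MeasurableSpace α] {ν : Measure α}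
    [NormedAddCommGroup E] [NormedAddCommGroup F] {f : α → E} {g : α → F} (hf : MemLp f 2 ν)
    (hg : MemLp g 2 ν) : ∫ x, ‖f x‖ * ‖g x‖ ∂ν ≤
      Real.sqrt (∫ x, ‖f x‖ ^ 2 ∂ν) * Real.sqrt (∫ x, ‖g x‖ ^ 2 ∂ν) := by
  have h := integral_mul_norm_le_Lp_mul_Lq (μ := ν) (f := fun x ↦ ‖f x‖) (g := fun x ↦ ‖g x‖)
    Real.HolderConjugate.two_two (by simpa using hf.norm) (by simpa using hg.norm)
  simpa [Real.sqrt_eq_rpow] using h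

/-- Fiberwise bounds imply membership in the domain of the Hamiltonian. -/
theorem IsGappedPeriodicHamiltonian.exists_mem_graph_of_fiber
    (hC : C.IsPrimitiveCell C.a) (hH : IsGappedPeriodicHamiltonian T H₀ Hk μ)
    {v z p q : Hilb C N} {φ χ ξ ζ : Pos d → HilbFiber C N} (hv : IsBFZ T v φ) (hz : IsBFZ T z χ)
    (hp : IsBFZ T p ξ) (hq : IsBFZ T q ζ) {K : ℝ} (hK : 0 ≤ K)
    (hb : ∀ᵐ k : Pos d, ∃ y', (φ k, y') ∈ (Hk k).graph ∧ ‖y' - χ k‖ ≤ K * (‖ζ k‖ + ‖ξ k‖)) :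
    ∃ w, (v, w) ∈ H₀.graph ∧ ‖w - z‖ ≤ K * (‖q‖ + ‖p‖) := by
  -- Membership is tested weakly against the domain of H₀, so the vectors y' never have to be chosen
  -- measurably in k.
  refine exists_mem_graph_of_bound hH.selfAdjoint (by positivity) fun x y hxy ↦ ?_
  obtain ⟨a, b, ha, hb', hab⟩ := (hH.fibered x y).mp hxy
  set ν := C.zoneMeasure 0 with hν
  have hac : ν ≪ volume := C.zoneMeasure_absolutelyContinuous 0
  have hsq : ∀ {ψ : Hilb C N} {f : Pos d → HilbFiber C N}, IsBFZ T ψ f →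
      Real.sqrt (∫ k, ‖f k‖ ^ 2 ∂ν) = ‖ψ‖ := fun hf ↦ by
    rw [hf.integral_norm_sq hC, Real.sqrt_sq (norm_nonneg _)]
  have hi : ∀ {ψ ψ' : Hilb C N} {f f' : Pos d → HilbFiber C N}, IsBFZ T ψ f → IsBFZ T ψ' f' →
      Integrable (fun k ↦ ‖f k‖ * ‖f' k‖) ν := fun hf hf' ↦
    (hf.memLp hC 0).norm.integrable_mul (hf'.memLp hC 0).norm
  have hpt : ∀ᵐ k ∂ν, ‖⟪φ k, b k⟫_ℂ - ⟪χ k, a k⟫_ℂ‖ ≤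
      K * (‖ζ k‖ * ‖a k‖ + ‖ξ k‖ * ‖a k‖) := by
    filter_upwards [hac.ae_le hb, hac.ae_le hab] with k ⟨y', h1, h2⟩ h3
    rw [← inner_graph_symm (hH.fiber_selfAdjoint k) h1 h3, ← inner_sub_left]
    calc _ ≤ ‖y' - χ k‖ * ‖a k‖ := norm_inner_le_norm _ _
      _ ≤ K * (‖ζ k‖ + ‖ξ k‖) * ‖a k‖ := by gcongr
      _ = _ := by ring
  have hii : ∀ {ψ ψ' : Hilb C N} {f f' : Pos d → HilbFiber C N}, IsBFZ T ψ f → IsBFZ T ψ' f' →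
      Integrable (fun k ↦ ⟪f k, f' k⟫_ℂ) ν := fun hf hf' ↦
    (hi hf hf').mono' ((hf.aestronglyMeasurable_zone 0).inner (hf'.aestronglyMeasurable_zone 0))
      (Eventually.of_forall fun k ↦ norm_inner_le_norm _ _)
  rw [← hv.integral_inner hC hb' 0, ← hz.integral_inner hC ha 0, ← integral_sub
    (hii hv hb') (hii hz ha)]
  refine (norm_integral_le_of_norm_le (((hi hq ha).add (hi hp ha)).const_mul K) hpt).trans ?_
  rw [integral_const_mul, Pi.add_def, integral_add (hi hq ha) (hi hp ha)]
  have h1 := integral_norm_mul_norm_le (hq.memLp hC 0) (ha.memLp hC 0)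
  have h2 := integral_norm_mul_norm_le (hp.memLp hC 0) (ha.memLp hC 0)
  rw [hsq hq, hsq ha] at h1
  rw [hsq hp, hsq ha] at h2
  calc _ ≤ K * (‖q‖ * ‖x‖ + ‖p‖ * ‖x‖) := by gcongr
    _ = _ := by ring

/-- The phase carries the fiber at k + κ to the one at k, so the fiberwise Lipschitz bound is
applied at k + κ with the shift -κ. -/
theorem IsGappedPeriodicHamiltonian.exists_phaseOp_mem_graph
    (hC : C.IsPrimitiveCell C.a) (hH : IsGappedPeriodicHamiltonian T H₀ Hk μ) :
    ∃ K : ℝ, 0 ≤ K ∧ ∀ κ : Pos d, ‖κ‖ ≤ 1 → ∀ x y, (x, y) ∈ H₀.graph →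
      ∃ w, (phaseOp N C.measure κ x, w) ∈ H₀.graph ∧
        ‖w - phaseOp N C.measure κ y‖ ≤ K * ‖κ‖ * (‖y‖ + ‖x‖) := by
  obtain ⟨K, hK, hs⟩ := hH.exists_fiber_shift
  refine ⟨K, hK, fun κ hκ x y hxy ↦ ?_⟩
  obtain ⟨φ, χ, hφ, hχ, hae⟩ := (hH.fibered x y).mp hxy
  have h1 := hH.exists_mem_graph_of_fiber hC (hφ.phaseOp κ) (hχ.phaseOp κ) (hφ.phaseOp κ)
    (hχ.phaseOp κ) (K := K * ‖κ‖) (by positivity) ?_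
  · simpa only [norm_phaseOp] using h1
  · have hmp := (measurePreserving_add_right (volume : Measure (Pos d)) κ).quasiMeasurePreserving
    filter_upwards [hmp.ae hae] with k hk
    obtain ⟨y', h2, h3⟩ := hs (k + κ) (-κ) (by rwa [norm_neg]) _ _ hk
    rw [add_neg_cancel_right] at h2
    rw [norm_neg] at h3
    exact ⟨y', h2, h3⟩

theorem IsSpin.translationOp_spinOp {h₀ : HilbFiber C N →ₗ.[ℂ] HilbFiber C N}
    {s : Spin N →L[ℂ] Spin N} (hs : IsSpin T h₀ s) (γ : C.lattice) (ψ : Hilb C N) :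
    translationOp T γ (spinOp C.measure s ψ) = spinOp C.measure s (translationOp T γ ψ) := by
  have h := hs.periodic γ
  have h1 : (ψ, spinOp C.measure s (translationOp T γ ψ)) ∈
      (pcomp (ofCLM (spinOp C.measure s)) (ofCLM (translationOp T γ))).graph :=
    mem_graph_pcomp.mpr ⟨_, mem_graph_ofCLM.mpr rfl, mem_graph_ofCLM.mpr rfl⟩
  rw [h] at h1
  obtain ⟨y, h2, h3⟩ := mem_graph_pcomp.mp h1
  rw [mem_graph_ofCLM] at h2 h3
  rw [h3, h2]

theorem IsGappedPeriodicHamiltonian.exists_spinOp_mem_graph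
    (hC : C.IsPrimitiveCell C.a) (hH : IsGappedPeriodicHamiltonian T H₀ Hk μ)
    {s : Spin N →L[ℂ] Spin N} (hs : IsSpin T (Hk 0) s) :
    ∃ K : ℝ, 0 ≤ K ∧ ∀ x y, (x, y) ∈ H₀.graph →
      ∃ w, (spinOp C.measure s x, w) ∈ H₀.graph ∧ ‖w‖ ≤ K * (‖y‖ + ‖x‖) := by
  obtain ⟨K, hK, hsp⟩ := hH.exists_fiber_spin hs
  refine ⟨K, hK, fun x y hxy ↦ ?_⟩
  obtain ⟨φ, χ, hφ, hχ, hae⟩ := (hH.fibered x y).mp hxy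
  have h1 := hH.exists_mem_graph_of_fiber hC (hφ.spinOp hs.translationOp_spinOp) (IsBFZ.zero T)
    hφ hχ hK ?_
  · simpa only [sub_zero] using h1
  · filter_upwards [hae] with k hk
    obtain ⟨y', h2, h3⟩ := hsp k _ _ hk
    refine ⟨y', h2, ?_⟩
    simpa using h3

end Fibers

/-! ## Commutators with the position operators -/

section AbstractCommutator

variable {F : Type} [NormedAddCommGroup F] [InnerProductSpace ℂ F] [CompleteSpace F]

/-- Conjugation by u preserves the spectrum and commutes with the functional calculus, so the
commutators have the norms of f(u a u*) - f(a) and u a u* - a, and the Lipschitz estimate applies.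
-/
theorem HasGap.norm_commutator_le {a : F →L[ℂ] F} {c : ℝ} (ha : HasGap a c)
    (u : unitary (F →L[ℂ] F)) : ‖(u : F →L[ℂ] F) * cfc negStep a - cfc negStep a * u‖ ≤
      2 * c⁻¹ * ‖(u : F →L[ℂ] F) * a - a * u‖ := by
  let Φ := Unitary.conjStarAlgAut ℝ (F →L[ℂ] F) u
  have hΦ : ∀ x, Φ x = u * x * star (u : F →L[ℂ] F) := fun x ↦ rfl
  have hΦc : Continuous Φ := by
    have : (Φ : (F →L[ℂ] F) → (F →L[ℂ] F)) = fun x ↦ u * x * star (u : F →L[ℂ] F) := rfl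
    rw [this]
    fun_prop
  have hsa : IsSelfAdjoint (Φ a) := ha.selfAdjoint.map Φ
  have hb : HasGap (Φ a) c := by
    refine ⟨hsa, ha.pos, ?_⟩
    have hsp : spectrum ℝ (Φ a) = spectrum ℝ a := AlgEquiv.spectrum_eq Φ.toAlgEquiv a
    rw [hsp]
    exact ha.spec
  have hcfc : Φ (cfc negStep a) = cfc negStep (Φ a) :=
    StarAlgHomClass.map_cfc Φ negStep a ha.continuousOn_negStep hΦc ha.selfAdjoint hsa
  have h1 := hb.norm_cfc_sub_le ha
  rw [← hcfc] at h1
  have h2 : ∀ x : F →L[ℂ] F, ‖Φ x - x‖ = ‖(u : F →L[ℂ] F) * x - x * u‖ := by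
    intro x
    rw [← CStarRing.norm_mul_coe_unitary (Φ x - x) u, sub_mul, hΦ, mul_assoc,
      Unitary.coe_star_mul_self, mul_one]
  rwa [h2, h2] at h1

/-- [E, R] = R (A E - E A) R, where the relative bound is absorbed by A R = 1 + z R. -/
theorem IsResolventAt.norm_commutator_le {A : F →ₗ.[ℂ] F} {z : ℂ} {R E : F →L[ℂ] F}
    (hR : IsResolventAt A z R) {K : ℝ} (hK : 0 ≤ K)
    (hE : ∀ x y, (x, y) ∈ A.graph → ∃ w, (E x, w) ∈ A.graph ∧ ‖w - E y‖ ≤ K * (‖y‖ + ‖x‖)) :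
    ‖E * R - R * E‖ ≤ ‖R‖ * (K * (1 + ‖z‖ * ‖R‖ + ‖R‖)) := by
  refine ContinuousLinearMap.opNorm_le_bound _ (by positivity) fun u ↦ ?_
  obtain ⟨w, h1, h2⟩ := hE _ _ (hR.mem_graph u)
  have h3 := hR.apply_sub h1
  have h4 : (E * R - R * E) u = R (w - E (u + z • R u)) := by
    change E (R u) - R (E u) = _
    rw [← h3]
    simp only [map_sub, map_add, map_smul]
    abel
  rw [h4]
  refine (R.le_opNorm _).trans ?_
  rw [mul_assoc]
  gcongr
  refine h2.trans ?_
  rw [mul_assoc]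
  gcongr
  have h5 := R.le_opNorm u
  calc ‖u + z • R u‖ + ‖R u‖ ≤ ‖u‖ + ‖z‖ * (‖R‖ * ‖u‖) + ‖R‖ * ‖u‖ := by
        refine add_le_add ((norm_add_le _ _).trans ?_) h5
        rw [norm_smul]
        gcongr
    _ = _ := by ring

end AbstractCommutator

/-! ### From commutators with phases to commutators with positions -/

section PhaseUnitary

variable {d N : ℕ} {μ : Measure (Pos d)}

/-- The phases as unitary operators. -/
def phaseUnitary (N : ℕ) (μ : Measure (Pos d)) (k : Pos d) : unitary (L2 N μ →L[ℂ] L2 N μ) :=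
  ⟨phaseOp N μ k, by
    have h : star (phaseOp N μ k) = phaseOp N μ (-k) := by
      rw [ContinuousLinearMap.star_eq_adjoint]
      symm
      rw [ContinuousLinearMap.eq_adjoint_iff]
      intro x y
      rw [inner_phaseOp_left, neg_neg]
    rw [Unitary.mem_iff, h]
    constructor
    · ext1 ψ
      exact phaseOp_neg_phaseOp k ψ
    · ext1 ψ
      exact phaseOp_phaseOp_neg k ψ⟩

theorem norm_single (l : Fin d) (t : ℝ) : ‖(EuclideanSpace.single l t : Pos d)‖ = |t| := by
  simp

/-- A bounded operator with Lipschitz commutators with the phases preserves the domain of the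
position operator. -/
theorem exists_position_of_commutator {A : L2 N μ →L[ℂ] L2 N μ} {l : Fin d} {K : ℝ}
    (hA : ∀ t : ℝ, |t| ≤ 1 → ‖coordPhase N μ l t * A - A * coordPhase N μ l t‖ ≤ K * |t|)
    {ψ η : L2 N μ} (h : (ψ, η) ∈ (positionOp N μ l).graph) :
    ∃ ζ, (A ψ, ζ) ∈ (positionOp N μ l).graph ∧ ‖ζ - A η‖ ≤ K * ‖ψ‖ := by
  -- The increment of A ψ is [E_t, A]ψ + A(E_t ψ - ψ). Both terms are O(t), the first by assumption
  -- and the second because ψ is in the domain of X_l, so A ψ is in this domain too.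
  have hcomm : ∀ t : ℝ, coordPhase N μ l t (A ψ) - A ψ =
      (coordPhase N μ l t * A - A * coordPhase N μ l t) ψ + A (coordPhase N μ l t ψ - ψ) := by
    intro t
    change _ = (coordPhase N μ l t (A ψ) - A (coordPhase N μ l t ψ)) + _
    rw [map_sub]
    abel
  have hbd : ∀ t : ℝ, |t| ≤ 1 →
      ‖(coordPhase N μ l t * A - A * coordPhase N μ l t) ψ‖ ≤ K * |t| * ‖ψ‖ := fun t ht ↦
    (ContinuousLinearMap.le_opNorm _ _).trans
      (mul_le_mul_of_nonneg_right (hA t ht) (norm_nonneg _))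
  obtain ⟨ζ, hζ⟩ : ∃ ζ, (A ψ, ζ) ∈ (positionOp N μ l).graph := by
    refine exists_position_of_lipschitz (K := K * ‖ψ‖ + ‖A‖ * ‖η‖) fun t ht0 ht1 ↦ ?_
    have habs : |t| = t := abs_of_pos ht0
    rw [hcomm]
    refine (norm_add_le _ _).trans ?_
    have h1 := hbd t (by rwa [habs])
    have h2 := norm_coordPhase_sub_le h t
    rw [habs] at h1 h2
    have h3 : ‖A (coordPhase N μ l t ψ - ψ)‖ ≤ ‖A‖ * (t * ‖η‖) :=
      (A.le_opNorm _).trans (by gcongr)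
    calc _ ≤ K * t * ‖ψ‖ + ‖A‖ * (t * ‖η‖) := add_le_add h1 h3
      _ = _ := by ring
  refine ⟨ζ, hζ, ?_⟩
  have hK : 0 ≤ K := by
    have := (norm_nonneg _).trans (hA 1 (by simp))
    simpa using this
  -- The weak limit of the same decomposition divided by t shows that -i(ζ - A η) is the limit of
  -- t⁻¹[E_t, A]ψ.
  refine norm_le_of_forall_inner (S := Set.univ) dense_univ (by positivity) fun χ _ ↦ ?_
  have h1 := tendsto_inner_coordPhase hζ χ
  have h2 := tendsto_inner_coordPhase h (ContinuousLinearMap.adjoint A χ)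
  have h3 := h1.sub h2
  have h4 : -Complex.I * ⟪χ, ζ⟫_ℂ - -Complex.I * ⟪ContinuousLinearMap.adjoint A χ, η⟫_ℂ =
      -Complex.I * ⟪χ, ζ - A η⟫_ℂ := by
    rw [ContinuousLinearMap.adjoint_inner_left, inner_sub_right]
    ring
  rw [h4] at h3
  have h5 := h3.norm
  rw [norm_mul, norm_neg, Complex.norm_I, one_mul] at h5
  refine le_of_tendsto h5 ?_
  have hsmall : ∀ᶠ t : ℝ in 𝓝[≠] 0, |t| ≤ 1 := by
    refine eventually_nhdsWithin_of_eventually_nhds ?_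
    filter_upwards [Metric.closedBall_mem_nhds (0 : ℝ) one_pos] with t ht
    simpa using ht
  filter_upwards [hsmall, self_mem_nhdsWithin] with t ht ht0
  have ht0' : 0 < |t| := abs_pos.mpr ht0
  rw [ContinuousLinearMap.adjoint_inner_left, ← mul_sub, ← inner_sub_right, hcomm,
    add_sub_cancel_right, norm_mul, norm_inv, Complex.norm_real, Real.norm_eq_abs]
  calc |t|⁻¹ * ‖⟪χ, (coordPhase N μ l t * A - A * coordPhase N μ l t) ψ⟫_ℂ‖
      ≤ |t|⁻¹ * (‖χ‖ * (K * |t| * ‖ψ‖)) := by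
        gcongr
        exact (norm_inner_le_norm _ _).trans (by gcongr; exact hbd t ht)
    _ = _ := by field_simp

end PhaseUnitary

/-! ### Commutators of the positions with the projection, the Hamiltonian and the resolvent -/

section Commutators

variable {d N : ℕ} {C : Crystal d} {T : MagneticCocycle C N}
  {H₀ : Hilb C N →ₗ.[ℂ] Hilb C N} {Hk : Pos d → HilbFiber C N →ₗ.[ℂ] HilbFiber C N} {μ : ℝ}

theorem IsGappedPeriodicHamiltonian.isResolventAt (hH : IsGappedPeriodicHamiltonian T H₀ Hk μ) :
    IsResolventAt H₀ μ (resolventOf H₀ μ) := isResolventAt_resolventOf hH.gap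

theorem IsGappedPeriodicHamiltonian.exists_hasGap (hH : IsGappedPeriodicHamiltonian T H₀ Hk μ) :
    ∃ c, HasGap (resolventOf H₀ μ) c := by
  have hR := hH.isResolventAt
  obtain ⟨m, hm⟩ := hH.bounded_below
  -- H₀ ≥ m on the vector R x reads Re⟪x, R x⟫ + (μ - m)‖R x‖² ≥ 0; the maximum with 1 keeps the
  -- constant positive when μ ≤ m.
  refine ⟨(max (μ - m) 1)⁻¹, hasGap_of_nonneg (hR.isSelfAdjoint hH.selfAdjoint)
    (lt_of_lt_of_le one_pos (le_max_right _ _)) fun x ↦ ?_⟩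
  set R := resolventOf H₀ μ
  obtain ⟨a, ha, hb⟩ := (LinearPMap.mem_graph_iff _).mp (hR.mem_graph x)
  have h1 := hm a
  rw [hb, ha, inner_add_right, inner_smul_right, inner_self_eq_norm_sq_to_K] at h1
  have h2 : (⟪R x, x⟫_ℂ).re = (⟪x, R x⟫_ℂ).re := by
    rw [← inner_conj_symm, Complex.conj_re]
  have h3 : ((μ : ℂ) * ((‖R x‖ : ℂ)) ^ 2).re = μ * ‖R x‖ ^ 2 := by
    rw [← Complex.ofReal_pow, ← Complex.ofReal_mul, Complex.ofReal_re]
  rw [Complex.add_re, h2] at h1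
  have h4 : (μ - m) * ‖R x‖ ^ 2 ≤ max (μ - m) 1 * ‖R x‖ ^ 2 := by
    gcongr
    exact le_max_left _ _
  change m * ‖R x‖ ^ 2 ≤ _ + ((μ : ℂ) * ((‖R x‖ : ℂ)) ^ 2).re at h1
  rw [h3] at h1
  change 0 ≤ (⟪x, R x⟫_ℂ).re + _
  linarith

theorem IsGappedPeriodicHamiltonian.exists_norm_commutator_resolvent
    (hC : C.IsPrimitiveCell C.a) (hH : IsGappedPeriodicHamiltonian T H₀ Hk μ) {z : ℂ}
    {R : Hilb C N →L[ℂ] Hilb C N} (hR : IsResolventAt H₀ z R) :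
    ∃ K : ℝ, 0 ≤ K ∧ ∀ κ : Pos d, ‖κ‖ ≤ 1 →
      ‖phaseOp N C.measure κ * R - R * phaseOp N C.measure κ‖ ≤ K * ‖κ‖ := by
  obtain ⟨K, hK, h⟩ := hH.exists_phaseOp_mem_graph hC
  refine ⟨‖R‖ * (K * (1 + ‖z‖ * ‖R‖ + ‖R‖)), by positivity, fun κ hκ ↦ ?_⟩
  have h1 := hR.norm_commutator_le (K := K * ‖κ‖) (by positivity) (h κ hκ)
  refine h1.trans_eq ?_
  ring

theorem IsGappedPeriodicHamiltonian.exists_norm_commutator_projection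
    (hC : C.IsPrimitiveCell C.a) (hH : IsGappedPeriodicHamiltonian T H₀ Hk μ) :
    ∃ K : ℝ, 0 ≤ K ∧ ∀ κ : Pos d, ‖κ‖ ≤ 1 →
      ‖phaseOp N C.measure κ * spectralProjectionBelow H₀ μ -
        spectralProjectionBelow H₀ μ * phaseOp N C.measure κ‖ ≤ K * ‖κ‖ := by
  obtain ⟨K, hK, h⟩ := hH.exists_norm_commutator_resolvent hC hH.isResolventAt
  obtain ⟨c, hc⟩ := hH.exists_hasGap
  have hc0 := hc.pos
  refine ⟨2 * c⁻¹ * K, by positivity, fun κ hκ ↦ ?_⟩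
  have h1 := hc.norm_commutator_le (phaseUnitary N C.measure κ)
  refine h1.trans ?_
  rw [mul_assoc (2 * c⁻¹)]
  gcongr
  exact h κ hκ

/-- The commutator of the position operator with the spectral projection is bounded. -/
theorem IsGappedPeriodicHamiltonian.exists_projection_commutator
    (hC : C.IsPrimitiveCell C.a) (hH : IsGappedPeriodicHamiltonian T H₀ Hk μ) (l : Fin d) :
    ∃ D : Hilb C N →L[ℂ] Hilb C N,
      ((pcomm (positionOp N C.measure l) (ofCLM (spectralProjectionBelow H₀ μ))).domRestrict
        (smoothCore T)).closure = ofCLM D ∧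
      ∀ ψ η, (ψ, η) ∈ (positionOp N C.measure l).graph →
        (spectralProjectionBelow H₀ μ ψ, D ψ + spectralProjectionBelow H₀ μ η) ∈
          (positionOp N C.measure l).graph := by
  set P := spectralProjectionBelow H₀ μ with hP
  obtain ⟨K, hK, hb⟩ := hH.exists_norm_commutator_projection hC
  have hA : ∀ t : ℝ, |t| ≤ 1 → ‖coordPhase N C.measure l t * P - P * coordPhase N C.measure l t‖ ≤
      K * |t| := by
    intro t ht
    have h1 := hb (EuclideanSpace.single l t) (by rwa [norm_single])
    rwa [norm_single] at h1
  set A := pcomm (positionOp N C.measure l) (ofCLM P) with hAdef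
  have hgraph : ∀ ψ η, (ψ, η) ∈ (positionOp N C.measure l).graph → ∃ ζ,
      (P ψ, ζ) ∈ (positionOp N C.measure l).graph ∧ (ψ, ζ - P η) ∈ A.graph := by
    intro ψ η h
    obtain ⟨ζ, hζ, -⟩ := exists_position_of_commutator hA h
    exact ⟨ζ, hζ, mem_graph_pcomm.mpr ⟨η, P ψ, ζ, P η, mem_graph_ofCLM.mpr rfl, hζ, h,
      mem_graph_ofCLM.mpr rfl, rfl⟩⟩
  have hdense : Dense {ψ : Hilb C N | HasBoundedSupport ψ} := dense_hasBoundedSupport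
  have hbound : ∀ x y, (x, y) ∈ A.graph → ‖y‖ ≤ K * ‖x‖ := by
    intro x y hxy
    obtain ⟨a, b, u, v, h1, h2, h3, h4, rfl⟩ := mem_graph_pcomm.mp hxy
    rw [mem_graph_ofCLM] at h1 h4
    obtain ⟨ζ, hζ, hn⟩ := exists_position_of_commutator hA h3
    rw [h1] at h2
    rw [h4, eq_of_mem_graph h2 hζ]
    exact hn
  have hdA : Dense (A.domain : Set (Hilb C N)) := by
    refine hdense.mono fun ψ hψ ↦ ?_
    obtain ⟨η, hη⟩ := hψ.exists_position l
    obtain ⟨ζ, -, h⟩ := hgraph ψ η hη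
    exact mem_domain_of_graph h
  obtain ⟨D, hD⟩ := exists_clm_extension hdA hbound
  -- The commutator restricted to the smooth core is still defined on all vectors of bounded
  -- support, whose transforms are finite sums; this is dense enough to give the same closure.
  refine ⟨D, closure_eq_ofCLM ?_ ?_, ?_⟩
  · refine hdense.mono fun ψ hψ ↦ ?_
    obtain ⟨η, hη⟩ := hψ.exists_position l
    obtain ⟨ζ, -, h⟩ := hgraph ψ η hη
    obtain ⟨φ, hφ, hφ'⟩ := hψ.exists_isCompactBFZ T
    exact mem_domain_of_graph (mem_graph_domRestrict.mpr ⟨⟨φ, hφ, hφ'.isBFZ⟩, h⟩)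
  · intro x y hxy
    exact hD x y (mem_graph_domRestrict.mp hxy).2
  · intro ψ η h
    obtain ⟨ζ, hζ, h1⟩ := hgraph ψ η h
    rw [← hD _ _ h1, sub_add_cancel]
    exact hζ

/-- The commutator of the Hamiltonian and the position operator is bounded relative to the
Hamiltonian. -/
theorem IsGappedPeriodicHamiltonian.exists_commutator_bound
    (hC : C.IsPrimitiveCell C.a) (hH : IsGappedPeriodicHamiltonian T H₀ Hk μ) (l : Fin d) :
    ∃ K : ℝ, 0 ≤ K ∧ ∀ ψ η ψ' η', (ψ, η) ∈ H₀.graph → (ψ, ψ') ∈ (positionOp N C.measure l).graph →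
      (η, η') ∈ (positionOp N C.measure l).graph →
        ∃ w, (ψ', w) ∈ H₀.graph ∧ ‖w - η'‖ ≤ K * (‖η‖ + ‖ψ‖) := by
  obtain ⟨K, hK, hE⟩ := hH.exists_phaseOp_mem_graph hC
  refine ⟨K, hK, fun ψ η ψ' η' h1 h2 h3 ↦ ?_⟩
  refine exists_mem_graph_of_bound hH.selfAdjoint (by positivity) fun x y hxy ↦ ?_
  -- Up to conjugation and a factor of modulus 1, the pairing to be bounded is the limit of t⁻¹⟪x,
  -- (H₀E_t - E_tH₀)ψ⟫, and the relative bound for the phases carries over.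
  have h4 := (tendsto_inner_coordPhase h2 y).sub (tendsto_inner_coordPhase h3 x)
  have h5 := h4.norm
  rw [← mul_sub, norm_mul, norm_neg, Complex.norm_I, one_mul] at h5
  have h6 : ‖⟪y, ψ'⟫_ℂ - ⟪x, η'⟫_ℂ‖ = ‖⟪ψ', y⟫_ℂ - ⟪η', x⟫_ℂ‖ := by
    rw [← inner_conj_symm y, ← inner_conj_symm x, ← map_sub, RCLike.norm_conj]
  rw [h6] at h5
  refine le_of_tendsto h5 ?_
  have hsmall : ∀ᶠ t : ℝ in 𝓝[≠] 0, |t| ≤ 1 := by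
    refine eventually_nhdsWithin_of_eventually_nhds ?_
    filter_upwards [Metric.closedBall_mem_nhds (0 : ℝ) one_pos] with t ht
    simpa using ht
  filter_upwards [hsmall, self_mem_nhdsWithin] with t ht ht0
  have ht0' : 0 < |t| := abs_pos.mpr ht0
  obtain ⟨w, h7, h8⟩ := hE (EuclideanSpace.single l t) (by rwa [norm_single]) _ _ h1
  rw [norm_single] at h8
  have h9 := inner_graph_symm hH.selfAdjoint hxy h7
  have h10 := inner_graph_symm hH.selfAdjoint hxy h1
  have h11 : ⟪y, coordPhase N C.measure l t ψ - ψ⟫_ℂ - ⟪x, coordPhase N C.measure l t η - η⟫_ℂ =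
      ⟪x, w - coordPhase N C.measure l t η⟫_ℂ := by
    rw [inner_sub_right, inner_sub_right, inner_sub_right, h10]
    unfold coordPhase
    rw [h9]
    ring
  rw [← mul_sub, h11, norm_mul, norm_inv, Complex.norm_real, Real.norm_eq_abs]
  calc |t|⁻¹ * ‖⟪x, w - coordPhase N C.measure l t η⟫_ℂ‖
      ≤ |t|⁻¹ * (‖x‖ * (K * |t| * (‖η‖ + ‖ψ‖))) := by
        gcongr
        exact (norm_inner_le_norm _ _).trans (by gcongr)
    _ = _ := by field_simp

/-- The transform of R ψ is G(k)φ(k), where G is the inverse of H₀(k) - i as a smooth map into D_f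
with its graph norm and φ is the smooth transform of ψ. -/
theorem resolvent_transform (hC : C.IsPrimitiveCell C.a)
    (hH : IsGappedPeriodicHamiltonian T H₀ Hk μ) {R : Hilb C N →L[ℂ] Hilb C N}
    (hR : IsResolventAt H₀ Complex.I R) {ψ : Hilb C N} (hψ : HasBoundedSupport ψ) :
    R ψ ∈ smoothDomainCore T (Hk 0) := by
  obtain ⟨h, hh, hg⟩ := hH.smooth
  obtain ⟨G, hG, hG1, hG2⟩ := hH.exists_inverse hh hg
  obtain ⟨φ, hφ, hφ'⟩ := hψ.exists_isCompactBFZ T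
  refine ⟨fun k ↦ G k (φ k), contDiff_clm_apply hG hφ, ?_⟩
  obtain ⟨a, b, ha, hb, hab⟩ := (hH.fibered _ _).mp (hR.mem_graph ψ)
  refine ha.congr ?_
  have h1 := (hφ'.isBFZ.add (ha.smul Complex.I)).ae_eq hC hb
  filter_upwards [h1, hab] with k h2 h3
  have h4 := mem_domain_of_graph h3
  rw [hH.domain_eq k] at h4
  obtain ⟨x, hx⟩ := GraphDomain.exists_val_eq h4
  have h5 := hg k x
  rw [hx] at h5
  have h6 := eq_of_mem_graph h3 h5
  rw [← h2] at h6
  have h7 : φ k = h k x - Complex.I • GraphDomain.val (Hk 0) x := by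
    rw [hx, ← h6]
    exact (add_sub_cancel_right _ _).symm
  rw [h7, hG2, hx]

theorem dense_range_resolvent {A : Hilb C N →ₗ.[ℂ] Hilb C N} (hd : Dense (A.domain : Set (Hilb C N)))
    {z : ℂ} {R : Hilb C N →L[ℂ] Hilb C N} (hR : IsResolventAt A z R) :
    DenseRange R := by
  refine hd.mono fun x hx ↦ ?_
  obtain ⟨y, hy⟩ := exists_mem_graph hx
  exact ⟨_, hR.apply_sub hy⟩

/-- The velocity operator, composed with the resolvent, is bounded. -/
theorem IsGappedPeriodicHamiltonian.exists_velocity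
    (hC : C.IsPrimitiveCell C.a) (hH : IsGappedPeriodicHamiltonian T H₀ Hk μ)
    {R : Hilb C N →L[ℂ] Hilb C N} (hR : IsResolventAt H₀ Complex.I R) (l : Fin d) :
    ∃ W : Hilb C N →L[ℂ] Hilb C N,
      (∀ f, (R f, W f) ∈ (velocityCommutator T H₀ (Hk 0) l).graph) ∧
      ∀ f η, (f, η) ∈ (positionOp N C.measure l).graph → ∃ ζ,
        (R f, ζ) ∈ (positionOp N C.measure l).graph ∧
          (ζ, W f + (η + Complex.I • ζ)) ∈ H₀.graph := by
  set X := positionOp N C.measure l with hX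
  obtain ⟨K, hK, hb⟩ := hH.exists_norm_commutator_resolvent hC hR
  obtain ⟨L, hL, hcb⟩ := hH.exists_commutator_bound hC l
  have hA : ∀ t : ℝ, |t| ≤ 1 → ‖coordPhase N C.measure l t * R - R * coordPhase N C.measure l t‖ ≤
      K * |t| := by
    intro t ht
    have h1 := hb (EuclideanSpace.single l t) (by rwa [norm_single])
    rwa [norm_single] at h1
  have key : ∀ f η, (f, η) ∈ X.graph → ∃ ζ w, (R f, ζ) ∈ X.graph ∧
      (f + Complex.I • R f, η + Complex.I • ζ) ∈ X.graph ∧ (ζ, w) ∈ H₀.graph ∧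
      ‖w - (η + Complex.I • ζ)‖ ≤ L * (2 + ‖R‖) * (‖f‖ + ‖R f‖) := by
    intro f η h
    obtain ⟨ζ, hζ, -⟩ := exists_position_of_commutator hA h
    have h1 := graph_add h (graph_smul Complex.I hζ)
    obtain ⟨w, h2, h3⟩ := hcb _ _ _ _ (hR.mem_graph f) hζ h1
    refine ⟨ζ, w, hζ, h1, h2, h3.trans ?_⟩
    rw [mul_assoc]
    gcongr
    have h4 : ‖f + Complex.I • R f‖ ≤ ‖f‖ + ‖R f‖ := by
      refine (norm_add_le _ _).trans ?_
      rw [norm_smul, Complex.norm_I, one_mul]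
    nlinarith [norm_nonneg f, norm_nonneg (R f), norm_nonneg R]
  set B := pcomp (pcomm H₀ X) (ofCLM R) with hB
  have hBg : ∀ f η ζ w, (R f, ζ) ∈ X.graph → (f + Complex.I • R f, η + Complex.I • ζ) ∈ X.graph →
      (ζ, w) ∈ H₀.graph → (f, w - (η + Complex.I • ζ)) ∈ B.graph := by
    intro f η ζ w h1 h2 h3
    exact mem_graph_pcomp.mpr ⟨_, mem_graph_ofCLM.mpr rfl, mem_graph_pcomm.mpr
      ⟨_, _, _, _, h1, h3, hR.mem_graph f, h2, rfl⟩⟩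
  -- the operator restricted to the domain of the position operator
  set B' := B.domRestrict X.domain with hB'
  have hdense : Dense {ψ : Hilb C N | HasBoundedSupport ψ} := dense_hasBoundedSupport
  have hB'g : ∀ f η, (f, η) ∈ X.graph → ∃ ζ w, (R f, ζ) ∈ X.graph ∧ (ζ, w) ∈ H₀.graph ∧
      (f, w - (η + Complex.I • ζ)) ∈ B'.graph := by
    intro f η h
    obtain ⟨ζ, w, h1, h2, h3, -⟩ := key f η h
    exact ⟨ζ, w, h1, h3, mem_graph_domRestrict.mpr
      ⟨mem_domain_of_graph h, hBg _ _ _ _ h1 h2 h3⟩⟩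
  have hd' : Dense (B'.domain : Set (Hilb C N)) := by
    refine hdense.mono fun ψ hψ ↦ ?_
    obtain ⟨η, hη⟩ := hψ.exists_position l
    obtain ⟨ζ, w, -, -, h⟩ := hB'g ψ η hη
    exact mem_domain_of_graph h
  have hbd : ∀ x y, (x, y) ∈ B'.graph → ‖y‖ ≤ L * (2 + ‖R‖) * (1 + ‖R‖) * ‖x‖ := by
    intro x y hxy
    obtain ⟨hx, hxy⟩ := mem_graph_domRestrict.mp hxy
    obtain ⟨η, hη⟩ := exists_mem_graph hx
    obtain ⟨ζ, w, h1, h2, h3, h4⟩ := key x η hη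
    rw [eq_of_mem_graph hxy (hBg _ _ _ _ h1 h2 h3)]
    refine h4.trans ?_
    rw [mul_assoc _ (1 + ‖R‖)]
    have h5 : ‖x‖ + ‖R x‖ ≤ (1 + ‖R‖) * ‖x‖ := by
      have := R.le_opNorm x
      linarith
    exact mul_le_mul_of_nonneg_left h5 (by positivity)
  obtain ⟨W, hW⟩ := exists_clm_extension hd' hbd
  refine ⟨W, ?_, ?_⟩
  · set V := (pcomm H₀ X).domRestrict (smoothDomainCore T (Hk 0)) with hV
    have hVg : ∀ f, HasBoundedSupport f → (R f, W f) ∈ V.graph := by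
      intro f hf
      obtain ⟨η, hη⟩ := hf.exists_position l
      obtain ⟨ζ, w, -, -, h⟩ := hB'g f η hη
      rw [← hW _ _ h]
      obtain ⟨-, h1⟩ := mem_graph_domRestrict.mp h
      obtain ⟨y, h2, h3⟩ := mem_graph_pcomp.mp h1
      rw [mem_graph_ofCLM] at h2
      rw [h2] at h3
      exact mem_graph_domRestrict.mpr ⟨resolvent_transform hC hH hR hf, h3⟩
    have hVd : Dense (V.domain : Set (Hilb C N)) := by
      have h1 := (dense_range_resolvent hH.dense_domain hR).dense_image R.continuous hdense
      refine h1.mono ?_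
      rintro _ ⟨f, hf, rfl⟩
      exact mem_domain_of_graph (hVg f hf)
    -- The commutator of two symmetric operators is antisymmetric; so -V is a densely defined formal
    -- adjoint of V, and V is closable.
    have hanti : ∀ x y u v, (x, y) ∈ V.graph → (u, v) ∈ V.graph → ⟪-y, u⟫_ℂ = ⟪x, v⟫_ℂ := by
      intro x y u v hx hu
      obtain ⟨-, hx⟩ := mem_graph_domRestrict.mp hx
      obtain ⟨-, hu⟩ := mem_graph_domRestrict.mp hu
      obtain ⟨a, b, p, q, h1, h2, h3, h4, rfl⟩ := mem_graph_pcomm.mp hx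
      obtain ⟨a', b', p', q', h1', h2', h3', h4', rfl⟩ := mem_graph_pcomm.mp hu
      rw [neg_sub, inner_sub_left, inner_sub_right, inner_position_symm h4 h1',
        inner_graph_symm hH.selfAdjoint h2 h3', inner_position_symm h1 h4',
        inner_graph_symm hH.selfAdjoint h3 h2']
    have hclos : V.IsClosable := by
      have hneg : Dense ((-V).domain : Set (Hilb C N)) := hVd
      have h1 : (-V).IsFormalAdjoint V := by
        intro x y
        have h2 := hanti (y : Hilb C N) (V y) x (V x) (V.mem_graph y) (V.mem_graph x)
        have h3 : (-V) x = - V x := rfl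
        rw [h3, inner_neg_left, ← inner_conj_symm, ← h2, inner_neg_left, map_neg, neg_neg,
          inner_conj_symm]
      exact (LinearPMap.adjoint_isClosed hneg).isClosable.leIsClosable (h1.le_adjoint hneg)
    -- Vectors f of bounded support give points (R f, W f) of the graph of V; by density and
    -- continuity all f give points of its closure.
    intro f
    change (R f, W f) ∈ V.closure.graph
    rw [← hclos.graph_closure_eq_closure_graph]
    change (R f, W f) ∈ closure (V.graph : Set (Hilb C N × Hilb C N))
    have hcont : Continuous fun f ↦ (R f, W f) := R.continuous.prodMk W.continuous
    exact map_mem_closure (f := fun f ↦ (R f, W f)) hcont (hdense f) fun g hg ↦ hVg g hg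
  · intro f η h
    obtain ⟨ζ, w, h1, h2, h3⟩ := hB'g f η h
    refine ⟨ζ, h1, ?_⟩
    rw [← hW _ _ h3, sub_add_cancel]
    exact h2

end Commutators

/-! ## The Fermi projection is locally Hilbert–Schmidt -/

section Abstract

variable {E : Type} [NormedAddCommGroup E] [InnerProductSpace ℂ E]

/-- Distinct orthonormal vectors are at distance √2, so the balls of radius 1/2 around them are
disjoint. -/
theorem countable_of_orthonormal [TopologicalSpace.SeparableSpace E] {ι : Type} {e : ι → E}
    (he : Orthonormal ℂ e) : Countable ι := by
  refine Pairwise.countable_of_isOpen_disjoint (s := fun n ↦ Metric.ball (e n) (1 / 2)) ?_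
    (fun n ↦ Metric.isOpen_ball) fun n ↦ ⟨e n, by simp⟩
  intro n m hnm
  refine Metric.ball_disjoint_ball ?_
  have h : ‖e n - e m‖ ^ 2 = 2 := by
    rw [@norm_sub_sq ℂ, he.1 n, he.1 m, he.2 hnm]
    norm_num
  rw [dist_eq_norm]
  nlinarith [norm_nonneg (e n - e m)]

/-- Nearby projections have the same rank. -/
theorem finrank_range_le_of_norm_sub_lt {P Q : E →L[ℂ] E} (hP : P * P = P)
    [FiniteDimensional ℂ Q.range] (h : ‖P - Q‖ < 1) :
    Module.finrank ℂ P.range ≤ Module.finrank ℂ Q.range := by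
  -- Q is injective on the range of P: Q P y = 0 would give ‖P y‖ = ‖(P - Q)P y‖ ≤ ‖P - Q‖‖P y‖.
  refine LinearMap.finrank_le_finrank_of_injective
    (f := (Q : E →ₗ[ℂ] E).rangeRestrict ∘ₗ P.range.subtype) ?_
  rw [← LinearMap.ker_eq_bot, LinearMap.ker_eq_bot']
  rintro ⟨x, y, rfl⟩ hx
  have h1 : Q (P y) = 0 := congrArg Subtype.val hx
  have h2 : P (P y) = P y := congrArg (fun A : E →L[ℂ] E ↦ A y) hP
  have h3 : ‖P y‖ ≤ ‖P - Q‖ * ‖P y‖ := by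
    calc ‖P y‖ = ‖(P - Q) (P y)‖ := by rw [_root_.sub_apply, h1, h2, sub_zero]
      _ ≤ _ := (P - Q).le_opNorm _
  have h4 : ‖P y‖ = 0 := by
    by_contra h0
    have : 0 < ‖P y‖ := lt_of_le_of_ne (norm_nonneg _) (Ne.symm h0)
    nlinarith
  exact Subtype.ext (norm_eq_zero.mp h4)

/-- Expand P x in an orthonormal basis of the range, exchange the sums, and apply Bessel's
inequality to each basis vector. -/
theorem sum_norm_sq_le_finrank [CompleteSpace E] {P : E →L[ℂ] E} (hP : IsStarProjection P)
    [FiniteDimensional ℂ P.range] {ι : Type} {e : ι → E} (he : Orthonormal ℂ e) (F : Finset ι) :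
    ∑ n ∈ F, ‖P (e n)‖ ^ 2 ≤ Module.finrank ℂ P.range := by
  let f := stdOrthonormalBasis ℂ P.range
  have h1 : ∀ x, ‖P x‖ ^ 2 = ∑ i, ‖⟪x, (f i : E)⟫_ℂ‖ ^ 2 := by
    intro x
    have h2 := f.sum_sq_norm_inner_right ⟨P x, x, rfl⟩
    have h3 : ∀ i, ‖⟪x, (f i : E)⟫_ℂ‖ = ‖⟪f i, (⟨P x, x, rfl⟩ : P.range)⟫_ℂ‖ := by
      intro i
      obtain ⟨y, hy⟩ := (f i).2
      have h4 : P (f i : E) = f i := by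
        have hy' : P y = f i := hy
        rw [← hy']
        exact congrArg (fun A : E →L[ℂ] E ↦ A y) hP.isIdempotentElem
      have h5 : ⟪(f i : E), P x⟫_ℂ = ⟪(f i : E), x⟫_ℂ := by
        have h6 : ContinuousLinearMap.adjoint P = P := hP.isSelfAdjoint
        rw [← ContinuousLinearMap.adjoint_inner_left, h6, h4]
      rw [Submodule.coe_inner, h5, norm_inner_symm]
    simp only [h3]
    exact h2.symm
  simp only [h1]
  rw [Finset.sum_comm]
  calc ∑ i, ∑ n ∈ F, ‖⟪e n, (f i : E)⟫_ℂ‖ ^ 2 ≤ ∑ i, ‖(f i : E)‖ ^ 2 :=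
        Finset.sum_le_sum fun i _ ↦ he.sum_inner_products_le _
    _ = Module.finrank ℂ P.range := by
        have : ∀ i, ‖(f i : E)‖ = 1 := fun i ↦ f.orthonormal.1 i
        simp [this]

end Abstract

/-- Fubini, applied to a measurable representative of F; translations preserve the null set on which
it differs from F. -/
theorem ae_ae_norm_sub_le {d : ℕ} {E : Type*} [NormedAddCommGroup E] {F : Pos d → E}
    (hF : AEStronglyMeasurable F volume) {b : Pos d → ℝ} (hb : Continuous b)
    (h : ∀ κ, ∀ᵐ k, ‖F (k + κ) - F k‖ ≤ b κ) : ∀ᵐ k, ∀ᵐ κ, ‖F (k + κ) - F k‖ ≤ b κ := by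
  have hg := hF.stronglyMeasurable_mk
  have he := hF.ae_eq_mk
  have h1 : ∀ κ : Pos d, ∀ᵐ k, F (k + κ) = hF.mk F (k + κ) := fun κ ↦
    (measurePreserving_add_right volume κ).quasiMeasurePreserving.ae he
  have h2 : ∀ k : Pos d, ∀ᵐ κ, F (k + κ) = hF.mk F (k + κ) := fun k ↦
    (measurePreserving_add_left volume k).quasiMeasurePreserving.ae he
  have hm : MeasurableSet {x : Pos d × Pos d | ‖hF.mk F (x.1 + x.2) - hF.mk F x.1‖ ≤ b x.2} := by
    refine measurableSet_le ?_ (hb.measurable.comp measurable_snd)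
    exact ((hg.comp_measurable (measurable_fst.add measurable_snd)).sub
      (hg.comp_measurable measurable_fst)).norm.measurable
  have h3 : ∀ᵐ κ : Pos d, ∀ᵐ k : Pos d, ‖hF.mk F (k + κ) - hF.mk F k‖ ≤ b κ := by
    refine Eventually.of_forall fun κ ↦ ?_
    filter_upwards [h κ, h1 κ, he] with k h4 h5 h6
    rwa [← h5, ← h6]
  rw [← Measure.ae_ae_comm hm] at h3
  filter_upwards [h3, he] with k h4 h5
  filter_upwards [h4, h2 k] with κ h6 h7
  rwa [h7, h5]

/-! ### Bounded rank of the fibers of the Fermi projection -/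

section Model

variable {d N : ℕ} {C : Crystal d} {T : MagneticCocycle C N}

instance : TopologicalSpace.SeparableSpace (HilbFiber C N) :=
  have : SecondCountableTopology (Lp (Spin N) 2 (C.measure.restrict (C.cell C.a 1))) :=
    have : Fact ((2 : ENNReal) ≠ ⊤) := ⟨by norm_num⟩
    Lp.SecondCountableTopology
  inferInstance

theorem norm_clm_le_of_dense {E : Type*} [NormedAddCommGroup E] [NormedSpace ℂ E] {A : E →L[ℂ] E}
    {M : ℝ} (hM : 0 ≤ M) {D : Set E} (hD : Dense D) (h : ∀ u ∈ D, ‖A u‖ ≤ M * ‖u‖) : ‖A‖ ≤ M := by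
  refine A.opNorm_le_bound hM fun u ↦ ?_
  have : IsClosed {u | ‖A u‖ ≤ M * ‖u‖} :=
    isClosed_le A.continuous.norm (continuous_const.mul continuous_norm)
  exact this.closure_subset_iff.mpr h (hD u)

/-- Test B on vectors with transform p(k)E_k u, where p is a trigonometric polynomial: combinations
of translates of vectors in the cell. Plancherel gives ∫|p|²‖Q(k)E_k u‖² ≤ ‖B‖²‖u‖²∫|p|² for all p,
which forces the pointwise bound for almost every k. A countable dense set of u makes the
exceptional set independent of u; the a priori bound b only serves this density argument. -/
theorem ae_norm_fiber_le (hC : C.IsPrimitiveCell C.a) {B : Hilb C N →L[ℂ] Hilb C N}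
    {Q : Pos d → HilbFiber C N →L[ℂ] HilbFiber C N} {b : ℝ} (hb : ∀ k, ‖Q k‖ ≤ b)
    (hB : ∀ ψ φ, IsBFZ T ψ φ → IsBFZ T (B ψ) fun k ↦ Q k (φ k)) : ∀ᵐ k, ‖Q k‖ ≤ ‖B‖ := by
  have hu : ∀ u : HilbFiber C N, ∀ᵐ k, ‖Q k (phaseOp N _ k u)‖ ≤ ‖B‖ * ‖u‖ := by
    intro u
    refine C.ae_of_forall_zoneMeasure fun q ↦ ?_
    have hbu := (isCompactBFZ_cellExtend (T := T) hC u).isBFZ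
    have hbB := hB _ _ hbu
    have key := C.ae_le_of_trigonometric q (G := fun k ↦ ‖Q k (phaseOp N _ k u)‖ₑ ^ 2)
      (B := ENNReal.ofReal (b * ‖u‖) ^ 2) (M := (‖B‖ₑ * ‖u‖ₑ) ^ 2)
      ((hbB.aestronglyMeasurable_zone q).enorm.pow_const 2)
      (ENNReal.pow_ne_top ENNReal.ofReal_ne_top) ?_
      (ENNReal.pow_ne_top (ENNReal.mul_ne_top enorm_ne_top enorm_ne_top)) ?_
    · filter_upwards [key] with k hk
      have h1 := (ENNReal.pow_right_strictMono two_ne_zero).le_iff_le.mp hk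
      rw [← enorm_norm, ← enorm_norm B, ← enorm_norm u, ← enorm_mul,
        Real.enorm_eq_ofReal (norm_nonneg _), Real.enorm_eq_ofReal (by positivity)] at h1
      exact (ENNReal.ofReal_le_ofReal_iff (by positivity)).mp h1
    · intro k
      gcongr
      rw [← ofReal_norm]
      refine ENNReal.ofReal_le_ofReal (((Q k).le_opNorm _).trans ?_)
      rw [norm_phaseOp]
      exact mul_le_mul_of_nonneg_right (hb k) (norm_nonneg _)
    · intro c
      set p : Pos d → ℂ := fun k ↦ c.sum fun γ z ↦ z * C.character γ k with hp
      have h1 : IsBFZ T (∑ γ ∈ c.support, c γ • translationOp T (-γ) (cellExtend C N u))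
          fun k ↦ p k • phaseOp N _ k u := by
        have h2 := IsBFZ.sum (F := c.support) fun γ _ ↦ (hbu.translationOp (-γ)).smul (c γ)
        convert h2 using 1
        funext k
        simp only [hp, Finsupp.sum, Finset.sum_smul, Finset.sum_apply, Pi.smul_apply, neg_neg,
          mul_smul]
      set ψ := ∑ γ ∈ c.support, c γ • translationOp T (-γ) (cellExtend C N u)
      have h3 := (hB _ _ h1).eLpNorm_eq hC q
      have h4 := h1.eLpNorm_eq hC q
      have h5 : ‖B ψ‖ₑ ≤ ‖B‖ₑ * ‖ψ‖ₑ := B.le_opENorm ψ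
      rw [← h3, ← h4] at h5
      have h6 := pow_le_pow_left₀ zero_le h5 2
      rw [mul_pow, eLpNorm_two_sq, eLpNorm_two_sq] at h6
      have h7 : ∀ k, ‖phaseOp N (C.measure.restrict (C.cell C.a 1)) k u‖ₑ = ‖u‖ₑ := fun k ↦ by
        rw [← ofReal_norm, norm_phaseOp, ofReal_norm]
      simp only [map_smul, enorm_smul, mul_pow, h7] at h6
      have hpc : Continuous p := by
        simp only [hp, Finsupp.sum]
        exact continuous_finsetSum _ fun γ _ ↦ continuous_const.mul (C.continuous_character γ)
      rw [lintegral_mul_const'' _ (hpc.enorm.measurable.pow_const 2).aemeasurable, ← mul_assoc,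
        mul_right_comm, ← mul_pow] at h6
      exact h6
  obtain ⟨D, hDc, hD⟩ := TopologicalSpace.exists_countable_dense (HilbFiber C N)
  have h1 : ∀ᵐ k, ∀ u ∈ D, ‖Q k (phaseOp N _ k u)‖ ≤ ‖B‖ * ‖u‖ :=
    (ae_ball_iff hDc).mpr fun u _ ↦ hu u
  filter_upwards [h1] with k hk
  have h2 : ‖Q k ∘L phaseOp N _ k‖ ≤ ‖B‖ := norm_clm_le_of_dense (norm_nonneg _) hD hk
  refine (Q k).opNorm_le_bound (norm_nonneg _) fun v ↦ ?_
  have h3 := (Q k ∘L phaseOp N _ k).le_opNorm (phaseOp N _ (-k) v)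
  have h4 : phaseOp N (C.measure.restrict (C.cell C.a 1)) k (phaseOp N _ (-k) v) = v := by
    rw [phaseOp_add, add_neg_cancel, phaseOp_zero]
  rw [ContinuousLinearMap.comp_apply, h4, norm_phaseOp] at h3
  exact h3.trans (mul_le_mul_of_nonneg_right h2 (norm_nonneg _))

theorem IsStarProjection.norm_le_one {E : Type} [NormedAddCommGroup E] [InnerProductSpace ℂ E]
    [CompleteSpace E] {P : E →L[ℂ] E} (hP : IsStarProjection P) : ‖P‖ ≤ 1 := by
  have h := CStarRing.norm_star_mul_self (x := P)
  rw [hP.isSelfAdjoint.star_eq, hP.isIdempotentElem.eq] at h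
  by_contra! h1
  nlinarith

/-- Only the transforms k ↦ Q(k)E_k u are known to be measurable. Expanding E_{-k}v in a countable
orthonormal basis, with coefficients continuous in k, writes Q(k)v as a limit of finite combinations
of them. -/
theorem aestronglyMeasurable_fiber {Q : Pos d → HilbFiber C N →L[ℂ] HilbFiber C N}
    (h : ∀ u, AEStronglyMeasurable (fun k ↦ Q k (phaseOp N _ k u)) volume) (v : HilbFiber C N) :
    AEStronglyMeasurable (fun k ↦ Q k v) volume := by
  obtain ⟨ι, ⟨e⟩⟩ := exists_hilbertBasis_type (HilbFiber C N)
  have : Countable ι := countable_of_orthonormal e.orthonormal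
  have h1 : ∀ k, HasSum (fun n ↦ ⟪e n, phaseOp N _ (-k) v⟫_ℂ • Q k (phaseOp N _ k (e n)))
      (Q k v) := by
    intro k
    have h2 := (e.hasSum_repr (phaseOp N _ (-k) v)).mapL (Q k ∘L phaseOp N _ k)
    rw [ContinuousLinearMap.comp_apply, phaseOp_add, add_neg_cancel, phaseOp_zero] at h2
    simpa only [map_smul, ContinuousLinearMap.comp_apply, e.repr_apply_apply] using h2
  obtain ⟨r, hr⟩ := exists_cell_norm_le C
  refine aestronglyMeasurable_of_tendsto_ae (atTop : Filter (Finset ι)) (fun F ↦ ?_)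
    (Eventually.of_forall h1)
  refine Finset.aestronglyMeasurable_fun_sum F fun n _ ↦ ?_
  refine AEStronglyMeasurable.fun_smul ?_ (h (e n))
  have h3 : Continuous fun k : Pos d ↦ phaseOp N (C.measure.restrict (C.cell C.a 1)) (-k) :=
    (contDiff_phaseOp hr).continuous.comp continuous_neg
  exact (Continuous.inner continuous_const (h3.clm_apply continuous_const)).aestronglyMeasurable

/-- E_κ B E_{-κ} - B has fibers P(k + κ) - P(k), so these are O(|κ|) for each κ and almost every k.
By Fubini there is a dense set of k₀ from which the bound holds for almost every κ. Finitely many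
small balls around such k₀ cover the zone, and almost everywhere in such a ball P(k) is at distance
less than 1 from P(k₀), so its rank is at most that of P(k₀). -/
theorem exists_finrank_bound (hC : C.IsPrimitiveCell C.a) {B : Hilb C N →L[ℂ] Hilb C N}
    {P : Pos d → HilbFiber C N →L[ℂ] HilbFiber C N}
    (hP : ∀ k, IsStarProjection (P k) ∧ FiniteDimensional ℂ (P k).range)
    (hB : ∀ ψ φ, IsBFZ T ψ φ → IsBFZ T (B ψ) fun k ↦ P k (φ k)) {K : ℝ} (hK : 0 ≤ K)
    (hBK : ∀ κ : Pos d, ‖κ‖ ≤ 1 →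
      ‖phaseOp N C.measure κ * B - B * phaseOp N C.measure κ‖ ≤ K * ‖κ‖) (q : Fin d → ℝ) :
    ∃ M : ℕ, ∀ᵐ k ∂C.zoneMeasure q, Module.finrank ℂ (P k).range ≤ M := by
  -- The summand 2 covers ‖κ‖ > 1, where only the trivial bound 2 for a difference of projections is
  -- available.
  set b : Pos d → ℝ := fun κ ↦ (K + 2) * ‖κ‖ with hb
  have hPn : ∀ k, ‖P k‖ ≤ 1 := fun k ↦ IsStarProjection.norm_le_one (hP k).1
  have hP2 : ∀ k l, ‖P k - P l‖ ≤ 2 := fun k l ↦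
    (norm_sub_le _ _).trans (by linarith [hPn k, hPn l])
  have h1 : ∀ κ, ∀ᵐ k, ‖P (k + κ) - P k‖ ≤ b κ := by
    intro κ
    by_cases hκ : ‖κ‖ ≤ 1
    · set A := phaseOp N C.measure κ * B * phaseOp N C.measure (-κ) - B with hA
      have hAn : ‖A‖ ≤ b κ := by
        have h2 : A = (phaseOp N C.measure κ * B - B * phaseOp N C.measure κ) *
            phaseOp N C.measure (-κ) := by
          rw [hA, sub_mul, mul_assoc B]
          congr 1
          ext1 ψ
          simp only [mul_apply_eq_comp]
          rw [phaseOp_add, add_neg_cancel, phaseOp_zero]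
        have h3 : ‖phaseOp N C.measure (-κ)‖ ≤ 1 :=
          ContinuousLinearMap.opNorm_le_bound _ zero_le_one fun ψ ↦ by rw [norm_phaseOp, one_mul]
        rw [h2]
        refine (norm_mul_le _ _).trans ?_
        refine (mul_le_of_le_one_right (norm_nonneg _) h3).trans ((hBK κ hκ).trans ?_)
        exact mul_le_mul_of_nonneg_right (by linarith) (norm_nonneg _)
      have h4 : ∀ ψ φ, IsBFZ T ψ φ → IsBFZ T (A ψ) fun k ↦ (P (k + κ) - P k) (φ k) := by
        intro ψ φ h
        have h5 := ((hB _ _ (h.phaseOp (-κ))).phaseOp κ).sub (hB _ _ h)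
        have h6 : (fun k ↦ (P (k + κ) - P k) (φ k)) =
            (fun k ↦ P (k + κ) (φ (k + κ + -κ))) - fun k ↦ P k (φ k) := by
          funext k
          simp
        rw [h6]
        exact h5
      filter_upwards [ae_norm_fiber_le hC (fun k ↦ hP2 (k + κ) k) h4] with k hk
      exact hk.trans hAn
    · refine Eventually.of_forall fun k ↦ (hP2 _ _).trans ?_
      rw [hb]
      dsimp only
      nlinarith
  have h2 : ∀ᵐ k, ∀ᵐ κ, ‖P (k + κ) - P k‖ ≤ b κ := by
    obtain ⟨D, hDc, hD⟩ := TopologicalSpace.exists_countable_dense (HilbFiber C N)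
    have h3 : ∀ᵐ k, ∀ u ∈ D, ∀ᵐ κ, ‖P (k + κ) u - P k u‖ ≤ b κ * ‖u‖ := by
      refine (ae_ball_iff hDc).mpr fun u _ ↦ ?_
      refine ae_ae_norm_sub_le (aestronglyMeasurable_fiber (fun v ↦
        (hB _ _ (isCompactBFZ_cellExtend (T := T) hC v).isBFZ).1) u) (by fun_prop) fun κ ↦ ?_
      filter_upwards [h1 κ] with k hk
      rw [← _root_.sub_apply]
      exact ((P (k + κ) - P k).le_opNorm u).trans
        (mul_le_mul_of_nonneg_right hk (norm_nonneg _))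
    filter_upwards [h3] with k hk
    filter_upwards [(ae_ball_iff hDc).mpr hk] with κ hκ
    refine norm_clm_le_of_dense (by positivity) hD fun u hu ↦ ?_
    rw [_root_.sub_apply]
    exact hκ u hu
  obtain ⟨S, c, hS, -, hle⟩ := C.exists_zoneMeasure_le q
  have hd := Measure.dense_of_ae h2
  -- Any radius with (K + 2)ε < 1 would do.
  set ε : ℝ := (K + 3)⁻¹ with hε
  have hε0 : 0 < ε := by positivity
  have hcov : S ⊆ ⋃ k₀ ∈ {k | ∀ᵐ κ, ‖P (k + κ) - P k‖ ≤ b κ}, Metric.ball k₀ ε := by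
    intro x _
    obtain ⟨k₀, hk₀, h5⟩ := hd.exists_dist_lt x hε0
    exact Set.mem_biUnion hk₀ h5
  obtain ⟨F, hF, hFfin, hFS⟩ := hS.elim_finite_subcover_image
    (fun k₀ _ ↦ Metric.isOpen_ball) hcov
  refine ⟨hFfin.toFinset.sup fun k₀ ↦ Module.finrank ℂ (P k₀).range, ?_⟩
  have h6 : ∀ᵐ k : Pos d, ∀ k₀ ∈ F, ‖P k - P k₀‖ ≤ b (k - k₀) := by
    refine (ae_ball_iff hFfin.countable).mpr fun k₀ hk₀ ↦ ?_
    have h7 := (measurePreserving_sub_right volume k₀).quasiMeasurePreserving.ae (hF hk₀)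
    filter_upwards [h7] with k hk
    rwa [add_sub_cancel] at hk
  have h8 : ∀ᵐ k ∂C.zoneMeasure q, k ∈ S :=
    (Measure.absolutelyContinuous_of_le_smul hle).ae_le (ae_restrict_mem hS.measurableSet)
  filter_upwards [h8, (C.zoneMeasure_absolutelyContinuous q).ae_le h6] with k hkS hk
  obtain ⟨k₀, hk₀, hkb⟩ := Set.mem_iUnion₂.mp (hFS hkS)
  have := (hP k₀).2
  refine (finrank_range_le_of_norm_sub_lt (hP k).1.isIdempotentElem
    ((hk k₀ hk₀).trans_lt ?_)).trans
    (Finset.le_sup (f := fun k₀ ↦ Module.finrank ℂ (P k₀).range) (hFfin.mem_toFinset.mpr hk₀))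
  rw [Metric.mem_ball, dist_eq_norm] at hkb
  calc b (k - k₀) ≤ (K + 2) * ε := mul_le_mul_of_nonneg_left hkb.le (by linarith)
    _ < 1 := by rw [hε, ← div_eq_mul_inv, div_lt_one (by linarith)]; linarith

/-- The Fermi projection is Hilbert–Schmidt on the unit cell. -/
theorem IsGappedPeriodicHamiltonian.isHS_projection_cellExtend
    {H₀ : Hilb C N →ₗ.[ℂ] Hilb C N} {Hk : Pos d → HilbFiber C N →ₗ.[ℂ] HilbFiber C N} {μ : ℝ}
    (hC : C.IsPrimitiveCell C.a) (hH : IsGappedPeriodicHamiltonian T H₀ Hk μ) :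
    IsHS (spectralProjectionBelow H₀ μ ∘L cellExtend C N) := by
  obtain ⟨P, hfib, hP⟩ := hH.finite_rank
  obtain ⟨K, hK, hBK⟩ := hH.exists_norm_commutator_projection hC
  have hB : ∀ ψ φ, IsBFZ T ψ φ → IsBFZ T (spectralProjectionBelow H₀ μ ψ) fun k ↦ P k (φ k) :=
    fun ψ φ h ↦ hfib.isBFZ_apply hC h
  obtain ⟨M, hM⟩ := exists_finrank_bound hC hP hB hK hBK 0
  obtain ⟨ι, ⟨e⟩⟩ := exists_hilbertBasis_type (HilbFiber C N)
  refine isHS_of_basis e (summable_of_sum_le (c := M) (fun _ ↦ by positivity) fun F ↦ ?_)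
  have h1 : ∀ n, IsBFZ T (spectralProjectionBelow H₀ μ (cellExtend C N (e n)))
      fun k ↦ P k (phaseOp N _ k (e n)) := fun n ↦ hB _ _ (isCompactBFZ_cellExtend hC (e n)).isBFZ
  -- Plancherel turns the sum into an integral over the zone; at each k the phase carries the basis
  -- to an orthonormal family, so the integrand is at most the rank of P(k).
  calc ∑ n ∈ F, ‖(spectralProjectionBelow H₀ μ ∘L cellExtend C N) (e n)‖ ^ 2
      = ∑ n ∈ F, ∫ k, ‖P k (phaseOp N _ k (e n))‖ ^ 2 ∂C.zoneMeasure 0 :=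
        Finset.sum_congr rfl fun n _ ↦ ((h1 n).integral_norm_sq hC 0).symm
    _ = ∫ k, ∑ n ∈ F, ‖P k (phaseOp N _ k (e n))‖ ^ 2 ∂C.zoneMeasure 0 :=
        (integral_finsetSum _ fun n _ ↦ ((h1 n).memLp hC 0).integrable_norm_pow two_ne_zero).symm
    _ ≤ ∫ k, (M : ℝ) ∂C.zoneMeasure 0 := by
        refine integral_mono_ae (integrable_finsetSum _ fun n _ ↦
          ((h1 n).memLp hC 0).integrable_norm_pow two_ne_zero) (integrable_const _) ?_
        filter_upwards [hM] with k hk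
        have := (hP k).2
        have h2 : Orthonormal ℂ fun n ↦ phaseOp N (C.measure.restrict (C.cell C.a 1)) k (e n) := by
          refine ⟨fun n ↦ (norm_phaseOp k _).trans (e.orthonormal.1 n), fun m n hmn ↦ ?_⟩
          dsimp only
          rw [inner_phaseOp_left, phaseOp_neg_phaseOp]
          exact e.orthonormal.2 hmn
        exact (sum_norm_sq_le_finrank (hP k).1 h2 F).trans (by exact_mod_cast hk)
    _ = M := by simp

/-- The Fermi projection is Hilbert–Schmidt on the unit cell. -/
theorem IsGappedPeriodicHamiltonian.isHS_projection_chi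
    {H₀ : Hilb C N →ₗ.[ℂ] Hilb C N} {Hk : Pos d → HilbFiber C N →ₗ.[ℂ] HilbFiber C N} {μ : ℝ}
    (hC : C.IsPrimitiveCell C.a) (hH : IsGappedPeriodicHamiltonian T H₀ Hk μ) :
    IsHS (spectralProjectionBelow H₀ μ ∘L
      chi N C.measure (C.cell C.a 1) (C.measurableSet_cell C.a 1)) := by
  have h1 := (hH.isHS_projection_cellExtend hC).comp_right (cellRestrict C N)
  convert h1 using 1
  ext1 ψ
  simp only [ContinuousLinearMap.comp_apply, cellExtend_cellRestrict]

end Model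

/-! ## Local traces of periodic operators -/

section LocalTrace

variable {d N : ℕ} {C : Crystal d} (T : MagneticCocycle C N)

/-- The bounded operator `B` commutes with the magnetic translations. -/
def IsTranslationInvariant (B : Hilb C N →L[ℂ] Hilb C N) : Prop :=
  ∀ γ, Commute (translationOp T γ) B

variable {T}

theorem translationOp_mul_neg (γ : C.lattice) : translationOp T γ * translationOp T (-γ) = 1 := by
  ext1 ψ
  rw [mul_apply_eq_comp, translationOp_translationOp, neg_add_cancel, translationOp_zero]
  rfl

theorem translationOp_neg_mul (γ : C.lattice) : translationOp T (-γ) * translationOp T γ = 1 := by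
  simpa using translationOp_mul_neg (T := T) (-γ)

theorem star_translationOp (γ : C.lattice) : star (translationOp T γ) = translationOp T (-γ) := by
  symm
  rw [ContinuousLinearMap.star_eq_adjoint, ContinuousLinearMap.eq_adjoint_iff]
  intro ψ φ
  have h := (translationIso T γ).inner_map_map (translationOp T (-γ) ψ) φ
  rw [translationIso_apply, translationIso_apply, translationOp_translationOp, neg_add_cancel,
    translationOp_zero] at h
  exact h.symm

theorem IsTranslationInvariant.mul {A B : Hilb C N →L[ℂ] Hilb C N}
    (hA : IsTranslationInvariant T A) (hB : IsTranslationInvariant T B) :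
    IsTranslationInvariant T (A * B) := fun γ ↦ (hA γ).mul_right (hB γ)

theorem IsTranslationInvariant.add {A B : Hilb C N →L[ℂ] Hilb C N}
    (hA : IsTranslationInvariant T A) (hB : IsTranslationInvariant T B) :
    IsTranslationInvariant T (A + B) := fun γ ↦ (hA γ).add_right (hB γ)

theorem IsTranslationInvariant.smul {A : Hilb C N →L[ℂ] Hilb C N} (c : ℂ)
    (hA : IsTranslationInvariant T A) : IsTranslationInvariant T (c • A) :=
  fun γ ↦ (hA γ).smul_right c

theorem IsTranslationInvariant.one : IsTranslationInvariant T 1 := fun _ ↦ Commute.one_right _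

theorem IsTranslationInvariant.star {A : Hilb C N →L[ℂ] Hilb C N}
    (hA : IsTranslationInvariant T A) : IsTranslationInvariant T (star A) := fun γ ↦ by
  have h := (hA (-γ)).star_star
  rwa [star_translationOp, neg_neg] at h

theorem chi_translate (γ : C.lattice) {A : Set (Pos d)} (hA : MeasurableSet A) :
    chi N C.measure (C.translate γ A) (C.measurableSet_translate γ hA) =
      translationOp T γ * chi N C.measure A hA * translationOp T (-γ) := by
  have h : translationOp T γ * chi N C.measure A hA =
      chi N C.measure (C.translate γ A) (C.measurableSet_translate γ hA) * translationOp T γ := by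
    ext1 ψ
    exact translationOp_chi T γ A hA ψ
  rw [h, mul_assoc, translationOp_mul_neg, mul_one]

theorem star_chi (A : Set (Pos d)) (hA : MeasurableSet A) :
    star (chi N C.measure A hA) = chi N C.measure A hA := chi_adjoint A hA

theorem tsum_norm_sq_conj {E : Type} [NormedAddCommGroup E] [InnerProductSpace ℂ E]
    [CompleteSpace E] {ι : Type} (e : HilbertBasis ι ℂ E) {V W Z : E →L[ℂ] E}
    (hV : ∀ x, ‖V x‖ = ‖x‖) (hW : ∀ x, ‖star W x‖ = ‖x‖) :
    ∑' n, ENNReal.ofReal (‖(V * Z * W) (e n)‖ ^ 2) = ∑' n, ENNReal.ofReal (‖Z (e n)‖ ^ 2) := by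
  have h1 : ∀ n, ‖(V * Z * W) (e n)‖ = ‖(Z * W) (e n)‖ := fun n ↦ by
    simp only [mul_apply_eq_comp, hV]
  simp only [h1]
  rw [tsum_norm_sq_adjoint e e (Z * W), tsum_norm_sq_adjoint e e Z]
  refine tsum_congr fun n ↦ ?_
  have h2 : ContinuousLinearMap.adjoint (Z * W) = star W * star Z := star_mul Z W
  rw [h2, mul_apply_eq_comp, hW]
  rfl

/-- For a periodic operator the cell may be put on either side. -/
theorem IsHS.chi_mul (hC : C.IsPrimitiveCell C.a) {A : Hilb C N →L[ℂ] Hilb C N}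
    (hA : IsTranslationInvariant T A)
    (h : IsHS (A * chi N C.measure (C.cell C.a 1) (C.measurableSet_cell C.a 1))) :
    IsHS (chi N C.measure (C.cell C.a 1) (C.measurableSet_cell C.a 1) * A) := by
  have hm := C.measurableSet_cell C.a 1
  set χ := chi N C.measure (C.cell C.a 1) hm with hχ
  let χt : C.lattice → Hilb C N →L[ℂ] Hilb C N := fun γ ↦
    chi N C.measure (C.translate γ (C.cell C.a 1)) (C.measurableSet_translate γ hm)
  obtain ⟨ι, ⟨e⟩⟩ := exists_hilbertBasis_type (Hilb C N)
  have h0 := h ι e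
  refine isHS_of_basis e ?_
  rw [summable_iff_tsum_ofReal_ne_top (fun _ ↦ by positivity)] at h0 ⊢
  -- The parts of the Hilbert–Schmidt norms over the translated cells agree: χ_γ A*χ has the adjoint
  -- χ A χ_γ, and conjugation by T_γ turns this into χ_{-γ} A χ. Summation over γ gives ‖χA‖ = ‖Aχ‖
  -- in Hilbert–Schmidt norm.
  have key : ∀ γ, ∑' m, ENNReal.ofReal (‖χt γ (star (χ * A) (e m))‖ ^ 2) =
      ∑' m, ENNReal.ofReal (‖χt (-γ) ((A * χ) (e m))‖ ^ 2) := by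
    intro γ
    have h1 := tsum_norm_sq_adjoint e e (χt γ * star (χ * A))
    have h2 : ContinuousLinearMap.adjoint (χt γ * star (χ * A)) =
        translationOp T γ * (χt (-γ) * (A * χ)) * translationOp T (-γ) := by
      have h3 : star (χt γ * star (χ * A)) = χ * A * χt γ := by
        rw [star_mul, star_star, star_chi]
      refine h3.trans ?_
      have h4 : χt γ = translationOp T γ * χ * translationOp T (-γ) := chi_translate γ hm
      have h5 : χt (-γ) = translationOp T (-γ) * χ * translationOp T γ := by
        simpa only [neg_neg] using chi_translate (T := T) (-γ) hm
      rw [h4, h5]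
      simp only [← mul_assoc]
      rw [translationOp_mul_neg, one_mul, mul_assoc χ A, ← (hA γ).eq]
      simp only [mul_assoc]
    rw [h2, tsum_norm_sq_conj e (norm_translationOp T γ)
      (fun x ↦ by rw [star_translationOp, norm_translationOp])] at h1
    exact h1
  rw [tsum_norm_sq_adjoint e e]
  have h3 : ∀ m, ENNReal.ofReal (‖ContinuousLinearMap.adjoint (χ * A) (e m)‖ ^ 2) =
      ∑' γ, ENNReal.ofReal (‖χt γ (star (χ * A) (e m))‖ ^ 2) :=
    fun m ↦ (tsum_norm_chi_translate hC _).symm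
  simp only [h3]
  rw [ENNReal.tsum_comm]
  simp only [key]
  rw [ENNReal.tsum_comm]
  have h4 : ∀ m, ∑' γ, ENNReal.ofReal (‖χt (-γ) ((A * χ) (e m))‖ ^ 2) =
      ENNReal.ofReal (‖(A * χ) (e m)‖ ^ 2) := fun m ↦
    ((Equiv.neg C.lattice).tsum_eq fun γ ↦ ENNReal.ofReal (‖χt γ ((A * χ) (e m))‖ ^ 2)).trans
      (tsum_norm_chi_translate hC _)
  simp only [h4]
  exact h0

/-- A bounded set decomposes into finitely many pieces inside the translates of a packing set. -/
theorem chi_eq_sum_translate {Ω P : Set (Pos d)} {r r' : ℝ} (hΩ : MeasurableSet Ω)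
    (hP : MeasurableSet P) (hΩr : Ω ⊆ Metric.closedBall 0 r) (hPr : P ⊆ Metric.closedBall 0 r')
    (hpack : C.IsPacking P) (hcov : ∀ᵐ x ∂C.measure, x ∈ Ω → x ∈ C.saturation P) {F : Finset C.lattice}
    (hF : ∀ γ : C.lattice, ‖(γ : Pos d)‖ ≤ r + r' → γ ∈ F) :
    chi N C.measure Ω hΩ = ∑ γ ∈ F, chi N C.measure (Ω ∩ C.translate γ P)
      (hΩ.inter (C.measurableSet_translate γ hP)) := by
  refine chi_eq_sum hΩ (fun γ ↦ hΩ.inter (C.measurableSet_translate γ hP)) ?_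
  filter_upwards [hcov, hpack.ae_unique C hP] with x h1 h2
  refine ⟨fun hx ↦ ?_, fun hx γ _ h ↦ hx h.1⟩
  obtain ⟨γ, hγ⟩ := Set.mem_iUnion.mp (h1 hx)
  refine ⟨γ, hF γ ?_, ⟨hx, hγ⟩, fun η _ hη ↦ h2 η γ hη.2 hγ⟩
  have h3 := hΩr hx
  have h4 := hPr hγ
  rw [mem_closedBall_zero_iff] at h3 h4
  calc ‖(γ : Pos d)‖ = ‖x - (x - γ)‖ := by rw [sub_sub_cancel]
    _ ≤ ‖x‖ + ‖x - γ‖ := norm_sub_le _ _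
    _ ≤ r + r' := add_le_add h3 h4

theorem Crystal.ae_mem_saturation_cell {b : Module.Basis (Fin d) ℝ (Pos d)}
    (hb : C.IsLatticeBasis b) : ∀ᵐ x ∂C.measure, x ∈ C.saturation (C.cell b 1) := by
  filter_upwards [C.ae_mem_X] with x hx
  obtain ⟨γ, hγ⟩ := C.exists_translate_mem_cell hb hx
  exact Set.mem_iUnion.mpr ⟨γ, hγ⟩

/-- A bounded set meets finitely many translates of the cell, and A commutes with the translations,
so each part is A χ between bounded operators. -/
theorem isHS_mul_chi (hC : C.IsPrimitiveCell C.a) {A : Hilb C N →L[ℂ] Hilb C N}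
    (hA : IsTranslationInvariant T A)
    (h : IsHS (A * chi N C.measure (C.cell C.a 1) (C.measurableSet_cell C.a 1)))
    {Ω : Set (Pos d)} (hΩ : MeasurableSet Ω) {r : ℝ} (hr : Ω ⊆ Metric.closedBall 0 r) :
    IsHS (A * chi N C.measure Ω hΩ) := by
  have hm := C.measurableSet_cell C.a 1
  obtain ⟨r', hr'⟩ := C.exists_cell_subset C.a 1
  rw [chi_eq_sum_translate (F := (C.finite_lattice_norm_le (r + r')).toFinset) hΩ hm hr hr' hC
    ((C.ae_mem_saturation_cell C.isLatticeBasis_self).mono fun x h _ ↦ h)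
    fun γ hγ ↦ (Set.Finite.mem_toFinset _).mpr hγ, Finset.mul_sum]
  refine IsHS.sum fun γ _ ↦ ?_
  have h1 : chi N C.measure (Ω ∩ C.translate γ (C.cell C.a 1))
      (hΩ.inter (C.measurableSet_translate γ hm)) =
      translationOp T γ * chi N C.measure (C.cell C.a 1) hm * translationOp T (-γ) *
        chi N C.measure Ω hΩ := by
    rw [← chi_translate, chi_mul_chi]
    exact chi_congr _ _ (by simp [and_comm])
  have h2 : A * chi N C.measure (Ω ∩ C.translate γ (C.cell C.a 1))
      (hΩ.inter (C.measurableSet_translate γ hm)) = translationOp T γ *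
      ((A * chi N C.measure (C.cell C.a 1) hm) * (translationOp T (-γ) * chi N C.measure Ω hΩ)) := by
    rw [h1]
    simp only [← mul_assoc]
    rw [(hA γ).eq]
  rw [h2]
  exact (h.comp_right _).comp_left _

/-- The compressions of `B` to bounded sets are sums of products of Hilbert–Schmidt operators. -/
def IsLocallyNuclear (B : Hilb C N →L[ℂ] Hilb C N) : Prop :=
  ∀ (Ω : Set (Pos d)) (hΩ : MeasurableSet Ω) (r : ℝ), Ω ⊆ Metric.closedBall 0 r →
    chi N C.measure Ω hΩ * B * chi N C.measure Ω hΩ ∈ nuclear (Hilb C N)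

theorem IsLocallyNuclear.add {A B : Hilb C N →L[ℂ] Hilb C N} (hA : IsLocallyNuclear A)
    (hB : IsLocallyNuclear B) : IsLocallyNuclear (A + B) := fun Ω hΩ r hr ↦ by
  rw [mul_add, add_mul]
  exact add_mem (hA Ω hΩ r hr) (hB Ω hΩ r hr)

theorem IsLocallyNuclear.smul {A : Hilb C N →L[ℂ] Hilb C N} (c : ℂ) (hA : IsLocallyNuclear A) :
    IsLocallyNuclear (c • A) := fun Ω hΩ r hr ↦ by
  rw [mul_smul_comm, smul_mul_assoc]
  exact Submodule.smul_mem _ c (hA Ω hΩ r hr)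

/-- χ G P K χ = (P G*χ)*(P K χ). Both factors are Hilbert–Schmidt: K*P χ is so on the cell,
`IsHS.chi_mul` moves the cell across, and the adjoint is P K χ; then the cell is enlarged to any
bounded set. -/
theorem isLocallyNuclear_mul_mul (hC : C.IsPrimitiveCell C.a) {P G K : Hilb C N →L[ℂ] Hilb C N}
    (hP : IsStarProjection P) (hPT : IsTranslationInvariant T P) (hG : IsTranslationInvariant T G)
    (hK : IsTranslationInvariant T K)
    (h : IsHS (P * chi N C.measure (C.cell C.a 1) (C.measurableSet_cell C.a 1))) :
    IsLocallyNuclear (G * P * K) := by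
  have key : ∀ K : Hilb C N →L[ℂ] Hilb C N, IsTranslationInvariant T K →
      ∀ (Ω : Set (Pos d)) (hΩ : MeasurableSet Ω) (r : ℝ), Ω ⊆ Metric.closedBall 0 r →
        IsHS (P * K * chi N C.measure Ω hΩ) := by
    intro K hK Ω hΩ r hr
    refine isHS_mul_chi hC (hPT.mul hK) ?_ hΩ hr
    have h1 : IsHS (star K * P * chi N C.measure (C.cell C.a 1) (C.measurableSet_cell C.a 1)) := by
      rw [mul_assoc]
      exact h.comp_left (star K)
    have h2 : IsHS (star (chi N C.measure (C.cell C.a 1) (C.measurableSet_cell C.a 1) *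
        (star K * P))) := (IsHS.chi_mul hC (hK.star.mul hPT) h1).adjoint
    rwa [star_mul, star_mul, star_star, star_chi, hP.isSelfAdjoint.star_eq] at h2
  intro Ω hΩ r hr
  have h1 : IsHS (star (P * star G * chi N C.measure Ω hΩ)) := (key _ hG.star Ω hΩ r hr).adjoint
  rw [star_mul, star_mul, star_star, star_chi, hP.isSelfAdjoint.star_eq] at h1
  have h2 := mul_mem_nuclear h1 (key K hK Ω hΩ r hr)
  convert h2 using 1
  simp only [mul_assoc]
  rw [← mul_assoc P P, hP.isIdempotentElem.eq]

/-- The local trace `Tr(χ_Ω B χ_Ω)`. -/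
def localTrace (B : Hilb C N →L[ℂ] Hilb C N) (Ω : Set (Pos d)) (hΩ : MeasurableSet Ω) : ℂ :=
  tr (chi N C.measure Ω hΩ * B * chi N C.measure Ω hΩ)

theorem localTrace_eq_sum {B : Hilb C N →L[ℂ] Hilb C N} (hB : IsLocallyNuclear B) {ι : Type}
    {s : Finset ι} {Ω : Set (Pos d)} {Ωs : ι → Set (Pos d)} (hΩ : MeasurableSet Ω)
    (hΩs : ∀ n, MeasurableSet (Ωs n)) {r : ℝ} (hr : Ω ⊆ Metric.closedBall 0 r)
    (hsub : ∀ n ∈ s, Ωs n ⊆ Ω)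
    (h : chi N C.measure Ω hΩ = ∑ n ∈ s, chi N C.measure (Ωs n) (hΩs n)) :
    localTrace B Ω hΩ = ∑ n ∈ s, localTrace B (Ωs n) (hΩs n) := by
  have h1 := tr_compress_sum (fun n _ ↦ chi_mul_self (Ωs n) (hΩs n)) (chi_mul_self Ω hΩ) h
    (hB Ω hΩ r hr)
  have h2 : ∀ n ∈ s, chi N C.measure (Ωs n) (hΩs n) * chi N C.measure Ω hΩ =
      chi N C.measure (Ωs n) (hΩs n) ∧ chi N C.measure Ω hΩ * chi N C.measure (Ωs n) (hΩs n) =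
      chi N C.measure (Ωs n) (hΩs n) := by
    intro n hn
    rw [chi_mul_chi, chi_mul_chi]
    exact ⟨chi_congr _ _ (Eventually.of_forall fun x ↦ ⟨fun h ↦ h.1, fun h ↦ ⟨h, hsub n hn h⟩⟩),
      chi_congr _ _ (Eventually.of_forall fun x ↦ ⟨fun h ↦ h.2, fun h ↦ ⟨hsub n hn h, h⟩⟩)⟩
  unfold localTrace
  have h3 : chi N C.measure Ω hΩ * (chi N C.measure Ω hΩ * B * chi N C.measure Ω hΩ) *
      chi N C.measure Ω hΩ = chi N C.measure Ω hΩ * B * chi N C.measure Ω hΩ := by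
    rw [mul_assoc _ _ (chi N C.measure Ω hΩ), mul_assoc _ (chi N C.measure Ω hΩ)
      (chi N C.measure Ω hΩ), chi_mul_self, ← mul_assoc, ← mul_assoc, chi_mul_self]
  rw [h3] at h1
  rw [h1]
  refine Finset.sum_congr rfl fun n hn ↦ congrArg tr ?_
  rw [← mul_assoc, ← mul_assoc, (h2 n hn).1, mul_assoc, (h2 n hn).2]

theorem tr_conj {E : Type} [NormedAddCommGroup E] [InnerProductSpace ℂ E] [CompleteSpace E]
    {V W B : E →L[ℂ] E} (hWV : W * V = 1) (hB : B ∈ nuclear E) : tr (V * B * W) = tr B := by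
  rw [← tr_comm (nuclear_mul_left V hB) W, ← mul_assoc, hWV, one_mul]

theorem localTrace_congr {B : Hilb C N →L[ℂ] Hilb C N} {Ω Ω' : Set (Pos d)} (hΩ : MeasurableSet Ω)
    (hΩ' : MeasurableSet Ω') (h : Ω = Ω') : localTrace B Ω hΩ = localTrace B Ω' hΩ' := by
  subst h
  rfl

theorem localTrace_translate {B : Hilb C N →L[ℂ] Hilb C N} (hB : IsLocallyNuclear B)
    (hT : IsTranslationInvariant T B) (γ : C.lattice) {Ω : Set (Pos d)} (hΩ : MeasurableSet Ω)
    {r : ℝ} (hr : Ω ⊆ Metric.closedBall 0 r) :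
    localTrace B (C.translate γ Ω) (C.measurableSet_translate γ hΩ) = localTrace B Ω hΩ := by
  unfold localTrace
  rw [← tr_conj (translationOp_neg_mul (T := T) γ) (hB Ω hΩ r hr), chi_translate (T := T) γ hΩ]
  congr 1
  have h1 : translationOp T (-γ) * B * translationOp T γ = B := by
    rw [(hT (-γ)).eq, mul_assoc, translationOp_neg_mul, mul_one]
  have h2 : ∀ χ : Hilb C N →L[ℂ] Hilb C N, translationOp T γ * χ * translationOp T (-γ) * B *
      (translationOp T γ * χ * translationOp T (-γ)) =
      translationOp T γ * (χ * (translationOp T (-γ) * B * translationOp T γ) * χ) *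
        translationOp T (-γ) := by
    intro χ
    simp only [mul_assoc]
  rw [h2, h1]

/-- The local traces on two fundamental domains of the same set are equal. -/
theorem localTrace_eq_of_saturation {B : Hilb C N →L[ℂ] Hilb C N} (hB : IsLocallyNuclear B)
    (hT : IsTranslationInvariant T B) {P P' : Set (Pos d)} (hP : MeasurableSet P)
    (hP' : MeasurableSet P') {r r' : ℝ} (hr : P ⊆ Metric.closedBall 0 r)
    (hr' : P' ⊆ Metric.closedBall 0 r') (hpack : C.IsPacking P) (hpack' : C.IsPacking P')
    (hsat : chi N C.measure (C.saturation P) (C.measurableSet_saturation hP) =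
      chi N C.measure (C.saturation P') (C.measurableSet_saturation hP')) :
    localTrace B P hP = localTrace B P' hP' := by
  -- The translates of P' cover P up to null sets and cut it into finitely many parts.
  have main : ∀ {P P' : Set (Pos d)} (hP : MeasurableSet P) (hP' : MeasurableSet P') {r r' : ℝ},
      P ⊆ Metric.closedBall 0 r → P' ⊆ Metric.closedBall 0 r' → C.IsPacking P' →
      chi N C.measure (C.saturation P) (C.measurableSet_saturation hP) =
        chi N C.measure (C.saturation P') (C.measurableSet_saturation hP') →
      ∀ F : Finset C.lattice, (∀ γ : C.lattice, ‖(γ : Pos d)‖ ≤ r + r' → γ ∈ F) →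
      localTrace B P hP = ∑ γ ∈ F, localTrace B (P ∩ C.translate γ P')
        (hP.inter (C.measurableSet_translate γ hP')) := by
    intro P P' hP hP' r r' hr hr' hpack' hsat F hF
    have h1 : chi N C.measure P hP = chi N C.measure (P ∩ C.saturation P')
        (hP.inter (C.measurableSet_saturation hP')) := by
      rw [← chi_mul_chi P _ hP (C.measurableSet_saturation hP'), ← hsat, chi_mul_chi]
      refine chi_congr _ _ (Eventually.of_forall fun x ↦
        ⟨fun h ↦ ⟨h, Set.mem_iUnion.mpr ⟨0, ?_⟩⟩, fun h ↦ h.1⟩)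
      simpa using h
    have h2 := chi_eq_sum_translate (N := N) (hP.inter (C.measurableSet_saturation hP')) hP'
      (Set.inter_subset_left.trans hr) hr' hpack' (Eventually.of_forall fun x h ↦ h.2) hF
    refine localTrace_eq_sum hB hP _ hr (fun γ _ ↦ Set.inter_subset_left) ?_
    rw [h1, h2]
    refine Finset.sum_congr rfl fun γ _ ↦ chi_congr _ _ (Eventually.of_forall fun x ↦ ?_)
    exact ⟨fun h ↦ ⟨h.1.1, h.2⟩, fun h ↦ ⟨⟨h.1, Set.mem_iUnion.mpr ⟨γ, h.2⟩⟩, h.2⟩⟩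
  set F := (C.finite_lattice_norm_le (r + r')).toFinset with hF
  have hFm : ∀ γ : C.lattice, γ ∈ F ↔ ‖(γ : Pos d)‖ ≤ r + r' := fun γ ↦ Set.Finite.mem_toFinset _
  rw [main hP hP' hr hr' hpack' hsat F fun γ h ↦ (hFm γ).mpr h,
    main hP' hP hr' hr hpack hsat.symm F fun γ h ↦ (hFm γ).mpr (by linarith)]
  -- P ∩ (P' + γ), moved by -γ, is P' ∩ (P - γ): the two decompositions have the same parts up to
  -- translation.
  refine Finset.sum_equiv (Equiv.neg C.lattice) (fun γ ↦ by simp [hFm]) fun γ _ ↦ ?_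
  rw [← localTrace_translate hB hT (-γ) (hP.inter (C.measurableSet_translate γ hP'))
    (Set.inter_subset_left.trans hr)]
  refine localTrace_congr _ _ ?_
  ext x
  simp [Crystal.mem_translate, and_comm]

end LocalTrace

/-! ## Symmetries -/

section Symmetry

variable {d N : ℕ} {C : Crystal d}

/-- `X_l V = V (α X_m + β X_n + κ)`. -/
def IntertwinesPosition (V : Hilb C N →L[ℂ] Hilb C N) (l m n : Fin d) (α β κ : ℂ) : Prop :=
  ∀ ψ η ξ, (ψ, η) ∈ (positionOp N C.measure m).graph → (ψ, ξ) ∈ (positionOp N C.measure n).graph →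
    (V ψ, V (α • η + β • ξ + κ • ψ)) ∈ (positionOp N C.measure l).graph

/-- `D` is a bounded extension of the commutator `[X_l, A]`. -/
def IsPositionCommutator (l : Fin d) (A D : Hilb C N →L[ℂ] Hilb C N) : Prop :=
  ∀ ψ η, (ψ, η) ∈ (positionOp N C.measure l).graph →
    (A ψ, D ψ + A η) ∈ (positionOp N C.measure l).graph

/-- On vectors of bounded support X_l A V = X_l V A is computed in two ways, by commuting X_l with A
and by commuting X_l with V. The scalar κ commutes with A and drops out. -/
theorem IntertwinesPosition.commutator_mul {V A D D' D'' : Hilb C N →L[ℂ] Hilb C N} {l m n : Fin d}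
    {α β κ : ℂ} (hV : IntertwinesPosition V l m n α β κ) (hVA : Commute V A)
    (hD : IsPositionCommutator l A D) (hD' : IsPositionCommutator m A D')
    (hD'' : IsPositionCommutator n A D'') : D * V = V * (α • D' + β • D'') := by
  have hcomm : ∀ ψ, V (A ψ) = A (V ψ) := fun ψ ↦ congrArg (fun B : Hilb C N →L[ℂ] Hilb C N ↦ B ψ) hVA.eq
  have h : Set.EqOn (D * V) (V * (α • D' + β • D'')) {ψ : Hilb C N | HasBoundedSupport ψ} := by
    intro ψ hψ
    obtain ⟨η, hη⟩ := HasBoundedSupport.exists_position hψ m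
    obtain ⟨ξ, hξ⟩ := HasBoundedSupport.exists_position hψ n
    have h1 := hV _ _ _ (hD' _ _ hη) (hD'' _ _ hξ)
    have h2 := hD _ _ (hV _ _ _ hη hξ)
    rw [hcomm] at h1
    have h3 := eq_of_mem_graph h2 h1
    rw [← hcomm, ← eq_sub_iff_add_eq, ← map_sub] at h3
    rw [mul_apply_eq_comp, mul_apply_eq_comp, h3]
    congr 1
    simp only [_root_.add_apply, _root_.smul_apply, map_add, map_smul, smul_add]
    abel
  have h1 := Continuous.ext_on dense_hasBoundedSupport (D * V).continuous
    (V * (α • D' + β • D'')).continuous h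
  exact ContinuousLinearMap.ext fun ψ ↦ congrFun h1 ψ

theorem intertwinesPosition_translationOp (T : MagneticCocycle C N) (γ : C.lattice) (l : Fin d) :
    IntertwinesPosition (translationOp T γ) l l l 1 0 (((γ : Pos d) l : ℝ) : ℂ) := by
  intro ψ η ξ h _
  have h1 := translationOp_position T γ h
  rwa [one_smul, zero_smul, add_zero, map_add, map_smul]

/-- A translation changes X_l only by the scalar γ_l, which disappears from commutators: they are
periodic although X_l is not. -/
theorem IsPositionCommutator.isTranslationInvariant {T : MagneticCocycle C N} {l : Fin d}
    {A D : Hilb C N →L[ℂ] Hilb C N} (hD : IsPositionCommutator l A D)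
    (hA : IsTranslationInvariant T A) : IsTranslationInvariant T D := by
  intro γ
  have h := (intertwinesPosition_translationOp T γ l).commutator_mul (hA γ) hD hD hD
  rw [one_smul, zero_smul, add_zero] at h
  exact h.symm

theorem ae_comp_symm (e : Pos d ≃ₗᵢ[ℝ] Pos d) (he : ∀ x, x ∈ C.X ↔ e x ∈ C.X) {p : Pos d → Prop}
    (h : ∀ᵐ x ∂C.measure, p x) : ∀ᵐ x ∂C.measure, p (e.symm x) :=
  (measurePreserving_isometry C e.symm (mem_symm_iff he)).quasiMeasurePreserving.ae h

/-! ### Action of the rotation operator on sets, spin and positions -/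

section RotationOp

variable (ρ : unitary (Spin N →L[ℂ] Spin N)) (e : Pos d ≃ₗᵢ[ℝ] Pos d)
  (he : ∀ x, x ∈ C.X ↔ e x ∈ C.X)

theorem coeFn_rotationOp (ψ : Hilb C N) : rotationOp C ρ e he ψ =ᵐ[C.measure]
    fun x ↦ (ρ : Spin N →L[ℂ] Spin N) (ψ (e.symm x)) := coeFn_rotationAux C ρ e he ψ

theorem rotationOp_chi {A : Set (Pos d)} (hA : MeasurableSet A) (ψ : Hilb C N) :
    rotationOp C ρ e he (chi N C.measure A hA ψ) =
      chi N C.measure (e.symm ⁻¹' A) (e.symm.continuous.measurable hA)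
        (rotationOp C ρ e he ψ) := by
  apply Lp.ext
  filter_upwards [coeFn_rotationOp ρ e he (chi N C.measure A hA ψ),
    coeFn_chi _ (e.symm.continuous.measurable hA) (rotationOp C ρ e he ψ),
    ae_comp_symm e he (coeFn_chi A hA ψ), coeFn_rotationOp ρ e he ψ] with x h1 h2 h3 h4
  rw [h1, h2, h3]
  by_cases hx : e.symm x ∈ A
  · rw [Set.indicator_of_mem hx, Set.indicator_of_mem (show x ∈ e.symm ⁻¹' A from hx), h4]
  · rw [Set.indicator_of_notMem hx, Set.indicator_of_notMem (show x ∉ e.symm ⁻¹' A from hx), map_zero]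

theorem rotationOp_spinOp {s : Spin N →L[ℂ] Spin N}
    (hs : ∀ v, s ((ρ : Spin N →L[ℂ] Spin N) v) = (ρ : Spin N →L[ℂ] Spin N) (s v)) (ψ : Hilb C N) :
    rotationOp C ρ e he (spinOp C.measure s ψ) = spinOp C.measure s (rotationOp C ρ e he ψ) := by
  apply Lp.ext
  filter_upwards [coeFn_rotationOp ρ e he (spinOp C.measure s ψ),
    coeFn_spinOp s (rotationOp C ρ e he ψ), ae_comp_symm e he (coeFn_spinOp s ψ),
    coeFn_rotationOp ρ e he ψ] with x h1 h2 h3 h4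
  rw [h1, h2, h3, h4, hs]

theorem intertwinesPosition_rotationOp {l m n : Fin d} {α β : ℝ}
    (h : ∀ x : Pos d, e x l = α * x m + β * x n) :
    IntertwinesPosition (rotationOp C ρ e he : Hilb C N →L[ℂ] Hilb C N) l m n α β 0 := by
  intro ψ η ξ hη hξ
  rw [zero_smul, add_zero]
  rw [mem_graph_position] at hη hξ ⊢
  filter_upwards [coeFn_rotationOp ρ e he ψ,
    coeFn_rotationOp ρ e he ((α : ℂ) • η + (β : ℂ) • ξ),
    ae_comp_symm e he hη, ae_comp_symm e he hξ,
    ae_comp_symm e he (Lp.coeFn_add ((α : ℂ) • η) ((β : ℂ) • ξ)),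
    ae_comp_symm e he (Lp.coeFn_smul (α : ℂ) η), ae_comp_symm e he (Lp.coeFn_smul (β : ℂ) ξ)]
    with x h1 h2 h3 h4 h5 h6 h7
  refine h2.trans ?_
  change _ = ((x l : ℝ) : ℂ) • (rotationOp C ρ e he ψ) x
  rw [h1, h5, Pi.add_apply, h6, h7, Pi.smul_apply, Pi.smul_apply, h3, h4]
  have h8 := h (e.symm x)
  rw [e.apply_symm_apply] at h8
  rw [h8, smul_smul, smul_smul, ← add_smul, map_smul]
  push_cast
  rfl

end RotationOp

theorem localTrace_add {A B : Hilb C N →L[ℂ] Hilb C N} (hA : IsLocallyNuclear A)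
    (hB : IsLocallyNuclear B) {Ω : Set (Pos d)} (hΩ : MeasurableSet Ω) {r : ℝ}
    (hr : Ω ⊆ Metric.closedBall 0 r) :
    localTrace (A + B) Ω hΩ = localTrace A Ω hΩ + localTrace B Ω hΩ := by
  unfold localTrace
  rw [mul_add, add_mul]
  exact tr_add (hA Ω hΩ r hr) (hB Ω hΩ r hr)

theorem localTrace_smul {A : Hilb C N →L[ℂ] Hilb C N} (c : ℂ) (hA : IsLocallyNuclear A)
    {Ω : Set (Pos d)} (hΩ : MeasurableSet Ω) {r : ℝ} (hr : Ω ⊆ Metric.closedBall 0 r) :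
    localTrace (c • A) Ω hΩ = c * localTrace A Ω hΩ := by
  unfold localTrace
  rw [mul_smul_comm, smul_mul_assoc]
  exact tr_smul c (hA Ω hΩ r hr)

theorem isometry_preimage_subset (e : Pos d ≃ₗᵢ[ℝ] Pos d) {P : Set (Pos d)} {r : ℝ}
    (hr : P ⊆ Metric.closedBall 0 r) : e.symm ⁻¹' P ⊆ Metric.closedBall 0 r := by
  intro x hx
  have := hr hx
  rw [mem_closedBall_zero_iff] at this ⊢
  rwa [e.symm.norm_map] at this

theorem Crystal.IsPacking.preimage {P : Set (Pos d)} (hP : MeasurableSet P) (hpack : C.IsPacking P)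
    (e : Pos d ≃ₗᵢ[ℝ] Pos d) (he : ∀ x, x ∈ C.X ↔ e x ∈ C.X)
    (hlat : ∀ x, x ∈ C.lattice ↔ e x ∈ C.lattice) : C.IsPacking (e.symm ⁻¹' P) := by
  intro γ hγ
  have hγ' : e.symm γ ∈ C.lattice := by
    rw [hlat, e.apply_symm_apply]
    exact γ.2
  have h0 : (⟨e.symm γ, hγ'⟩ : C.lattice) ≠ 0 := by
    intro h
    apply hγ
    have h1 : e.symm (γ : Pos d) = 0 := congrArg Subtype.val h
    rw [map_eq_zero_iff _ e.symm.injective] at h1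
    exact Subtype.ext h1
  have hm := (measurePreserving_isometry C e.symm (mem_symm_iff he)).measure_preimage
    (hP.inter (C.measurableSet_translate ⟨e.symm γ, hγ'⟩ hP)).nullMeasurableSet
  rw [hpack _ h0] at hm
  convert hm using 2
  ext x
  simp [Crystal.mem_translate]

theorem saturation_preimage (e : Pos d ≃ₗᵢ[ℝ] Pos d)
    (hlat : ∀ x, x ∈ C.lattice ↔ e x ∈ C.lattice) (P : Set (Pos d)) :
    C.saturation (e.symm ⁻¹' P) = e.symm ⁻¹' C.saturation P := by
  ext x
  simp only [Crystal.saturation, Set.mem_preimage, Set.mem_iUnion, map_sub]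
  constructor
  · rintro ⟨γ, h⟩
    exact ⟨⟨e.symm γ, by rw [hlat, e.apply_symm_apply]; exact γ.2⟩, h⟩
  · rintro ⟨γ, h⟩
    exact ⟨⟨e γ, (hlat γ).mp γ.2⟩, by simpa using h⟩

/-- The local trace of a vector of operators over a fundamental domain of a rotation invariant set
rotates, and hence vanishes. -/
theorem localTrace_eq_zero_of_rotation {T : MagneticCocycle C N} {A B : Hilb C N →L[ℂ] Hilb C N}
    (hA : IsLocallyNuclear A) (hB : IsLocallyNuclear B) (hAT : IsTranslationInvariant T A)
    (hBT : IsTranslationInvariant T B) (ρ : unitary (Spin N →L[ℂ] Spin N)) (e : Pos d ≃ₗᵢ[ℝ] Pos d)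
    (he : ∀ x, x ∈ C.X ↔ e x ∈ C.X) (hlat : ∀ x, x ∈ C.lattice ↔ e x ∈ C.lattice) {θ : ℝ}
    (hθ : Real.cos θ ≠ 1)
    (hAU : A * (rotationOp C ρ e he : Hilb C N →L[ℂ] Hilb C N) = (rotationOp C ρ e he :
      Hilb C N →L[ℂ] Hilb C N) * ((Real.cos θ : ℂ) • A + ((-Real.sin θ : ℝ) : ℂ) • B))
    (hBU : B * (rotationOp C ρ e he : Hilb C N →L[ℂ] Hilb C N) = (rotationOp C ρ e he :
      Hilb C N →L[ℂ] Hilb C N) * ((Real.sin θ : ℂ) • A + (Real.cos θ : ℂ) • B))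
    {P : Set (Pos d)} (hP : MeasurableSet P) {r : ℝ} (hr : P ⊆ Metric.closedBall 0 r)
    (hpack : C.IsPacking P) (hinv : ∀ ψ, rotationOp C ρ e he (chi N C.measure (C.saturation P)
      (C.measurableSet_saturation hP) ψ) = chi N C.measure (C.saturation P)
      (C.measurableSet_saturation hP) (rotationOp C ρ e he ψ)) :
    localTrace A P hP = 0 ∧ localTrace B P hP = 0 := by
  set U : Hilb C N →L[ℂ] Hilb C N := (rotationOp C ρ e he : Hilb C N →L[ℂ] Hilb C N) with hU
  set V : Hilb C N →L[ℂ] Hilb C N := ((rotationOp C ρ e he).symm : Hilb C N →L[ℂ] Hilb C N) with hV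
  have hUV : U * V = 1 := ContinuousLinearMap.ext fun ψ ↦ (rotationOp C ρ e he).apply_symm_apply ψ
  have hVU : V * U = 1 := ContinuousLinearMap.ext fun ψ ↦ (rotationOp C ρ e he).symm_apply_apply ψ
  have hP' : MeasurableSet (e.symm ⁻¹' P) := e.symm.continuous.measurable hP
  have hchi : chi N C.measure (e.symm ⁻¹' P) hP' = U * chi N C.measure P hP * V := by
    have h : U * chi N C.measure P hP = chi N C.measure (e.symm ⁻¹' P) hP' * U :=
      ContinuousLinearMap.ext fun ψ ↦ rotationOp_chi ρ e he hP ψ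
    rw [h, mul_assoc, hUV, mul_one]
  -- U commutes with χ of the saturation by assumption, but also carries it to χ of the rotated
  -- saturation; so the two sets agree up to null sets.
  have hsat : chi N C.measure (C.saturation P) (C.measurableSet_saturation hP) =
      chi N C.measure (C.saturation (e.symm ⁻¹' P)) (C.measurableSet_saturation hP') := by
    refine ContinuousLinearMap.ext fun ψ ↦ ?_
    obtain ⟨φ, rfl⟩ := (rotationOp C ρ e he).surjective ψ
    rw [← hinv, rotationOp_chi]
    exact congrArg (fun A : Hilb C N →L[ℂ] Hilb C N ↦ A (rotationOp C ρ e he φ))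
      (chi_congr _ _ (by rw [saturation_preimage e hlat]; simp))
  -- The trace of A over P equals its trace over the rotated P, which has the same saturation;
  -- undoing the rotation by conjugation with U replaces A by B.
  have key : ∀ {A B : Hilb C N →L[ℂ] Hilb C N}, IsLocallyNuclear A → IsLocallyNuclear B →
      IsTranslationInvariant T A → A * U = U * B → localTrace A P hP = localTrace B P hP := by
    intro A B hA hB hAT h
    rw [localTrace_eq_of_saturation hA hAT hP hP' hr (isometry_preimage_subset e hr) hpack
      (hpack.preimage hP e he hlat) hsat]
    unfold localTrace
    rw [← tr_conj hVU (hB P hP r hr), hchi]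
    congr 1
    calc U * chi N C.measure P hP * V * A * (U * chi N C.measure P hP * V)
        = U * chi N C.measure P hP * V * (A * U) * chi N C.measure P hP * V := by
          simp only [mul_assoc]
      _ = U * chi N C.measure P hP * (V * U) * B * chi N C.measure P hP * V := by
          rw [h]; simp only [mul_assoc]
      _ = _ := by rw [hVU, mul_one]; simp only [mul_assoc]
  have h1 := key hA ((hA.smul _).add (hB.smul _)) hAT hAU
  have h2 := key hB ((hA.smul _).add (hB.smul _)) hBT hBU
  rw [localTrace_add (hA.smul _) (hB.smul _) hP hr, localTrace_smul _ hA hP hr,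
    localTrace_smul _ hB hP hr] at h1 h2
  set t := localTrace A P hP
  set u := localTrace B P hP
  have hc : (Real.cos θ : ℂ) ^ 2 + (Real.sin θ : ℂ) ^ 2 = 1 := by
    exact_mod_cast Real.cos_sq_add_sin_sq θ
  -- 2(1 - cos θ) = (1 - cos θ)² + sin² θ is the determinant of the linear system stating that the
  -- vector (t, u) is fixed by the rotation; the combinations below are Cramer's rule.
  have hne : 2 * (1 - (Real.cos θ : ℂ)) ≠ 0 := by
    refine mul_ne_zero two_ne_zero (sub_ne_zero.mpr fun h ↦ hθ ?_)
    exact_mod_cast h.symm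
  rw [Complex.ofReal_neg] at h1
  constructor
  · refine (mul_eq_zero.mp (?_ : 2 * (1 - (Real.cos θ : ℂ)) * t = 0)).resolve_left hne
    linear_combination (1 - (Real.cos θ : ℂ)) * h1 - (Real.sin θ : ℂ) * h2 - t * hc
  · refine (mul_eq_zero.mp (?_ : 2 * (1 - (Real.cos θ : ℂ)) * u = 0)).resolve_left hne
    linear_combination (1 - (Real.cos θ : ℂ)) * h2 + (Real.sin θ : ℂ) * h1 - u * hc

end Symmetry

/-! ## The inverse Liouvillian -/

section Liouvillian

variable {F : Type} [NormedAddCommGroup F] [InnerProductSpace ℂ F] [CompleteSpace F]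

theorem mul_left_cancel_of_injective {R A B : F →L[ℂ] F} (hR : Function.Injective R)
    (h : R * A = R * B) : A = B :=
  ContinuousLinearMap.ext fun x ↦ hR (congrArg (fun A : F →L[ℂ] F ↦ A x) h)

/-- An operator whose range is contained in the range of an injective operator factors through
it. -/
theorem exists_eq_mul_of_range {A R : F →L[ℂ] F} (hR : Function.Injective R)
    (h : ∀ x, ∃ y, A x = R y) : ∃ B : F →L[ℂ] F, A = R * B := by
  choose g hg using h
  let G : F →ₗ[ℂ] F :=
    { toFun := g
      map_add' := fun x y ↦ hR (by rw [← hg, map_add, map_add, ← hg, ← hg])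
      map_smul' := fun c x ↦ hR (by rw [← hg, map_smul, RingHom.id_apply, map_smul, ← hg]) }
  -- Closed graph theorem; the limits are compared after applying the injective R.
  have hG : Continuous G := by
    refine LinearMap.continuous_of_seq_closed_graph G fun u x y hu hy ↦ hR ?_
    have h1 : Tendsto (fun n ↦ A (u n)) atTop (𝓝 (A x)) := (A.continuous.tendsto x).comp hu
    have h2 : Tendsto (fun n ↦ R (g (u n))) atTop (𝓝 (R y)) := (R.continuous.tendsto y).comp hy
    simp only [← hg] at h2
    exact (tendsto_nhds_unique h2 h1).trans (hg x)
  exact ⟨⟨G, hG⟩, ContinuousLinearMap.ext hg⟩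

theorem IsResolventAt.injective {A : F →ₗ.[ℂ] F} {z : ℂ} {R : F →L[ℂ] F}
    (hR : IsResolventAt A z R) : Function.Injective R := by
  rw [injective_iff_map_eq_zero]
  intro x hx
  have h := hR.mem_graph x
  rw [hx, smul_zero, add_zero] at h
  exact eq_of_mem_graph h A.graph.zero_mem

theorem EnclosesSpectrumBelow.sphere_subset {A : F →ₗ.[ℂ] F} {μ : ℝ} {c : ℂ} {r : ℝ}
    (h : EnclosesSpectrumBelow A μ c r) : Metric.sphere c r ⊆ resolventSetOf A := by
  intro z hz
  by_contra hzA
  rcases lt_or_ge z.re μ with h1 | h1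
  · have h2 := (h.2 z hzA).1 h1
    rw [Metric.mem_ball] at h2
    exact h2.ne (Metric.mem_sphere.mp hz)
  · exact (h.2 z hzA).2 h1 (Metric.sphere_subset_closedBall hz)

theorem clm_circleIntegral {E G : Type*} [NormedAddCommGroup E] [NormedSpace ℂ E] [CompleteSpace E]
    [NormedAddCommGroup G] [NormedSpace ℂ G] [CompleteSpace G] (L : E →L[ℂ] G) {f : ℂ → E} {c : ℂ}
    {r : ℝ} (hr : 0 ≤ r) (hf : ContinuousOn f (Metric.sphere c r)) :
    L (∮ z in C(c, r), f z) = ∮ z in C(c, r), L (f z) := by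
  have h := (hf.circleIntegrable hr).out
  unfold circleIntegral
  rw [← L.intervalIntegral_comp_comm h]
  simp only [map_smul]

/-- The integrand of `(A - i) I(D)`. -/
def liouvillianIntegrand (A : F →ₗ.[ℂ] F) (P D : F →L[ℂ] F) (z : ℂ) : F →L[ℂ] F :=
  (1 + (z - Complex.I) • resolventOf A z) * (D * P - P * D) * resolventOf A z

/-- The bounded operator `(A - i) I(D)`. -/
def reducedLiouvillian (A : F →ₗ.[ℂ] F) (P : F →L[ℂ] F) (c : ℂ) (r : ℝ) (D : F →L[ℂ] F) :
    F →L[ℂ] F :=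
  (Complex.I / (2 * Real.pi)) • ∮ z in C(c, r), liouvillianIntegrand A P D z

variable {A : F →ₗ.[ℂ] F} {P : F →L[ℂ] F} {c : ℂ} {r : ℝ}

theorem continuousOn_liouvillianIntegrand (hs : Metric.sphere c r ⊆ resolventSetOf A)
    (D : F →L[ℂ] F) : ContinuousOn (liouvillianIntegrand A P D) (Metric.sphere c r) := by
  have h := continuousOn_resolventOf hs
  unfold liouvillianIntegrand
  exact ((continuousOn_const.add ((continuousOn_id.sub continuousOn_const).smul h)).mul
    continuousOn_const).mul h

/-- By the resolvent identity (A - z)⁻¹ = R(1 + (z - i)(A - z)⁻¹), and R leaves the contour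
integral. In particular the range of I(D) lies in the domain of A. -/
theorem inverseLiouvillian_eq (hr : 0 ≤ r) (hs : Metric.sphere c r ⊆ resolventSetOf A)
    {R : F →L[ℂ] F} (hR : IsResolventAt A Complex.I R) (D : F →L[ℂ] F) :
    inverseLiouvillian A P c r D = R * reducedLiouvillian A P c r D := by
  unfold inverseLiouvillian reducedLiouvillian
  rw [mul_smul_comm]
  congr 1
  have h := clm_circleIntegral (ContinuousLinearMap.mul ℂ (F →L[ℂ] F) R) hr
    (continuousOn_liouvillianIntegrand (P := P) hs D)
  simp only [ContinuousLinearMap.mul_apply'] at h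
  rw [h]
  refine circleIntegral.integral_congr hr fun z hz ↦ ?_
  have h1 : resolventOf A z = R * (1 + (z - Complex.I) • resolventOf A z) := by
    refine ContinuousLinearMap.ext fun x ↦ ?_
    have h2 := (isResolventAt_resolventOf (hs hz)).identity hR x
    rw [mul_apply_eq_comp, _root_.add_apply, map_add, _root_.smul_apply, map_smul]
    exact h2
  change resolventOf A z * ((D * P - P * D) * resolventOf A z) = _
  unfold liouvillianIntegrand
  rw [← mul_assoc, ← mul_assoc, ← mul_assoc, ← h1]

theorem reducedLiouvillian_add_smul (hr : 0 ≤ r) (hs : Metric.sphere c r ⊆ resolventSetOf A)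
    (α β : ℂ) (D D' : F →L[ℂ] F) : reducedLiouvillian A P c r (α • D + β • D') =
      α • reducedLiouvillian A P c r D + β • reducedLiouvillian A P c r D' := by
  have h1 : ∀ z, liouvillianIntegrand A P (α • D + β • D') z =
      α • liouvillianIntegrand A P D z + β • liouvillianIntegrand A P D' z := by
    intro z
    unfold liouvillianIntegrand
    have h2 : (α • D + β • D') * P - P * (α • D + β • D') =
        α • (D * P - P * D) + β • (D' * P - P * D') := by
      rw [add_mul, mul_add, smul_mul_assoc, smul_mul_assoc, mul_smul_comm, mul_smul_comm, smul_sub,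
        smul_sub]
      abel
    rw [h2, mul_add, add_mul, mul_smul_comm, mul_smul_comm, smul_mul_assoc, smul_mul_assoc]
  have hc : ∀ (α : ℂ) D, CircleIntegrable (fun z ↦ α • liouvillianIntegrand A P D z) c r :=
    fun α D ↦ ((continuousOn_liouvillianIntegrand hs D).const_smul α).circleIntegrable hr
  unfold reducedLiouvillian
  simp only [h1]
  rw [circleIntegral.integral_add (hc α D) (hc β D'),
    circleIntegral.integral_smul, circleIntegral.integral_smul, smul_add, smul_comm _ α,
    smul_comm _ β]

theorem mul_circleIntegral (hr : 0 ≤ r) (hs : Metric.sphere c r ⊆ resolventSetOf A)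
    (V D : F →L[ℂ] F) : V * reducedLiouvillian A P c r D = (Complex.I / (2 * Real.pi)) •
      ∮ z in C(c, r), V * liouvillianIntegrand A P D z := by
  unfold reducedLiouvillian
  rw [mul_smul_comm]
  congr 1
  exact clm_circleIntegral (ContinuousLinearMap.mul ℂ (F →L[ℂ] F) V) hr
    (continuousOn_liouvillianIntegrand (P := P) hs D)

theorem circleIntegral_mul (hr : 0 ≤ r) (hs : Metric.sphere c r ⊆ resolventSetOf A)
    (V D : F →L[ℂ] F) : reducedLiouvillian A P c r D * V = (Complex.I / (2 * Real.pi)) •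
      ∮ z in C(c, r), liouvillianIntegrand A P D z * V := by
  unfold reducedLiouvillian
  rw [smul_mul_assoc]
  congr 1
  exact clm_circleIntegral ((ContinuousLinearMap.mul ℂ (F →L[ℂ] F)).flip V) hr
    (continuousOn_liouvillianIntegrand (P := P) hs D)

theorem reducedLiouvillian_mul (hr : 0 ≤ r) (hs : Metric.sphere c r ⊆ resolventSetOf A)
    {V D D' : F →L[ℂ] F} (hV : ∀ z ∈ resolventSetOf A, Commute V (resolventOf A z))
    (hVP : Commute V P) (h : D * V = V * D') :
    reducedLiouvillian A P c r D * V = V * reducedLiouvillian A P c r D' := by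
  rw [mul_circleIntegral hr hs, circleIntegral_mul hr hs]
  congr 1
  refine circleIntegral.integral_congr hr fun z hz ↦ ?_
  have h1 := (hV z (hs hz)).eq
  have h2 : Commute V (1 + (z - Complex.I) • resolventOf A z) :=
    (Commute.one_right V).add_right ((hV z (hs hz)).smul_right _)
  have h3 : (D * P - P * D) * V = V * (D' * P - P * D') := by
    rw [sub_mul, mul_sub, mul_assoc, ← hVP.eq, ← mul_assoc, h, mul_assoc P, h, ← mul_assoc P,
      ← hVP.eq, mul_assoc, mul_assoc]
  dsimp only [liouvillianIntegrand]
  rw [mul_assoc, ← h1, ← mul_assoc, mul_assoc _ _ V, h3, ← mul_assoc, ← h2.eq]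
  simp only [mul_assoc]

/-- The inverse Liouvillian is off-diagonal. -/
theorem reducedLiouvillian_offDiagonal (hr : 0 ≤ r) (hs : Metric.sphere c r ⊆ resolventSetOf A)
    (hP : P * P = P) (hPR : ∀ z ∈ resolventSetOf A, Commute P (resolventOf A z)) (D : F →L[ℂ] F) :
    reducedLiouvillian A P c r D =
      P * reducedLiouvillian A P c r D + reducedLiouvillian A P c r D * P := by
  have hc := continuousOn_liouvillianIntegrand (P := P) hs D
  have h4 : CircleIntegrable (fun z ↦ P * liouvillianIntegrand A P D z) c r :=
    (continuousOn_const.mul hc).circleIntegrable hr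
  have h5 : CircleIntegrable (fun z ↦ liouvillianIntegrand A P D z * P) c r :=
    (hc.mul continuousOn_const).circleIntegrable hr
  rw [mul_circleIntegral hr hs, circleIntegral_mul hr hs, ← smul_add,
    ← circleIntegral.integral_add h4 h5]
  unfold reducedLiouvillian
  congr 1
  refine circleIntegral.integral_congr hr fun z hz ↦ ?_
  have h1 := (hPR z (hs hz)).eq
  have h2 : Commute P (1 + (z - Complex.I) • resolventOf A z) :=
    (Commute.one_right P).add_right ((hPR z (hs hz)).smul_right _)
  -- A commutator with a projection is off-diagonal, and the resolvents on both sides commute with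
  -- P.
  have h3 : D * P - P * D = P * (D * P - P * D) + (D * P - P * D) * P := by
    rw [mul_sub, sub_mul, ← mul_assoc P P, hP, mul_assoc D P P, hP, mul_assoc P D P]
    abel
  dsimp only [liouvillianIntegrand]
  rw [mul_assoc _ (resolventOf A z) P, ← h1, ← mul_assoc P, ← mul_assoc P, h2.eq,
    mul_assoc _ P (D * P - P * D), ← mul_assoc _ P (resolventOf A z), mul_assoc _ (D * P - P * D) P, ← add_mul,
    ← mul_add, ← h3]

end Liouvillian

/-! ## The spin rotation and the conventional current -/

section Transport

variable {d N : ℕ} {C : Crystal d} {T : MagneticCocycle C N} {H₀ : Hilb C N →ₗ.[ℂ] Hilb C N}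
  {Hk : Pos d → HilbFiber C N →ₗ.[ℂ] HilbFiber C N} {μ : ℝ}

theorem CommutesWith.commute_resolventOf {F : Type} [NormedAddCommGroup F] [InnerProductSpace ℂ F]
    {A : F →ₗ.[ℂ] F} {V : F →L[ℂ] F} (hV : CommutesWith A V) {z : ℂ} {R : F →L[ℂ] F}
    (hR : IsResolventAt A z R) : Commute V R :=
  ContinuousLinearMap.ext fun ψ ↦ (hR.commute hV ψ).symm

theorem commute_cfc {F : Type} [NormedAddCommGroup F] [InnerProductSpace ℂ F] [CompleteSpace F]
    {V B : F →L[ℂ] F} (h : Commute V B) (f : ℝ → ℝ) : Commute V (cfc f B) :=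
  (h.symm.cfc_real f).symm

theorem IsGappedPeriodicHamiltonian.commute_projection
    (hH : IsGappedPeriodicHamiltonian T H₀ Hk μ) {V : Hilb C N →L[ℂ] Hilb C N}
    (hV : CommutesWith H₀ V) : Commute V (spectralProjectionBelow H₀ μ) :=
  commute_cfc (hV.commute_resolventOf hH.isResolventAt) negStep

theorem IsPeriodic.commutesWith {A : Hilb C N →ₗ.[ℂ] Hilb C N} (h : IsPeriodic T A) (γ : C.lattice) :
    CommutesWith A (translationOp T γ) := by
  intro x y hxy
  have h1 : (x, translationOp T γ y) ∈ (pcomp (ofCLM (translationOp T γ)) A).graph :=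
    mem_graph_pcomp.mpr ⟨y, hxy, mem_graph_ofCLM.mpr rfl⟩
  rw [← h γ, mem_graph_pcomp] at h1
  obtain ⟨z, hz, hzy⟩ := h1
  rw [mem_graph_ofCLM] at hz
  rwa [← hz]

theorem IsRotationInvariant.commutesWith {U : Hilb C N ≃L[ℂ] Hilb C N}
    {A : Hilb C N →ₗ.[ℂ] Hilb C N} (h : IsRotationInvariant U A) :
    CommutesWith A (U : Hilb C N →L[ℂ] Hilb C N) := by
  intro x y hxy
  rw [← h, mem_graph_pcomp] at hxy
  obtain ⟨z, hz, hzy⟩ := hxy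
  obtain ⟨w, hw, hwz⟩ := mem_graph_pcomp.mp hz
  rw [mem_graph_ofCLM] at hw hzy
  have h1 : (U : Hilb C N →L[ℂ] Hilb C N) y = z := by
    rw [hzy]
    exact U.apply_symm_apply z
  rw [h1, ← hw]
  exact hwz

theorem compress_ofCLM {Ω : Set (Pos d)} (hΩ : MeasurableSet Ω) (B : Hilb C N →L[ℂ] Hilb C N) :
    compress Ω hΩ (ofCLM B) = ofCLM (chi N C.measure Ω hΩ * B * chi N C.measure Ω hΩ) :=
  eq_ofCLM fun _ ↦ mem_graph_pcomp.mpr ⟨_, mem_graph_pcomp.mpr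
    ⟨_, mem_graph_ofCLM.mpr rfl, mem_graph_ofCLM.mpr rfl⟩, mem_graph_ofCLM.mpr rfl⟩

/-- The bounded operator `Q` is the spin operator in the image of the resolvent. -/
theorem IsGappedPeriodicHamiltonian.exists_spin_factor (hC : C.IsPrimitiveCell C.a)
    (hH : IsGappedPeriodicHamiltonian T H₀ Hk μ) {s : Spin N →L[ℂ] Spin N} (hs : IsSpin T (Hk 0) s)
    {R : Hilb C N →L[ℂ] Hilb C N} (hR : IsResolventAt H₀ Complex.I R) :
    ∃ Q, spinOp C.measure s * R = R * Q := by
  obtain ⟨K, -, hK⟩ := hH.exists_spinOp_mem_graph hC hs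
  refine exists_eq_mul_of_range hR.injective fun x ↦ ?_
  obtain ⟨w, hw, -⟩ := hK _ _ (hR.mem_graph x)
  exact ⟨_, (hR.apply_sub hw).symm⟩

/-- The gap factors the projection through the resolvent at μ, and the resolvent identity factors
the latter through R. -/
theorem IsGappedPeriodicHamiltonian.exists_projection_factor
    (hH : IsGappedPeriodicHamiltonian T H₀ Hk μ) {R : Hilb C N →L[ℂ] Hilb C N}
    (hR : IsResolventAt H₀ Complex.I R) :
    ∃ Q, spectralProjectionBelow H₀ μ = R * Q := by
  obtain ⟨c, hc⟩ := hH.exists_hasGap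
  obtain ⟨g, hg⟩ := hc.exists_factor
  refine exists_eq_mul_of_range hR.injective fun x ↦
    ⟨g x + ((μ : ℂ) - Complex.I) • resolventOf H₀ μ (g x), ?_⟩
  have h1 : spectralProjectionBelow H₀ μ x = resolventOf H₀ μ (g x) :=
    congrArg (fun A : Hilb C N →L[ℂ] Hilb C N ↦ A x) hg
  rw [h1, map_add, map_smul]
  exact hH.isResolventAt.identity hR (g x)

theorem IsGappedPeriodicHamiltonian.isStarProjection (hH : IsGappedPeriodicHamiltonian T H₀ Hk μ) :
    IsStarProjection (spectralProjectionBelow H₀ μ) := by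
  obtain ⟨c, hc⟩ := hH.exists_hasGap
  exact ⟨hc.cfc_mul_self, HasGap.isSelfAdjoint_cfc⟩

/-- H₀ S R - S H₀ R = (Q + i S R) - S(1 + i R) = Q - S, where S R = R Q is used to apply H₀. -/
theorem spinRotation_eq {s : Spin N →L[ℂ] Spin N} {R Q : Hilb C N →L[ℂ] Hilb C N}
    (hR : IsResolventAt H₀ Complex.I R) (hQ : spinOp C.measure s * R = R * Q)
    (K : Hilb C N →L[ℂ] Hilb C N) :
    spinRotation H₀ s (R * K) = ofCLM (Complex.I • ((Q - spinOp C.measure s) * K)) := by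
  refine eq_ofCLM fun f ↦ mem_graph_smul (mem_graph_pcomp.mpr
    ⟨R (K f), mem_graph_ofCLM.mpr rfl, mem_graph_pcomm.mpr ?_⟩)
  have h1 : spinOp C.measure s (R (K f)) = R (Q (K f)) :=
    congrArg (fun A : Hilb C N →L[ℂ] Hilb C N ↦ A (K f)) hQ
  refine ⟨_, _, Q (K f) + Complex.I • R (Q (K f)), _, mem_graph_ofCLM.mpr rfl, ?_,
    hR.mem_graph (K f), mem_graph_ofCLM.mpr rfl, ?_⟩
  · rw [h1]
    exact hR.mem_graph _
  · change Q (K f) - spinOp C.measure s (K f) = _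
    rw [map_add, map_smul, h1]
    abel

/-- In the first term S is moved through the resolvent, S R = R Q, so that in both terms the
velocity acts on the range of R, where it is W. -/
theorem conventionalCurrent_eq {h₀ : HilbFiber C N →ₗ.[ℂ] HilbFiber C N} {s : Spin N →L[ℂ] Spin N}
    {R Q P K W : Hilb C N →L[ℂ] Hilb C N} (hQ : spinOp C.measure s * R = R * Q) (hK : P = R * K)
    {i : Fin d} (hW : ∀ f, (R f, W f) ∈ (velocityCommutator T H₀ h₀ i).graph) :
    pcomp (conventionalCurrent T H₀ h₀ s i) (ofCLM P) =
      ofCLM ((1 / 2 : ℂ) • Complex.I • ((W * Q + spinOp C.measure s * W) * K)) := by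
  refine eq_ofCLM fun f ↦ mem_graph_pcomp.mpr ⟨R (K f), ?_, ?_⟩
  · rw [hK]
    exact mem_graph_ofCLM.mpr rfl
  · have h1 : spinOp C.measure s (R (K f)) = R (Q (K f)) :=
      congrArg (fun A : Hilb C N →L[ℂ] Hilb C N ↦ A (K f)) hQ
    refine mem_graph_smul (z := (Complex.I • ((W * Q + spinOp C.measure s * W) * K)) f) ?_
    refine mem_graph_add.mpr ⟨Complex.I • W (Q (K f)), Complex.I • spinOp C.measure s (W (K f)),
      mem_graph_smul (mem_graph_pcomp.mpr ⟨R (Q (K f)), mem_graph_ofCLM.mpr h1.symm, hW _⟩),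
      mem_graph_smul (mem_graph_pcomp.mpr ⟨W (K f), hW _, mem_graph_ofCLM.mpr rfl⟩), ?_⟩
    rw [← smul_add]
    rfl

/-- The velocity is a commutator of the position with the resolvent. -/
theorem isPositionCommutator_velocity {R W : Hilb C N →L[ℂ] Hilb C N}
    (hR : IsResolventAt H₀ Complex.I R) {l : Fin d}
    (hW : ∀ f η, (f, η) ∈ (positionOp N C.measure l).graph → ∃ ζ,
      (R f, ζ) ∈ (positionOp N C.measure l).graph ∧ (ζ, W f + (η + Complex.I • ζ)) ∈ H₀.graph) :
    IsPositionCommutator l R (R * W) := by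
  intro f η h
  obtain ⟨ζ, h1, h2⟩ := hW f η h
  have h3 := hR.apply_sub h2
  rw [← add_assoc, add_sub_cancel_right, map_add] at h3
  rw [mul_apply_eq_comp, h3]
  exact h1

/-- The rule for commutators is applied to [X_l, R] = R W; then V passes through R, and the
injective R is cancelled. -/
theorem velocity_mul {R V W W' W'' : Hilb C N →L[ℂ] Hilb C N} (hR : IsResolventAt H₀ Complex.I R)
    {l m n : Fin d} {α β κ : ℂ} (hV : IntertwinesPosition V l m n α β κ) (hVR : Commute V R)
    (hW : IsPositionCommutator l R (R * W)) (hW' : IsPositionCommutator m R (R * W'))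
    (hW'' : IsPositionCommutator n R (R * W'')) : W * V = V * (α • W' + β • W'') := by
  have h := hV.commutator_mul hVR hW hW' hW''
  refine mul_left_cancel_of_injective hR.injective ?_
  rw [← mul_assoc, h, ← mul_smul_comm, ← mul_smul_comm, ← mul_add, ← mul_assoc, ← mul_assoc, hVR.eq]

/-- Cancellation of the injective R lets the auxiliary factors Q, K and W inherit the symmetries of
H₀, S and the commutators. -/
theorem commute_of_mul_eq {R Q S V : Hilb C N →L[ℂ] Hilb C N} (hR : Function.Injective R)
    (h : S = R * Q) (hVR : Commute V R) (hVS : Commute V S) : Commute V Q := by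
  refine mul_left_cancel_of_injective hR ?_
  rw [← mul_assoc, ← mul_assoc, ← hVR.eq, mul_assoc, ← h, hVS.eq]

/-- The bounded operator which gives the spin rotation of the first order response to `D`. -/
def spinRotationBounded (H₀ : Hilb C N →ₗ.[ℂ] Hilb C N) (μ : ℝ) (c : ℂ) (r : ℝ)
    (s : Spin N →L[ℂ] Spin N) (Q D : Hilb C N →L[ℂ] Hilb C N) : Hilb C N →L[ℂ] Hilb C N :=
  Complex.I • ((Q - spinOp C.measure s) *
    reducedLiouvillian H₀ (spectralProjectionBelow H₀ μ) c r D)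

/-- The bounded operator which gives the conventional current in the state `R K`, where `W` is the
velocity. -/
def currentBounded (s : Spin N →L[ℂ] Spin N) (Q K W : Hilb C N →L[ℂ] Hilb C N) :
    Hilb C N →L[ℂ] Hilb C N :=
  (1 / 2 : ℂ) • Complex.I • ((W * Q + spinOp C.measure s * W) * K)

theorem spinRotationBounded_mul {c : ℂ} {r : ℝ} (hcr : EnclosesSpectrumBelow H₀ μ c r)
    (hH : IsGappedPeriodicHamiltonian T H₀ Hk μ) {s : Spin N →L[ℂ] Spin N}
    {Q V D D' D'' : Hilb C N →L[ℂ] Hilb C N} {α β : ℂ} (hV : CommutesWith H₀ V)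
    (hVS : Commute V (spinOp C.measure s)) (hVQ : Commute V Q)
    (h : D * V = V * (α • D' + β • D'')) : spinRotationBounded H₀ μ c r s Q D * V =
      V * (α • spinRotationBounded H₀ μ c r s Q D' + β • spinRotationBounded H₀ μ c r s Q D'') := by
  have h1 := reducedLiouvillian_mul hcr.1.le hcr.sphere_subset
    (fun z hz ↦ hV.commute_resolventOf (isResolventAt_resolventOf hz)) (hH.commute_projection hV) h
  rw [reducedLiouvillian_add_smul hcr.1.le hcr.sphere_subset] at h1
  unfold spinRotationBounded
  rw [smul_mul_assoc, mul_assoc, h1, ← mul_assoc, ← (hVQ.sub_right hVS).eq, mul_assoc]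
  simp only [mul_add, mul_smul_comm, smul_add]
  rw [smul_comm Complex.I α, smul_comm Complex.I β]

theorem currentBounded_mul {s : Spin N →L[ℂ] Spin N} {Q K V W W' W'' : Hilb C N →L[ℂ] Hilb C N}
    {α β : ℂ} (hVS : Commute V (spinOp C.measure s)) (hVQ : Commute V Q) (hVK : Commute V K)
    (h : W * V = V * (α • W' + β • W'')) : currentBounded s Q K W * V =
      V * (α • currentBounded s Q K W' + β • currentBounded s Q K W'') := by
  have h1 : (W * Q + spinOp C.measure s * W) * V =
      V * (α • (W' * Q + spinOp C.measure s * W') + β • (W'' * Q + spinOp C.measure s * W'')) := by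
    rw [add_mul, mul_assoc, ← hVQ.eq, ← mul_assoc, mul_assoc _ W V, h, ← mul_assoc _ V, ← hVS.eq]
    simp only [mul_add, add_mul, mul_smul_comm, smul_mul_assoc, mul_assoc, smul_add]
    abel
  unfold currentBounded
  rw [smul_mul_assoc, smul_mul_assoc, mul_assoc, ← hVK.eq, ← mul_assoc, h1]
  simp only [mul_add, add_mul, mul_smul_comm, smul_mul_assoc, mul_assoc, smul_add,
    smul_comm Complex.I α, smul_comm Complex.I β, smul_comm (1 / 2 : ℂ) α, smul_comm (1 / 2 : ℂ) β]

end Transport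

/-! ## The main theorem -/

section Main

variable {d N : ℕ} {C : Crystal d} {T : MagneticCocycle C N} {H₀ : Hilb C N →ₗ.[ℂ] Hilb C N}
  {Hk : Pos d → HilbFiber C N →ₗ.[ℂ] HilbFiber C N} {μ : ℝ}

theorem Crystal.exists_finset_repr_le (C : Crystal d) (l : ℝ) :
    ∃ F : Finset C.lattice, ∀ γ : C.lattice, γ ∈ F ↔ ∀ j, |C.a.repr (γ : Pos d) j| ≤ l := by
  have h : {γ : C.lattice | ∀ j, |C.a.repr (γ : Pos d) j| ≤ l}.Finite := by
    refine (C.finite_lattice_norm_le (∑ j, |l| * ‖C.a j‖)).subset fun γ hγ ↦ ?_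
    change ‖(γ : Pos d)‖ ≤ _
    rw [← C.a.sum_repr (γ : Pos d)]
    refine (norm_sum_le _ _).trans (Finset.sum_le_sum fun j _ ↦ ?_)
    rw [norm_smul]
    exact mul_le_mul_of_nonneg_right ((hγ j).trans (le_abs_self _)) (norm_nonneg _)
  exact ⟨h.toFinset, fun γ ↦ h.mem_toFinset⟩

/-- If the local traces over the pieces vanish, so do those over the cells of odd side length. -/
theorem localTrace_cell_eq_zero {B : Hilb C N →L[ℂ] Hilb C N} (hB : IsLocallyNuclear B)
    (hT : IsTranslationInvariant T B) (hC : C.IsPrimitiveCell C.a)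
    {b : Module.Basis (Fin d) ℝ (Pos d)} (hb : C.IsLatticeBasis b) (hbC : C.IsPrimitiveCell b)
    (h : ∀ γ, localTrace B (C.piece b γ) (C.measurableSet_piece b γ) = 0) (l : ℕ) :
    localTrace B (C.cell C.a (2 * l + 1)) (C.measurableSet_cell C.a (2 * l + 1)) = 0 := by
  obtain ⟨r, hr⟩ := C.exists_cell_subset C.a 1
  obtain ⟨r', hr'⟩ := C.exists_cell_subset b 1
  obtain ⟨r'', hr''⟩ := C.exists_cell_subset C.a (2 * l + 1)
  have hm := C.measurableSet_cell C.a 1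
  have hm' := C.measurableSet_cell b 1
  -- The cell is cut by the translates of the second cell, and C_1 ∩ (C̃_1 + γ) = P_γ + γ.
  have h1 : localTrace B (C.cell C.a 1) hm = 0 := by
    have h2 := chi_eq_sum_translate (N := N) (F := (C.finite_lattice_norm_le (r + r')).toFinset) hm
      hm' hr hr' hbC ((C.ae_mem_saturation_cell hb).mono fun x h _ ↦ h)
      fun γ hγ ↦ (Set.Finite.mem_toFinset _).mpr hγ
    rw [localTrace_eq_sum hB hm (fun γ ↦ hm.inter (C.measurableSet_translate γ hm')) hr
      (fun γ _ ↦ Set.inter_subset_left) h2]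
    refine Finset.sum_eq_zero fun γ _ ↦ ?_
    rw [← h γ, ← localTrace_translate hB hT γ (C.measurableSet_piece b γ)
      (Set.inter_subset_right.trans hr')]
    refine localTrace_congr _ _ ?_
    ext x
    simp [Crystal.mem_translate, Crystal.piece]
  obtain ⟨F, hF⟩ := C.exists_finset_repr_le l
  have hsub : ∀ γ ∈ F, C.translate γ (C.cell C.a 1) ⊆ C.cell C.a (2 * l + 1) := by
    intro γ hγ x hx
    refine ⟨(C.sub_mem_iff γ x).mp hx.1, fun j ↦ ?_⟩
    have h3 := hx.2 j
    have h4 := (hF γ).mp hγ j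
    rw [map_sub, Finsupp.sub_apply] at h3
    calc |C.a.repr x j| = |(C.a.repr x j - C.a.repr (γ : Pos d) j) + C.a.repr (γ : Pos d) j| := by
          rw [sub_add_cancel]
      _ ≤ 1 / 2 + l := (abs_add_le _ _).trans (add_le_add h3 h4)
      _ = (2 * l + 1) / 2 := by ring
  have h5 : chi N C.measure (C.cell C.a (2 * l + 1)) (C.measurableSet_cell C.a (2 * l + 1)) =
      ∑ γ ∈ F, chi N C.measure (C.translate γ (C.cell C.a 1)) (C.measurableSet_translate γ hm) := by
    refine chi_eq_sum _ (fun γ ↦ C.measurableSet_translate γ hm) ?_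
    filter_upwards [Crystal.IsPacking.ae_unique C hC hm] with x hx
    refine ⟨fun hxL ↦ ?_, fun hxL γ hγ hxγ ↦ hxL (hsub γ hγ hxγ)⟩
    obtain ⟨γ, hγ, hγx⟩ := C.exists_sub_mem_cell C.isLatticeBasis_self l hxL
    exact ⟨γ, (hF γ).mpr hγ, hγx, fun η _ hη ↦ hx η γ hη hγx⟩
  rw [localTrace_eq_sum hB _ (fun γ ↦ C.measurableSet_translate γ hm) hr'' hsub h5]
  refine Finset.sum_eq_zero fun γ _ ↦ ?_
  rw [localTrace_translate hB hT γ hm hr, h1]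

theorem hasTrace_compress {B : Hilb C N →L[ℂ] Hilb C N} (hB : IsLocallyNuclear B)
    {Ω : Set (Pos d)} (hΩ : MeasurableSet Ω) {r : ℝ} (hr : Ω ⊆ Metric.closedBall 0 r) :
    HasTrace (compress Ω hΩ (ofCLM B)) (localTrace B Ω hΩ) :=
  hasTrace_of_nuclear (compress_ofCLM hΩ B) (hB Ω hΩ r hr)

theorem hasTracePerUnitVolume_zero {B : Hilb C N →L[ℂ] Hilb C N} (hB : IsLocallyNuclear B)
    (h : ∀ l : ℕ,
      localTrace B (C.cell C.a (2 * l + 1)) (C.measurableSet_cell C.a (2 * l + 1)) = 0) :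
    HasTracePerUnitVolume (ofCLM B) 0 := by
  refine ⟨fun K hK ↦ ?_, fun _ ↦ 0, fun l ↦ ?_, by simp⟩
  · obtain ⟨r, hr⟩ := hK.isBounded.subset_closedBall 0
    exact ⟨_, hasTrace_compress hB hK.measurableSet hr⟩
  · obtain ⟨r, hr⟩ := C.exists_cell_subset C.a (2 * l + 1)
    have h1 := hasTrace_compress hB (C.measurableSet_cell C.a (2 * l + 1)) hr
    rwa [h l] at h1

/-- Off-diagonality splits the reduced Liouvillian into Π₀𝓛 + 𝓛Π₀, so each summand has a factor Π₀
between periodic operators. -/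
theorem isLocallyNuclear_spinRotationBounded (hC : C.IsPrimitiveCell C.a)
    (hH : IsGappedPeriodicHamiltonian T H₀ Hk μ) {c : ℂ} {r : ℝ}
    (hcr : EnclosesSpectrumBelow H₀ μ c r) {s : Spin N →L[ℂ] Spin N}
    {Q D : Hilb C N →L[ℂ] Hilb C N} (hQ : IsTranslationInvariant T (Q - spinOp C.measure s))
    (hP : IsTranslationInvariant T (spectralProjectionBelow H₀ μ))
    (hL : IsTranslationInvariant T
      (reducedLiouvillian H₀ (spectralProjectionBelow H₀ μ) c r D)) :
    IsLocallyNuclear (spinRotationBounded H₀ μ c r s Q D) := by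
  have hPp := hH.isStarProjection
  have hHS := hH.isHS_projection_chi hC
  unfold spinRotationBounded
  have h1 : ∀ z ∈ resolventSetOf H₀, Commute (spectralProjectionBelow H₀ μ) (resolventOf H₀ z) := by
    intro z hz
    refine (commute_cfc ?_ negStep).symm
    exact ContinuousLinearMap.ext fun x ↦
      (isResolventAt_resolventOf hz).commutesWith hH.isResolventAt x
  rw [reducedLiouvillian_offDiagonal hcr.1.le hcr.sphere_subset hPp.isIdempotentElem h1, mul_add]
  refine IsLocallyNuclear.smul _ (IsLocallyNuclear.add ?_ ?_)
  · rw [← mul_assoc]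
    exact isLocallyNuclear_mul_mul hC hPp hP hQ hL hHS
  · rw [← mul_assoc, ← mul_one (_ * spectralProjectionBelow H₀ μ)]
    exact isLocallyNuclear_mul_mul hC hPp hP (hQ.mul hL) IsTranslationInvariant.one hHS

/-- R K = Π₀ is idempotent and R is injective, so K = KΠ₀; this supplies the factor Π₀. -/
theorem isLocallyNuclear_currentBounded (hC : C.IsPrimitiveCell C.a)
    (hH : IsGappedPeriodicHamiltonian T H₀ Hk μ) {s : Spin N →L[ℂ] Spin N}
    {R Q K W : Hilb C N →L[ℂ] Hilb C N} (hR : Function.Injective R)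
    (hK : spectralProjectionBelow H₀ μ = R * K)
    (hP : IsTranslationInvariant T (spectralProjectionBelow H₀ μ))
    (hT : IsTranslationInvariant T ((W * Q + spinOp C.measure s * W) * K)) :
    IsLocallyNuclear (currentBounded s Q K W) := by
  have hPp := hH.isStarProjection
  have h1 : K = K * spectralProjectionBelow H₀ μ := by
    refine mul_left_cancel_of_injective hR ?_
    rw [← mul_assoc, ← hK, hPp.isIdempotentElem.eq]
  refine IsLocallyNuclear.smul _ (IsLocallyNuclear.smul _ ?_)
  rw [h1, ← mul_assoc, ← mul_one (_ * spectralProjectionBelow H₀ μ)]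
  exact isLocallyNuclear_mul_mul hC hPp hP hT IsTranslationInvariant.one (hH.isHS_projection_chi hC)

theorem planeRotation_apply_left (θ : ℝ) {i j : Fin d} (hij : i ≠ j) (x : Pos d) :
    planeRotation θ hij x i = Real.cos θ * x i + -Real.sin θ * x j := by
  change rotationLinear θ i j x i = _
  simp only [rotationLinear, LinearMap.coe_mk, AddHom.coe_mk, if_true]
  ring

theorem planeRotation_apply_right (θ : ℝ) {i j : Fin d} (hij : i ≠ j) (x : Pos d) :
    planeRotation θ hij x j = Real.sin θ * x i + Real.cos θ * x j := by
  change rotationLinear θ i j x j = _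
  simp [rotationLinear, hij.symm]

theorem cos_two_pi_div_ne_one {n : ℕ} (hn : 2 ≤ n) : Real.cos (2 * Real.pi / n) ≠ 1 := by
  have hn' : (2 : ℝ) ≤ n := by exact_mod_cast hn
  have hpi := Real.pi_pos
  have h0 : 0 < 2 * Real.pi / n := by positivity
  intro h
  rw [Real.cos_eq_one_iff_of_lt_of_lt (by linarith)
    (by rw [div_lt_iff₀ (by linarith)]; nlinarith)] at h
  exact h0.ne' h

end Main

end SpinTransport

end

open SpinTransport

theorem propositionA3 {d N : ℕ} (C : Crystal d) (T : MagneticCocycle C N)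
    (hC : C.IsPrimitiveCell C.a)
    (b : Module.Basis (Fin d) ℝ (Pos d)) (hb : C.IsLatticeBasis b)
    (hbC : C.IsPrimitiveCell b)
    -- the unperturbed Hamiltonian, its fibers, the Fermi energy and the spin operator
    (H₀ : Hilb C N →ₗ.[ℂ] Hilb C N) (Hk : Pos d → HilbFiber C N →ₗ.[ℂ] HilbFiber C N) (μ : ℝ)
    (hH : IsGappedPeriodicHamiltonian T H₀ Hk μ)
    (s : Spin N →L[ℂ] Spin N) (hs : IsSpin T (Hk 0) s)
    -- the contour in the definition of `Π₁`
    (c : ℂ) (r : ℝ) (hcr : EnclosesSpectrumBelow H₀ μ c r)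
    -- the rotation symmetry
    (i j : Fin d) (hij : i ≠ j) (n : ℕ) (hn : 2 ≤ n)
    (hlattice : ∀ x, x ∈ C.lattice ↔ planeRotation (2 * Real.pi / n) hij x ∈ C.lattice)
    (hX : ∀ x, x ∈ C.X ↔ planeRotation (2 * Real.pi / n) hij x ∈ C.X)
    (ρ : unitary (Spin N →L[ℂ] Spin N))
    (hpieces : ∀ γ : C.lattice,
      IsRotationInvariant (rotationOp C ρ (planeRotation (2 * Real.pi / n) hij) hX)
        (ofCLM (chi N C.measure (C.saturation (C.piece b γ))
          (C.measurableSet_saturation (C.measurableSet_piece b γ)))))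
    (hHrot : IsRotationInvariant (rotationOp C ρ (planeRotation (2 * Real.pi / n) hij) hX) H₀)
    (hsrot : ((ρ⁻¹ : unitary (Spin N →L[ℂ] Spin N)) : Spin N →L[ℂ] Spin N) ∘L s ∘L
      (ρ : Spin N →L[ℂ] Spin N) = s) :
    (∃ P₁ : Hilb C N →L[ℂ] Hilb C N, IsFirstOrderNEASS T H₀ μ j c r P₁ ∧
      ∀ γ : C.lattice,
        HasTrace (compress (C.piece b γ) (C.measurableSet_piece b γ) (spinRotation H₀ s P₁)) 0) ∧
    HasTracePerUnitVolume
      (pcomp (conventionalCurrent T H₀ (Hk 0) s i) (ofCLM (spectralProjectionBelow H₀ μ))) 0 := by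
  set e := planeRotation (2 * Real.pi / n) hij with he
  set U : Hilb C N →L[ℂ] Hilb C N := (rotationOp C ρ e hX : Hilb C N →L[ℂ] Hilb C N) with hU
  have hcos := cos_two_pi_div_ne_one hn
  obtain ⟨R, hR⟩ := exists_isResolventAt_I hH.selfAdjoint
  obtain ⟨Q, hQ⟩ := hH.exists_spin_factor hC hs hR
  obtain ⟨K, hK⟩ := hH.exists_projection_factor hR
  obtain ⟨D, hDcl, hD⟩ := hH.exists_projection_commutator hC j
  -- The rotation mixes the directions i and j, so the commutators in both directions are needed,
  -- although the claims concern D in direction j and W in direction i only.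
  obtain ⟨D', -, hD'⟩ := hH.exists_projection_commutator hC i
  obtain ⟨W, hWv, hW⟩ := hH.exists_velocity hC hR i
  obtain ⟨W', -, hW'⟩ := hH.exists_velocity hC hR j
  have hWc := isPositionCommutator_velocity hR hW
  have hWc' := isPositionCommutator_velocity hR hW'
  -- bounded operators which commute with `H₀` and `S`
  have hcomm : ∀ {V}, CommutesWith H₀ V → Commute V (spinOp C.measure s) →
      Commute V R ∧ Commute V (spectralProjectionBelow H₀ μ) ∧ Commute V Q ∧ Commute V K := by
    intro V hV hVS
    have h1 := hV.commute_resolventOf hR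
    have h2 := hH.commute_projection hV
    exact ⟨h1, h2, commute_of_mul_eq hR.injective hQ h1 (hVS.mul_right h1),
      commute_of_mul_eq hR.injective hK h1 h2⟩
  have hTH : ∀ γ, CommutesWith H₀ (translationOp T γ) := hH.periodic.commutesWith
  have hTS : IsTranslationInvariant T (spinOp C.measure s) := fun γ ↦
    ContinuousLinearMap.ext fun ψ ↦ hs.translationOp_spinOp γ ψ
  have hTR : IsTranslationInvariant T R := fun γ ↦ (hcomm (hTH γ) (hTS γ)).1
  have hTP : IsTranslationInvariant T (spectralProjectionBelow H₀ μ) :=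
    fun γ ↦ (hcomm (hTH γ) (hTS γ)).2.1
  have hTQ : IsTranslationInvariant T Q := fun γ ↦ (hcomm (hTH γ) (hTS γ)).2.2.1
  have hTK : IsTranslationInvariant T K := fun γ ↦ (hcomm (hTH γ) (hTS γ)).2.2.2
  have hUH : CommutesWith H₀ U := hHrot.commutesWith
  have hUS : Commute U (spinOp C.measure s) := by
    refine ContinuousLinearMap.ext fun ψ ↦ rotationOp_spinOp ρ e hX (fun v ↦ ?_) ψ
    have h1 : ((ρ * ρ⁻¹ : unitary (Spin N →L[ℂ] Spin N)) : Spin N →L[ℂ] Spin N) = 1 := by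
      rw [mul_inv_cancel]
      rfl
    have h2 := congrArg (fun A : Spin N →L[ℂ] Spin N ↦ (ρ : Spin N →L[ℂ] Spin N) (A v)) hsrot
    have h3 := congrArg (fun A : Spin N →L[ℂ] Spin N ↦ A (s ((ρ : Spin N →L[ℂ] Spin N) v))) h1
    exact h3.symm.trans h2
  obtain ⟨hUR, hUP, hUQ, hUK⟩ := hcomm hUH hUS
  -- the symmetries of the commutators with the position operators
  have hXi : IntertwinesPosition U i i j (Real.cos (2 * Real.pi / n) : ℝ)
      (-Real.sin (2 * Real.pi / n) : ℝ) 0 :=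
    intertwinesPosition_rotationOp ρ e hX (planeRotation_apply_left _ hij)
  have hXj : IntertwinesPosition U j i j (Real.sin (2 * Real.pi / n) : ℝ)
      (Real.cos (2 * Real.pi / n) : ℝ) 0 :=
    intertwinesPosition_rotationOp ρ e hX (planeRotation_apply_right _ hij)
  have hTL : ∀ {l : Fin d} {D : Hilb C N →L[ℂ] Hilb C N},
      IsPositionCommutator l (spectralProjectionBelow H₀ μ) D → IsTranslationInvariant T
        (reducedLiouvillian H₀ (spectralProjectionBelow H₀ μ) c r D) := fun {l D} hD γ ↦
    (reducedLiouvillian_mul hcr.1.le hcr.sphere_subset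
      (fun z hz ↦ (hTH γ).commute_resolventOf (isResolventAt_resolventOf hz)) (hTP γ)
      (hD.isTranslationInvariant hTP γ).eq.symm).symm
  have hTW : ∀ {l : Fin d} {W : Hilb C N →L[ℂ] Hilb C N}, IsPositionCommutator l R (R * W) →
      IsTranslationInvariant T ((W * Q + spinOp C.measure s * W) * K) := by
    intro l W hW
    have h1 : IsTranslationInvariant T W := fun γ ↦
      commute_of_mul_eq hR.injective rfl (hTR γ) (hW.isTranslationInvariant hTR γ)
    exact ((h1.mul hTQ).add (hTS.mul h1)).mul hTK
  have hTQS : IsTranslationInvariant T (Q - spinOp C.measure s) := fun γ ↦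
    (hTQ γ).sub_right (hTS γ)
  -- the local traces over the pieces vanish
  have hpiece : ∀ {A B : Hilb C N →L[ℂ] Hilb C N}, IsLocallyNuclear A → IsLocallyNuclear B →
      IsTranslationInvariant T A → IsTranslationInvariant T B →
      A * U = U * (((Real.cos (2 * Real.pi / n) : ℝ) : ℂ) • A +
        ((-Real.sin (2 * Real.pi / n) : ℝ) : ℂ) • B) →
      B * U = U * (((Real.sin (2 * Real.pi / n) : ℝ) : ℂ) • A +
        ((Real.cos (2 * Real.pi / n) : ℝ) : ℂ) • B) → ∀ γ : C.lattice,
      localTrace A (C.piece b γ) (C.measurableSet_piece b γ) = 0 ∧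
        localTrace B (C.piece b γ) (C.measurableSet_piece b γ) = 0 := by
    intro A B hA hB hAT hBT hAU hBU γ
    obtain ⟨r', hr'⟩ := C.exists_cell_subset b 1
    refine localTrace_eq_zero_of_rotation hA hB hAT hBT ρ e hX hlattice hcos hAU hBU
      (C.measurableSet_piece b γ) (Set.inter_subset_right.trans hr') (fun η hη ↦ ?_) fun ψ ↦ ?_
    -- A piece is contained in the second cell, whose translates are already disjoint up to null
    -- sets.
    · refine measure_mono_null ?_ (hbC η hη)
      exact Set.inter_subset_inter Set.inter_subset_right
        (Set.preimage_mono Set.inter_subset_right)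
    · exact mem_graph_ofCLM.mp ((hpieces γ).commutesWith ψ _ (mem_graph_ofCLM.mpr rfl))
  have hN := isLocallyNuclear_spinRotationBounded hC hH hcr hTQS hTP (hTL hD)
  have hN' := isLocallyNuclear_spinRotationBounded hC hH hcr hTQS hTP (hTL hD')
  have hM := isLocallyNuclear_currentBounded hC hH hR.injective hK hTP (hTW hWc)
  have hM' := isLocallyNuclear_currentBounded hC hH hR.injective hK hTP (hTW hWc')
  constructor
  · refine ⟨_, ⟨D, hDcl, rfl⟩, fun γ ↦ ?_⟩
    obtain ⟨r', hr'⟩ := C.exists_cell_subset b 1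
    rw [inverseLiouvillian_eq hcr.1.le hcr.sphere_subset hR, spinRotation_eq hR hQ,
      -- The pair is ordered as (i, j) to match the rotation matrix; the spin rotation is its second
      -- component, the current below is the first.
      ← (hpiece hN' hN ((hTQS.mul (hTL hD')).smul _) ((hTQS.mul (hTL hD)).smul _)
        (spinRotationBounded_mul hcr hH hUH hUS hUQ (hXi.commutator_mul hUP hD' hD' hD))
        (spinRotationBounded_mul hcr hH hUH hUS hUQ (hXj.commutator_mul hUP hD hD' hD)) γ).2]
    exact hasTrace_compress hN (C.measurableSet_piece b γ) (Set.inter_subset_right.trans hr')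
  · rw [conventionalCurrent_eq hQ hK hWv]
    exact hasTracePerUnitVolume_zero hM (localTrace_cell_eq_zero hM (((hTW hWc).smul _).smul _)
      hC hb hbC fun γ ↦ (hpiece hM hM' (((hTW hWc).smul _).smul _) (((hTW hWc').smul _).smul _)
        (currentBounded_mul hUS hUQ hUK (velocity_mul hR hXi hUR hWc hWc hWc'))
        (currentBounded_mul hUS hUQ hUK (velocity_mul hR hXj hUR hWc' hWc hWc')) γ).1)
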